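/- Let $(M,\omega)$ be a closed (compact, without boundary) smooth symplectic manifold of dimension $2n$, oriented by $\omega^n$, and let $\nabla$ be a symplectic connection (torsion-free, $\nabla\omega=0$). In local coordinates $\omega=\tfrac12\omega_{ij}dx^i\wedge dx^j$, $(\omega^{ij})=(\omega_{ij})^{-1}$, and $y^i$ are the induced linear coordinates on the tangent spaces. *Weyl bundle.* $\mathcal W=\prod_{k\ge0}\mathrm{Sym}^k(T^*M)[[\hbar]]$ carries the fibrewise Moyal product $a\star b=\exp\big(\tfrac{\hbar}{2}\omega^{ij}\partial_{y^i}\partial_{z^j}\big)a(y)b(z)\big|_{z=y}$, extended to $\mathcal W$-valued forms, with graded commutator $[-,-]_\star$. Give $y^i$ weight $1$ and $\hbar$ weight $2$. Put $R_\nabla=\tfrac14R_{ijkl}\,y^iy^jdx^k\wedge dx^l$ with $R_{ijkl}=\omega_{im}R^m{}_{jkl}$, $R^m{}_{jkl}\partial_m=R(\partial_k,\partial_l)\partial_j$. Let $\omega_k$ $(k\ge1)$ be closed $2$-forms, $\omega_\hbar=-\omega+\sum_{k\ge1}\hbar^k\omega_k$, and let $\gamma=\omega_{ij}y^idx^j+r$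 be a smooth $\mathcal W$-valued $1$-form, with all terms of $r$ of weight at least $3$, solving Fedosov's equation $$\nabla\gamma+\frac1{2\hbar}[\gamma,\gamma]_\star+R_\nabla=\omega_\hbar .$$ Then $D=\nabla+\frac1\hbar[\gamma,-]_\star$ is a flat connection on $\mathcal W$ and the symbol map $\sigma$ ($y\mapsto0$) is a bijection from smooth $D$-flat sections onto $C^\infty(M)[[\hbar]]$. The Fedosov star product is $f\star g=\sigma(\sigma^{-1}(f)\star\sigma^{-1}(g))$. *BV side.* Consider forms on $M$ with values in $\widehat{\mathrm{Sym}}(T^*M)\otimes\wedge^{\bullet}(T^*M)$, with fibre variables $y^i$ and odd $dy^i$ (anticommuting with the $dx^j$), and $d_{TM}=dy^i\,\partial_{y^i}$. For $k$ points $\theta=(\theta^1,\dots,\theta^k)$ on $S^1=\mathbb R/\mathbb Z$ let $P(\theta^\alpha,\theta^\beta)=u-\tfrac12$, where $u\in(0,1)$, $u\equiv\theta^\alpha-\theta^\beta$ mod $1$, and on the $k$-fold tensor power put $\partial_P=\tfrac12\sum_{\alpha\ne\beta}P(\theta^\alpha,\theta^\beta)\,\omega^{ij}\partial_{y^i_\alpha}\partial_{y^j_\beta}$.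 Let $\mathrm{Mult}$ denote multiplication of the tensor factors. Define $\gamma_\infty$ and, for a section $O$ of $\mathcal W$, $[O]_\infty$ by $$e^{\gamma_\infty/\hbar}=\sum_{k\ge0}\frac1{k!\hbar^k}\,\mathrm{Mult}\int_{(S^1)^k}d\theta^1\cdots d\theta^k\;e^{\hbar\partial_P}(d_{TM}\gamma)^{\otimes k},$$ $$[O]_\infty\,e^{\gamma_\infty/\hbar}=\sum_{k\ge0}\frac1{k!\hbar^k}\,\mathrm{Mult}\int_{(S^1)^{k+1}}d\theta^0\cdots d\theta^k\;e^{\hbar\partial_P}\big(O\otimes(d_{TM}\gamma)^{\otimes k}\big)$$ (the sums are finite). Let $\int_{\gamma_\infty}a=\frac1{n!}\big(\tfrac12\omega^{ij}\partial_{dy^i}\partial_{dy^j}\big)^n\big(e^{\gamma_\infty/\hbar}a\big)\big|_{y=dy=0}$, a form on $M$ with coefficients Laurent series in $\hbar$, and define $$\mathrm{Tr}:C^\infty(M)[[\hbar]]\to\mathbb R((\hbar)),\qquad \mathrm{Tr}(f)=\int_M\int_{\gamma_\infty}[\sigma^{-1}(f)]_\infty .$$ **Proposition.** For all $f,g\in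 C^\infty(M)[[\hbar]]$, in particular for all $f,g\in C^\infty(M)$, $$\mathrm{Tr}(f\star g)=\mathrm{Tr}(g\star f).$$ -/

import Mathlib

open Bundle Manifold
open scoped ContDiff

noncomputable section

namespace Fedosov

/-! ### Formal functions and power series in `ħ`

Fibres of tensor bundles at `p : M` are written in the standard basis of
`TangentSpace (𝓡 d) p`, which is by definition the model space `EuclideanSpace ℝ (Fin d)`.
So the fibre at `p` of the completed symmetric algebra of the cotangent bundle is
`MvPowerSeries (Fin d) ℝ`, the variable `X i` being the `i`-th coordinate function `yⁱ` on the
tangent space at `p`. -/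

/-- Power series in `ħ` (the variable of `PowerSeries`) whose coefficients are families, indexed
by the points of `M`, of formal functions in the variables `ι`. -/
abbrev FormalSection (M : Type*) (ι : Type*) := PowerSeries (M → MvPowerSeries ι ℝ)

/-- Sections of the Weyl bundle (smoothness is the predicate `IsSmooth` below). -/
abbrev WeylSection (M : Type*) (d : ℕ) := FormalSection M (Fin d)

/-- Laurent series in `ħ` whose coefficients are families of formal functions of `y`. -/
abbrev LaurentSection (M : Type*) (d : ℕ) := LaurentSeries (M → MvPowerSeries (Fin d) ℝ)

section Algebra

variable {M : Type*} {d : ℕ}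

/-- Embedding as the `α`-th factor of the `k`-fold completed tensor power, whose elements are the
formal functions of `k` copies `y_0, …, y_{k-1}` of `y`. -/
def slot {k : ℕ} (α : Fin k) : WeylSection M d →+* FormalSection M (Fin k × Fin d) :=
  PowerSeries.map ((MvPowerSeries.rename (R := ℝ)
    (Prod.mk α : Fin d → Fin k × Fin d)).toRingHom.compLeft M)

/-- The multiplication map on the `k`-fold completed tensor power: all copies of `y` are set
equal. -/
def multMap (k : ℕ) : FormalSection M (Fin k × Fin d) →+* WeylSection M d :=
  PowerSeries.map ((MvPowerSeries.rename (R := ℝ)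
    (Prod.snd : Fin k × Fin d → Fin d)).toRingHom.compLeft M)

/-- The operator `exp (ħ T) = ∑ₘ ħᵐ Tᵐ / m!` on power series in `ħ`. -/
def expHbar {R : Type*} [CommRing R] [Algebra ℝ R] (T : Module.End ℝ R) (a : PowerSeries R) :
    PowerSeries R :=
  PowerSeries.mk fun N => ∑ m ∈ Finset.range (N + 1),
    ((m.factorial : ℝ)⁻¹) • (T ^ m) (PowerSeries.coeff (N - m) a)

/-- Division by `ħ` of a power series in `ħ` without constant term. -/
def divHbar {R : Type*} [Semiring R] (a : PowerSeries R) : PowerSeries R :=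
  PowerSeries.mk fun N => PowerSeries.coeff (N + 1) a

/-- The fibrewise partial derivative `∂/∂yⁱ`. -/
def dy (i : Fin d) : WeylSection M d → WeylSection M d := fun a =>
  PowerSeries.mk fun N p => MvPowerSeries.pderiv ℝ i (PowerSeries.coeff N a p)

/-- The symbol map, `y ↦ 0`. -/
def symbol : WeylSection M d →+* PowerSeries (M → ℝ) :=
  PowerSeries.map ((MvPowerSeries.constantCoeff (σ := Fin d) (R := ℝ)).compLeft M)

/-- For `Pi p = (Ω^{ij}(p))` this is the operator
`Ω^{ij} (∂/∂y_αⁱ) (∂/∂y_βʲ)` on functions of `k` copies of `y`. -/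
def biDer (Pi : M → Matrix (Fin d) (Fin d) ℝ) {k : ℕ} (α β : Fin k) :
    Module.End ℝ (M → MvPowerSeries (Fin k × Fin d) ℝ) where
  toFun a p := ∑ i, ∑ j, Pi p i j •
    MvPowerSeries.pderiv ℝ (α, i) (MvPowerSeries.pderiv ℝ (β, j) (a p))
  map_add' a b := by
    funext p
    simp [Finset.sum_add_distrib]
  map_smul' c a := by
    funext p
    simp [Finset.smul_sum, smul_comm c]

/-- The fibrewise Moyal product
`exp ((ħ/2) Ω^{ij} ∂_{yⁱ} ∂_{zʲ}) a(y) b(z) |_{y = z}`. -/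
def moyal (Pi : M → Matrix (Fin d) (Fin d) ℝ) (a b : WeylSection M d) : WeylSection M d :=
  multMap 2 (expHbar ((1 / 2 : ℝ) • biDer Pi (0 : Fin 2) 1)
    (slot (0 : Fin 2) a * slot (1 : Fin 2) b))

/-- The Moyal commutator of two sections. -/
def moyalComm (Pi : M → Matrix (Fin d) (Fin d) ℝ) (a b : WeylSection M d) : WeylSection M d :=
  moyal Pi a b - moyal Pi b a

/-! ### The BV bundle -/

/-- Differential forms on `M` with values in the BV bundle, with scalars `R` for the formal
functions of `y` and `ħ`: the exterior `R`-algebra on the odd generators `dx^1, …, dx^d`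
(forms on the base) and `dy^1, …, dy^d` (forms along the fibre). -/
abbrev BVForms (R : Type*) [CommRing R] (d : ℕ) :=
  ExteriorAlgebra R ((Fin d ⊕ₗ Fin d) → R)

/-- Differential forms on `M`, in the basis `dx^1, …, dx^d`. -/
abbrev BaseForms (R : Type*) [CommRing R] (d : ℕ) := ExteriorAlgebra R (Fin d → R)

/-- The basis of monomials in `dx^1, …, dx^d, dy^1, …, dy^d` (in this order). -/
def bvBasis (R : Type*) [CommRing R] (d : ℕ) :
    Module.Basis (Finset (Fin d ⊕ₗ Fin d)) R (BVForms R d) :=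
  (Pi.basisFun R (Fin d ⊕ₗ Fin d)).ExteriorAlgebra

/-- The basis of monomials in `dx^1, …, dx^d`. -/
def baseBasis (R : Type*) [CommRing R] (d : ℕ) :
    Module.Basis (Finset (Fin d)) R (BaseForms R d) :=
  (Pi.basisFun R (Fin d)).ExteriorAlgebra

/-- The generator `dx^j`. -/
def dX (R : Type*) [CommRing R] {d : ℕ} (j : Fin d) : BVForms R d :=
  ExteriorAlgebra.ι R (Pi.single (Sum.inlₗ j) 1)

/-- The generator `dy^i`. -/
def dY (R : Type*) [CommRing R] {d : ℕ} (i : Fin d) : BVForms R d :=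
  ExteriorAlgebra.ι R (Pi.single (Sum.inrₗ i) 1)

/-- Apply a map to the coefficients of a form. -/
def mapCoeff {R S : Type*} [CommRing R] [CommRing S] (T : R → S) (a : BVForms R d) :
    BVForms S d :=
  ∑ s, T ((bvBasis R d).repr a s) • bvBasis S d s

/-- The fibrewise de Rham differential `dyⁱ ∂/∂yⁱ`. -/
def dTM (a : BVForms (WeylSection M d) d) : BVForms (WeylSection M d) d :=
  ∑ i, dY (WeylSection M d) i * mapCoeff (dy i) a

/-- The propagator: `u - 1/2` on the pair of points `(exp(2πi(θ+u)), exp(2πiθ))`, `0 < u < 1`,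
of the circle. -/
def propagator (s t : ℝ) : ℝ := Int.fract (s - t) - 1 / 2

/-- The operator `∂_P` at the configuration `θ` of `k` points on the circle. -/
def partialP (Pi : M → Matrix (Fin d) (Fin d) ℝ) {k : ℕ} (θ : Fin k → ℝ) :
    Module.End ℝ (M → MvPowerSeries (Fin k × Fin d) ℝ) :=
  (1 / 2 : ℝ) • ∑ α, ∑ β, if α = β then 0 else propagator (θ α) (θ β) • biDer Pi α β

/-- `Mult ∫_{S¹[k]} dθ^1 ⋯ dθ^k exp(ħ ∂_P) a`, coefficient by coefficient.  (The compactified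
configuration space differs from the torus `(S¹)^k` by a null set.) -/
def configIntegral (Pi : M → Matrix (Fin d) (Fin d) ℝ) (k : ℕ)
    (a : FormalSection M (Fin k × Fin d)) : WeylSection M d :=
  PowerSeries.mk fun N p m => ∫ θ in Set.Icc (0 : Fin k → ℝ) 1,
    MvPowerSeries.coeff m (PowerSeries.coeff N (multMap k (expHbar (partialP Pi θ) a)) p)

/-- Multiplication by `1 / (k! ħ^k)`, with values in Laurent series. -/
def divFactorialHbarPow (k : ℕ) (a : WeylSection M d) : LaurentSection M d :=
  HahnSeries.single (-(k : ℤ)) (fun _ => MvPowerSeries.C ((k.factorial : ℝ)⁻¹)) *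
    HahnSeries.ofPowerSeries ℤ (M → MvPowerSeries (Fin d) ℝ) a

/-- `e^{γ_∞/ħ} = ∑ₖ (1/(k! ħᵏ)) Mult ∫_{S¹[k]} dθ^1 ⋯ dθ^k e^{ħ ∂_P} (d_{TM} γ)^{⊗ k}`, for a
one-form `γ` with values in the Weyl bundle.  The terms with `k > d` vanish, as each `d_{TM} γ` is
a one-form on the `d`-dimensional base.  The operator `∂_P` does not involve the odd variables, so
those of different tensor factors are multiplied at once. -/
def expGammaInfty (Pi : M → Matrix (Fin d) (Fin d) ℝ) (γ : BVForms (WeylSection M d) d) :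
    BVForms (LaurentSection M d) d :=
  ∑ k ∈ Finset.range (d + 1),
    mapCoeff (fun a => divFactorialHbarPow k (configIntegral Pi k a))
      (List.ofFn fun α : Fin k => mapCoeff (slot α) (dTM γ)).prod

/-- `Mult ∫_{S¹[*]} e^{ħ ∂_P + D} (O dθ^1) ⊗ e^{⊗ γ/ħ}` for a section `O` of the Weyl bundle. -/
def insertion (Pi : M → Matrix (Fin d) (Fin d) ℝ) (γ : BVForms (WeylSection M d) d)
    (O : WeylSection M d) : BVForms (LaurentSection M d) d :=
  ∑ k ∈ Finset.range (d + 1),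
    mapCoeff (fun a => divFactorialHbarPow k (configIntegral Pi (k + 1) a))
      (slot (0 : Fin (k + 1)) O •
        (List.ofFn fun α : Fin k => mapCoeff (slot α.succ) (dTM γ)).prod)

/-- The local-to-global map `[O]_∞`, defined by
`[O]_∞ e^{γ_∞/ħ} = Mult ∫_{S¹[*]} e^{ħ ∂_P + D} (O dθ^1) ⊗ e^{⊗ γ/ħ}`
(`e^{γ_∞/ħ}` is `1` plus a nilpotent element, hence invertible). -/
def localToGlobal (Pi : M → Matrix (Fin d) (Fin d) ℝ) (γ : BVForms (WeylSection M d) d)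
    (O : WeylSection M d) : BVForms (LaurentSection M d) d :=
  insertion Pi γ O * Ring.inverse (expGammaInfty Pi γ)

/-- The operator `(1/2) Ω^{ij} ∂_{θⁱ} ∂_{θʲ}`, where `θⁱ = dyⁱ`. -/
def berOp (Pi : M → Matrix (Fin d) (Fin d) ℝ) (a : BVForms (LaurentSection M d) d) :
    BVForms (LaurentSection M d) d :=
  ∑ i, ∑ j,
    (HahnSeries.C (fun p => MvPowerSeries.C ((1 / 2 : ℝ) * Pi p i j)) : LaurentSection M d) •
      CliffordAlgebra.contractLeft (LinearMap.proj (Sum.inrₗ i))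
        (CliffordAlgebra.contractLeft (LinearMap.proj (Sum.inrₗ j)) a)

/-- The fibrewise BV integration `(1/n!) ((1/2) Ω^{ij} ∂_{θⁱ} ∂_{θʲ})ⁿ a |_{y = θ = 0}`: only the
monomials in `dx^1, …, dx^d` survive, and `y` is set to `0` in their coefficients. -/
def berezin (n : ℕ) (Pi : M → Matrix (Fin d) (Fin d) ℝ) (a : BVForms (LaurentSection M d) d) :
    BaseForms (LaurentSeries (M → ℝ)) d :=
  ∑ s : Finset (Fin d),
    ((HahnSeries.C (fun _ => ((n.factorial : ℝ)⁻¹)) : LaurentSeries (M → ℝ)) *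
      ((bvBasis (LaurentSection M d) d).repr ((berOp Pi)^[n] a)
        (s.map ⟨fun j => Sum.inlₗ j, fun _ _ h => Sum.inl_injective (toLex.injective h)⟩)).map
          ((MvPowerSeries.constantCoeff (σ := Fin d) (R := ℝ)).compLeft M)) •
      baseBasis (LaurentSeries (M → ℝ)) d s

end Algebra

/-! ### Coordinate frames -/

section Geometry

variable {d : ℕ} {M : Type*} [TopologicalSpace M] [ChartedSpace (EuclideanSpace ℝ (Fin d)) M]
  [IsManifold (𝓡 d) ∞ M]

/-- The `j`-th vector of the standard basis of the tangent space at `p`. -/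
def stdVec (j : Fin d) (p : M) : TangentSpace (𝓡 d) p :=
  (EuclideanSpace.single j (1 : ℝ) : EuclideanSpace ℝ (Fin d))

/-- The components of a tangent vector in the standard basis. -/
def comp {p : M} (v : TangentSpace (𝓡 d) p) (i : Fin d) : ℝ :=
  (show EuclideanSpace ℝ (Fin d) from v) i

/-- The `j`-th coordinate vector field of the chart at `x₀` (zero outside the chart domain). -/
def coordField (x₀ : M) (j : Fin d) (q : M) : TangentSpace (𝓡 d) q :=
  (trivializationAt (EuclideanSpace ℝ (Fin d)) (TangentSpace (𝓡 d) : M → Type _) x₀).localFrame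
    (EuclideanSpace.basisFun (Fin d) ℝ).toBasis j q

/-- The matrix of the coordinate frame of the chart at `x₀` at the point `q`. -/
def frameMatrix (x₀ q : M) : Matrix (Fin d) (Fin d) ℝ :=
  Matrix.of fun i j => comp (coordField x₀ j q) i

/-- A formal function on the tangent space at `q`, rewritten in the linear coordinates dual to the
coordinate frame of the chart at `x₀`. -/
def inFrame (x₀ q : M) (a : MvPowerSeries (Fin d) ℝ) : MvPowerSeries (Fin d) ℝ :=
  MvPowerSeries.subst (fun i => ∑ j, MvPowerSeries.C (frameMatrix x₀ q i j) *
    (MvPowerSeries.X j : MvPowerSeries (Fin d) ℝ)) a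

/-- The coefficients of a section of the Weyl bundle in the chart at `x₀` are smooth functions on
the chart domain. -/
def IsSmoothInChart (x₀ : M) (a : WeylSection M d) : Prop :=
  ∀ (N : ℕ) (m : Fin d →₀ ℕ), ContMDiffOn (𝓡 d) 𝓘(ℝ, ℝ) ∞
    (fun q => MvPowerSeries.coeff m (inFrame x₀ q (PowerSeries.coeff N a q)))
    (chartAt (EuclideanSpace ℝ (Fin d)) x₀).source

/-- A smooth section of the Weyl bundle. -/
def IsSmooth (a : WeylSection M d) : Prop := ∀ x₀ : M, IsSmoothInChart x₀ a

/-! ### Symplectic forms and symplectic connections -/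

variable (d M) in
/-- Fields of bilinear forms on the tangent spaces. -/
abbrev BilinField := Π p : M, TangentSpace (𝓡 d) p →L[ℝ] TangentSpace (𝓡 d) p →L[ℝ] ℝ

/-- A smooth closed two-form.  Closedness is expressed at each point in the coordinate frame of the
chart at that point. -/
structure IsClosedTwoForm (α : BilinField d M) : Prop where
  smooth : ContMDiff (𝓡 d)
    ((𝓡 d).prod 𝓘(ℝ, EuclideanSpace ℝ (Fin d) →L[ℝ] EuclideanSpace ℝ (Fin d) →L[ℝ] ℝ)) ∞
    (fun p => TotalSpace.mk' (EuclideanSpace ℝ (Fin d) →L[ℝ] EuclideanSpace ℝ (Fin d) →L[ℝ] ℝ)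
      (E := fun p : M => TangentSpace (𝓡 d) p →L[ℝ] TangentSpace (𝓡 d) p →L[ℝ] ℝ) p (α p))
  alternating : ∀ p v, α p v v = 0
  closed : ∀ (p : M) (i j k : Fin d),
    mvfderiv (𝓡 d) (fun q => α q (coordField p j q) (coordField p k q)) p (coordField p i p) +
    mvfderiv (𝓡 d) (fun q => α q (coordField p k q) (coordField p i q)) p (coordField p j p) +
    mvfderiv (𝓡 d) (fun q => α q (coordField p i q) (coordField p j q)) p (coordField p k p) = 0

/-- A symplectic form: a closed nondegenerate two-form. -/
structure IsSymplectic (Ω : BilinField d M) : Prop extends IsClosedTwoForm Ω where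
  nondegenerate : ∀ p u, (∀ v, Ω p u v = 0) → u = 0

/-- The inverse matrix `(Ω^{ij})` of the matrix `(Ω_{ij})` of `Ω` at a point. -/
def poisson (Ω : BilinField d M) (p : M) : Matrix (Fin d) (Fin d) ℝ :=
  (Matrix.of fun i j => Ω p (stdVec i p) (stdVec j p))⁻¹

variable (d M) in
/-- Connections on the tangent bundle. -/
abbrev TangentConnection :=
  CovariantDerivative (𝓡 d) (EuclideanSpace ℝ (Fin d)) (TangentSpace (𝓡 d) : M → Type _)

/-- A smooth torsion-free connection `∇` with `∇ Ω = 0`. -/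
structure IsSymplecticConnection (Ω : BilinField d M) (cov : TangentConnection d M) : Prop where
  smooth : CovariantDerivative.ContMDiffCovariantDerivative cov ∞
  torsion_free : cov.torsion = 0
  parallel : ∀ (Y Z : Π p : M, TangentSpace (𝓡 d) p) (p : M),
    MDifferentiableAt (𝓡 d) (𝓡 d).tangent
      (fun q => (⟨q, Y q⟩ : TangentBundle (𝓡 d) M)) p →
    MDifferentiableAt (𝓡 d) (𝓡 d).tangent
      (fun q => (⟨q, Z q⟩ : TangentBundle (𝓡 d) M)) p →
    ∀ v : TangentSpace (𝓡 d) p,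
      mvfderiv (𝓡 d) (fun q => Ω q (Y q) (Z q)) p v = Ω p (cov Y p v) (Z p) + Ω p (Y p) (cov Z p v)

/-! ### The Weyl bundle and Fedosov's equation -/

/-- The induced connection on the Weyl bundle, in the direction of `V`: at each point `p`, it is
`V^k (∂/∂x^k - Γ^i_{kj} y^j ∂/∂y^i)` in the coordinates of the chart at `p` (whose coordinate frame
is, at `p` itself, the standard basis). -/
def nabla (cov : TangentConnection d M) (V : Π p : M, TangentSpace (𝓡 d) p)
    (a : WeylSection M d) : WeylSection M d :=
  PowerSeries.mk fun N p m =>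
    mvfderiv (𝓡 d) (fun q => MvPowerSeries.coeff m (inFrame p q (PowerSeries.coeff N a q))) p (V p)
    - MvPowerSeries.coeff m (∑ i, ∑ j,
        MvPowerSeries.C (comp (cov (coordField p j) p (V p)) i) *
          (MvPowerSeries.X j * MvPowerSeries.pderiv ℝ i (PowerSeries.coeff N a p)))

variable (d M) in
/-- One-forms with values in the Weyl bundle. -/
abbrev WeylOneForm :=
  Π p : M, TangentSpace (𝓡 d) p →ₗ[ℝ] PowerSeries (MvPowerSeries (Fin d) ℝ)

/-- Contraction of a Weyl bundle valued one-form with a vector field. -/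
def WeylOneForm.along (γ : WeylOneForm d M) (V : Π p : M, TangentSpace (𝓡 d) p) :
    WeylSection M d :=
  PowerSeries.mk fun N p => PowerSeries.coeff N (γ p (V p))

/-- `γ = γ_j dx^j` as an element of the algebra of BV bundle valued forms. -/
def WeylOneForm.toBV (γ : WeylOneForm d M) : BVForms (WeylSection M d) d :=
  ∑ j, γ.along (stdVec j) • dX (WeylSection M d) j

/-- The value on `(∂_k, ∂_l)`, in the coordinates of the chart at `p`, of
`R_∇ = (1/4) R_{ijkl} yⁱ yʲ dx^k ∧ dx^l`, where `R_{ijkl} = Ω(∂_i, R(∂_k, ∂_l) ∂_j)`. -/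
def curvatureQuad (Ω : BilinField d M) (cov : TangentConnection d M) (p : M) (k l : Fin d) :
    MvPowerSeries (Fin d) ℝ :=
  ∑ i, ∑ j, MvPowerSeries.C ((1 / 2 : ℝ) * Ω p (coordField p i p)
      (cov (fun q => cov (coordField p j) q (coordField p l q)) p (coordField p k p) -
       cov (fun q => cov (coordField p j) q (coordField p k q)) p (coordField p l p))) *
    (MvPowerSeries.X i * MvPowerSeries.X j)

/-- The covariant derivative `D_V = ∇_V + (1/ħ) [γ(V), ·]_⋆` on the Weyl bundle. -/
def fedosovD (Ω : BilinField d M) (cov : TangentConnection d M) (γ : WeylOneForm d M)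
    (V : Π p : M, TangentSpace (𝓡 d) p) (a : WeylSection M d) : WeylSection M d :=
  nabla cov V a + divHbar (moyalComm (poisson Ω) (γ.along V) a)

/-- `γ` is a smooth solution of the form `γ = Ω_{ij} yⁱ dxʲ + r`, with `r` of weight at least `3`,
of Fedosov's equation `∇ γ + (1/2ħ) [γ, γ]_⋆ + R_∇ = Ω_ħ = ∑_N ħ^N (Ωh N)`.
The equation is evaluated at each `p` on pairs of coordinate vector fields `∂_k, ∂_l` of the chart
at `p`, where `(∇γ)(∂_k, ∂_l) = ∇_{∂_k} (γ(∂_l)) - ∇_{∂_l} (γ(∂_k))` and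
`(1/2) [γ, γ]_⋆ (∂_k, ∂_l) = [γ(∂_k), γ(∂_l)]_⋆`. -/
structure IsFedosovSolution (Ω : BilinField d M) (cov : TangentConnection d M)
    (Ωh : ℕ → BilinField d M) (γ : WeylOneForm d M) : Prop where
  smooth : ∀ (x₀ : M) (j : Fin d), IsSmoothInChart x₀ (γ.along (coordField x₀ j))
  leading : ∀ (p : M) (v : TangentSpace (𝓡 d) p) (N : ℕ) (m : Fin d →₀ ℕ),
    2 * N + m.degree < 3 →
    MvPowerSeries.coeff m (PowerSeries.coeff N (γ p v)) =
      MvPowerSeries.coeff m (PowerSeries.coeff N (PowerSeries.C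
        (∑ i, MvPowerSeries.C (Ω p (stdVec i p) v) *
          (MvPowerSeries.X i : MvPowerSeries (Fin d) ℝ))))
  equation : ∀ (p : M) (k l : Fin d) (N : ℕ),
    PowerSeries.coeff N (nabla cov (coordField p k) (γ.along (coordField p l))
      - nabla cov (coordField p l) (γ.along (coordField p k))
      + divHbar (moyalComm (poisson Ω) (γ.along (coordField p k)) (γ.along (coordField p l)))) p
      + (if N = 0 then curvatureQuad Ω cov p k l else 0) =
    MvPowerSeries.C (Ωh N p (coordField p k p) (coordField p l p))

/-- Smooth flat sections of the Weyl bundle. -/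
def IsFlatSection (Ω : BilinField d M) (cov : TangentConnection d M) (γ : WeylOneForm d M)
    (a : WeylSection M d) : Prop :=
  IsSmooth a ∧ ∀ V : Π p : M, TangentSpace (𝓡 d) p, fedosovD Ω cov γ V a = 0

open scoped Classical in
/-- The inverse `σ⁻¹` of the symbol map on flat sections: the flat section with symbol `f`. -/
def symbolInv (Ω : BilinField d M) (cov : TangentConnection d M) (γ : WeylOneForm d M)
    (f : PowerSeries (M → ℝ)) : WeylSection M d :=
  if h : ∃ a, IsFlatSection Ω cov γ a ∧ symbol a = f then h.choose else 0

/-- The star product `f ⋆ g = σ(σ⁻¹(f) ⋆ σ⁻¹(g))`. -/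
def star (Ω : BilinField d M) (cov : TangentConnection d M) (γ : WeylOneForm d M)
    (f g : PowerSeries (M → ℝ)) : PowerSeries (M → ℝ) :=
  symbol (moyal (poisson Ω) (symbolInv Ω cov γ f) (symbolInv Ω cov γ g))

/-- Power series in `ħ` with coefficients in `C^∞(M)`. -/
def IsSmoothSeries (f : PowerSeries (M → ℝ)) : Prop :=
  ∀ N, ContMDiff (𝓡 d) 𝓘(ℝ, ℝ) ∞ (PowerSeries.coeff N f)

end Geometry

/-! ### Integration over `M` and the trace -/

section Trace

variable {n : ℕ} {M : Type*} [TopologicalSpace M]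
  [ChartedSpace (EuclideanSpace ℝ (Fin (2 * n))) M] [IsManifold (𝓡 (2 * n)) ∞ M]

/-- The sign, relative to the standard basis of the tangent space at `p`, of the orientation
defined by `Ωⁿ`, where `Ω = (1/2) Ω_{ij} dxⁱ ∧ dxʲ`. -/
def orientationSign (Ω : BilinField (2 * n) M) (p : M) : ℝ :=
  Real.sign ((baseBasis ℝ (2 * n)).repr
    ((∑ i, ∑ j, ((1 / 2 : ℝ) * Ω p (stdVec i p) (stdVec j p)) •
      (ExteriorAlgebra.ι ℝ (Pi.single i 1) * ExteriorAlgebra.ι ℝ (Pi.single j 1))) ^ n)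
    Finset.univ)

variable [T2Space M] [CompactSpace M]

/-- The integral over `M`, oriented by `Ωⁿ`, of the top form whose component at `p` in the standard
basis of the tangent space at `p` is `τ p`: a partition of unity subordinate to the charts is
chosen, and in the chart at `x₀` the component in the coordinate frame is
`τ * det (frameMatrix x₀)`. -/
def integralTop (Ω : BilinField (2 * n) M) (τ : M → ℝ) : ℝ :=
  ∑ᶠ x₀ : M, ∫ x in (chartAt (EuclideanSpace ℝ (Fin (2 * n))) x₀).target,
    (fun q : M =>
      (SmoothPartitionOfUnity.exists_isSubordinate_chartAt_source (𝓡 (2 * n)) M).choose x₀ q *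
        (orientationSign Ω q * τ q * |(frameMatrix (d := 2 * n) x₀ q).det|))
      ((chartAt (EuclideanSpace ℝ (Fin (2 * n))) x₀).symm x)

/-- Integration over `M` of forms with coefficients Laurent series in `ħ`. -/
def integralForms (Ω : BilinField (2 * n) M)
    (α : BaseForms (LaurentSeries (M → ℝ)) (2 * n)) : LaurentSeries ℝ :=
  ((baseBasis (LaurentSeries (M → ℝ)) (2 * n)).repr α Finset.univ).map
    (⟨integralTop Ω, by simp [integralTop]⟩ : ZeroHom (M → ℝ) ℝ)

/-- The twisted integration map `∫_{γ_∞} a = ∫_Ber e^{γ_∞/ħ} a`. -/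
def twistedIntegral (Ω : BilinField (2 * n) M) (γ : WeylOneForm (2 * n) M)
    (a : BVForms (LaurentSection M (2 * n)) (2 * n)) :
    BaseForms (LaurentSeries (M → ℝ)) (2 * n) :=
  berezin n (poisson Ω) (expGammaInfty (poisson Ω) γ.toBV * a)

/-- The trace map `Tr(f) = ∫_M ∫_{γ_∞} [σ⁻¹(f)]_∞`. -/
def trace (Ω : BilinField (2 * n) M) (cov : TangentConnection (2 * n) M)
    (γ : WeylOneForm (2 * n) M) (f : PowerSeries (M → ℝ)) : LaurentSeries ℝ :=
  integralForms Ω (twistedIntegral Ω γ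
    (localToGlobal (poisson Ω) γ.toBV (symbolInv Ω cov γ f)))

end Trace

end Fedosov

end

/-!
The trace is the integral over `M` of a local density, and the density of a Moyal commutator of two
flat sections is a divergence with respect to the symplectic connection, so that its integral
vanishes.

*The density.*  Elements of a fibre of the Weyl bundle are described by the functionals
`f ↦ (f(∂_y) a)(0)` on polynomials `f` (`WeylDual`), for which multidifferential operators become
multiplications by their symbols.  The fibrewise integral extracts the top coefficient in the odd
variables (`repr_berOp`), and in `e^{γ_∞/ħ} [O]_∞` it comes from the term with `d = 2n` copies of
`d_{TM} γ`.  Its value at `y = 0` is, up to a universal constant, `Theta Π O (γ_1, …, γ_d)`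
(`exists_configIntegral_top`): the section `O` and the components of `γ` are placed at `d + 1`
points of the circle, and the symbol is the determinant of the dual variables of the last `d` points
multiplied by the integral of the exponentiated propagators over all configurations.  Thus `Theta` is
the cocycle of Feigin, Felder and Shoikhet.

*The cocycle identity.*  Move one additional point around the circle.  The derivative of the
configuration integral with respect to its position integrates to the sum of the jumps at the other
points, and the jump at a point is the Moyal commutator with the element placed there
(`cfgH_boundary`, `corr_update_commL`).  The derivative itself is the contraction with the bivector;
multiplied by the determinant, it is redistributed over the other points by Cramer's rule
(`rowDet_mul_boundary`).  This gives the identity `Theta_cocycle` between the values of `Theta` on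
commutators.  Moreover `Theta` vanishes if one of its last `d` entries is constant or quadratic
(`Theta_eq_zero_of_isHomog`), because the propagator has mean value zero.

*The local identity.*  For flat sections, `(1/ħ) [γ, a]_⋆ = -∇ a`, and Fedosov's equation expresses
`(1/ħ) [γ_k, γ_l]_⋆` by `∇ γ`, up to the central terms `Ω_ħ` and the quadratic term `R_∇`, which
the cocycle does not see.  The cocycle identity then states that the density of a commutator is the
divergence of the vector field obtained by replacing one entry `γ_k` by a flat section
(`coeff_Theta_commL_eq_divergence`).  Covariant derivatives are computed as ordinary derivatives in a
frame along a coordinate line that is parallel to first order; the symplectic form is stationary in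
such a frame, so that the product rule holds for all fibrewise operations.

*Globalization.*  The Pfaffian of the symplectic form is parallel, hence the divergence theorem holds
for the Liouville density, first in a chart by integration by parts and then on `M` by a partition of
unity (`sum_chartIntegral_divergence`).  Finally `σ⁻¹ (f ⋆ g) = σ⁻¹ f ⋆ σ⁻¹ g`, as products of flat
sections are flat and flat sections are determined by their symbols (`symbolInv_star`).
-/

set_option linter.unusedSectionVars false

noncomputable section

namespace Fedosov

/-! ### The Fischer pairing of polynomials with power series -/

section Fischer

variable {σ τ : Type*}

/-- The multifactorial `m! = ∏ᵢ (mᵢ)!`. -/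
def multiFactorial (m : σ →₀ ℕ) : ℝ := m.prod fun _ k => (k.factorial : ℝ)

lemma multiFactorial_ne_zero (m : σ →₀ ℕ) : multiFactorial m ≠ 0 :=
  Finset.prod_ne_zero_iff.2 fun _ _ => by positivity

lemma multiFactorial_add_single (m : σ →₀ ℕ) (s : σ) :
    multiFactorial (m + Finsupp.single s 1) = (m s + 1) * multiFactorial m := by
  classical
  unfold multiFactorial
  rw [Finsupp.prod_of_support_subset (s := insert s m.support), 
    Finsupp.prod_of_support_subset m (s := insert s m.support),
    ← Finset.mul_prod_erase _ _ (Finset.mem_insert_self s m.support),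
    ← Finset.mul_prod_erase _ _ (Finset.mem_insert_self s m.support)]
  · rw [Finset.prod_congr rfl (g := fun i => ((m i).factorial : ℝ))]
    · simp [Nat.factorial_succ]; ring
    · intro i hi
      simp [(Finset.ne_of_mem_erase hi).symm]
  · exact Finset.subset_insert _ _
  · simp
  · intro i hi
    simp [Finsupp.single_apply] at hi ⊢
    grind
  · simp

lemma linearMap_ext_monomial {V : Type*} [AddCommGroup V] [Module ℝ V]
    {l l' : MvPolynomial σ ℝ →ₗ[ℝ] V}
    (h : ∀ m, l (MvPolynomial.monomial m 1) = l' (MvPolynomial.monomial m 1)) : l = l' :=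
  (MvPolynomial.basisMonomials σ ℝ).ext fun m => by simpa using h m

/-- The Fischer pairing `⟨f, F⟩ = (f(∂) F)(0)` of a polynomial `f` with a formal power series
`F`, as a functional on polynomials. -/
def pair (F : MvPowerSeries σ ℝ) : MvPolynomial σ ℝ →ₗ[ℝ] ℝ :=
  (MvPolynomial.basisMonomials σ ℝ).constr ℝ fun m => multiFactorial m * MvPowerSeries.coeff m F

lemma pair_monomial (F : MvPowerSeries σ ℝ) (m : σ →₀ ℕ) (c : ℝ) :
    pair F (MvPolynomial.monomial m c) = c * (multiFactorial m * MvPowerSeries.coeff m F) := by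
  have : MvPolynomial.monomial m c = c • (MvPolynomial.basisMonomials σ ℝ m) := by
    simp [MvPolynomial.smul_monomial]
  rw [this, map_smul, pair, Module.Basis.constr_basis, smul_eq_mul]

lemma pair_one (F : MvPowerSeries σ ℝ) : pair F 1 = MvPowerSeries.constantCoeff F := by
  rw [← MvPolynomial.C_1, MvPolynomial.C_apply, pair_monomial]
  simp [multiFactorial]

lemma pair_add (F G : MvPowerSeries σ ℝ) : pair (F + G) = pair F + pair G := by
  refine linearMap_ext_monomial fun m => ?_
  simp [pair_monomial, mul_add]

lemma pair_smul (c : ℝ) (F : MvPowerSeries σ ℝ) : pair (c • F) = c • pair F := by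
  refine linearMap_ext_monomial fun m => ?_
  simp only [LinearMap.smul_apply, pair_monomial, map_smul, smul_eq_mul]
  ring

/-- The Fischer pairing, linear in the power series. -/
def pairHom : MvPowerSeries σ ℝ →ₗ[ℝ] (MvPolynomial σ ℝ →ₗ[ℝ] ℝ) where
  toFun := pair
  map_add' := pair_add
  map_smul' := pair_smul

lemma pairHom_apply (F : MvPowerSeries σ ℝ) : pairHom F = pair F := rfl

lemma pair_injective {F G : MvPowerSeries σ ℝ} (h : pair F = pair G) : F = G := by
  ext m
  have := congrArg (fun l => l (MvPolynomial.monomial m 1)) h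
  simpa [pair_monomial, multiFactorial_ne_zero] using this

/-- Multiplication by a variable is adjoint to the partial derivative. -/
lemma pair_X_mul (F : MvPowerSeries σ ℝ) (s : σ) (f : MvPolynomial σ ℝ) :
    pair F (MvPolynomial.X s * f) = pair (MvPowerSeries.pderiv ℝ s F) f := by
  have : (pair F).comp (LinearMap.mulLeft ℝ (MvPolynomial.X s)) =
      pair (MvPowerSeries.pderiv ℝ s F) := by
    refine linearMap_ext_monomial fun m => ?_
    simp only [LinearMap.comp_apply, LinearMap.mulLeft_apply]
    rw [mul_comm, MvPolynomial.X, MvPolynomial.monomial_mul, pair_monomial, pair_monomial,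
      multiFactorial_add_single, MvPowerSeries.coeff_pderiv]
    ring
  exact LinearMap.congr_fun this f

lemma pair_X_mul_apply (F : MvPowerSeries σ ℝ) (s : σ) (f : MvPolynomial σ ℝ) :
    pair (MvPowerSeries.X s * F) f = pair F (MvPolynomial.pderiv s f) := by
  have : pair (MvPowerSeries.X s * F) =
      (pair F).comp (MvPolynomial.pderiv (R := ℝ) s).toLinearMap := by
    classical
    refine linearMap_ext_monomial fun m => ?_
    simp only [LinearMap.comp_apply, Derivation.coeFn_coe, MvPolynomial.pderiv_monomial]
    rw [pair_monomial, pair_monomial, MvPowerSeries.X_def, MvPowerSeries.coeff_monomial_mul]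
    rcases Nat.eq_zero_or_pos (m s) with h | h
    · have h0 : ¬ Finsupp.single s 1 ≤ m := by simp [Finsupp.single_le_iff, h]
      simp [h, h0]
    · have hle : Finsupp.single s 1 ≤ m := Finsupp.single_le_iff.2 h
      rw [if_pos hle]
      obtain ⟨m', rfl⟩ : ∃ m', m = m' + Finsupp.single s 1 :=
        ⟨m - Finsupp.single s 1, (tsub_add_cancel_of_le hle).symm⟩
      rw [multiFactorial_add_single]
      simp
      ring
  exact LinearMap.congr_fun this f

lemma pair_C_mul (F : MvPowerSeries σ ℝ) (c : ℝ) (f : MvPolynomial σ ℝ) :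
    pair F (MvPolynomial.C c * f) = c * pair F f := by
  rw [← MvPolynomial.smul_eq_C_mul, map_smul, smul_eq_mul]

/-- The linear change of variables `X_s ↦ ∑ₜ A s t X_t` on polynomials. -/
def linSubst [Fintype τ] (A : σ → τ → ℝ) : MvPolynomial σ ℝ →ₐ[ℝ] MvPolynomial τ ℝ :=
  MvPolynomial.aeval fun s => ∑ t, MvPolynomial.C (A s t) * MvPolynomial.X t

@[simp] lemma linSubst_X [Fintype τ] (A : σ → τ → ℝ) (s : σ) :
    linSubst A (MvPolynomial.X s) = ∑ t, MvPolynomial.C (A s t) * MvPolynomial.X t := by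
  simp [linSubst]

lemma pderiv_linSubst [Fintype σ] [Fintype τ] (A : σ → τ → ℝ) (t : τ) (G : MvPolynomial σ ℝ) :
    MvPolynomial.pderiv t (linSubst A G) =
      ∑ s, MvPolynomial.C (A s t) * linSubst A (MvPolynomial.pderiv s G) := by
  classical
  induction G using MvPolynomial.induction_on with
  | C a => simp [linSubst]
  | add p q hp hq => simp [hp, hq, mul_add, Finset.sum_add_distrib]
  | mul_X p s hp =>
    simp only [map_mul, Derivation.leibniz, smul_eq_mul, hp, linSubst_X, map_sum,
      MvPolynomial.pderiv_C, MvPolynomial.pderiv_X, map_add, mul_add, Finset.sum_add_distrib,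
      Pi.single_apply, MvPolynomial.pderiv_C]
    congr 1
    · simp [mul_comm]
    · rw [Finset.mul_sum]
      exact Finset.sum_congr rfl fun _ _ => by ring

/-- A linear substitution in power series is adjoint to the transposed substitution in
polynomials; first for the pairing of two polynomials. -/
lemma pair_coe_linSubst [Fintype σ] [Fintype τ] (A : σ → τ → ℝ) (f : MvPolynomial τ ℝ)
    (G : MvPolynomial σ ℝ) :
    pair (linSubst A G : MvPowerSeries τ ℝ) f =
      pair (G : MvPowerSeries σ ℝ) (linSubst (fun t s => A s t) f) := by
  induction f using MvPolynomial.induction_on generalizing G with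
  | C a =>
    have h : ∀ {ρ : Type _} (F : MvPowerSeries ρ ℝ), pair F (MvPolynomial.C a) =
        a * MvPowerSeries.constantCoeff F := fun F => by
      rw [← pair_one, ← pair_C_mul, mul_one]
    rw [h, show linSubst (fun t s => A s t) (MvPolynomial.C a) = MvPolynomial.C a by
      simp [linSubst]]
    have h' : ∀ {ρ : Type _} (F : MvPolynomial ρ ℝ), pair (F : MvPowerSeries ρ ℝ)
        (MvPolynomial.C a) = a * MvPolynomial.constantCoeff F := fun F => by
      rw [← mul_one (MvPolynomial.C a), pair_C_mul, pair_one]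
      simp [← MvPowerSeries.coeff_zero_eq_constantCoeff_apply, MvPolynomial.constantCoeff_eq]
    rw [h', ← MvPowerSeries.coeff_zero_eq_constantCoeff_apply, MvPolynomial.coeff_coe,
      ← MvPolynomial.constantCoeff_eq]
    congr 1
    induction G using MvPolynomial.induction_on with
    | C a => simp [linSubst]
    | add p q hp hq => simp [hp, hq]
    | mul_X p n hp => simp [map_sum]
  | add p q hp hq => simp [hp, hq]
  | mul_X f t hf =>
    rw [mul_comm, pair_X_mul, MvPowerSeries.pderiv_coe, pderiv_linSubst, map_mul, linSubst_X,
      Finset.sum_mul, map_sum]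
    have h1 : (((∑ s, MvPolynomial.C (A s t) * linSubst A (MvPolynomial.pderiv s G) :
        MvPolynomial τ ℝ) : MvPowerSeries τ ℝ)) =
        ∑ s, A s t • ((linSubst A (MvPolynomial.pderiv s G) : MvPolynomial τ ℝ) :
          MvPowerSeries τ ℝ) := by
      simp only [← MvPolynomial.smul_eq_C_mul]
      rw [← MvPolynomial.coeToMvPowerSeries.ringHom_apply, map_sum]
      exact Finset.sum_congr rfl fun s _ => by
        rw [MvPolynomial.coeToMvPowerSeries.ringHom_apply, MvPolynomial.coe_smul]
    rw [h1, ← pairHom_apply, map_sum, LinearMap.sum_apply]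
    refine Finset.sum_congr rfl fun s _ => ?_
    rw [map_smul, LinearMap.smul_apply, pairHom_apply, hf, mul_assoc, pair_C_mul, pair_X_mul,
      MvPowerSeries.pderiv_coe, smul_eq_mul]

lemma hasSubst_linear [Fintype σ] [Fintype τ] (A : σ → τ → ℝ) :
    MvPowerSeries.HasSubst (fun s => ∑ t, MvPowerSeries.C (A s t) *
      (MvPowerSeries.X t : MvPowerSeries τ ℝ)) :=
  MvPowerSeries.hasSubst_of_constantCoeff_zero fun s => by simp [map_sum]

/-- A linear substitution in power series is adjoint to the transposed substitution in
polynomials. -/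
lemma pair_subst [Fintype σ] [Fintype τ] (A : σ → τ → ℝ) (F : MvPowerSeries σ ℝ)
    (f : MvPolynomial τ ℝ) :
    pair (MvPowerSeries.subst (fun s => ∑ t, MvPowerSeries.C (A s t) *
      (MvPowerSeries.X t : MvPowerSeries τ ℝ)) F) f =
      pair F (linSubst (fun t s => A s t) f) := by
  classical
  have key : (pair (MvPowerSeries.subst (fun s => ∑ t, MvPowerSeries.C (A s t) *
      (MvPowerSeries.X t : MvPowerSeries τ ℝ)) F)) =
      (pair F).comp (linSubst (fun t s => A s t)).toLinearMap := by
    refine linearMap_ext_monomial fun ν => ?_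
    rw [pair_monomial, LinearMap.comp_apply, AlgHom.toLinearMap_apply, one_mul]
    set g := linSubst (fun t s => A s t) (MvPolynomial.monomial ν 1) with hg
    have hc : ∀ d : σ →₀ ℕ, multiFactorial ν * MvPowerSeries.coeff ν (d.prod fun s e =>
        (∑ t, MvPowerSeries.C (A s t) * (MvPowerSeries.X t : MvPowerSeries τ ℝ)) ^ e) =
        multiFactorial d * g.coeff d := by
      intro d
      have h := pair_coe_linSubst A (MvPolynomial.monomial ν 1) (MvPolynomial.monomial d 1)
      rw [pair_monomial, one_mul] at h
      have h2 : ((linSubst A (MvPolynomial.monomial d 1) : MvPolynomial τ ℝ) :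
          MvPowerSeries τ ℝ) = d.prod fun s e =>
          (∑ t, MvPowerSeries.C (A s t) * (MvPowerSeries.X t : MvPowerSeries τ ℝ)) ^ e := by
        rw [linSubst, MvPolynomial.aeval_monomial, map_one, one_mul, Finsupp.prod, Finsupp.prod,
          ← MvPolynomial.coeToMvPowerSeries.ringHom_apply, map_prod]
        simp only [map_pow, map_sum, map_mul, MvPolynomial.coeToMvPowerSeries.ringHom_apply,
          MvPolynomial.coe_C, MvPolynomial.coe_X]
      rw [← h2, h, ← hg]
      conv_lhs => rw [g.as_sum]
      rw [map_sum]
      simp only [pair_monomial, MvPolynomial.coeff_coe, MvPolynomial.coeff_monomial]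
      simp only [mul_ite, mul_one, mul_zero]
      rw [Finset.sum_ite_eq]
      split_ifs with hd
      · ring
      · rw [MvPolynomial.notMem_support_iff.1 hd, mul_zero]
    rw [MvPowerSeries.coeff_subst (hasSubst_linear A)]
    simp only [smul_eq_mul]
    rw [finsum_eq_sum_of_support_subset (s := g.support), Finset.mul_sum]
    · conv_rhs => rw [g.as_sum]
      rw [map_sum]
      refine Finset.sum_congr rfl fun d _ => ?_
      rw [pair_monomial, mul_left_comm, hc]
      ring
    · intro d hd
      by_contra hd'
      have h0 := hc d
      rw [MvPolynomial.notMem_support_iff.1 hd', mul_zero] at h0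
      have := (mul_eq_zero.1 h0).resolve_left (multiFactorial_ne_zero ν)
      exact hd (by simp only [this, mul_zero])
  exact LinearMap.congr_fun key f

/-- Renaming variables in power series is adjoint to the transposed substitution. -/
lemma pair_rename [Fintype σ] [Fintype τ] [DecidableEq τ] (r : σ → τ) (F : MvPowerSeries σ ℝ)
    (f : MvPolynomial τ ℝ) :
    pair (MvPowerSeries.rename r F) f =
      pair F (MvPolynomial.aeval (fun t => ∑ s with r s = t, MvPolynomial.X s) f) := by
  have h : (MvPowerSeries.X ∘ r : σ → MvPowerSeries τ ℝ) =
      fun s => ∑ t, MvPowerSeries.C (if r s = t then 1 else 0) * MvPowerSeries.X t := by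
    funext s
    simp [apply_ite MvPowerSeries.C]
  rw [MvPowerSeries.rename_eq_subst, h, pair_subst]
  congr 2
  unfold linSubst
  congr 1
  funext t
  rw [Finset.sum_filter]
  exact Finset.sum_congr rfl fun s _ => by by_cases hs : r s = t <;> simp [hs]

end Fischer

/-! ### Tensor products of functionals -/

section Tensor

variable {d : ℕ} {P Q : Type*}

/-- The dual description of an element of a fibre of the Weyl bundle: the `ℝ[[ħ]]`-valued functional
`f ↦ (f(∂_y) a)(0)` on polynomials. -/
abbrev WeylDual (d : ℕ) := MvPolynomial (Fin d) ℝ →ₗ[ℝ] PowerSeries ℝ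

/-- The exponents of the variables of the `α`-th tensor factor. -/
def slice (m : P × Fin d →₀ ℕ) (α : P) : Fin d →₀ ℕ :=
  m.comapDomain (Prod.mk α) (Prod.mk_right_injective α).injOn

@[simp] lemma slice_apply (m : P × Fin d →₀ ℕ) (α : P) (i : Fin d) : slice m α i = m (α, i) := rfl

lemma monomial_eq_prod_slice [Fintype P] (m : P × Fin d →₀ ℕ) :
    (MvPolynomial.monomial m 1 : MvPolynomial (P × Fin d) ℝ) =
      ∏ α, MvPolynomial.rename (Prod.mk α) (MvPolynomial.monomial (slice m α) 1) := by
  classical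
  simp only [MvPolynomial.rename_monomial]
  rw [← MvPolynomial.monomial_sum_one]
  refine congrArg (fun u => MvPolynomial.monomial u (1 : ℝ)) (Finsupp.ext ?_) 
  rintro ⟨α, i⟩
  rw [Finsupp.finsetSum_apply, Finset.sum_eq_single α]
  · rw [Finsupp.mapDomain_apply (Prod.mk_right_injective α), slice_apply]
  · intro β _ hβ
    exact Finsupp.mapDomain_of_notMem_range _ _ (by rintro ⟨j, hj⟩; exact hβ (Prod.ext_iff.1 hj).1)
  · simp

variable [Fintype P] [Fintype Q]

/-- The tensor product of a family of functionals. -/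
def tensor : MultilinearMap (PowerSeries ℝ) (fun _ : P => WeylDual d)
    (MvPolynomial (P × Fin d) ℝ →ₗ[ℝ] PowerSeries ℝ) where
  toFun lam := (MvPolynomial.basisMonomials (P × Fin d) ℝ).constr ℝ fun m =>
    ∏ α, lam α (MvPolynomial.monomial (slice m α) 1)
  map_update_add' lam α x y := by
    refine (MvPolynomial.basisMonomials (P × Fin d) ℝ).ext fun m => ?_
    simp only [LinearMap.add_apply, Module.Basis.constr_basis]
    have h : ∀ z : WeylDual d, ∀ β, Function.update lam α z β (MvPolynomial.monomial (slice m β) 1)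
        =
        Function.update (fun β => lam β (MvPolynomial.monomial (slice m β) 1)) α
          (z (MvPolynomial.monomial (slice m α) 1)) β := fun z β => by
      by_cases hβ : β = α
      · subst hβ; simp
      · simp [hβ]
    simp only [h]
    exact (MultilinearMap.mkPiAlgebra ℝ P (PowerSeries ℝ)).map_update_add _ α _ _
  map_update_smul' lam α c x := by
    refine (MvPolynomial.basisMonomials (P × Fin d) ℝ).ext fun m => ?_
    simp only [LinearMap.smul_apply, Module.Basis.constr_basis]
    have h : ∀ z : WeylDual d, ∀ β, Function.update lam α z β (MvPolynomial.monomial (slice m β) 1)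
        =
        Function.update (fun β => lam β (MvPolynomial.monomial (slice m β) 1)) α
          (z (MvPolynomial.monomial (slice m α) 1)) β := fun z β => by
      by_cases hβ : β = α
      · subst hβ; simp
      · simp [hβ]
    simp only [h]
    exact (MultilinearMap.mkPiAlgebra (PowerSeries ℝ) P (PowerSeries ℝ)).map_update_smul _ α _ _

lemma tensor_monomial (lam : P → WeylDual d) (m : P × Fin d →₀ ℕ) :
    tensor lam (MvPolynomial.monomial m 1) = ∏ α, lam α (MvPolynomial.monomial (slice m α) 1) := by
  have h : MvPolynomial.monomial m (1 : ℝ) = MvPolynomial.basisMonomials (P × Fin d) ℝ m := by simp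
  rw [h]
  exact Module.Basis.constr_basis _ _ _ _

lemma tensor_prod (lam : P → WeylDual d) (f : P → MvPolynomial (Fin d) ℝ) :
    tensor lam (∏ α, MvPolynomial.rename (Prod.mk α) (f α)) = ∏ α, lam α (f α) := by
  classical
  have key : (tensor lam).compMultilinearMap
      ((MultilinearMap.mkPiAlgebra ℝ P (MvPolynomial (P × Fin d) ℝ)).compLinearMap fun α =>
        (MvPolynomial.rename (Prod.mk α) :
          MvPolynomial (Fin d) ℝ →ₐ[ℝ] MvPolynomial (P × Fin d) ℝ).toLinearMap) =
      (MultilinearMap.mkPiAlgebra ℝ P (PowerSeries ℝ)).compLinearMap lam := by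
    refine Module.Basis.ext_multilinear (fun _ => MvPolynomial.basisMonomials (Fin d) ℝ) fun m => ?_
    have h : ∏ α, MvPolynomial.rename (Prod.mk α) (MvPolynomial.monomial (m α) (1 : ℝ)) =
        MvPolynomial.monomial (∑ α : P, (m α).mapDomain (Prod.mk α)) (1 : ℝ) := by
      simp only [MvPolynomial.rename_monomial, MvPolynomial.monomial_sum_one]
    have hs : ∀ α, slice (∑ α : P, (m α).mapDomain (Prod.mk α)) α = m α := by
      intro α
      ext i
      rw [slice_apply, Finsupp.finsetSum_apply, Finset.sum_eq_single α]
      · rw [Finsupp.mapDomain_apply (Prod.mk_right_injective α)]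
      · intro β _ hβ
        exact Finsupp.mapDomain_of_notMem_range _ _
          (by rintro ⟨j, hj⟩; exact hβ (Prod.ext_iff.1 hj).1)
      · simp
    simp only [LinearMap.compMultilinearMap_apply, MultilinearMap.compLinearMap_apply,
      MultilinearMap.mkPiAlgebra_apply, AlgHom.toLinearMap_apply,
      MvPolynomial.coe_basisMonomials]
    rw [h, tensor_monomial]
    simp only [hs]
  exact DFunLike.congr_fun key f

lemma tensor_relabel (e : Q ≃ P) (lam : P → WeylDual d) (f : MvPolynomial (Q × Fin d) ℝ) :
    tensor (fun β => lam (e β)) f =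
      tensor lam (MvPolynomial.rename (Prod.map e id) f) := by
  have : tensor (fun β => lam (e β)) =
      (tensor lam).comp (MvPolynomial.rename (R := ℝ) (Prod.map e (id : Fin d → Fin
        d))).toLinearMap := by
    refine linearMap_ext_monomial fun m => ?_
    have hinj : Function.Injective (Prod.map e (id : Fin d → Fin d)) :=
      e.injective.prodMap Function.injective_id
    rw [LinearMap.comp_apply, AlgHom.toLinearMap_apply, MvPolynomial.rename_monomial,
      tensor_monomial, tensor_monomial, ← e.prod_comp]
    refine Finset.prod_congr rfl fun β _ => ?_
    refine congrArg (fun u => lam (e β) (MvPolynomial.monomial u (1 : ℝ))) (Finsupp.ext fun i => ?_)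
    rw [slice_apply, slice_apply]
    exact (Finsupp.mapDomain_apply hinj m (β, i)).symm
  exact LinearMap.congr_fun this f

/-- The `ħ`-linear extension of an `ℝ[[ħ]]`-valued functional to power series in `ħ`. -/
def hExt {A : Type*} [CommRing A] [Algebra ℝ A] (l : A →ₗ[ℝ] PowerSeries ℝ) :
    PowerSeries A →ₗ[ℝ] PowerSeries ℝ where
  toFun F := PowerSeries.mk fun N => ∑ x ∈ Finset.HasAntidiagonal.antidiagonal N,
    PowerSeries.coeff x.2 (l (PowerSeries.coeff x.1 F))
  map_add' F G := by ext N; simp [Finset.sum_add_distrib]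
  map_smul' c F := by ext N; simp [Finset.mul_sum]

section hExt

variable {A B : Type*} [CommRing A] [Algebra ℝ A] [CommRing B] [Algebra ℝ B]

lemma coeff_hExt (l : A →ₗ[ℝ] PowerSeries ℝ) (F : PowerSeries A) (N : ℕ) :
    PowerSeries.coeff N (hExt l F) = ∑ x ∈ Finset.HasAntidiagonal.antidiagonal N,
      PowerSeries.coeff x.2 (l (PowerSeries.coeff x.1 F)) := by
  simp [hExt]

lemma hExt_C (l : A →ₗ[ℝ] PowerSeries ℝ) (f : A) : hExt l (PowerSeries.C f) = l f := by
  ext N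
  rw [coeff_hExt, Finset.sum_eq_single (0, N)]
  · simp
  · rintro ⟨i, j⟩ _ h
    have : i ≠ 0 := by
      rintro rfl
      simp_all
    simp [PowerSeries.coeff_C, this]
  · simp

lemma hExt_X_mul (l : A →ₗ[ℝ] PowerSeries ℝ) (F : PowerSeries A) :
    hExt l (PowerSeries.X * F) = PowerSeries.X * hExt l F := by
  ext N
  cases N with
  | zero => simp [coeff_hExt]
  | succ N =>
    rw [PowerSeries.coeff_succ_X_mul, coeff_hExt, coeff_hExt,
      Finset.Nat.antidiagonal_succ, Finset.sum_cons]
    simp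

/-- The coefficientwise extension of an algebra map to power series in `ħ`. -/
abbrev mapH (φ : A →ₐ[ℝ] B) : PowerSeries A →+* PowerSeries B := PowerSeries.map (φ : A →+* B)

lemma hExt_map (l : B →ₗ[ℝ] PowerSeries ℝ) (φ : A →ₐ[ℝ] B) (F : PowerSeries A) :
    hExt l (mapH φ F) = hExt (l.comp φ.toLinearMap) F := by
  ext N
  simp [coeff_hExt]

lemma hExt_add (l l' : A →ₗ[ℝ] PowerSeries ℝ) : hExt (l + l') = hExt l + hExt l' := by
  ext F N
  simp [coeff_hExt, Finset.sum_add_distrib]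

lemma hExt_smul (c : PowerSeries ℝ) (l : A →ₗ[ℝ] PowerSeries ℝ) : hExt (c • l) = c • hExt l := by
  ext F N
  simp only [coeff_hExt, LinearMap.smul_apply, smul_eq_mul, PowerSeries.coeff_mul]
  simp only [Finset.mul_sum]
  rw [Finset.sum_sigma', Finset.sum_sigma']
  refine Finset.sum_bij' (fun x _ => ⟨(x.2.1, x.1.1 + x.2.2), (x.1.1, x.2.2)⟩)
    (fun x _ => ⟨(x.2.1, x.1.1 + x.2.2), (x.1.1, x.2.2)⟩) ?_ ?_ ?_ ?_ ?_
  all_goals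
    rintro ⟨⟨a, b⟩, ⟨e, f⟩⟩ h
    simp only [Finset.mem_sigma, Finset.HasAntidiagonal.mem_antidiagonal] at h ⊢
  · exact ⟨by rw [← h.1, ← h.2, add_left_comm], trivial⟩
  · exact ⟨by rw [← h.1, ← h.2, add_left_comm], trivial⟩
  · obtain ⟨h1, h2⟩ := h
    subst h2
    rfl
  · obtain ⟨h1, h2⟩ := h
    subst h2
    rfl

/-- The `ħ`-linear extension as a linear map in the functional. -/
def hExtHom : (A →ₗ[ℝ] PowerSeries ℝ) →ₗ[PowerSeries ℝ] (PowerSeries A →ₗ[ℝ] PowerSeries ℝ) where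
  toFun := hExt
  map_add' := hExt_add
  map_smul' := hExt_smul

/-- `exp (ħ t)` as a power series in `ħ`. -/
def expH (t : A) : PowerSeries A := PowerSeries.mk fun m => ((m.factorial : ℝ)⁻¹) • t ^ m

lemma expH_add (s t : A) : expH (s + t) = expH s * expH t := by
  ext N
  simp only [expH, PowerSeries.coeff_mk, PowerSeries.coeff_mul]
  rw [(Commute.all s t).add_pow', Finset.smul_sum]
  refine Finset.sum_congr rfl fun x hx => ?_
  rw [smul_mul_smul_comm, ← Nat.cast_smul_eq_nsmul ℝ, smul_smul]
  congr 1
  rw [← Finset.HasAntidiagonal.mem_antidiagonal.1 hx, Nat.add_comm, ←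
      Nat.add_choose_mul_factorial_mul_factorial x.2 x.1]
  push_cast
  have := Nat.choose_pos (Nat.le_add_left x.1 x.2)
  field_simp

lemma map_expH (φ : A →ₐ[ℝ] B) (t : A) :
    mapH φ (expH t) = expH (φ t) := by
  ext N
  simp [expH]

lemma mapH_C (φ : A →ₐ[ℝ] B) (f : A) : mapH φ (PowerSeries.C f) = PowerSeries.C (φ f) :=
  PowerSeries.map_C _ f

lemma mapH_expH_mul_C (φ : A →ₐ[ℝ] B) (t f : A) :
    mapH φ (expH t * PowerSeries.C f) = expH (φ t) * PowerSeries.C (φ f) := by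
  rw [map_mul, map_expH, mapH_C]

end hExt

end Tensor

/-! ### Multidifferential operators and the Moyal product in the dual description -/

section Corr

variable {d : ℕ} {P Q : Type*} [Fintype P] [Fintype Q]

/-- The value at `y = 0` of the multidifferential operator with symbol `F` (a power series in `ħ`
of polynomials in the dual variables of the factors `P`) on a family of elements of the Weyl
algebra. -/
def corr : MultilinearMap (PowerSeries ℝ) (fun _ : P => WeylDual d)
    (PowerSeries (MvPolynomial (P × Fin d) ℝ) →ₗ[ℝ] PowerSeries ℝ) :=
  hExtHom.compMultilinearMap tensor

lemma corr_apply (lam : P → WeylDual d) (F : PowerSeries (MvPolynomial (P × Fin d) ℝ)) :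
    corr lam F = hExt (tensor lam) F := rfl

/-- Relabelling of the points of a configuration. -/
def relabel (e : Q → P) : MvPolynomial (Q × Fin d) ℝ →ₐ[ℝ] MvPolynomial (P × Fin d) ℝ :=
  MvPolynomial.rename (Prod.map e id)

@[simp] lemma relabel_X (e : Q → P) (α : Q) (i : Fin d) :
    relabel e (MvPolynomial.X (α, i)) = MvPolynomial.X (e α, i) := by
  simp [relabel]

lemma corr_relabel (e : Q ≃ P) (lam : P → WeylDual d)
    (F : PowerSeries (MvPolynomial (Q × Fin d) ℝ)) :
    corr (fun β => lam (e β)) F =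
      corr lam (mapH (relabel e) F) := by
  rw [corr_apply, corr_apply, hExt_map]
  have h : tensor (fun β => lam (e β)) = (tensor lam).comp (relabel e).toLinearMap :=
    LinearMap.ext fun f => tensor_relabel e lam f
  rw [h]

/-- The symbol `Ω^{ij} ξ_αᵢ ξ_βⱼ` of the bidifferential operator defined by a bivector. -/
def bsym (Pi : Matrix (Fin d) (Fin d) ℝ) (α β : P) : MvPolynomial (P × Fin d) ℝ :=
  ∑ i, ∑ j, MvPolynomial.C (Pi i j) * (MvPolynomial.X (α, i) * MvPolynomial.X (β, j))

@[simp] lemma relabel_bsym (e : Q → P) (Pi : Matrix (Fin d) (Fin d) ℝ) (α β : Q) :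
    relabel e (bsym Pi α β) = bsym Pi (e α) (e β) := by
  simp [bsym, map_sum, relabel]

lemma bsym_transpose (Pi : Matrix (Fin d) (Fin d) ℝ) (α β : P) :
    bsym Pi.transpose α β = bsym Pi β α := by
  unfold bsym
  rw [Finset.sum_comm]
  refine Finset.sum_congr rfl fun i _ => Finset.sum_congr rfl fun j _ => ?_
  rw [Matrix.transpose_apply, mul_comm (MvPolynomial.X (β, i))]

lemma bsym_neg (Pi : Matrix (Fin d) (Fin d) ℝ) (α β : P) : bsym (-Pi) α β = -bsym Pi α β := by
  simp [bsym]

lemma bsym_swap {Pi : Matrix (Fin d) (Fin d) ℝ} (hPi : Pi.transpose = -Pi) (α β : P) :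
    bsym Pi α β = -bsym Pi β α := by
  rw [← bsym_transpose, hPi, bsym_neg]

lemma bsym_self {Pi : Matrix (Fin d) (Fin d) ℝ} (hPi : Pi.transpose = -Pi) (α : P) :
    bsym Pi α α = 0 := self_eq_neg.1 (bsym_swap hPi α α)

/-- The substitution `ξ ↦ ξ₀ + ξ₁`, dual to the multiplication map. -/
def diag : MvPolynomial (Fin d) ℝ →ₐ[ℝ] MvPolynomial (Fin 2 × Fin d) ℝ :=
  MvPolynomial.aeval fun i => MvPolynomial.X (0, i) + MvPolynomial.X (1, i)

/-- The Moyal product in the dual description. -/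
def starL (Pi : Matrix (Fin d) (Fin d) ℝ) (a b : WeylDual d) : WeylDual d where
  toFun f := corr ![a, b] (expH ((1 / 2 : ℝ) • bsym Pi 0 1) * PowerSeries.C (diag f))
  map_add' f g := by simp [mul_add]
  map_smul' c f := by
    have : PowerSeries.C (diag (c • f)) = c • PowerSeries.C (diag f) := by
      rw [map_smul]; ext N; simp [PowerSeries.coeff_C]
    rw [this, mul_smul_comm, map_smul]
    rfl

lemma starL_apply (Pi : Matrix (Fin d) (Fin d) ℝ) (a b : WeylDual d) (f : MvPolynomial (Fin d) ℝ) :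
    starL Pi a b f = corr ![a, b] (expH ((1 / 2 : ℝ) • bsym Pi 0 1) * PowerSeries.C (diag f)) :=
  rfl

lemma starL_swap (Pi : Matrix (Fin d) (Fin d) ℝ) (a b : WeylDual d) :
    starL Pi a b = starL Pi.transpose b a := by
  refine LinearMap.ext fun f => ?_
  rw [starL_apply, starL_apply]
  have h : (![a, b] : Fin 2 → WeylDual d) = fun β => (![b, a] : Fin 2 → WeylDual d)
      (Equiv.swap 0 1 β) := by
    funext β; fin_cases β <;> simp
  have h1 : relabel (Equiv.swap (0 : Fin 2) 1) (diag f) = diag f := by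
    have : (relabel (Equiv.swap (0 : Fin 2) 1)).comp (diag (d := d)) = diag := by
      refine MvPolynomial.algHom_ext fun i => ?_
      simp [diag, add_comm]
    exact DFunLike.congr_fun this f
  have h2 : relabel (Equiv.swap (0 : Fin 2) 1) ((1 / 2 : ℝ) • bsym Pi 0 1) =
      (1 / 2 : ℝ) • bsym Pi.transpose 0 1 := by
    rw [map_smul, relabel_bsym, bsym_transpose, Equiv.swap_apply_left, Equiv.swap_apply_right]
  rw [h, corr_relabel, mapH_expH_mul_C, h1, h2]

lemma update_pair_zero (a b x : WeylDual d) : Function.update ![a, b] 0 x = ![x, b] := by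
  funext i; fin_cases i <;> simp

lemma update_pair_one (a b x : WeylDual d) : Function.update ![a, b] 1 x = ![a, x] := by
  funext i; fin_cases i <;> simp

/-- The Moyal product, as a bilinear map over `ℝ[[ħ]]`. -/
def starB (Pi : Matrix (Fin d) (Fin d) ℝ) :
    WeylDual d →ₗ[PowerSeries ℝ] WeylDual d →ₗ[PowerSeries ℝ] WeylDual d :=
  LinearMap.mk₂ (PowerSeries ℝ) (starL Pi)
    (fun a b c => by
      refine LinearMap.ext fun f => ?_
      have := (corr (d := d) (P := Fin 2)).map_update_add ![a, c] 0 a b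
      simp only [update_pair_zero] at this
      simp [starL_apply, this])
    (fun r a c => by
      refine LinearMap.ext fun f => ?_
      have := (corr (d := d) (P := Fin 2)).map_update_smul ![a, c] 0 r a
      simp only [update_pair_zero] at this
      simp [starL_apply, this])
    (fun a b c => by
      refine LinearMap.ext fun f => ?_
      have := (corr (d := d) (P := Fin 2)).map_update_add ![a, b] 1 b c
      simp only [update_pair_one] at this
      simp [starL_apply, this])
    (fun r a c => by
      refine LinearMap.ext fun f => ?_
      have := (corr (d := d) (P := Fin 2)).map_update_smul ![a, c] 1 r c
      simp only [update_pair_one] at this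
      simp [starL_apply, this])

lemma starB_apply (Pi : Matrix (Fin d) (Fin d) ℝ) (a b : WeylDual d) :
    starB Pi a b = starL Pi a b := rfl

end Corr

section Collapse

variable {d : ℕ} {P : Type*} [Fintype P] [DecidableEq P]

/-- A family indexed by `Option P`, with the given element at the additional point. -/
def consPt (u : WeylDual d) (lam : P → WeylDual d) : Option P → WeylDual d :=
  fun o => o.elim u lam

@[simp] lemma consPt_none (u : WeylDual d) (lam : P → WeylDual d) : consPt u lam none = u := rfl
@[simp] lemma consPt_some (u : WeylDual d) (lam : P → WeylDual d) (α : P) :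
    consPt u lam (some α) = lam α := rfl

/-- The substitution `ξ_β ↦ ξ_β + ξ_none`, dual to merging the additional point with `β`. -/
def collapse (β : P) : MvPolynomial (P × Fin d) ℝ →ₐ[ℝ] MvPolynomial (Option P × Fin d) ℝ :=
  MvPolynomial.aeval fun x => MvPolynomial.X (some x.1, x.2) +
    if x.1 = β then MvPolynomial.X (none, x.2) else 0

lemma tensor_consPt_split (β : P) (u : WeylDual d) (lam : P → WeylDual d)
    (g : MvPolynomial (Fin 2 × Fin d) ℝ) (f : P → MvPolynomial (Fin d) ℝ) :
    tensor (consPt u lam) (relabel ![none, some β] g *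
      ∏ α ∈ Finset.univ.erase β, MvPolynomial.rename (Prod.mk (some α)) (f α)) =
    tensor ![u, lam β] g * ∏ α ∈ Finset.univ.erase β, lam α (f α) := by
  have : (tensor (consPt u lam)).comp ((LinearMap.mulRight ℝ
      (∏ α ∈ Finset.univ.erase β, MvPolynomial.rename (Prod.mk (some α)) (f α))).comp
        (relabel ![none, some β] : MvPolynomial (Fin 2 × Fin d) ℝ →ₐ[ℝ] _).toLinearMap) =
      (LinearMap.mulRight ℝ (∏ α ∈ Finset.univ.erase β, lam α (f α))).comp
        (tensor ![u, lam β]) := by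
    refine linearMap_ext_monomial fun m => ?_
    simp only [LinearMap.comp_apply, LinearMap.mulRight_apply, AlgHom.toLinearMap_apply]
    rw [monomial_eq_prod_slice, tensor_prod, map_prod, Fin.prod_univ_two, Fin.prod_univ_two]
    have h : ∀ o : Fin 2, ∀ q : MvPolynomial (Fin d) ℝ,
        relabel (![none, some β] : Fin 2 → Option P) (MvPolynomial.rename (Prod.mk o) q) =
        MvPolynomial.rename (Prod.mk ((![none, some β] : Fin 2 → Option P) o)) q := fun o q => by
      rw [relabel, MvPolynomial.rename_rename]; rfl
    rw [h, h]
    have key := tensor_prod (consPt u lam) (fun o => o.elim (MvPolynomial.monomial (slice m 0) 1)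
      (Function.update f β (MvPolynomial.monomial (slice m 1) 1)))
    rw [Fintype.prod_option, Fintype.prod_option, ← Finset.mul_prod_erase _ _ (Finset.mem_univ β),
      ← Finset.mul_prod_erase _ _ (Finset.mem_univ β), ← mul_assoc, ← mul_assoc] at key
    simp only [Option.elim, Function.update_self, consPt_none, consPt_some] at key
    rw [Finset.prod_congr rfl (g := fun α => MvPolynomial.rename (Prod.mk (some α)) (f α))
      (fun α hα => by rw [Function.update_of_ne (Finset.ne_of_mem_erase hα)]),
      Finset.prod_congr rfl (g := fun α => lam α (f α))
      (fun α hα => by rw [Function.update_of_ne (Finset.ne_of_mem_erase hα)])] at key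
    simpa using key
  exact LinearMap.congr_fun this g

/-- Inserting a Moyal product at a point amounts to merging two points. -/
lemma tensor_update_starL (Pi : Matrix (Fin d) (Fin d) ℝ) (β : P) (u : WeylDual d)
    (lam : P → WeylDual d) (f : MvPolynomial (P × Fin d) ℝ) :
    tensor (Function.update lam β (starL Pi u (lam β))) f =
      corr (consPt u lam) (expH ((1 / 2 : ℝ) • bsym Pi none (some β)) *
        PowerSeries.C (collapse β f)) := by
  have hcol : ∀ (α : P) (q : MvPolynomial (Fin d) ℝ),
      collapse β (MvPolynomial.rename (Prod.mk α) q) =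
      if α = β then relabel ![none, some β] (diag q) else
        MvPolynomial.rename (Prod.mk (some α)) q := by
    intro α q
    split_ifs with h
    · subst h
      have : (collapse α).comp (MvPolynomial.rename (Prod.mk α)) =
          (relabel (![none, some α] : Fin 2 → Option P)).comp (diag (d := d)) := by
        refine MvPolynomial.algHom_ext fun i => ?_
        simp [collapse, diag, add_comm]
      exact DFunLike.congr_fun this q
    · have : (collapse β).comp (MvPolynomial.rename (Prod.mk α)) =
          (MvPolynomial.rename (Prod.mk (some α)) :
            MvPolynomial (Fin d) ℝ →ₐ[ℝ] MvPolynomial (Option P × Fin d) ℝ) := by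
        refine MvPolynomial.algHom_ext fun i => ?_
        simp [collapse, h]
      exact DFunLike.congr_fun this q
  have key : tensor (Function.update lam β (starL Pi u (lam β))) =
      (corr (consPt u lam)).comp ((LinearMap.mulLeft ℝ
        (expH ((1 / 2 : ℝ) • bsym Pi none (some β)))).comp
        ({ toFun := fun f => PowerSeries.C (collapse β f)
           map_add' := by simp
           map_smul' := fun c f => by ext N; simp [PowerSeries.coeff_C] } :
           MvPolynomial (P × Fin d) ℝ →ₗ[ℝ] _)) := by
    refine linearMap_ext_monomial fun m => ?_
    simp only [LinearMap.comp_apply, LinearMap.mulLeft_apply, LinearMap.coe_mk, AddHom.coe_mk]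
    rw [monomial_eq_prod_slice, tensor_prod, map_prod]
    simp only [hcol]
    rw [← Finset.mul_prod_erase _ _ (Finset.mem_univ β),
      ← Finset.mul_prod_erase _ _ (Finset.mem_univ β), if_pos rfl, Function.update_self,
      Finset.prod_congr rfl (g := fun α => lam α (MvPolynomial.monomial (slice m α) 1))
      (fun α hα => by rw [Function.update_of_ne (Finset.ne_of_mem_erase hα)]),
      Finset.prod_congr rfl (g := fun α => MvPolynomial.rename (Prod.mk (some α))
        (MvPolynomial.monomial (slice m α) 1))
      (fun α hα => by rw [if_neg (Finset.ne_of_mem_erase hα)]), starL_apply]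
    ext N
    rw [corr_apply, corr_apply, coeff_hExt, PowerSeries.coeff_mul]
    simp only [coeff_hExt]
    have h2 : ∀ i, PowerSeries.coeff i (expH ((1 / 2 : ℝ) • bsym Pi none (some β)) *
        PowerSeries.C (relabel ![none, some β] (diag (MvPolynomial.monomial (slice m β) (1 : ℝ))) *
        ∏ α ∈ Finset.univ.erase β, MvPolynomial.rename (Prod.mk (some α))
          (MvPolynomial.monomial (slice m α) (1 : ℝ)))) =
        relabel ![none, some β] (PowerSeries.coeff i (expH ((1 / 2 : ℝ) • bsym Pi (0 : Fin 2) 1) *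
          PowerSeries.C (diag (MvPolynomial.monomial (slice m β) (1 : ℝ))))) *
        ∏ α ∈ Finset.univ.erase β, MvPolynomial.rename (Prod.mk (some α))
          (MvPolynomial.monomial (slice m α) (1 : ℝ)) := by
      intro i
      rw [PowerSeries.coeff_mul_C, PowerSeries.coeff_mul_C, map_mul, mul_assoc]
      congr 1
      simp [expH]
    simp only [h2, tensor_consPt_split, PowerSeries.coeff_mul]
    simp only [Finset.sum_mul]
    rw [Finset.sum_sigma', Finset.sum_sigma']
    refine Finset.sum_bij' (fun x _ => ⟨(x.2.1, x.2.2 + x.1.2), (x.2.2, x.1.2)⟩)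
      (fun x _ => ⟨(x.1.1 + x.2.1, x.2.2), (x.1.1, x.2.1)⟩) ?_ ?_ ?_ ?_ ?_
    all_goals
      rintro ⟨⟨a, b⟩, ⟨e, f⟩⟩ h
      simp only [Finset.mem_sigma, Finset.HasAntidiagonal.mem_antidiagonal] at h ⊢
    · exact ⟨by rw [← h.1, ← h.2, add_assoc], trivial⟩
    · exact ⟨by rw [← h.1, ← h.2, add_assoc], trivial⟩
    · obtain ⟨h1, h2⟩ := h
      subst h2
      rfl
    · obtain ⟨h1, h2⟩ := h
      subst h2
      rfl
  exact LinearMap.congr_fun key f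

/-- `tensor_update_starL` for symbols that are power series in `ħ`. -/
lemma corr_update_starL (Pi : Matrix (Fin d) (Fin d) ℝ) (β : P) (u : WeylDual d)
    (lam : P → WeylDual d) (F : PowerSeries (MvPolynomial (P × Fin d) ℝ)) :
    corr (Function.update lam β (starL Pi u (lam β))) F =
      corr (consPt u lam) (expH ((1 / 2 : ℝ) • bsym Pi none (some β)) *
        mapH (collapse β) F) := by
  ext N
  rw [corr_apply, corr_apply, coeff_hExt, coeff_hExt]
  simp only [tensor_update_starL, corr_apply, coeff_hExt, PowerSeries.coeff_mul_C]
  simp only [PowerSeries.coeff_mul, map_sum, PowerSeries.coeff_map]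
  simp only [Finset.sum_sigma']
  refine Finset.sum_bij' (fun x _ => ⟨(x.2.1 + x.1.1, x.2.2), (x.2.1, x.1.1)⟩)
    (fun x _ => ⟨(x.2.2, x.2.1 + x.1.2), (x.2.1, x.1.2)⟩) ?_ ?_ ?_ ?_ ?_
  all_goals
    rintro ⟨⟨a, b⟩, ⟨e, f⟩⟩ h
    simp only [Finset.mem_sigma, Finset.HasAntidiagonal.mem_antidiagonal] at h ⊢
  · exact ⟨by rw [← h.1, ← h.2, add_comm e a, add_assoc], trivial⟩
  · exact ⟨by rw [← h.1, ← h.2, add_comm e f, add_assoc], trivial⟩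
  · obtain ⟨h1, h2⟩ := h
    subst h2
    rfl
  · obtain ⟨h1, h2⟩ := h
    subst h2
    rfl
  · rfl

lemma corr_update_starL_right (Pi : Matrix (Fin d) (Fin d) ℝ) (β : P) (u : WeylDual d)
    (lam : P → WeylDual d) (F : PowerSeries (MvPolynomial (P × Fin d) ℝ)) :
    corr (Function.update lam β (starL Pi (lam β) u)) F =
      corr (consPt u lam) (expH ((1 / 2 : ℝ) • bsym Pi (some β) none) *
        mapH (collapse β) F) := by
  rw [starL_swap, corr_update_starL, bsym_transpose]

/-- The Moyal commutator in the dual description. -/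
def commL (Pi : Matrix (Fin d) (Fin d) ℝ) (a b : WeylDual d) : WeylDual d :=
  starL Pi a b - starL Pi b a

/-- The symbol of the commutator with the additional point, `2 sinh (ħ Ω(ξ_none, ξ_β) / 2)`. -/
def sinhSym {A : Type*} [CommRing A] [Algebra ℝ A] (t : A) : PowerSeries A :=
  expH ((1 / 2 : ℝ) • t) - expH (-((1 / 2 : ℝ) • t))

lemma corr_update_commL {Pi : Matrix (Fin d) (Fin d) ℝ} (hPi : Pi.transpose = -Pi) (β : P)
    (u : WeylDual d) (lam : P → WeylDual d) (F : PowerSeries (MvPolynomial (P × Fin d) ℝ)) :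
    corr (Function.update lam β (commL Pi u (lam β))) F =
      corr (consPt u lam) (sinhSym (bsym Pi none (some β)) *
        mapH (collapse β) F) := by
  rw [commL, MultilinearMap.map_update_sub, LinearMap.sub_apply, corr_update_starL,
    corr_update_starL_right, sinhSym, sub_mul, map_sub, bsym_swap hPi (some β) none, smul_neg]

/-- Merging the additional point with `β` turns each edge at `β` into a sum of two edges. -/
lemma collapse_bsym (Pi : Matrix (Fin d) (Fin d) ℝ) (β x y : P) :
    collapse β (bsym Pi x y) = bsym Pi (some x) (some y) +
      (if x = β then bsym Pi none (some y) else 0) + (if y = β then bsym Pi (some x) none else 0) +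
      (if x = β ∧ y = β then bsym Pi none none else 0) := by
  simp only [bsym, collapse, map_sum, map_mul, MvPolynomial.aeval_X, MvPolynomial.algHom_C]
  by_cases hx : x = β <;> by_cases hy : y = β <;>
    simp only [hx, hy, Finset.sum_add_distrib, mul_add, add_mul, if_true, if_false, add_zero,
      and_self, and_true, and_false, MvPolynomial.algebraMap_eq]
  abel

lemma starL_starL_left (Pi : Matrix (Fin d) (Fin d) ℝ) (a b c : WeylDual d)
    (f : MvPolynomial (Fin d) ℝ) :
    starL Pi (starL Pi a b) c f = corr (consPt a ![b, c])
      (expH ((1 / 2 : ℝ) • (bsym Pi none (some 0) + bsym Pi (some 0) (some 1) +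
        bsym Pi none (some 1))) * PowerSeries.C (collapse (0 : Fin 2) (diag f))) := by
  have h1 : starL Pi (starL Pi a b) c f = corr (consPt a ![b, c])
      (expH ((1 / 2 : ℝ) • bsym Pi none (some 0)) * mapH (collapse (0 : Fin 2))
        (expH ((1 / 2 : ℝ) • bsym Pi (0 : Fin 2) 1) * PowerSeries.C (diag f))) := by
    rw [← corr_update_starL, starL_apply, update_pair_zero]
    rfl
  have h2 : collapse (0 : Fin 2) ((1 / 2 : ℝ) • bsym Pi (0 : Fin 2) 1) =
      (1 / 2 : ℝ) • (bsym Pi (some 0) (some 1) + bsym Pi none (some 1)) := by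
    rw [map_smul, collapse_bsym]; simp
  rw [h1, mapH_expH_mul_C, h2, ← mul_assoc, ← expH_add, ← smul_add, ← add_assoc]

lemma starL_starL_right (Pi : Matrix (Fin d) (Fin d) ℝ) (a b c : WeylDual d)
    (f : MvPolynomial (Fin d) ℝ) :
    starL Pi a (starL Pi b c) f = corr (consPt b ![a, c])
      (expH ((1 / 2 : ℝ) • (bsym Pi none (some 1) + bsym Pi (some 0) (some 1) +
        bsym Pi (some 0) none)) * PowerSeries.C (collapse (1 : Fin 2) (diag f))) := by
  have h1 : starL Pi a (starL Pi b c) f = corr (consPt b ![a, c])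
      (expH ((1 / 2 : ℝ) • bsym Pi none (some 1)) * mapH (collapse (1 : Fin 2))
        (expH ((1 / 2 : ℝ) • bsym Pi (0 : Fin 2) 1) * PowerSeries.C (diag f))) := by
    rw [← corr_update_starL, starL_apply, update_pair_one]
    rfl
  have h2 : collapse (1 : Fin 2) ((1 / 2 : ℝ) • bsym Pi (0 : Fin 2) 1) =
      (1 / 2 : ℝ) • (bsym Pi (some 0) (some 1) + bsym Pi (some 0) none) := by
    rw [map_smul, collapse_bsym]; simp
  rw [h1, mapH_expH_mul_C, h2, ← mul_assoc, ← expH_add, ← smul_add, ← add_assoc]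

lemma relabel_swap_collapse (f : MvPolynomial (Fin d) ℝ) :
    relabel (Equiv.swap none (some (0 : Fin 2))) (collapse (1 : Fin 2) (diag f)) =
      collapse (0 : Fin 2) (diag f) := by
  have e2 : Equiv.swap none (some (0 : Fin 2)) (some 1) = some 1 := by
    rw [Equiv.swap_apply_of_ne_of_ne] <;> simp
  have : (relabel (Equiv.swap none (some (0 : Fin 2)))).comp
      ((collapse (1 : Fin 2)).comp (diag (d := d))) = (collapse (0 : Fin 2)).comp diag := by
    refine MvPolynomial.algHom_ext fun i => ?_
    simp only [AlgHom.comp_apply, diag, collapse, MvPolynomial.aeval_X, map_add, relabel_X]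
    simp [e2]
    abel
  exact DFunLike.congr_fun this f

lemma consPt_swap (a b c : WeylDual d) : consPt b ![a, c] = fun o =>
    consPt a ![b, c] (Equiv.swap none (some (0 : Fin 2)) o) := by
  have e2 : Equiv.swap none (some (0 : Fin 2)) (some 1) = some 1 := by
    rw [Equiv.swap_apply_of_ne_of_ne] <;> simp
  funext o
  match o with
  | none => simp
  | some 0 => simp
  | some 1 => simp [e2]

/-- The Moyal product is associative: both bracketings are given by the exponential of all edges
between three points. -/
lemma starL_assoc (Pi : Matrix (Fin d) (Fin d) ℝ) (a b c : WeylDual d) :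
    starL Pi (starL Pi a b) c = starL Pi a (starL Pi b c) := by
  refine LinearMap.ext fun f => ?_
  have e2 : Equiv.swap none (some (0 : Fin 2)) (some 1) = some 1 := by
    rw [Equiv.swap_apply_of_ne_of_ne] <;> simp
  have h : relabel (Equiv.swap none (some (0 : Fin 2))) ((1 / 2 : ℝ) •
      (bsym Pi none (some 1) + bsym Pi (some 0) (some 1) + bsym Pi (some 0) none)) =
      (1 / 2 : ℝ) • (bsym Pi none (some 0) + bsym Pi (some 0) (some 1) +
        bsym Pi none (some 1)) := by
    simp only [map_smul, map_add, relabel_bsym, Equiv.swap_apply_left, Equiv.swap_apply_right, e2]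
    exact congrArg _ (add_rotate _ _ _).symm
  rw [starL_starL_left, starL_starL_right, consPt_swap a b c, corr_relabel, mapH_expH_mul_C,
    relabel_swap_collapse, h]

lemma commL_starL (Pi : Matrix (Fin d) (Fin d) ℝ) (g a b : WeylDual d) :
    commL Pi g (starL Pi a b) = starL Pi (commL Pi g a) b + starL Pi a (commL Pi g b) := by
  unfold commL
  simp only [← starB_apply, map_sub, LinearMap.sub_apply]
  simp only [starB_apply, starL_assoc]
  abel

end Collapse

/-! ### Integrals over configurations of points on the circle -/

section Config

variable {P Q : Type*} [Fintype P] [DecidableEq P] [Fintype Q] [DecidableEq Q]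
variable {A B : Type*} [CommRing A] [Algebra ℝ A] [CommRing B] [Algebra ℝ B]

/-- The propagator between the points `x.1` and `x.2` of a configuration, with the symmetry factor
`1 / 2`. -/
def wickKernel (θ : P → ℝ) (x : P × P) : ℝ :=
  if x.1 = x.2 then 0 else (1 / 2) * propagator (θ x.1) (θ x.2)

/-- The integral of a product of propagators over all configurations of points on the circle. -/
def wickCoeff {m : ℕ} (f : Fin m → P × P) : ℝ :=
  ∫ θ in Set.Icc (0 : P → ℝ) 1, ∏ i, wickKernel θ (f i)

/-- The coefficient of `ħ^m` in the integral of `exp (ħ ∑ P(θ_α, θ_β) b_αβ / 2)` over all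
configurations of points on the circle, for `b` with entries in a commutative algebra. -/
def cfg (m : ℕ) (b : P → P → A) : A :=
  ((m.factorial : ℝ)⁻¹) • ∑ f : Fin m → P × P, wickCoeff f • ∏ i, b (f i).1 (f i).2

/-- The generating series of the configuration integrals `cfg`. -/
def cfgH (b : P → P → A) : PowerSeries A := PowerSeries.mk fun m => cfg m b

lemma map_cfg (φ : A →ₐ[ℝ] B) (m : ℕ) (b : P → P → A) :
    φ (cfg m b) = cfg m fun α β => φ (b α β) := by
  simp [cfg, map_sum, map_prod]

lemma mapH_cfgH (φ : A →ₐ[ℝ] B) (b : P → P → A) :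
    mapH φ (cfgH b) = cfgH fun α β => φ (b α β) := by
  ext m
  simp [cfgH, ← map_cfg]

lemma wickCoeff_relabel (e : Q ≃ P) {m : ℕ} (f : Fin m → Q × Q) :
    wickCoeff (fun i => (e (f i).1, e (f i).2)) = wickCoeff f := by
  unfold wickCoeff
  have hmp := MeasureTheory.volume_measurePreserving_piCongrLeft (fun _ : P => ℝ) e
  rw [← hmp.setIntegral_preimage_emb (MeasurableEquiv.measurableEmbedding _)]
  have happ : ∀ (θ : Q → ℝ) (α : Q), (MeasurableEquiv.piCongrLeft (fun _ : P => ℝ) e) θ (e α) =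
      θ α := fun θ α => Equiv.piCongrLeft_apply_apply (fun _ : P => ℝ) e θ α
  have hset : (MeasurableEquiv.piCongrLeft (fun _ : P => ℝ) e) ⁻¹' Set.Icc 0 1 =
      Set.Icc (0 : Q → ℝ) 1 := by
    ext θ
    simp only [Set.mem_preimage, Set.mem_Icc, Pi.le_def]
    rw [← e.forall_congr_right (q := fun a => (0 : P → ℝ) a ≤ _),
      ← e.forall_congr_right (q := fun a => _ ≤ (1 : P → ℝ) a)]
    simp [happ]
  rw [hset]
  refine MeasureTheory.integral_congr_ae (Filter.Eventually.of_forall fun θ => ?_)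
  simp [wickKernel, happ]

lemma cfg_relabel (e : Q ≃ P) (m : ℕ) (b : P → P → A) :
    cfg m (fun α β => b (e α) (e β)) = cfg m b := by
  unfold cfg
  congr 1
  refine Fintype.sum_equiv (Equiv.arrowCongr (Equiv.refl (Fin m)) (Equiv.prodCongr e e)) _ _
    fun f => ?_
  rw [← wickCoeff_relabel e]
  rfl

lemma cfgH_relabel (e : Q ≃ P) (b : P → P → A) : cfgH (fun α β => b (e α) (e β)) = cfgH b := by
  ext m
  simp [cfgH, cfg_relabel]

/-- The exponent `∑ P(θ_α, θ_β) b_αβ / 2`. -/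
def phase (b : P → P → ℝ) (θ : P → ℝ) : ℝ := ∑ x : P × P, wickKernel θ x * b x.1 x.2

lemma measurable_wickKernel (x : P × P) : Measurable fun θ : P → ℝ => wickKernel θ x := by
  unfold wickKernel propagator
  split_ifs
  · exact measurable_const
  · fun_prop

lemma abs_propagator_le (s t : ℝ) : |propagator s t| ≤ 1 := by
  unfold propagator
  rw [abs_le]
  have := Int.fract_nonneg (s - t)
  have := Int.fract_lt_one (s - t)
  constructor <;> linarith

lemma abs_wickKernel_le (θ : P → ℝ) (x : P × P) : |wickKernel θ x| ≤ 1 := by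
  unfold wickKernel
  split_ifs
  · simp
  · rw [abs_mul]
    have := abs_propagator_le (θ x.1) (θ x.2)
    rw [abs_of_pos (by norm_num : (0 : ℝ) < 1 / 2)]
    linarith

lemma measurable_phase (b : P → P → ℝ) : Measurable (phase b) := by
  unfold phase
  exact Finset.measurable_sum _ fun x _ => (measurable_wickKernel x).mul_const _

lemma abs_phase_le (b : P → P → ℝ) (θ : P → ℝ) : |phase b θ| ≤ ∑ x : P × P, |b x.1 x.2| := by
  unfold phase
  refine (Finset.abs_sum_le_sum_abs _ _).trans (Finset.sum_le_sum fun x _ => ?_)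
  rw [abs_mul]
  exact mul_le_of_le_one_left (abs_nonneg _) (abs_wickKernel_le θ x)

lemma integrableOn_Icc_of_bounded {f : (P → ℝ) → ℝ} (hf : Measurable f) (C : ℝ)
    (hC : ∀ θ, |f θ| ≤ C) : MeasureTheory.IntegrableOn f (Set.Icc 0 1) := by
  refine MeasureTheory.Measure.integrableOn_of_bounded (M := C) ?_ hf.aestronglyMeasurable
    (Filter.Eventually.of_forall fun θ => hC θ)
  exact (isCompact_Icc).measure_lt_top.ne

lemma integrableOn_wick {m : ℕ} (f : Fin m → P × P) :
    MeasureTheory.IntegrableOn (fun θ : P → ℝ => ∏ i, wickKernel θ (f i)) (Set.Icc 0 1) := by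
  refine integrableOn_Icc_of_bounded (Finset.measurable_prod _ fun i _ => measurable_wickKernel _) 1
    fun θ => ?_
  rw [Finset.abs_prod]
  exact Finset.prod_le_one (fun _ _ => abs_nonneg _) fun i _ => abs_wickKernel_le _ _

/-- For real symbols, the configuration integral is the integral of a power of the phase, so that
`cfgH b` is the integral of `exp (ħ phase)`. -/
lemma cfg_real (m : ℕ) (b : P → P → ℝ) :
    cfg m b = ∫ θ in Set.Icc (0 : P → ℝ) 1, ((m.factorial : ℝ)⁻¹) * phase b θ ^ m := by
  have h : ∀ θ : P → ℝ, phase b θ ^ m = ∑ f : Fin m → P × P,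
      (∏ i, wickKernel θ (f i)) * ∏ i, b (f i).1 (f i).2 := by
    intro θ
    rw [phase, ← Fin.prod_const, Finset.prod_univ_sum]
    simp [Finset.prod_mul_distrib]
  simp only [h]
  rw [MeasureTheory.integral_const_mul, MeasureTheory.integral_finsetSum]
  · simp only [MeasureTheory.integral_mul_const]
    rfl
  · exact fun f _ => (integrableOn_wick f).mul_const _

end Config

/-! ### Piecewise polynomial functions on the circle -/

section Circle

variable {P : Type*} [Fintype P] [DecidableEq P]

lemma ite_le_eq_ite_lt {s t : ℝ} (h : s ≠ t) :
    (if s ≤ t then (1 : ℝ) else 0) = if s < t then 1 else 0 := by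
  simp [h.le_iff_lt]

/-- On the fundamental domain, the propagator is an affine function plus a step function. -/
lemma propagator_of_mem {s t : ℝ} (hs : s ∈ Set.Icc (0 : ℝ) 1) (ht : t ∈ Set.Ioo (0 : ℝ) 1) :
    propagator s t = s - t + (if s < t then 1 else 0) - 1 / 2 := by
  unfold propagator
  obtain ⟨h0, h1⟩ := hs
  obtain ⟨h2, h3⟩ := ht
  split_ifs with h
  · have : Int.fract (s - t) = s - t + 1 := by
      rw [Int.fract_eq_iff]
      exact ⟨by linarith, by linarith, -1, by push_cast; ring⟩
    rw [this]
  · have : Int.fract (s - t) = s - t := by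
      rw [Int.fract_eq_self]
      exact ⟨by linarith, by linarith⟩
    rw [this]; ring

/-- The primitive used in `integral_circle`, for given values `e` of the step functions. -/
def stepPrimitive (T c J : P → ℝ) (y : ℝ) (m : ℕ) (e : P → ℝ) (s : ℝ) : ℝ :=
  (((m + 1).factorial : ℝ)⁻¹) * (∑ β, (s - T β + e β - 1 / 2) * c β + y) ^ (m + 1) +
    ∑ β, J β * (1 - e β)

lemma hasDerivAt_stepPrimitive (T c J : P → ℝ) (y : ℝ) (m : ℕ) (e : P → ℝ) (s : ℝ) :
    HasDerivAt (stepPrimitive T c J y m e)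
      ((∑ β, c β) * (((m.factorial : ℝ)⁻¹) * (∑ β, (s - T β + e β - 1 / 2) * c β + y) ^ m)) s := by
  have h1 : HasDerivAt (fun s => ∑ β, (s - T β + e β - 1 / 2) * c β + y) (∑ β, c β) s := by
    have : HasDerivAt (fun s => ∑ β, (s - T β + e β - 1 / 2) * c β) (∑ β, 1 * c β) s := by
      refine HasDerivAt.fun_sum fun β _ => ?_
      exact ((((hasDerivAt_id s).sub_const (T β)).add_const (e β)).sub_const (1 / 2)).mul_const (c
          β)
    simpa using this.add_const y
  have h2 := ((h1.pow (m + 1)).const_mul (((m + 1).factorial : ℝ)⁻¹)).add_const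
    (∑ β, J β * (1 - e β))
  refine h2.congr_deriv ?_
  have hm : (m.factorial : ℝ) ≠ 0 := by positivity
  simp only [Nat.factorial_succ, Nat.add_sub_cancel]
  push_cast
  set Z := ∑ β, (s - T β + e β - 1 / 2) * c β + y
  field_simp

/-- Integration of the derivative of a function on the circle with jumps at the points `T β`. -/
lemma integral_circle (T : P → ℝ) (hT : Function.Injective T) (hT1 : ∀ β, T β ∈ Set.Ioo (0 : ℝ) 1)
    (c : P → ℝ) (y : ℝ) (m : ℕ) (Y : P → ℝ)
    (hY : ∀ β, Y β = (∑ β' ∈ Finset.univ.erase β, propagator (T β) (T β') * c β') + y) :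
    ∫ s in (0 : ℝ)..1, (∑ β, c β) *
      (((m.factorial : ℝ)⁻¹) * (∑ β, propagator s (T β) * c β + y) ^ m) =
    ∑ β, (((m + 1).factorial : ℝ)⁻¹) *
      ((Y β + (1 / 2) * c β) ^ (m + 1) - (Y β - (1 / 2) * c β) ^ (m + 1)) := by
  -- `J β` is the jump at `T β`; adding the jumps passed so far makes the primitive continuous
  set J : P → ℝ := fun β => (((m + 1).factorial : ℝ)⁻¹) *
      ((Y β + (1 / 2) * c β) ^ (m + 1) - (Y β - (1 / 2) * c β) ^ (m + 1)) with hJ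
  set e2 : ℝ → P → ℝ := fun s β => if s < T β then 1 else 0 with he2
  set e1 : ℝ → P → ℝ := fun s β => if s ≤ T β then 1 else 0 with he1
  set F := stepPrimitive T c J y m with hF
  set G : ℝ → ℝ := fun s => F (e2 s) s with hG
  have hcont : ∀ e s, ContinuousAt (F e) s := fun e s =>
    (hasDerivAt_stepPrimitive T c J y m e s).continuousAt
  -- near `s`, the step functions are constant on either side of `s`
  have hloc : ∀ s, ∀ᶠ s' in nhds s, G s' = if s' < s then F (e1 s) s' else F (e2 s) s' := by
    intro s
    have h1 : ∀ᶠ s' in nhds s, ∀ β, (s < T β → s' < T β) ∧ (T β < s → T β < s') := by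
      rw [Filter.eventually_all]
      intro β
      rcases lt_trichotomy s (T β) with h | h | h
      · filter_upwards [eventually_lt_nhds h] with s' hs'
        exact ⟨fun _ => hs', fun h' => absurd h' h.le.not_gt⟩
      · exact Filter.Eventually.of_forall fun s' => ⟨fun h' => by linarith, fun h' => by linarith⟩
      · filter_upwards [eventually_gt_nhds h] with s' hs'
        exact ⟨fun h' => absurd h' h.le.not_gt, fun _ => hs'⟩
    filter_upwards [h1] with s' hs'
    split_ifs with h
    · have : e2 s' = e1 s := by
        funext β
        simp only [he1, he2]
        rcases lt_trichotomy s (T β) with h' | h' | h'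
        · simp [(hs' β).1 h', h'.le]
        · rw [← h', if_pos h, if_pos le_rfl]
        · rw [if_neg ((hs' β).2 h').le.not_gt, if_neg h'.not_ge]
      simp only [hG, this]
    · have : e2 s' = e2 s := by
        funext β
        change (if s' < T β then (1 : ℝ) else 0) = if s < T β then 1 else 0
        rcases lt_trichotomy s (T β) with h' | h' | h'
        · simp [(hs' β).1 h', h']
        · simp [← h', h]
        · rw [if_neg ((hs' β).2 h').le.not_gt, if_neg h'.le.not_gt]
      simp only [hG, this]
  -- both one-sided descriptions have the same value at `s`, by the choice of `J`
  have hmatch : ∀ s ∈ Set.Icc (0 : ℝ) 1, F (e1 s) s = F (e2 s) s := by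
    intro s hs
    by_cases hex : ∃ α, T α = s
    · obtain ⟨α, rfl⟩ := hex
      have hne : ∀ β, β ≠ α → e1 (T α) β = e2 (T α) β := by
        intro β hβ
        have : T α ≠ T β := fun h => hβ (hT h).symm
        simp only [he1, he2]
        exact ite_le_eq_ite_lt this
      have hq1 : ∀ e : P → ℝ, (∀ β, β ≠ α → e β = e2 (T α) β) →
          (∑ β, (T α - T β + e β - 1 / 2) * c β + y) = Y α + (e α - 1 / 2) * c α := by
        intro e he
        rw [← Finset.add_sum_erase _ _ (Finset.mem_univ α), hY]
        have : ∑ β ∈ Finset.univ.erase α, (T α - T β + e β - 1 / 2) * c β =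
            ∑ β ∈ Finset.univ.erase α, propagator (T α) (T β) * c β := by
          refine Finset.sum_congr rfl fun β hβ => ?_
          rw [propagator_of_mem hs (hT1 β), he β (Finset.ne_of_mem_erase hβ)]
        rw [this]; ring
      have hJs : ∀ e : P → ℝ, (∀ β, β ≠ α → e β = e2 (T α) β) →
          ∑ β, J β * (1 - e β) = J α * (1 - e α) +
            ∑ β ∈ Finset.univ.erase α, J β * (1 - e2 (T α) β) := by
        intro e he
        rw [← Finset.add_sum_erase _ _ (Finset.mem_univ α)]
        congr 1
        refine Finset.sum_congr rfl fun β hβ => ?_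
        rw [he β (Finset.ne_of_mem_erase hβ)]
      simp only [hF, stepPrimitive]
      rw [hq1 _ hne, hq1 _ fun _ _ => rfl, hJs _ hne, hJs (e2 (T α)) fun _ _ => rfl]
      have a1 : e1 (T α) α = 1 := by simp [he1]
      have a2 : e2 (T α) α = 0 := by simp [he2]
      rw [a1, a2]
      simp only [hJ]
      ring
    · have : e1 s = e2 s := by
        funext β
        have : s ≠ T β := fun h => hex ⟨β, h.symm⟩
        simp only [he1, he2]
        exact ite_le_eq_ite_lt this
      rw [this]
  have hGc : ContinuousOn G (Set.Icc 0 1) := by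
    intro s hs
    refine ContinuousAt.continuousWithinAt ?_
    refine ContinuousAt.congr ?_ ((hloc s).mono fun _ h => h.symm)
    rw [continuousAt_iff_continuous_left'_right']
    have hval : (if s < s then F (e1 s) s else F (e2 s) s) = F (e2 s) s := by simp
    constructor
    · refine ((hcont (e1 s) s).continuousWithinAt).congr (fun z hz => ?_) ?_
      · exact if_pos hz
      · rw [hval, hmatch s hs]
    · refine ((hcont (e2 s) s).continuousWithinAt).congr (fun z hz => ?_) ?_
      · exact if_neg (not_lt.2 (le_of_lt hz))
      · rw [hval]
  have hderiv : ∀ s ∈ Set.Ioo (0 : ℝ) 1 \ Set.range T, HasDerivAt G ((∑ β, c β) *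
      (((m.factorial : ℝ)⁻¹) * (∑ β, propagator s (T β) * c β + y) ^ m)) s := by
    rintro s ⟨hs, hsT⟩
    have he : e1 s = e2 s := by
      funext β
      have : s ≠ T β := fun h => hsT ⟨β, h.symm⟩
      simp only [he1, he2]
      exact ite_le_eq_ite_lt this
    have h1 : G =ᶠ[nhds s] F (e2 s) := by
      filter_upwards [hloc s] with s' hs'
      rw [hs', he]
      simp
    have h2 := (hasDerivAt_stepPrimitive T c J y m (e2 s) s).congr_of_eventuallyEq h1
    refine h2.congr_deriv ?_
    have : ∀ β, propagator s (T β) = s - T β + e2 s β - 1 / 2 := fun β =>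
      propagator_of_mem ⟨hs.1.le, hs.2.le⟩ (hT1 β)
    simp only [this]
  have hint : IntervalIntegrable (fun s => (∑ β, c β) *
      (((m.factorial : ℝ)⁻¹) * (∑ β, propagator s (T β) * c β + y) ^ m)) MeasureTheory.volume 0 1
        := by
    rw [intervalIntegrable_iff_integrableOn_Ioc_of_le zero_le_one]
    refine MeasureTheory.Measure.integrableOn_of_bounded
      (M := |∑ β, c β| * (((m.factorial : ℝ)⁻¹) * (∑ β, |c β| + |y|) ^ m)) (by simp) ?_
      (Filter.Eventually.of_forall fun s => ?_)
    · refine Measurable.aestronglyMeasurable ?_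
      unfold propagator
      fun_prop
    · rw [Real.norm_eq_abs, abs_mul, abs_mul, abs_pow, abs_of_nonneg (by positivity : (0:ℝ) ≤
        (m.factorial : ℝ)⁻¹)]
      gcongr
      refine (abs_add_le _ _).trans ?_
      gcongr
      refine (Finset.abs_sum_le_sum_abs _ _).trans (Finset.sum_le_sum fun x _ => ?_)
      rw [abs_mul]
      exact mul_le_of_le_one_left (abs_nonneg _) (abs_propagator_le _ _)
  rw [MeasureTheory.integral_eq_of_hasDerivAt_off_countable_of_le G _ zero_le_one
    (Set.finite_range T).countable hGc hderiv hint]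
  have e20 : e2 0 = fun _ => 1 := by
    funext β; simp [he2, (hT1 β).1]
  have e21 : e2 1 = fun _ => 0 := by
    funext β; simp [he2, (hT1 β).2.le]
  simp only [hG, e20, e21, hF, stepPrimitive]
  simp only [sub_zero, sub_self, mul_one, mul_zero, Finset.sum_const_zero, add_zero]
  have : ∀ β, (1 : ℝ) - T β = 0 - T β + 1 := fun β => by ring
  simp only [this]
  ring

end Circle

/-! ### The boundary formula for configuration integrals -/

section Boundary

variable {P : Type*} [Fintype P] [DecidableEq P]

/-- The configuration of `Option P` with additional point `s`. -/
def addPt (s : ℝ) (θ : P → ℝ) : Option P → ℝ := fun o => o.elim s θ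

@[simp] lemma addPt_some (s : ℝ) (θ : P → ℝ) (α : P) : addPt s θ (some α) = θ α := rfl

@[simp] lemma addPt_none (s : ℝ) (θ : P → ℝ) : addPt s θ none = s := rfl

lemma setIntegral_Icc_option (F : (Option P → ℝ) → ℝ)
    (hF : MeasureTheory.IntegrableOn F (Set.Icc 0 1)) :
    ∫ θ in Set.Icc (0 : Option P → ℝ) 1, F θ =
      ∫ θ in Set.Icc (0 : P → ℝ) 1, ∫ s in (0 : ℝ)..1, F (addPt s θ) := by
  set E := (MeasurableEquiv.piOptionEquivProd (fun _ : Option P => ℝ)).symm with hE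
  have happ : ∀ x : (P → ℝ) × ℝ, E x = addPt x.2 x.1 := by
    intro x
    funext o
    cases o <;> rfl
  have hmp : MeasureTheory.MeasurePreserving E MeasureTheory.volume MeasureTheory.volume :=
    ⟨E.measurable, MeasureTheory.Measure.pi_map_piOptionEquivProd
      (fun _ : Option P => (MeasureTheory.volume : MeasureTheory.Measure ℝ))⟩
  have hset : E ⁻¹' Set.Icc 0 1 = Set.Icc (0 : P → ℝ) 1 ×ˢ Set.Icc (0 : ℝ) 1 := by
    ext x
    simp only [Set.mem_preimage, happ, Set.mem_Icc, Pi.le_def, Option.forall, Set.mem_prod,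
      addPt_none, addPt_some, Pi.zero_apply, Pi.one_apply]
    tauto
  rw [← hmp.setIntegral_preimage_emb E.measurableEmbedding, hset]
  have hint : MeasureTheory.IntegrableOn (fun x => F (E x))
      (Set.Icc (0 : P → ℝ) 1 ×ˢ Set.Icc (0 : ℝ) 1) := by
    rw [← hset]
    exact (hmp.integrableOn_comp_preimage E.measurableEmbedding).2 hF
  rw [MeasureTheory.Measure.volume_eq_prod] at hint ⊢
  rw [MeasureTheory.setIntegral_prod _ hint]
  simp only [happ]
  refine MeasureTheory.integral_congr_ae (Filter.Eventually.of_forall fun θ => ?_)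
  simp only
  rw [intervalIntegral.integral_of_le zero_le_one, MeasureTheory.integral_Icc_eq_integral_Ioc]

lemma propagator_swap {s t : ℝ} (h : Int.fract (s - t) ≠ 0) : propagator t s = -propagator s t := by
  unfold propagator
  rw [← neg_sub s t, Int.fract_neg h]
  ring

lemma fract_sub_ne_zero {s t : ℝ} (hs : s ∈ Set.Ioo (0 : ℝ) 1) (ht : t ∈ Set.Ioo (0 : ℝ) 1)
    (h : s ≠ t) : Int.fract (s - t) ≠ 0 := by
  intro h0'
  obtain ⟨z, hz⟩ : ∃ z : ℤ, (z : ℝ) = s - t := by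
    obtain ⟨-, -, z, hz⟩ := Int.fract_eq_iff.1 h0'
    exact ⟨z, by linarith⟩
  obtain ⟨h0, h1⟩ := hs
  obtain ⟨h2, h3⟩ := ht
  have hz1 : (z : ℝ) < 1 := by linarith
  have hz2 : (-1 : ℝ) < z := by linarith
  have : z = 0 := by
    have h1 : z < 1 := by exact_mod_cast hz1
    have h2 : -1 < z := by exact_mod_cast hz2
    omega
  rw [this] at hz
  apply h
  push_cast at hz
  linarith

/-- Almost every configuration consists of distinct points different from the base point. -/
lemma ae_generic : ∀ᵐ θ : P → ℝ, θ ∈ Set.Icc (0 : P → ℝ) 1 →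
    Function.Injective θ ∧ ∀ β, θ β ∈ Set.Ioo (0 : ℝ) 1 := by
  have h1 : ∀ α β : P, α ≠ β → ∀ᵐ θ : P → ℝ, θ α ≠ θ β := by
    intro α β h
    have := MeasureTheory.Measure.addHaar_submodule (MeasureTheory.volume : MeasureTheory.Measure
        (P → ℝ))
      (LinearMap.ker ((LinearMap.proj α : (P → ℝ) →ₗ[ℝ] ℝ) - LinearMap.proj β)) ?_
    · rw [MeasureTheory.ae_iff]
      convert this using 2
      ext θ
      simp [sub_eq_zero]
    · intro htop
      have : (Pi.single α 1 : P → ℝ) ∈ LinearMap.ker ((LinearMap.proj α : (P → ℝ) →ₗ[ℝ] ℝ) -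
        LinearMap.proj β) := by rw [htop]; trivial
      simp [h.symm] at this
  have h2 : ∀ (β : P) (c : ℝ), ∀ᵐ θ : P → ℝ, θ β ≠ c := by
    intro β c
    rw [MeasureTheory.ae_iff]
    have := MeasureTheory.Measure.pi_hyperplane
      (fun _ : P => (MeasureTheory.volume : MeasureTheory.Measure ℝ)) β c
    rw [← MeasureTheory.volume_pi] at this
    simpa using this
  have h1' : ∀ᵐ θ : P → ℝ, ∀ α β : P, α ≠ β → θ α ≠ θ β :=
    MeasureTheory.ae_all_iff.2 fun α => MeasureTheory.ae_all_iff.2 fun β => by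
      by_cases h : α = β
      · exact Filter.Eventually.of_forall fun _ h' => absurd h h'
      · filter_upwards [h1 α β h] with θ hθ _ using hθ
  have h2' : ∀ᵐ θ : P → ℝ, ∀ β, θ β ≠ 0 ∧ θ β ≠ 1 :=
    MeasureTheory.ae_all_iff.2 fun β => (h2 β 0).and (h2 β 1)
  filter_upwards [h1', h2'] with θ ha hb hθ
  refine ⟨fun α β h => by_contra fun hne => ha α β hne h, fun β => ?_⟩
  exact ⟨lt_of_le_of_ne (hθ.1 β) (hb β).1.symm, lt_of_le_of_ne (hθ.2 β) (hb β).2⟩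

/-- The symbols `b`, with the additional point moved to the position of `β`. -/
def mergeSym {A : Type*} [AddCommMonoid A] (β : P) (b : Option P → Option P → A) : P → P → A :=
  fun x y => b (some x) (some y) + (if x = β then b none (some y) else 0) +
    if y = β then b (some x) none else 0

/-- Dependence of the phase on the position of the additional point. -/
lemma phase_addPt (b : Option P → Option P → ℝ) (hb : ∀ x y, b x y = -b y x) (s : ℝ) (θ : P → ℝ)
    (hs : ∀ β, propagator (θ β) s = -propagator s (θ β)) :
    phase b (addPt s θ) = ∑ β, propagator s (θ β) * b none (some β) +
      phase (fun x y => b (some x) (some y)) θ := by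
  unfold phase
  rw [Fintype.sum_prod_type, Fintype.sum_prod_type]
  simp only [Fintype.sum_option, wickKernel, if_true, addPt_none, addPt_some, zero_mul,
    Option.some.injEq, reduceCtorEq, if_false, zero_add, Finset.sum_add_distrib, hs]
  rw [← add_assoc, ← Finset.sum_add_distrib]
  congr 1
  refine Finset.sum_congr rfl fun β _ => ?_
  rw [hb (some β) none]
  ring

/-- The phase at a jump: when the additional point meets `β`, the two one-sided limits of the phase
differ from this value by `± b none (some β) / 2`. -/
lemma phase_mergeSym (b : Option P → Option P → ℝ) (hb : ∀ x y, b x y = -b y x) (θ : P → ℝ) (β : P)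
    (hs : ∀ α, α ≠ β → propagator (θ α) (θ β) = -propagator (θ β) (θ α)) :
    phase (mergeSym β b) θ =
      (∑ α ∈ Finset.univ.erase β, propagator (θ β) (θ α) * b none (some α)) +
      phase (fun x y => b (some x) (some y)) θ := by
  unfold phase mergeSym
  simp only [mul_add, Finset.sum_add_distrib]
  rw [add_assoc, add_comm]
  congr 1
  rw [Fintype.sum_prod_type, Fintype.sum_prod_type_right]
  simp only [mul_ite, mul_zero, Finset.sum_ite_irrel, Finset.sum_const_zero, Finset.sum_ite_eq',
    Finset.mem_univ, if_true]
  rw [← Finset.sum_add_distrib, ← Finset.add_sum_erase _ _ (Finset.mem_univ β)]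
  simp only [wickKernel, if_true, zero_mul, zero_add, add_zero]
  refine Finset.sum_congr rfl fun α hα => ?_
  have hne := Finset.ne_of_mem_erase hα
  rw [if_neg hne, if_neg hne.symm, hs α hne, hb (some α) none]
  ring

lemma coeff_expH_mul_cfgH (N : ℕ) (c : ℝ) (b : P → P → ℝ) :
    PowerSeries.coeff N (expH c * cfgH b) =
      ∫ θ in Set.Icc (0 : P → ℝ) 1, ((N.factorial : ℝ)⁻¹) * (phase b θ + c) ^ N := by
  have h : ∀ θ : P → ℝ, ((N.factorial : ℝ)⁻¹) * (phase b θ + c) ^ N =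
      ∑ x ∈ Finset.HasAntidiagonal.antidiagonal N,
        (((x.1.factorial : ℝ)⁻¹) * c ^ x.1) * (((x.2.factorial : ℝ)⁻¹) * phase b θ ^ x.2) := by
    intro θ
    have := congrArg (PowerSeries.coeff N) (expH_add c (phase b θ))
    rw [PowerSeries.coeff_mul] at this
    simp only [expH, PowerSeries.coeff_mk, smul_eq_mul] at this
    rw [add_comm, this]
  simp only [h]
  rw [MeasureTheory.integral_finsetSum, PowerSeries.coeff_mul]
  · refine Finset.sum_congr rfl fun x _ => ?_
    rw [MeasureTheory.integral_const_mul, ← cfg_real]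
    simp [expH, cfgH]
  · intro x _
    refine MeasureTheory.Integrable.const_mul ?_ _
    refine integrableOn_Icc_of_bounded (((measurable_phase b).pow_const _).const_mul _)
      (((x.2.factorial : ℝ)⁻¹) * (∑ x : P × P, |b x.1 x.2|) ^ x.2) fun θ => ?_
    rw [abs_mul, abs_pow, abs_of_nonneg (by positivity : (0 : ℝ) ≤ ((x.2.factorial : ℝ)⁻¹))]
    gcongr
    exact abs_phase_le b θ

lemma integrableOn_phase_pow (N : ℕ) (c : ℝ) (b : P → P → ℝ) :
    MeasureTheory.IntegrableOn (fun θ : P → ℝ => ((N.factorial : ℝ)⁻¹) * (phase b θ + c) ^ N)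
      (Set.Icc 0 1) := by
  refine integrableOn_Icc_of_bounded ((((measurable_phase b).add_const c).pow_const _).const_mul _)
      (((N.factorial : ℝ)⁻¹) * (∑ x : P × P, |b x.1 x.2| + |c|) ^ N) fun θ => ?_
  rw [abs_mul, abs_pow, abs_of_nonneg (by positivity : (0 : ℝ) ≤ ((N.factorial : ℝ)⁻¹))]
  gcongr
  exact (abs_add_le _ _).trans (add_le_add (abs_phase_le b θ) le_rfl)

/-- The boundary formula for configuration integrals, for real symbols. -/
lemma cfgH_boundary_real (b : Option P → Option P → ℝ) (hb : ∀ x y, b x y = -b y x) :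
    PowerSeries.X * (PowerSeries.C (∑ β, b none (some β)) * cfgH b) =
      ∑ β, sinhSym (b none (some β)) * cfgH (mergeSym β b) := by
  ext N
  rw [map_sum (PowerSeries.coeff N)]
  cases N with
  | zero =>
    rw [PowerSeries.coeff_zero_X_mul]
    refine (Finset.sum_eq_zero fun β _ => ?_).symm
    rw [PowerSeries.coeff_mul]
    simp [expH, sinhSym]
  | succ m =>
    rw [PowerSeries.coeff_succ_X_mul, PowerSeries.coeff_C_mul]
    have hc : PowerSeries.coeff m (cfgH b) =
        ∫ θ in Set.Icc (0 : P → ℝ) 1, ∫ s in (0 : ℝ)..1,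
          ((m.factorial : ℝ)⁻¹) * phase b (addPt s θ) ^ m := by
      rw [cfgH, PowerSeries.coeff_mk, cfg_real,
        setIntegral_Icc_option (fun θ => ((m.factorial : ℝ)⁻¹) * phase b θ ^ m)]
      simpa using integrableOn_phase_pow m 0 b
    rw [hc, ← MeasureTheory.integral_const_mul]
    have hR : ∀ β, PowerSeries.coeff (m + 1) (sinhSym (b none (some β)) * cfgH (mergeSym β b)) =
        ∫ θ in Set.Icc (0 : P → ℝ) 1, (((m + 1).factorial : ℝ)⁻¹) *
          ((phase (mergeSym β b) θ + (1 / 2) * b none (some β)) ^ (m + 1) -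
           (phase (mergeSym β b) θ - (1 / 2) * b none (some β)) ^ (m + 1)) := by
      intro β
      rw [sinhSym, sub_mul, map_sub, coeff_expH_mul_cfgH, coeff_expH_mul_cfgH,
        ← MeasureTheory.integral_sub (integrableOn_phase_pow _ _ _) (integrableOn_phase_pow _ _ _)]
      refine MeasureTheory.integral_congr_ae (Filter.Eventually.of_forall fun θ => ?_)
      simp only [smul_eq_mul]
      ring
    simp only [hR]
    rw [← MeasureTheory.integral_finsetSum]
    · refine MeasureTheory.setIntegral_congr_ae measurableSet_Icc ?_
      filter_upwards [ae_generic (P := P)] with θ hθ hθ'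
      obtain ⟨hinj, hIoo⟩ := hθ hθ'
      -- for fixed positions of the other points, this is the formula on the circle
      rw [← integral_circle θ hinj hIoo (fun β => b none (some β))
        (phase (fun x y => b (some x) (some y)) θ) m (fun β => phase (mergeSym β b) θ) ?_]
      · rw [← intervalIntegral.integral_const_mul]
        refine intervalIntegral.integral_congr_ae ?_
        have hfin : ∀ᵐ s : ℝ, s ∉ insert 1 (Set.range θ) :=
          MeasureTheory.measure_eq_zero_iff_ae_notMem.1
            (((Set.finite_range θ).insert 1).measure_zero _)
        filter_upwards [hfin] with s hs1 hs2
        rw [Set.uIoc_of_le zero_le_one] at hs2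
        have hs3 : s ∈ Set.Ioo (0 : ℝ) 1 := ⟨hs2.1, lt_of_le_of_ne hs2.2 fun h =>
          hs1 (Or.inl h)⟩
        rw [phase_addPt b hb]
        intro β
        refine propagator_swap (fract_sub_ne_zero hs3 (hIoo β) fun h => hs1 (Or.inr ⟨β, h.symm⟩))
      · intro β
        rw [phase_mergeSym b hb]
        intro α hα
        exact propagator_swap (fract_sub_ne_zero (hIoo β) (hIoo α) fun h => hα (hinj h).symm)
    · intro β _
      have h1 := integrableOn_phase_pow (m + 1) ((1 / 2) * b none (some β)) (mergeSym β b)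
      have h2 := integrableOn_phase_pow (m + 1) (-((1 / 2) * b none (some β))) (mergeSym β b)
      refine (h1.sub h2).congr (Filter.Eventually.of_forall fun θ => ?_)
      simp only [Pi.sub_apply]
      ring

lemma mapH_sinhSym {A B : Type*} [CommRing A] [Algebra ℝ A] [CommRing B] [Algebra ℝ B]
    (φ : A →ₐ[ℝ] B) (t : A) : mapH φ (sinhSym t) = sinhSym (φ t) := by
  rw [sinhSym, map_sub (mapH φ), map_expH, map_expH, sinhSym, map_neg, map_smul]

/-- The boundary formula for configuration integrals: integrating the derivative with respect to
the position of the additional point gives the jumps at the positions of the other points. -/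
lemma cfgH_boundary {σ : Type*} (b : Option P → Option P → MvPolynomial σ ℝ)
    (hb : ∀ x y, b x y = -b y x) :
    PowerSeries.X * (PowerSeries.C (∑ β, b none (some β)) * cfgH b) =
      ∑ β, sinhSym (b none (some β)) * cfgH (mergeSym β b) := by
  -- an identity of polynomials may be checked at all real points
  have key : ∀ x : σ → ℝ, mapH (MvPolynomial.aeval x)
      (PowerSeries.X * (PowerSeries.C (∑ β, b none (some β)) * cfgH b)) =
      mapH (MvPolynomial.aeval x) (∑ β, sinhSym (b none (some β)) * cfgH (mergeSym β b)) := by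
    intro x
    have h := cfgH_boundary_real (fun α β => MvPolynomial.aeval x (b α β))
      fun α β => by rw [hb α β, map_neg]
    rw [map_mul (mapH _), map_mul (mapH _), map_sum (mapH _), mapH_cfgH, mapH_C, map_sum,
      PowerSeries.map_X, h]
    refine Finset.sum_congr rfl fun β _ => ?_
    rw [map_mul (mapH _), mapH_sinhSym, mapH_cfgH]
    congr 2
    funext γ δ
    simp only [mergeSym, map_add]
    split_ifs <;> simp
  ext1 N
  refine MvPolynomial.funext fun x => ?_
  have := congrArg (PowerSeries.coeff N) (key x)
  rw [PowerSeries.coeff_map, PowerSeries.coeff_map] at this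
  simpa only [RingHom.coe_coe, MvPolynomial.aeval_eq_eval] using this

/-- The integral of a product of propagators vanishes if exactly one of them involves the
additional point. -/
lemma wickCoeff_none {m : ℕ} (f : Fin m → Option P × Option P) (i₀ : Fin m)
    (h0 : (f i₀).1 = none ∨ (f i₀).2 = none)
    (h : ∀ i, i ≠ i₀ → (f i).1 ≠ none ∧ (f i).2 ≠ none) : wickCoeff f = 0 := by
  have hP : ∀ t : ℝ, t ∈ Set.Ioo (0 : ℝ) 1 → ∫ s in (0 : ℝ)..1, propagator s t = 0 := by
    intro t ht
    have := integral_circle (P := Unit) (fun _ => t) (fun _ _ _ => rfl) (fun _ => ht)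
      (fun _ => 1) 0 1 (fun _ => 0) (by simp)
    simpa using this
  rw [wickCoeff, setIntegral_Icc_option _ (integrableOn_wick f)]
  refine (MeasureTheory.setIntegral_congr_ae (g := fun _ => (0 : ℝ)) measurableSet_Icc ?_).trans
    (by simp)
  filter_upwards [ae_generic (P := P)] with θ hθ hθ'
  obtain ⟨-, hIoo⟩ := hθ hθ'
  have hconst : ∀ s, ∏ i, wickKernel (addPt s θ) (f i) = wickKernel (addPt s θ) (f i₀) *
      ∏ i ∈ Finset.univ.erase i₀, wickKernel (addPt 0 θ) (f i) := by
    intro s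
    rw [← Finset.mul_prod_erase _ _ (Finset.mem_univ i₀)]
    congr 1
    refine Finset.prod_congr rfl fun i hi => ?_
    obtain ⟨h1, h2⟩ := h i (Finset.ne_of_mem_erase hi)
    obtain ⟨α, hα⟩ := Option.ne_none_iff_exists'.1 h1
    obtain ⟨β, hβ⟩ := Option.ne_none_iff_exists'.1 h2
    simp [wickKernel, hα, hβ]
  simp only [hconst]
  rw [intervalIntegral.integral_mul_const]
  have hk : ∫ s in (0 : ℝ)..1, wickKernel (addPt s θ) (f i₀) = 0 := by
    obtain ⟨x, y, hxy⟩ : ∃ x y, f i₀ = (x, y) := ⟨_, _, rfl⟩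
    rw [hxy] at h0 ⊢
    cases x with
    | none =>
      cases y with
      | none => simp [wickKernel]
      | some β => simp [wickKernel, hP _ (hIoo β)]
    | some α =>
      cases y with
      | some β => simp at h0
      | none =>
        have : ∫ s in (0 : ℝ)..1, wickKernel (addPt s θ) (some α, none) =
            ∫ s in (0 : ℝ)..1, (-(1 / 2 : ℝ)) * propagator s (θ α) := by
          refine intervalIntegral.integral_congr_ae ?_
          have hfin : ∀ᵐ s : ℝ, s ∉ ({1, θ α} : Set ℝ) :=
            MeasureTheory.measure_eq_zero_iff_ae_notMem.1 ((Set.toFinite _).measure_zero _)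
          filter_upwards [hfin] with s hs1 hs2
          rw [Set.uIoc_of_le zero_le_one] at hs2
          simp only [Set.mem_insert_iff, Set.mem_singleton_iff, not_or] at hs1
          have hs3 : s ∈ Set.Ioo (0 : ℝ) 1 := ⟨hs2.1, lt_of_le_of_ne hs2.2 hs1.1⟩
          simp [wickKernel, propagator_swap (fract_sub_ne_zero hs3 (hIoo α) hs1.2)]
        rw [this, intervalIntegral.integral_const_mul, hP _ (hIoo α), mul_zero]
  rw [hk, zero_mul]

/-- The integral of a product of propagators vanishes if exactly one of them involves the
point `β`. -/
lemma wickCoeff_eq_zero {m : ℕ} (f : Fin m → P × P) (β : P) (i₀ : Fin m)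
    (h0 : (f i₀).1 = β ∨ (f i₀).2 = β)
    (h : ∀ i, i ≠ i₀ → (f i).1 ≠ β ∧ (f i).2 ≠ β) : wickCoeff f = 0 := by
  set e := Equiv.optionSubtypeNe β
  have he : ∀ x : P, e.symm x = none ↔ x = β := by
    intro x
    rw [Equiv.symm_apply_eq]
    simp [e]
  have := wickCoeff_relabel e (fun i => (e.symm (f i).1, e.symm (f i).2))
  simp only [Equiv.apply_symm_apply, Prod.mk.eta] at this
  rw [this]
  refine wickCoeff_none _ i₀ (by simpa [he] using h0) fun i hi => ?_
  simpa [he] using h i hi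

end Boundary

/-! ### The cocycle of the trace density -/

section Theta

variable {d : ℕ} {P Q : Type*} [Fintype P] [DecidableEq P] [Fintype Q] [DecidableEq Q]

/-- The determinant of the matrix with rows `ξ_{r k}`, for `k < d`. -/
def rowDet (r : Fin d → Q) : MvPolynomial (Q × Fin d) ℝ :=
  (Matrix.of fun k i => MvPolynomial.X (r k, i) : Matrix (Fin d) (Fin d) _).det

@[simp] lemma relabel_rowDet (e : Q → P) (r : Fin d → Q) : relabel e (rowDet r) = rowDet (e ∘ r) :=
    by
  unfold rowDet
  rw [AlgHom.map_det]
  congr 1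
  ext k i
  simp [relabel]

lemma rowDet_comp_swap (r : Fin d → Q) {k l : Fin d} (h : k ≠ l) :
    rowDet (r ∘ Equiv.swap k l) = -rowDet r := by
  have := Matrix.det_permute (Equiv.swap k l)
    (Matrix.of fun k i => MvPolynomial.X (r k, i) : Matrix (Fin d) (Fin d) (MvPolynomial (Q × Fin
      d) ℝ))
  rw [Equiv.Perm.sign_swap h] at this
  rw [Units.val_neg, Units.val_one, Int.cast_neg, Int.cast_one, neg_one_mul] at this
  exact this

/-- Cramer's rule: a vector `ξ_q` is the combination of the rows `ξ_{r k}` whose coefficients are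
determinants with one row replaced. -/
lemma rowDet_cramer (r : Fin d → Q) (q : Q) (i : Fin d) :
    rowDet r * MvPolynomial.X (q, i) =
      ∑ k, rowDet (Function.update r k q) * MvPolynomial.X (r k, i) := by
  set V : Matrix (Fin d) (Fin d) (MvPolynomial (Q × Fin d) ℝ) :=
    Matrix.of fun k i => MvPolynomial.X (r k, i) with hV
  have h := congrFun (Matrix.mulVec_cramer V.transpose fun i => MvPolynomial.X (q, i)) i
  rw [Matrix.det_transpose, Pi.smul_apply, smul_eq_mul] at h
  rw [rowDet, ← hV, ← h, Matrix.mulVec, dotProduct]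
  refine Finset.sum_congr rfl fun k _ => ?_
  rw [Matrix.cramer_transpose_apply, mul_comm, rowDet]
  congr 2
  ext k' i'
  by_cases hk : k' = k
  · subst hk; simp
  · simp [hk, hV]

lemma collapse_rowDet_none :
    collapse (none : Option (Fin d)) (rowDet some) = rowDet fun k : Fin d => some (some k) := by
  unfold rowDet
  rw [AlgHom.map_det]
  congr 1
  ext k i
  simp [collapse]

lemma collapse_rowDet_some (k : Fin d) :
    collapse (some k) (rowDet some) = rowDet (fun k : Fin d => some (some k)) +
      rowDet (Function.update (fun k : Fin d => some (some k)) k none) := by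
  unfold rowDet
  rw [AlgHom.map_det]
  set V : Matrix (Fin d) (Fin d) (MvPolynomial (Option (Option (Fin d)) × Fin d) ℝ) :=
    Matrix.of fun k i => MvPolynomial.X (some (some k), i) with hV
  have h := Matrix.det_updateRow_add V k (V k) fun i => MvPolynomial.X (none, i)
  rw [Matrix.updateRow_eq_self] at h
  convert h using 2
  · ext k' i'
    by_cases hk : k' = k
    · subst hk; simp [collapse, hV]
    · simp [hk, hV, collapse]
  · congr 1
    ext k' i'
    by_cases hk : k' = k
    · subst hk; simp
    · simp [hk, hV]

/-- The symbol of the trace density. -/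
def thetaSym (Pi : Matrix (Fin d) (Fin d) ℝ) :
    PowerSeries (MvPolynomial (Option (Fin d) × Fin d) ℝ) :=
  PowerSeries.C (rowDet some) * cfgH (bsym Pi)

/-- The cocycle of the trace density: the observable `x` is placed at one point of the circle and
`v 0, …, v (d - 1)` at `d` further points, and the result is integrated over all
configurations. -/
def Theta (Pi : Matrix (Fin d) (Fin d) ℝ) (x : WeylDual d) (v : Fin d → WeylDual d) :
    PowerSeries ℝ := corr (consPt x v) (thetaSym Pi)

lemma update_consPt_none (x y : WeylDual d) (v : P → WeylDual d) :
    Function.update (consPt x v) none y = consPt y v := by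
  funext o; cases o <;> simp [consPt]

lemma update_consPt_some (x y : WeylDual d) (v : P → WeylDual d) (k : P) :
    Function.update (consPt x v) (some k) y = consPt x (Function.update v k y) := by
  funext o
  rcases o with - | k'
  · simp
  · by_cases h : k' = k
    · subst h; simp
    · simp [h]

lemma Theta_comp_swap (Pi : Matrix (Fin d) (Fin d) ℝ) (x : WeylDual d) (v : Fin d → WeylDual d)
    {k l : Fin d} (h : k ≠ l) : Theta Pi x (v ∘ Equiv.swap k l) = -Theta Pi x v := by
  have h1 := corr_relabel (Equiv.optionCongr (Equiv.swap k l)) (consPt x v) (thetaSym Pi)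
  have h2 : (fun β => consPt x v (Equiv.optionCongr (Equiv.swap k l) β)) =
      consPt x (v ∘ Equiv.swap k l) := by
    funext o; cases o <;> rfl
  rw [h2] at h1
  rw [Theta, h1, thetaSym, map_mul (mapH _), mapH_C, mapH_cfgH, relabel_rowDet]
  simp only [relabel_bsym]
  rw [cfgH_relabel]
  have h3 : ⇑(Equiv.optionCongr (Equiv.swap k l)) ∘ some = some ∘ Equiv.swap k l := rfl
  rw [h3, rowDet_comp_swap _ h, Theta, thetaSym, map_neg, neg_mul, map_neg]

lemma Theta_swap_update (Pi : Matrix (Fin d) (Fin d) ℝ) (x : WeylDual d) (v : Fin d → WeylDual d)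
    {k l : Fin d} (h : k ≠ l) (y z : WeylDual d) :
    Theta Pi x (Function.update (Function.update v k y) l z) =
      -Theta Pi x (Function.update (Function.update v k z) l y) := by
  rw [← Theta_comp_swap Pi x _ h]
  congr 1
  funext m
  by_cases h1 : m = k
  · subst h1; simp [h]
  · by_cases h2 : m = l
    · subst h2; simp [h]
    · simp [h1, h2, Equiv.swap_apply_of_ne_of_ne h1 h2]

/-- The symbol of the jump at the point `β` of the configuration integral. -/
def jumpSym (Pi : Matrix (Fin d) (Fin d) ℝ) (β : P) :
    PowerSeries (MvPolynomial (Option P × Fin d) ℝ) :=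
  sinhSym (bsym Pi none (some β)) * mapH (collapse β) (cfgH (bsym Pi))

/-- The jump at the point `β` of the configuration integral, with weight the determinant of the
rows `r`. -/
def jump (Pi : Matrix (Fin d) (Fin d) ℝ) (w : Option P → WeylDual d) (r : Fin d → Option P)
    (β : P) : PowerSeries ℝ := corr w (PowerSeries.C (rowDet r) * jumpSym Pi β)

lemma mapH_collapse_cfgH {Pi : Matrix (Fin d) (Fin d) ℝ} (hPi : Pi.transpose = -Pi) (β : P) :
    mapH (collapse β) (cfgH (bsym Pi)) = cfgH (mergeSym β (bsym Pi)) := by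
  rw [mapH_cfgH]
  congr 1
  funext x y
  rw [collapse_bsym, mergeSym, bsym_self hPi none]
  simp

/-- The boundary formula: the sum of all jumps is the integral with the derivative of the phase
inserted. -/
lemma sum_jump {Pi : Matrix (Fin d) (Fin d) ℝ} (hPi : Pi.transpose = -Pi)
    (w : Option P → WeylDual d) (r : Fin d → Option P) :
    ∑ β, jump Pi w r β = corr w (PowerSeries.X * (PowerSeries.C (rowDet r * ∑ β, bsym Pi none (some
      β)) *
      cfgH (bsym Pi))) := by
  simp only [jump, ← map_sum, ← Finset.mul_sum, jumpSym, mapH_collapse_cfgH hPi]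
  rw [← cfgH_boundary _ fun x y => bsym_swap hPi x y, map_mul PowerSeries.C]
  rw [mul_left_comm (PowerSeries.C (rowDet r)) PowerSeries.X, ← mul_assoc (PowerSeries.C (rowDet
      r))]

lemma relabel_comp_collapse (e : Option P ≃ Option P) (e' : P ≃ P)
    (he : ∀ β, e (some β) = some (e' β)) (hn : e none = none) (β : P)
    (f : MvPolynomial (P × Fin d) ℝ) :
    relabel e (collapse β f) = collapse (e' β) (relabel e' f) := by
  have : (relabel e).comp (collapse β) = (collapse (d := d) (e' β)).comp (relabel e') := by
    refine MvPolynomial.algHom_ext fun x => ?_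
    obtain ⟨γ, i⟩ := x
    rw [AlgHom.comp_apply, AlgHom.comp_apply, relabel_X]
    simp only [collapse, MvPolynomial.aeval_X, map_add, relabel_X, he]
    by_cases h : γ = β
    · simp [h, hn]
    · simp [h]
  exact congrArg (fun φ => φ f) this

lemma jump_comp (Pi : Matrix (Fin d) (Fin d) ℝ) (w : Option P → WeylDual d) (r : Fin d → Option P)
    (e : Equiv.Perm P) (β : P) :
    jump Pi (fun o => w (Equiv.optionCongr e o)) r β =
      jump Pi w (Equiv.optionCongr e ∘ r) (e β) := by
  have h : mapH (relabel (Equiv.optionCongr e)) (mapH (collapse β) (cfgH (bsym Pi))) =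
      mapH (collapse (d := d) (e β)) (cfgH (bsym Pi)) := by
    rw [mapH_cfgH, mapH_cfgH, mapH_cfgH, 
      ← cfgH_relabel e fun x y => collapse (e β) (bsym Pi x y)]
    congr 1
    funext x y
    rw [relabel_comp_collapse (Equiv.optionCongr e) e (fun _ => rfl) rfl, relabel_bsym]
  rw [jump, corr_relabel (Equiv.optionCongr e) w, jump, jumpSym, jumpSym, map_mul (mapH _),
    map_mul (mapH _), mapH_C, mapH_sinhSym, relabel_rowDet, relabel_bsym, h]
  rfl

/-- Exchanging the two merged points changes the sign of the jump. -/
lemma jump_comp_swap_none {Pi : Matrix (Fin d) (Fin d) ℝ} (hPi : Pi.transpose = -Pi)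
    (w : Option P → WeylDual d) (r : Fin d → Option P) (β : P) :
    jump Pi (fun o => w (Equiv.swap none (some β) o)) r β =
      -jump Pi w (Equiv.swap none (some β) ∘ r) β := by
  rw [jump, corr_relabel (Equiv.swap none (some β)) w, jump, jumpSym, map_mul (mapH _),
    map_mul (mapH _), mapH_C, mapH_sinhSym, relabel_rowDet, relabel_bsym, mapH_collapse_cfgH hPi,
    mapH_cfgH, Equiv.swap_apply_left, Equiv.swap_apply_right, bsym_swap hPi (some β) none]
  have h1 : (fun x y => relabel (Equiv.swap none (some β)) (mergeSym β (bsym Pi) x y)) =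
      mergeSym (A := MvPolynomial (Option P × Fin d) ℝ) β (bsym Pi) := by
    funext x y
    have hs : ∀ z, z ≠ β → Equiv.swap none (some β) (some z) = some z := fun z hz =>
      Equiv.swap_apply_of_ne_of_ne (by simp) (by simpa using hz)
    simp only [mergeSym, map_add]
    by_cases hx : x = β <;> by_cases hy : y = β <;> simp [hx, hy, hs, bsym_self hPi] <;> ring
  rw [h1]
  have h2 : ∀ t : MvPolynomial (Option P × Fin d) ℝ, sinhSym (-t) = -sinhSym t := by
    intro t
    simp [sinhSym]
  rw [h2, neg_mul, mul_neg, map_neg]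

/-- A commutator in the observable is the jump at its position. -/
lemma Theta_commL_left {Pi : Matrix (Fin d) (Fin d) ℝ} (hPi : Pi.transpose = -Pi)
    (u x : WeylDual d) (v : Fin d → WeylDual d) :
    Theta Pi (commL Pi u x) v =
      jump Pi (consPt u (consPt x v)) (fun k : Fin d => some (some k)) none := by
  have h := corr_update_commL hPi none u (consPt x v) (thetaSym Pi)
  rw [update_consPt_none, consPt_none] at h
  rw [Theta, h, jump, jumpSym, thetaSym, map_mul (mapH _), mapH_C, collapse_rowDet_none,
    mul_left_comm]

/-- A commutator in one of the other entries is a difference of two jumps, as the determinant of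
the merged configuration is the sum of two determinants. -/
lemma Theta_commL_right {Pi : Matrix (Fin d) (Fin d) ℝ} (hPi : Pi.transpose = -Pi)
    (u x : WeylDual d) (v : Fin d → WeylDual d) (k : Fin d) :
    Theta Pi x (Function.update v k (commL Pi u (v k))) =
      jump Pi (consPt u (consPt x v)) (fun k : Fin d => some (some k)) (some k) -
      jump Pi (consPt (v k) (consPt x (Function.update v k u))) (fun k : Fin d => some (some k))
        (some k) := by
  have h := corr_update_commL hPi (some k) u (consPt x v) (thetaSym Pi)
  rw [update_consPt_some, consPt_some] at h
  have hw : consPt (v k) (consPt x (Function.update v k u)) =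
      fun o => consPt u (consPt x v) (Equiv.swap none (some (some k)) o) := by
    funext o
    rcases o with - | - | l
    · simp
    · rw [Equiv.swap_apply_of_ne_of_ne (by simp) (by simp)]; rfl
    · by_cases hl : l = k
      · subst hl; simp
      · rw [Equiv.swap_apply_of_ne_of_ne (by simp) (by simpa using hl)]; simp [hl]
  have hr : (Equiv.swap none (some (some k)) ∘ fun k : Fin d => some (some k)) =
      Function.update (fun k : Fin d => some (some k)) k none := by
    funext l
    by_cases hl : l = k
    · subst hl; simp
    · rw [Function.comp_apply, Equiv.swap_apply_of_ne_of_ne (by simp) (by simpa using hl)]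
      simp [hl]
  rw [hw, jump_comp_swap_none hPi, hr, sub_neg_eq_add]
  rw [Theta, h, jump, jump, jumpSym, thetaSym, map_mul (mapH _), mapH_C, collapse_rowDet_some,
    mul_left_comm, map_add PowerSeries.C, add_mul, map_add]

lemma rowDet_mul_bsym (Pi : Matrix (Fin d) (Fin d) ℝ) (r : Fin d → Q) (q q' : Q) :
    rowDet r * bsym Pi q q' = ∑ k, rowDet (Function.update r k q) * bsym Pi (r k) q' := by
  have h : ∀ i j, rowDet r * (MvPolynomial.C (Pi i j) *
      (MvPolynomial.X (q, i) * MvPolynomial.X (q', j))) =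
      ∑ k, rowDet (Function.update r k q) * (MvPolynomial.C (Pi i j) *
        (MvPolynomial.X (r k, i) * MvPolynomial.X (q', j))) := by
    intro i j
    calc _ = rowDet r * MvPolynomial.X (q, i) *
          (MvPolynomial.C (Pi i j) * MvPolynomial.X (q', j)) := by ring
      _ = _ := by
        rw [rowDet_cramer, Finset.sum_mul]
        refine Finset.sum_congr rfl fun k _ => ?_
        ring
  simp only [bsym, Finset.mul_sum, h]
  calc _ = ∑ i, ∑ k, ∑ j, rowDet (Function.update r k q) * (MvPolynomial.C (Pi i j) *
        (MvPolynomial.X (r k, i) * MvPolynomial.X (q', j))) :=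
      Finset.sum_congr rfl fun i _ => Finset.sum_comm
    _ = _ := Finset.sum_comm

/-- By Cramer's rule and the antisymmetry of the bivector, the derivative of the phase with respect
to the additional point, multiplied by the determinant, is the sum of the terms obtained by
exchanging the additional point with the other entries. -/
lemma rowDet_mul_boundary {Pi : Matrix (Fin d) (Fin d) ℝ} (hPi : Pi.transpose = -Pi) :
    rowDet (fun k : Fin d => some (some k)) * ∑ β : Option (Fin d), bsym Pi none (some β) =
      ∑ k, relabel (Equiv.swap none (some (some k)))
        (rowDet (fun k : Fin d => some (some k)) *
          ∑ β : Option (Fin d), bsym Pi none (some β)) := by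
  have hS : ∑ β : Option (Fin d), bsym Pi none (some β) =
      ∑ q : Option (Option (Fin d)), bsym Pi none q := by
    rw [Fintype.sum_option (f := fun q : Option (Option (Fin d)) => bsym Pi none q),
      bsym_self hPi, zero_add]
  rw [hS]
  have hσ : ∀ k : Fin d, relabel (Equiv.swap none (some (some k)))
      (rowDet (fun k : Fin d => some (some k)) *
        ∑ q : Option (Option (Fin d)), bsym Pi none q) =
      rowDet (Function.update (fun k : Fin d => some (some k)) k none) *
        ∑ q : Option (Option (Fin d)), bsym Pi (some (some k)) q := by
    intro k
    have h1 : Equiv.swap none (some (some k)) ∘ (fun k : Fin d => some (some k)) =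
        Function.update (fun k : Fin d => some (some k)) k none := by
      funext l
      by_cases hl : l = k
      · subst hl; simp
      · rw [Function.comp_apply, Equiv.swap_apply_of_ne_of_ne (by simp) (by simpa using hl)]
        simp [hl]
    have h2 := Equiv.sum_comp (Equiv.swap none (some (some k)))
      fun q => bsym (d := d) Pi (some (some k)) q
    rw [map_mul (relabel _), map_sum, relabel_rowDet, h1]
    simp only [relabel_bsym, Equiv.swap_apply_left]
    rw [h2]
  simp only [hσ]
  rw [Finset.mul_sum, Finset.sum_congr rfl fun q _ => rowDet_mul_bsym Pi _ none q, Finset.sum_comm]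
  exact Finset.sum_congr rfl fun k _ => (Finset.mul_sum _ _ _).symm

/-- The integrated form of `rowDet_mul_boundary`; it contains all terms of the cocycle identity. -/
lemma sum_jump_eq {Pi : Matrix (Fin d) (Fin d) ℝ} (hPi : Pi.transpose = -Pi)
    (w : Option (Option (Fin d)) → WeylDual d) :
    ∑ β, jump Pi w (fun k : Fin d => some (some k)) β =
      ∑ k : Fin d, ∑ β, jump Pi (fun o => w (Equiv.swap none (some (some k)) o))
        (fun k : Fin d => some (some k)) β := by
  rw [sum_jump hPi, rowDet_mul_boundary hPi, map_sum PowerSeries.C, Finset.sum_mul, Finset.mul_sum,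
      map_sum]
  refine Finset.sum_congr rfl fun k _ => ?_
  rw [sum_jump hPi, corr_relabel (Equiv.swap none (some (some k))) w, map_mul (mapH _), map_mul
      (mapH _),
    mapH_C, mapH_cfgH, PowerSeries.map_X]
  simp only [relabel_bsym]
  rw [cfgH_relabel]

/-- The cocycle identity for `Theta`. -/
lemma Theta_cocycle {Pi : Matrix (Fin d) (Fin d) ℝ} (hPi : Pi.transpose = -Pi)
    (u x : WeylDual d) (v : Fin d → WeylDual d) :
    2 * (Theta Pi (commL Pi u x) v + ∑ k, Theta Pi x (Function.update v k (commL Pi u (v k))) -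
        ∑ k, Theta Pi (commL Pi (v k) x) (Function.update v k u)) =
      ∑ k, ∑ l ∈ Finset.univ.erase k,
        Theta Pi x (Function.update (Function.update v k u) l (commL Pi (v k) (v l))) := by
  set r : Fin d → Option (Option (Fin d)) := fun k => some (some k) with hr
  set w : Fin d → Option (Option (Fin d)) → WeylDual d := fun k =>
    consPt (v k) (consPt x (Function.update v k u)) with hw
  have hwσ : ∀ k, (fun o => consPt u (consPt x v) (Equiv.swap none (some (some k)) o)) = w k := by
    intro k
    funext o
    rcases o with - | - | l
    · simp [hw]
    · rw [Equiv.swap_apply_of_ne_of_ne (by simp) (by simp)]; rfl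
    · by_cases hl : l = k
      · subst hl; simp [hw]
      · rw [Equiv.swap_apply_of_ne_of_ne (by simp) (by simpa using hl)]; simp [hw, hl]
  have hT : ∀ k l, l ≠ k →
      Theta Pi x (Function.update (Function.update v k u) l (commL Pi (v k) (v l))) =
        jump Pi (w k) r (some l) + jump Pi (w l) r (some k) := by
    intro k l hl
    have h1 := Theta_commL_right hPi (v k) x (Function.update v k u) l
    rw [Function.update_of_ne hl] at h1
    rw [h1, ← hr]
    have h2 : consPt (v l) (consPt x (Function.update (Function.update v k u) l (v k))) =
        fun o => w l (Equiv.optionCongr (Equiv.optionCongr (Equiv.swap k l)) o) := by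
      funext o
      rcases o with - | - | m
      · rfl
      · rfl
      · change Function.update (Function.update v k u) l (v k) m =
          Function.update v l u (Equiv.swap k l m)
        by_cases h3 : m = l
        · subst h3; simp [hl.symm]
        · by_cases h4 : m = k
          · subst h4; simp [h3]
          · simp [h3, h4, Equiv.swap_apply_of_ne_of_ne h4 h3]
    rw [h2, jump_comp]
    have h3 : ⇑(Equiv.optionCongr (Equiv.optionCongr (Equiv.swap k l))) ∘ r =
        r ∘ Equiv.swap k l := rfl
    have h4 : (Equiv.optionCongr (Equiv.swap k l)) (some l) = some k := by
      change some (Equiv.swap k l l) = some k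
      rw [Equiv.swap_apply_right]
    have h5 : jump Pi (w l) (r ∘ Equiv.swap k l) (some k) = -jump Pi (w l) r (some k) := by
      rw [jump, rowDet_comp_swap r hl.symm, map_neg, neg_mul, map_neg, jump]
    rw [h3, h4, h5, sub_neg_eq_add]
  -- all terms are now jumps, and the identity is `sum_jump_eq`
  have hD := sum_jump_eq hPi (consPt u (consPt x v))
  simp only [hwσ, Fintype.sum_option, ← hr] at hD
  simp only [Theta_commL_left hPi, Theta_commL_right hPi, ← hr]
  change 2 * (_ + ∑ k, (_ - jump Pi (w k) r (some k)) - ∑ k, jump Pi (w k) r none) = _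
  rw [Finset.sum_sub_distrib]
  have hR : ∑ k, ∑ l ∈ Finset.univ.erase k,
        Theta Pi x (Function.update (Function.update v k u) l (commL Pi (v k) (v l))) =
      2 * ((∑ k, ∑ l, jump Pi (w k) r (some l)) - ∑ k, jump Pi (w k) r (some k)) := by
    have h1 : ∀ k, ∑ l ∈ Finset.univ.erase k,
        Theta Pi x (Function.update (Function.update v k u) l (commL Pi (v k) (v l))) =
        ∑ l, (jump Pi (w k) r (some l) + jump Pi (w l) r (some k)) -
          2 * jump Pi (w k) r (some k) := by
      intro k
      rw [← Finset.add_sum_erase _ _ (Finset.mem_univ k), two_mul, add_sub_cancel_left]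
      exact Finset.sum_congr rfl fun l hl => hT k l (Finset.ne_of_mem_erase hl)
    simp only [h1, Finset.sum_sub_distrib, Finset.sum_add_distrib]
    rw [Finset.sum_comm (f := fun k l => jump Pi (w l) r (some k)), ← Finset.mul_sum]
    ring
  rw [hR]
  rw [Finset.sum_add_distrib] at hD
  linear_combination 2 * hD

end Theta

/-! ### Linear changes of the fibre coordinates -/

section Frames

variable {d : ℕ} {P Q : Type*} [Fintype P] [DecidableEq P]

/-- The substitution which is given by the matrix `A α` at the point `α`. -/
def pointSubst (A : P → Fin d → Fin d → ℝ) :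
    MvPolynomial (P × Fin d) ℝ →ₐ[ℝ] MvPolynomial (P × Fin d) ℝ :=
  MvPolynomial.aeval fun x => ∑ j, MvPolynomial.C (A x.1 x.2 j) * MvPolynomial.X (x.1, j)

lemma pointSubst_X (A : P → Fin d → Fin d → ℝ) (α : P) (i : Fin d) :
    pointSubst A (MvPolynomial.X (α, i)) =
      ∑ j, MvPolynomial.C (A α i j) * MvPolynomial.X (α, j) := by
  simp [pointSubst]

lemma pointSubst_rename (A : P → Fin d → Fin d → ℝ) (α : P) (f : MvPolynomial (Fin d) ℝ) :
    pointSubst A (MvPolynomial.rename (Prod.mk α) f) =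
      MvPolynomial.rename (Prod.mk α) (linSubst (A α) f) := by
  have : (pointSubst A).comp (MvPolynomial.rename (Prod.mk α)) =
      (MvPolynomial.rename (Prod.mk α)).comp (linSubst (A α)) := by
    refine MvPolynomial.algHom_ext fun i => ?_
    simp [pointSubst_X, map_sum]
  exact congrArg (fun φ => φ f) this

lemma tensor_comp_linSubst (A : P → Fin d → Fin d → ℝ) (lam : P → WeylDual d) :
    tensor (fun α => (lam α).comp (linSubst (A α)).toLinearMap) =
      (tensor lam).comp (pointSubst A).toLinearMap := by
  refine linearMap_ext_monomial fun m => ?_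
  rw [LinearMap.comp_apply, AlgHom.toLinearMap_apply, monomial_eq_prod_slice, tensor_prod,
    map_prod (pointSubst A)]
  simp only [pointSubst_rename]
  rw [tensor_prod]
  rfl

lemma corr_comp_linSubst (A : P → Fin d → Fin d → ℝ) (lam : P → WeylDual d)
    (F : PowerSeries (MvPolynomial (P × Fin d) ℝ)) :
    corr (fun α => (lam α).comp (linSubst (A α)).toLinearMap) F =
      corr lam (mapH (pointSubst A) F) := by
  rw [corr_apply, corr_apply, hExt_map, tensor_comp_linSubst]

/-- A functional, rewritten in the linear coordinates dual to the frame with matrix `Φ`. -/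
def frame (Φ : Matrix (Fin d) (Fin d) ℝ) (lam : WeylDual d) : WeylDual d :=
  lam.comp (linSubst fun j i => Φ i j).toLinearMap

/-- The dual of a linear change of the fibre coordinates, for all points of a configuration. -/
def frameSubst (Φ : Matrix (Fin d) (Fin d) ℝ) :
    MvPolynomial (P × Fin d) ℝ →ₐ[ℝ] MvPolynomial (P × Fin d) ℝ :=
  pointSubst fun _ j i => Φ i j

lemma corr_frame (Φ : Matrix (Fin d) (Fin d) ℝ) (lam : P → WeylDual d)
    (F : PowerSeries (MvPolynomial (P × Fin d) ℝ)) :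
    corr (fun α => frame Φ (lam α)) F = corr lam (mapH (frameSubst Φ) F) :=
  corr_comp_linSubst _ _ _

lemma frameSubst_X (Φ : Matrix (Fin d) (Fin d) ℝ) (α : P) (j : Fin d) :
    frameSubst Φ (MvPolynomial.X (α, j)) =
      ((Φ.map MvPolynomial.C).transpose.mulVec fun i => MvPolynomial.X (α, i)) j := by
  simp [frameSubst, pointSubst_X, Matrix.mulVec, dotProduct]

lemma bsym_eq_dotProduct (Pi : Matrix (Fin d) (Fin d) ℝ) (α β : P) :
    bsym Pi α β = dotProduct (fun i => MvPolynomial.X (α, i))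
      ((Pi.map MvPolynomial.C).mulVec fun j => MvPolynomial.X (β, j)) := by
  simp only [bsym, Matrix.mulVec, dotProduct, Finset.mul_sum, Matrix.map_apply]
  refine Finset.sum_congr rfl fun i _ => Finset.sum_congr rfl fun j _ => ?_
  ring

lemma frameSubst_bsym (Φ Pi : Matrix (Fin d) (Fin d) ℝ) (α β : P) :
    frameSubst Φ (bsym Pi α β) = bsym (Φ * Pi * Φ.transpose) α β := by
  rw [bsym_eq_dotProduct (Φ * Pi * Φ.transpose), Matrix.map_mul, Matrix.map_mul,
    ← Matrix.mulVec_mulVec, ← Matrix.mulVec_mulVec, Matrix.dotProduct_mulVec,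
    ← Matrix.mulVec_transpose, ← Matrix.transpose_map]
  simp only [bsym, Matrix.mulVec, map_sum, map_mul, frameSubst_X, MvPolynomial.algHom_C,
    MvPolynomial.algebraMap_eq]
  simp only [dotProduct, Finset.mul_sum, Matrix.map_apply, Matrix.mulVec, Matrix.transpose_apply]
  refine Finset.sum_congr rfl fun i _ => Finset.sum_congr rfl fun j _ => ?_
  ring_nf

lemma frameSubst_rowDet (Φ : Matrix (Fin d) (Fin d) ℝ) (r : Fin d → P) :
    frameSubst Φ (rowDet r) = MvPolynomial.C Φ.det * rowDet r := by
  unfold rowDet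
  rw [AlgHom.map_det]
  have : (Matrix.of fun k i => (MvPolynomial.X (r k, i) : MvPolynomial (P × Fin d) ℝ)).map
      (frameSubst Φ) = (Matrix.of fun k i => MvPolynomial.X (r k, i)) * Φ.map MvPolynomial.C := by
    ext1 k i
    rw [Matrix.map_apply, Matrix.of_apply, frameSubst_X, Matrix.mulVec_transpose]
    rfl
  have h2 : (frameSubst Φ).mapMatrix (Matrix.of fun k i => (MvPolynomial.X (r k, i) :
      MvPolynomial (P × Fin d) ℝ)) = (Matrix.of fun k i => MvPolynomial.X (r k, i)) * Φ.map
        MvPolynomial.C :=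
    this
  rw [h2, Matrix.det_mul, mul_comm, RingHom.map_det]
  rfl

lemma frameSubst_diag (Φ : Matrix (Fin d) (Fin d) ℝ) (f : MvPolynomial (Fin d) ℝ) :
    frameSubst Φ (diag f) = diag (linSubst (fun j i => Φ i j) f) := by
  have : (frameSubst Φ).comp diag = diag.comp (linSubst fun j i => Φ i j) := by
    refine MvPolynomial.algHom_ext fun i => ?_
    simp [diag, frameSubst, pointSubst_X, mul_add, Finset.sum_add_distrib, map_sum]
  exact congrArg (fun φ => φ f) this

/-- Equivariance of the cocycle under linear changes of the fibre coordinates. -/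
lemma Theta_frame (Φ Pi : Matrix (Fin d) (Fin d) ℝ) (x : WeylDual d) (v : Fin d → WeylDual d) :
    Theta Pi (frame Φ x) (fun k => frame Φ (v k)) =
      Φ.det • Theta (Φ * Pi * Φ.transpose) x v := by
  have h : consPt (frame Φ x) (fun k => frame Φ (v k)) = fun o => frame Φ (consPt x v o) := by
    funext o; cases o <;> rfl
  rw [Theta, h, corr_frame, thetaSym, map_mul (mapH _), mapH_C, mapH_cfgH, frameSubst_rowDet]
  simp only [frameSubst_bsym]
  rw [Theta, thetaSym, map_mul PowerSeries.C, mul_assoc, ← map_smul]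
  congr 1
  ext N : 1
  rw [PowerSeries.coeff_C_mul, PowerSeries.coeff_smul, MvPolynomial.smul_eq_C_mul]

lemma starL_frame (Φ Pi : Matrix (Fin d) (Fin d) ℝ) (a b : WeylDual d) :
    starL Pi (frame Φ a) (frame Φ b) = frame Φ (starL (Φ * Pi * Φ.transpose) a b) := by
  refine LinearMap.ext fun f => ?_
  have h : ![frame Φ a, frame Φ b] = fun o => frame Φ (![a, b] o) := by
    funext o
    refine Fin.cases ?_ (fun o => ?_) o
    · rfl
    · rw [Fin.fin_one_eq_zero o]
      rfl
  have h2 : frame Φ (starL (Φ * Pi * Φ.transpose) a b) f =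
      starL (Φ * Pi * Φ.transpose) a b (linSubst (fun j i => Φ i j) f) := rfl
  rw [starL_apply, h, corr_frame, mapH_expH_mul_C, map_smul, frameSubst_bsym, frameSubst_diag, h2,
    starL_apply]

lemma frame_mul (Φ Ψ : Matrix (Fin d) (Fin d) ℝ) (a : WeylDual d) :
    frame (Φ * Ψ) a = frame Ψ (frame Φ a) := by
  have : linSubst (fun j i => (Φ * Ψ) i j) =
      (linSubst fun j i => Φ i j).comp (linSubst fun j i => Ψ i j) := by
    refine MvPolynomial.algHom_ext fun i => ?_
    simp only [linSubst_X, Matrix.mul_apply, map_sum, AlgHom.comp_apply, map_mul,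
      MvPolynomial.algHom_C, MvPolynomial.algebraMap_eq, Finset.mul_sum, Finset.sum_mul]
    rw [Finset.sum_comm]
    refine Finset.sum_congr rfl fun j _ => Finset.sum_congr rfl fun k _ => ?_
    rw [mul_left_comm, mul_assoc]
  refine LinearMap.ext fun f => ?_
  have h1 : frame (Φ * Ψ) a f = a (linSubst (fun j i => (Φ * Ψ) i j) f) := rfl
  have h2 : frame Ψ (frame Φ a) f =
      a (linSubst (fun j i => Φ i j) (linSubst (fun j i => Ψ i j) f)) := rfl
  rw [h1, h2, this, AlgHom.comp_apply]

lemma frame_one (a : WeylDual d) : frame 1 a = a := by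
  have : linSubst (fun j i => (1 : Matrix (Fin d) (Fin d) ℝ) i j) = AlgHom.id ℝ _ := by
    refine MvPolynomial.algHom_ext fun i => ?_
    simp [linSubst_X, Matrix.one_apply]
  unfold frame
  rw [this]
  rfl

end Frames

/-! ### Vanishing of the cocycle on constants and quadratic functions -/

section Vanishing

variable {d : ℕ} {P : Type*} [Fintype P] [DecidableEq P]

/-- The number of ends of the edges `f` at the point `β`. -/
def degAt (β : P) {m : ℕ} (f : Fin m → P × P) : ℕ :=
  ∑ i, ((if (f i).1 = β then 1 else 0) + if (f i).2 = β then 1 else 0)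

/-- A configuration integral vanishes if some point carries exactly one end of an edge, as the
propagator has mean value zero. -/
lemma wickCoeff_of_degAt_eq_one (β : P) {m : ℕ} (f : Fin m → P × P) (h : degAt β f = 1) :
    wickCoeff f = 0 := by
  obtain ⟨i₀, -, hi₀⟩ : ∃ i ∈ Finset.univ,
      ((if (f i).1 = β then 1 else 0) + if (f i).2 = β then 1 else 0) ≠ 0 := by
    refine Finset.exists_ne_zero_of_sum_ne_zero ?_
    rw [← degAt, h]
    exact one_ne_zero
  refine wickCoeff_eq_zero f β i₀ ?_ fun i hi => ?_
  · by_contra hc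
    simp only [not_or] at hc
    simp [hc.1, hc.2] at hi₀
  · rw [degAt, ← Finset.add_sum_erase _ _ (Finset.mem_univ i₀), ← Finset.add_sum_erase _ _
      (Finset.mem_erase.2 ⟨hi, Finset.mem_univ i⟩)] at h
    constructor
    · intro hc
      rw [if_pos hc] at h
      omega
    · intro hc
      rw [if_pos hc] at h
      omega

/-- The substitution which doubles the variables at the point `β`. -/
def doubleAt (β : P) : MvPolynomial (P × Fin d) ℝ →ₐ[ℝ] MvPolynomial (P × Fin d) ℝ :=
  pointSubst fun α i j => if i = j then (if α = β then 2 else 1) else 0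

lemma doubleAt_X (β α : P) (i : Fin d) :
    doubleAt β (MvPolynomial.X (α, i)) =
      MvPolynomial.C (if α = β then 2 else 1) * MvPolynomial.X (α, i) := by
  rw [doubleAt, pointSubst_X, Finset.sum_eq_single i (fun j _ hj => by simp [hj.symm]) (by simp),
    if_pos rfl]

lemma doubleAt_bsym (Pi : Matrix (Fin d) (Fin d) ℝ) (β x y : P) :
    doubleAt β (bsym Pi x y) =
      MvPolynomial.C ((2 : ℝ) ^ ((if x = β then 1 else 0) + if y = β then 1 else 0)) *
        bsym Pi x y := by
  have h : ∀ z : P, (2 : ℝ) ^ (if z = β then 1 else 0) = if z = β then 2 else 1 := fun z => by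
    split_ifs <;> simp
  rw [pow_add, h, h, map_mul]
  simp only [bsym, map_sum, map_mul, doubleAt_X, MvPolynomial.algHom_C, MvPolynomial.algebraMap_eq,
    Finset.mul_sum]
  refine Finset.sum_congr rfl fun i _ => Finset.sum_congr rfl fun j _ => ?_
  ring

lemma doubleAt_rowDet (l : Fin d) :
    doubleAt (some l) (rowDet (some : Fin d → Option (Fin d))) = MvPolynomial.C 2 * rowDet some :=
      by
  unfold rowDet
  rw [AlgHom.map_det]
  set V : Matrix (Fin d) (Fin d) (MvPolynomial (Option (Fin d) × Fin d) ℝ) :=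
    Matrix.of fun k i => MvPolynomial.X (some k, i) with hV
  have h := Matrix.det_updateRow_smul V l (MvPolynomial.C 2) (V l)
  rw [Matrix.updateRow_eq_self] at h
  rw [← h]
  congr 1
  ext1 k i
  change doubleAt (some l) (MvPolynomial.X (some k, i)) = _
  rw [doubleAt_X]
  by_cases hk : k = l
  · subst hk; simp [hV]
  · simp [hk, hV]

/-- A functional is homogeneous of degree `j` if it corresponds to a homogeneous polynomial of
degree `j` in the fibre coordinates. -/
def IsHomog (j : ℕ) (a : WeylDual d) : Prop :=
  a.comp (linSubst fun i k => if i = k then (2 : ℝ) else 0).toLinearMap = (2 : ℝ) ^ j • a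

/-- Homogeneity detected by doubling the variables of one point. -/
lemma tensor_doubleAt (β : P) (lam : P → WeylDual d) {j : ℕ} (h : IsHomog j (lam β))
    (f : MvPolynomial (P × Fin d) ℝ) :
    tensor lam (doubleAt β f) = (2 : ℝ) ^ j • tensor lam f := by
  have h1 := LinearMap.congr_fun
    (tensor_comp_linSubst (fun α i k => if i = k then (if α = β then (2 : ℝ) else 1) else 0) lam) f
  have h2 : (fun α => (lam α).comp
      (linSubst fun i k : Fin d => if i = k then (if α = β then (2 : ℝ) else 1) else
        0).toLinearMap) =
      Function.update lam β (PowerSeries.C ((2 : ℝ) ^ j) • lam β) := by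
    funext α
    by_cases hα : α = β
    · subst hα
      simp only [if_true, Function.update_self]
      rw [h]
      refine LinearMap.ext fun g => ?_
      rw [LinearMap.smul_apply, LinearMap.smul_apply, smul_eq_mul, PowerSeries.smul_eq_C_mul]
    · simp only [hα, if_false, Function.update_of_ne, ne_eq, not_false_eq_true]
      have : linSubst (fun i k : Fin d => if i = k then (1 : ℝ) else 0) = AlgHom.id ℝ _ := by
        refine MvPolynomial.algHom_ext fun i => ?_
        simp [linSubst_X]
      rw [this]
      rfl
  rw [h2, MultilinearMap.map_update_smul, Function.update_eq_self] at h1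
  rw [LinearMap.smul_apply, smul_eq_mul, ← PowerSeries.smul_eq_C_mul] at h1
  exact h1.symm

/-- The cocycle vanishes if one of its arguments is a constant or a homogeneous quadratic
polynomial: the determinant is linear in the variables of the point, and no configuration integral
is linear in them. -/
lemma Theta_eq_zero_of_isHomog (Pi : Matrix (Fin d) (Fin d) ℝ) (x : WeylDual d)
    (v : Fin d → WeylDual d) (l : Fin d) (j : ℕ) (hj : j = 0 ∨ j = 2) (h : IsHomog j (v l)) :
    Theta Pi x v = 0 := by
  have key : ∀ m, tensor (consPt x v) (PowerSeries.coeff m (thetaSym Pi)) = 0 := by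
    intro m
    rw [thetaSym, PowerSeries.coeff_C_mul, cfgH, PowerSeries.coeff_mk, cfg, mul_smul_comm, map_smul,
      Finset.mul_sum, map_sum]
    refine (congrArg _ (Finset.sum_eq_zero fun f _ => ?_)).trans (smul_zero _)
    rw [mul_smul_comm, map_smul]
    by_cases hf : degAt (some l) f = 1
    · rw [wickCoeff_of_degAt_eq_one _ f hf, zero_smul]
    · have h1 := tensor_doubleAt (some l) (consPt x v) h
        (rowDet some * ∏ i, bsym Pi (f i).1 (f i).2)
      rw [map_mul (doubleAt _), map_prod, doubleAt_rowDet] at h1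
      simp only [doubleAt_bsym] at h1
      rw [Finset.prod_mul_distrib, ← map_prod, Finset.prod_pow_eq_pow_sum, ← degAt,
        mul_mul_mul_comm, ← map_mul, ← MvPolynomial.smul_eq_C_mul, map_smul, ← pow_succ'] at h1
      have h2 : ((2 : ℝ) ^ (degAt (some l) f + 1) - 2 ^ j) •
          tensor (consPt x v) (rowDet some * ∏ i, bsym Pi (f i).1 (f i).2) = 0 := by
        rw [sub_smul, h1, sub_self]
      have h3 : ((2 : ℝ) ^ (degAt (some l) f + 1) - 2 ^ j) ≠ 0 := by
        intro h0
        have := pow_right_injective₀ (by norm_num : (0 : ℝ) < 2) (by norm_num : (2 : ℝ) ≠ 1)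
          (sub_eq_zero.1 h0)
        omega
      rw [(smul_eq_zero.1 h2).resolve_left h3, smul_zero]
  rw [Theta, corr_apply]
  ext N
  rw [coeff_hExt]
  simp [key]

end Vanishing

/-! ### Formal functions as functionals -/

section Dual

variable {σ τ : Type*}

/-- The functional corresponding to a power series in `ħ` with formal functions as
coefficients. -/
def dualW (A : PowerSeries (MvPowerSeries σ ℝ)) : MvPolynomial σ ℝ →ₗ[ℝ] PowerSeries ℝ where
  toFun f := PowerSeries.mk fun N => pair (PowerSeries.coeff N A) f
  map_add' f g := by ext N; simp
  map_smul' c f := by ext N; simp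

lemma coeff_dualW (A : PowerSeries (MvPowerSeries σ ℝ)) (f : MvPolynomial σ ℝ) (N : ℕ) :
    PowerSeries.coeff N (dualW A f) = pair (PowerSeries.coeff N A) f := by
  simp [dualW]

lemma dualW_injective {A B : PowerSeries (MvPowerSeries σ ℝ)} (h : dualW A = dualW B) : A = B := by
  ext1 N
  refine pair_injective (LinearMap.ext fun f => ?_)
  rw [← coeff_dualW, h, coeff_dualW]

lemma dualW_add (A B : PowerSeries (MvPowerSeries σ ℝ)) : dualW (A + B) = dualW A + dualW B := by
  refine LinearMap.ext fun f => ?_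
  ext N
  simp [coeff_dualW, pair_add]

lemma dualW_sub (A B : PowerSeries (MvPowerSeries σ ℝ)) : dualW (A - B) = dualW A - dualW B := by
  rw [eq_sub_iff_add_eq, ← dualW_add, sub_add_cancel]

/-- The coefficientwise partial derivative. -/
def pdW (s : σ) (A : PowerSeries (MvPowerSeries σ ℝ)) : PowerSeries (MvPowerSeries σ ℝ) :=
  PowerSeries.mk fun N => MvPowerSeries.pderiv ℝ s (PowerSeries.coeff N A)

lemma pdW_mul (s : σ) (A B : PowerSeries (MvPowerSeries σ ℝ)) :
    pdW s (A * B) = pdW s A * B + A * pdW s B := by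
  ext1 N
  simp only [pdW, PowerSeries.coeff_mk, map_add, PowerSeries.coeff_mul, map_sum]
  rw [← Finset.sum_add_distrib]
  refine Finset.sum_congr rfl fun x _ => ?_
  rw [Derivation.leibniz, smul_eq_mul, smul_eq_mul]
  ring

lemma pdW_one (s : σ) : pdW s (1 : PowerSeries (MvPowerSeries σ ℝ)) = 0 := by
  ext1 N
  rw [pdW, PowerSeries.coeff_mk, PowerSeries.coeff_one]
  split_ifs <;> simp

lemma pdW_prod_eq_zero {ι : Type*} (S : Finset ι) (s : σ) (A : ι → PowerSeries (MvPowerSeries σ ℝ))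
    (h : ∀ i ∈ S, pdW s (A i) = 0) : pdW s (∏ i ∈ S, A i) = 0 := by
  classical
  induction S using Finset.induction_on with
  | empty => exact pdW_one s
  | insert i S hi ih =>
    rw [Finset.prod_insert hi, pdW_mul, h i (Finset.mem_insert_self i S),
      ih fun j hj => h j (Finset.mem_insert_of_mem hj)]
    simp

lemma dualW_mul_X (A : PowerSeries (MvPowerSeries σ ℝ)) (s : σ) (f : MvPolynomial σ ℝ) :
    dualW A (f * MvPolynomial.X s) = dualW (pdW s A) f := by
  ext N
  rw [mul_comm, coeff_dualW, coeff_dualW, pair_X_mul, pdW, PowerSeries.coeff_mk]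

lemma dualW_C (A : PowerSeries (MvPowerSeries σ ℝ)) (c : ℝ) :
    dualW A (MvPolynomial.C c) = c • PowerSeries.map MvPowerSeries.constantCoeff A := by
  ext N
  rw [← mul_one (MvPolynomial.C c), coeff_dualW, pair_C_mul, pair_one]
  simp

variable {d : ℕ} {P : Type*} [Fintype P] [DecidableEq P]

/-- Embedding as the factor with index `α` of a tensor power. -/
def slotW (α : P) : PowerSeries (MvPowerSeries (Fin d) ℝ) →+*
    PowerSeries (MvPowerSeries (P × Fin d) ℝ) :=
  PowerSeries.map (MvPowerSeries.rename (R := ℝ) (Prod.mk α : Fin d → P × Fin d)).toRingHom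

lemma pderiv_rename_mk (α β : P) (i : Fin d) (F : MvPowerSeries (Fin d) ℝ) :
    MvPowerSeries.pderiv ℝ (β, i) (MvPowerSeries.rename (Prod.mk α : Fin d → P × Fin d) F) =
      if α = β then MvPowerSeries.rename (Prod.mk α : Fin d → P × Fin d)
        (MvPowerSeries.pderiv ℝ i F) else 0 := by
  refine pair_injective (LinearMap.ext fun f => ?_)
  rw [← pair_X_mul, pair_rename, map_mul, MvPolynomial.aeval_X]
  split_ifs with h
  · subst h
    have : (Finset.univ.filter fun s : Fin d => (α, s) = (α, i)) = {i} := by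
      ext j; simp
    rw [this, Finset.sum_singleton, pair_X_mul, pair_rename]
  · have : (Finset.univ.filter fun s : Fin d => (α, s) = (β, i)) = ∅ := by
      ext j; simp [h]
    rw [this, Finset.sum_empty, zero_mul, map_zero]
    have h0 : pair (0 : MvPowerSeries (P × Fin d) ℝ) = 0 := map_zero pairHom
    rw [h0, LinearMap.zero_apply]

lemma pdW_slotW (α β : P) (i : Fin d) (A : PowerSeries (MvPowerSeries (Fin d) ℝ)) :
    pdW (β, i) (slotW α A) = if α = β then slotW α (pdW i A) else 0 := by
  ext1 N
  have : PowerSeries.coeff N (slotW α A) =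
      MvPowerSeries.rename (Prod.mk α : Fin d → P × Fin d) (PowerSeries.coeff N A) := by
    simp [slotW]
  rw [pdW, PowerSeries.coeff_mk, this, pderiv_rename_mk]
  split_ifs
  · simp [slotW, pdW]
  · simp

lemma tensor_mul_X (lam : P → WeylDual d) (β : P) (i : Fin d) (f : MvPolynomial (P × Fin d) ℝ) :
    tensor lam (f * MvPolynomial.X (β, i)) =
      tensor (Function.update lam β ((lam β).comp (LinearMap.mulRight ℝ (MvPolynomial.X i)))) f :=
        by
  have : (tensor lam).comp (LinearMap.mulRight ℝ (MvPolynomial.X (β, i))) =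
      tensor (Function.update lam β
        ((lam β).comp (LinearMap.mulRight ℝ (MvPolynomial.X i)))) := by
    refine linearMap_ext_monomial fun m => ?_
    rw [LinearMap.comp_apply, LinearMap.mulRight_apply, monomial_eq_prod_slice, tensor_prod]
    have h : (MvPolynomial.X (β, i) : MvPolynomial (P × Fin d) ℝ) =
        ∏ α, MvPolynomial.rename (Prod.mk α) (if α = β then MvPolynomial.X i else 1) := by
      rw [Finset.prod_eq_single β]
      · simp
      · intro α _ hα; simp [hα]
      · simp
    rw [h, ← Finset.prod_mul_distrib]
    simp only [← map_mul]
    rw [tensor_prod]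
    refine Finset.prod_congr rfl fun α _ => ?_
    by_cases hα : α = β
    · subst hα; simp
    · simp [hα]
  exact LinearMap.congr_fun this f

/-- The functional of a product of functions of different variables is the tensor product. -/
lemma dualW_prod_slotW (A : P → PowerSeries (MvPowerSeries (Fin d) ℝ)) :
    dualW (∏ α, slotW α (A α)) = tensor fun α => dualW (A α) := by
  refine LinearMap.ext fun f => ?_
  induction f using MvPolynomial.induction_on generalizing A with
  | C c =>
    have h : (MvPolynomial.C c : MvPolynomial (P × Fin d) ℝ) = c •
        ∏ α, MvPolynomial.rename (Prod.mk α) (1 : MvPolynomial (Fin d) ℝ) := by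
      simp [MvPolynomial.smul_eq_C_mul]
    have h1 : ∀ B : PowerSeries (MvPowerSeries (Fin d) ℝ), dualW B 1 =
        PowerSeries.map MvPowerSeries.constantCoeff B := fun B => by
      rw [← MvPolynomial.C_1, dualW_C, one_smul]
    rw [dualW_C, h, map_smul, tensor_prod, map_prod]
    congr 1
    refine Finset.prod_congr rfl fun α _ => ?_
    rw [h1]
    ext N
    simp [slotW, MvPowerSeries.constantCoeff_rename]
  | add f g hf hg => rw [map_add, map_add, hf, hg]
  | mul_X f x hf =>
    obtain ⟨β, i⟩ := x
    rw [dualW_mul_X, tensor_mul_X]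
    have h1 : pdW (β, i) (∏ α, slotW α (A α)) =
        ∏ α, slotW α (Function.update A β (pdW i (A β)) α) := by
      rw [← Finset.mul_prod_erase _ _ (Finset.mem_univ β), pdW_mul,
        pdW_prod_eq_zero _ _ _ fun α hα => ?_, ← Finset.mul_prod_erase Finset.univ
          (fun α => slotW α (Function.update A β (pdW i (A β)) α)) (Finset.mem_univ β)]
      · rw [pdW_slotW, if_pos rfl, mul_zero, add_zero, Function.update_self]
        congr 1
        refine Finset.prod_congr rfl fun α hα => ?_
        rw [Function.update_of_ne (Finset.ne_of_mem_erase hα)]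
      · rw [pdW_slotW, if_neg (Finset.ne_of_mem_erase hα)]
    rw [h1, hf]
    congr 2
    funext α
    by_cases hα : α = β
    · subst hα
      refine LinearMap.ext fun g => ?_
      simp [dualW_mul_X]
    · simp [hα]

end Dual

/-! ### The fibrewise operations in the dual description -/

section Bridge

variable {M : Type*} {d : ℕ} {σ : Type*}

/-- The value at `p` of a family of formal functions. -/
def atPt (p : M) : FormalSection M σ →+* PowerSeries (MvPowerSeries σ ℝ) :=
  PowerSeries.map (Pi.evalRingHom (fun _ : M => MvPowerSeries σ ℝ) p)

@[simp] lemma coeff_atPt (p : M) (A : FormalSection M σ) (N : ℕ) :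
    PowerSeries.coeff N (atPt p A) = PowerSeries.coeff N A p := by
  simp [atPt]

lemma atPt_ext {A B : FormalSection M σ} (h : ∀ p, atPt p A = atPt p B) : A = B := by
  ext1 N
  funext p
  rw [← coeff_atPt, h, coeff_atPt]

lemma atPt_slot (p : M) {k : ℕ} (α : Fin k) (A : WeylSection M d) :
    atPt p (slot α A) = slotW α (atPt p A) := by
  ext1 N
  simp [slot, slotW]

/-- The multiplication map is dual to the substitution of the sum of all variables. -/
lemma dualW_multMap (p : M) {k : ℕ} (A : FormalSection M (Fin k × Fin d))
    (f : MvPolynomial (Fin d) ℝ) :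
    dualW (atPt p (multMap k A)) f =
      dualW (atPt p A) (MvPolynomial.aeval (fun i => ∑ α, MvPolynomial.X (α, i)) f) := by
  ext N
  rw [coeff_dualW, coeff_dualW, coeff_atPt, coeff_atPt]
  have : PowerSeries.coeff N (multMap k A) p =
      MvPowerSeries.rename (Prod.snd : Fin k × Fin d → Fin d) (PowerSeries.coeff N A p) := by
    simp [multMap]
  rw [this, pair_rename]
  congr 3
  funext i
  have h : (Finset.univ.filter fun s : Fin k × Fin d => s.2 = i) =
      Finset.univ.map ⟨fun α => (α, i), fun _ _ h => (Prod.mk.inj h).1⟩ := by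
    ext ⟨α, j⟩
    simp only [Finset.mem_filter, Finset.mem_univ, true_and, Finset.mem_map]
    constructor
    · rintro rfl
      exact ⟨α, rfl⟩
    · rintro ⟨a, h⟩
      exact (Prod.mk.inj h).2.symm
  rw [h, Finset.sum_map]
  rfl

lemma pair_biDer (Pi : M → Matrix (Fin d) (Fin d) ℝ) {k : ℕ} (α β : Fin k)
    (F : M → MvPowerSeries (Fin k × Fin d) ℝ) (p : M) (f : MvPolynomial (Fin k × Fin d) ℝ) :
    pair (biDer Pi α β F p) f = pair (F p) (bsym (Pi p) α β * f) := by
  have h : biDer Pi α β F p = ∑ i, ∑ j, Pi p i j •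
      MvPowerSeries.pderiv ℝ (α, i) (MvPowerSeries.pderiv ℝ (β, j) (F p)) := rfl
  rw [h, ← pairHom_apply]
  simp only [map_sum, map_smul, LinearMap.sum_apply, LinearMap.smul_apply, pairHom_apply,
    ← pair_X_mul, bsym, Finset.sum_mul, mul_assoc, pair_C_mul, smul_eq_mul]
  refine Finset.sum_congr rfl fun i _ => Finset.sum_congr rfl fun j _ => ?_
  rw [mul_left_comm]

/-- The exponential of a differential operator is dual to multiplication by the exponential of its
symbol. -/
lemma dualW_expHbar (p : M) (T : Module.End ℝ (M → MvPowerSeries σ ℝ)) (t : MvPolynomial σ ℝ)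
    (hT : ∀ F f, pair (T F p) f = pair (F p) (t * f)) (A : FormalSection M σ)
    (f : MvPolynomial σ ℝ) :
    dualW (atPt p (expHbar T A)) f = hExt (dualW (atPt p A)) (expH t * PowerSeries.C f) := by
  have hm : ∀ m F g, pair ((T ^ m) F p) g = pair (F p) (t ^ m * g) := by
    intro m
    induction m with
    | zero => intro F g; simp
    | succ m ih =>
      intro F g
      rw [pow_succ, Module.End.mul_apply, ih, hT, pow_succ', mul_assoc]
  ext N
  rw [coeff_dualW, coeff_atPt, expHbar, PowerSeries.coeff_mk, coeff_hExt,
    Finset.Nat.sum_antidiagonal_eq_sum_range_succ_mk, Finset.sum_apply, ← pairHom_apply, map_sum,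
    LinearMap.sum_apply]
  refine Finset.sum_congr rfl fun m _ => ?_
  rw [coeff_dualW, coeff_atPt, PowerSeries.coeff_mul_C, expH, PowerSeries.coeff_mk, smul_mul_assoc,
    map_smul, Pi.smul_apply, map_smul, LinearMap.smul_apply, pairHom_apply, hm]

/-- The Moyal product in the dual description. -/
lemma dualW_moyal (Pi : M → Matrix (Fin d) (Fin d) ℝ) (a b : WeylSection M d) (p : M) :
    dualW (atPt p (moyal Pi a b)) = starL (Pi p) (dualW (atPt p a)) (dualW (atPt p b)) := by
  have h0 : atPt p (slot (0 : Fin 2) a * slot (1 : Fin 2) b) =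
      ∏ α : Fin 2, slotW α (![atPt p a, atPt p b] α) := by
    rw [map_mul, atPt_slot, atPt_slot, Fin.prod_univ_two]
    rfl
  have h1 : (fun α => dualW (![atPt p a, atPt p b] α)) = ![dualW (atPt p a), dualW (atPt p b)] := by
    funext α
    refine Fin.cases rfl (fun α => ?_) α
    rw [Fin.fin_one_eq_zero α]
    rfl
  have h2 : MvPolynomial.aeval (fun i => ∑ α : Fin 2, MvPolynomial.X (α, i)) =
      (diag : MvPolynomial (Fin d) ℝ →ₐ[ℝ] _) := by
    simp only [diag, Fin.sum_univ_two]
  have h3 : ∀ (F : M → MvPowerSeries (Fin 2 × Fin d) ℝ) f,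
      pair ((((1 / 2 : ℝ) • biDer Pi (0 : Fin 2) 1) F) p) f =
        pair (F p) ((1 / 2 : ℝ) • bsym (Pi p) 0 1 * f) := by
    intro F f
    have h : ((1 / 2 : ℝ) • biDer Pi (0 : Fin 2) 1) F p =
      (1 / 2 : ℝ) • biDer Pi (0 : Fin 2) 1 F p := rfl
    rw [h, ← pairHom_apply, map_smul, LinearMap.smul_apply, pairHom_apply, pair_biDer,
        smul_mul_assoc, map_smul]
  refine LinearMap.ext fun f => ?_
  rw [moyal, dualW_multMap, dualW_expHbar p _ _ h3, h0, dualW_prod_slotW, h1, h2, starL_apply,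
    corr_apply]

lemma dualW_moyalComm (Pi : M → Matrix (Fin d) (Fin d) ℝ) (a b : WeylSection M d) (p : M) :
    dualW (atPt p (moyalComm Pi a b)) = commL (Pi p) (dualW (atPt p a)) (dualW (atPt p b)) := by
  rw [moyalComm, map_sub, dualW_sub, dualW_moyal, dualW_moyal, commL]

/-- The constant term of a configuration integral. -/
lemma configIntegral_zero (Pi : M → Matrix (Fin d) (Fin d) ℝ) (k : ℕ)
    (A : FormalSection M (Fin k × Fin d)) (p : M) (N : ℕ) :
    MvPowerSeries.constantCoeff (PowerSeries.coeff N (configIntegral Pi k A) p) =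
      PowerSeries.coeff N (hExt (dualW (atPt p A)) (cfgH (bsym (Pi p)))) := by
  have h0 : MvPowerSeries.constantCoeff (PowerSeries.coeff N (configIntegral Pi k A) p) =
      ∫ θ in Set.Icc (0 : Fin k → ℝ) 1, MvPowerSeries.coeff 0
        (PowerSeries.coeff N (multMap k (expHbar (partialP Pi θ) A)) p) := by
    rw [← MvPowerSeries.coeff_zero_eq_constantCoeff_apply]
    have h : PowerSeries.coeff N (configIntegral Pi k A) = _ := PowerSeries.coeff_mk N _
    rw [h]
    rfl
  rw [h0]
  -- expand the exponential into edges, at a fixed configuration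
  have hθ : ∀ θ : Fin k → ℝ, MvPowerSeries.coeff 0
      (PowerSeries.coeff N (multMap k (expHbar (partialP Pi θ) A)) p) =
      ∑ x ∈ Finset.HasAntidiagonal.antidiagonal N, ((x.1.factorial : ℝ)⁻¹) *
        ∑ f : Fin x.1 → Fin k × Fin k, (∏ i, wickKernel θ (f i)) *
          PowerSeries.coeff x.2 (dualW (atPt p A) (∏ i, bsym (Pi p) (f i).1 (f i).2)) := by
    intro θ
    rw [MvPowerSeries.coeff_zero_eq_constantCoeff_apply, ← pair_one, ← coeff_atPt, ← coeff_dualW,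
      dualW_multMap, map_one,
      dualW_expHbar p _ (∑ x : Fin k × Fin k, wickKernel θ x • bsym (Pi p) x.1 x.2)]
    · rw [map_one, mul_one, coeff_hExt]
      refine Finset.sum_congr rfl fun x _ => ?_
      rw [expH, PowerSeries.coeff_mk, map_smul, PowerSeries.coeff_smul, ← Fin.prod_const,
        Finset.prod_univ_sum, smul_eq_mul, map_sum, map_sum]
      simp only [Fintype.piFinset_univ]
      congr 1
      refine Finset.sum_congr rfl fun f _ => ?_
      rw [Finset.prod_smul, map_smul, PowerSeries.coeff_smul, smul_eq_mul]
    · intro F f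
      have h : partialP Pi θ F p = ∑ x : Fin k × Fin k,
          wickKernel θ x • biDer Pi x.1 x.2 F p := by
        have h' : partialP Pi θ F p = (1 / 2 : ℝ) • (∑ α, ∑ β, (if α = β then
          (0 : Module.End ℝ (M → MvPowerSeries (Fin k × Fin d) ℝ))
          else propagator (θ α) (θ β) • biDer Pi α β)) F p := rfl
        rw [h', Fintype.sum_prod_type, LinearMap.sum_apply, Finset.sum_apply, Finset.smul_sum]
        refine Finset.sum_congr rfl fun α _ => ?_
        rw [LinearMap.sum_apply, Finset.sum_apply, Finset.smul_sum]
        refine Finset.sum_congr rfl fun β _ => ?_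
        unfold wickKernel
        split_ifs
        · rw [zero_smul]
          exact smul_zero _
        · exact smul_smul _ _ _
      rw [h, ← pairHom_apply, map_sum, LinearMap.sum_apply, Finset.sum_mul, map_sum]
      refine Finset.sum_congr rfl fun x _ => ?_
      rw [map_smul, LinearMap.smul_apply, pairHom_apply, pair_biDer, smul_mul_assoc, map_smul]
  simp only [hθ]
  rw [MeasureTheory.integral_finsetSum, coeff_hExt]
  · refine Finset.sum_congr rfl fun x _ => ?_
    rw [MeasureTheory.integral_const_mul, MeasureTheory.integral_finsetSum]
    · simp only [MeasureTheory.integral_mul_const]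
      rw [cfgH, PowerSeries.coeff_mk, cfg, map_smul, map_sum, PowerSeries.coeff_smul, map_sum,
        smul_eq_mul]
      congr 1
      refine Finset.sum_congr rfl fun f _ => ?_
      rw [map_smul, PowerSeries.coeff_smul, smul_eq_mul]
      rfl
    · exact fun f _ => (integrableOn_wick f).mul_const _
  · intro x _
    exact (MeasureTheory.integrable_finsetSum _ fun f _ =>
      (integrableOn_wick f).mul_const _).const_mul _

end Bridge

/-! ### Differentiation along curves -/

section Curves

/-- Coefficientwise differentiability at `0` of a curve of power series. -/
def HasDerivPS (φ : ℝ → PowerSeries ℝ) (φ' : PowerSeries ℝ) : Prop :=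
  ∀ N, HasDerivAt (fun t => PowerSeries.coeff N (φ t)) (PowerSeries.coeff N φ') 0

namespace HasDerivPS

variable {φ ψ : ℝ → PowerSeries ℝ} {φ' ψ' : PowerSeries ℝ}

lemma const (c : PowerSeries ℝ) : HasDerivPS (fun _ => c) 0 := fun N => by
  simpa using hasDerivAt_const (0 : ℝ) (PowerSeries.coeff N c)

lemma add (h : HasDerivPS φ φ') (k : HasDerivPS ψ ψ') :
    HasDerivPS (fun t => φ t + ψ t) (φ' + ψ') := fun N => by
  rw [map_add]
  exact (h N).add (k N)

lemma sum {ι : Type*} (S : Finset ι) {f : ι → ℝ → PowerSeries ℝ} {f' : ι → PowerSeries ℝ}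
    (h : ∀ i ∈ S, HasDerivPS (f i) (f' i)) :
    HasDerivPS (fun t => ∑ i ∈ S, f i t) (∑ i ∈ S, f' i) := fun N => by
  simpa using HasDerivAt.fun_sum fun i hi => h i hi N

lemma mul (h : HasDerivPS φ φ') (k : HasDerivPS ψ ψ') :
    HasDerivPS (fun t => φ t * ψ t) (φ' * ψ 0 + φ 0 * ψ') := fun N => by
  simp only [PowerSeries.coeff_mul, map_add, ← Finset.sum_add_distrib]
  exact HasDerivAt.fun_sum fun x _ => (h x.1).mul (k x.2)

lemma smul {c : ℝ → ℝ} {c' : ℝ} (hc : HasDerivAt c c' 0) (h : HasDerivPS φ φ') :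
    HasDerivPS (fun t => c t • φ t) (c' • φ 0 + c 0 • φ') := fun N => by
  rw [map_add, PowerSeries.coeff_smul, PowerSeries.coeff_smul]
  exact hc.mul (h N)

lemma prod {ι : Type*} [DecidableEq ι] (S : Finset ι) {f : ι → ℝ → PowerSeries ℝ}
    {f' : ι → PowerSeries ℝ} (h : ∀ i ∈ S, HasDerivPS (f i) (f' i)) :
    HasDerivPS (fun t => ∏ i ∈ S, f i t) (∑ i ∈ S, f' i * ∏ j ∈ S.erase i, f j 0) := by
  induction S using Finset.induction_on with
  | empty => simpa using const 1
  | insert i S hi ih =>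
    have h1 := (h i (Finset.mem_insert_self i S)).mul
      (ih fun j hj => h j (Finset.mem_insert_of_mem hj))
    simp only [Finset.prod_insert hi, Finset.sum_insert hi, Finset.erase_insert hi]
    convert! h1 using 2
    rw [Finset.mul_sum]
    refine Finset.sum_congr rfl fun j hj => ?_
    have hij : i ≠ j := fun h => hi (h ▸ hj)
    rw [Finset.erase_insert_of_ne hij, Finset.prod_insert fun h => hi (Finset.mem_of_mem_erase h)]
    ring

lemma congr_deriv (h : HasDerivPS φ φ') (e : φ' = ψ') : HasDerivPS φ ψ' := e ▸ h

lemma unique (h : HasDerivPS φ φ') (k : HasDerivPS φ ψ') : φ' = ψ' := by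
  ext N
  exact (h N).unique (k N)

end HasDerivPS

variable {V : Type*} [AddCommGroup V] [Module ℝ V]

/-- Pointwise differentiability at `0` of a curve of functionals. -/
def HasDerivL (l : ℝ → (V →ₗ[ℝ] PowerSeries ℝ)) (l' : V →ₗ[ℝ] PowerSeries ℝ) : Prop :=
  ∀ g, HasDerivPS (fun t => l t g) (l' g)

/-- Differentiability at `0` of a curve of vectors, tested against differentiable curves of
functionals.  This form of the product rule is stable under the algebraic operations. -/
def HasDerivIn (f : ℝ → V) (f' : V) : Prop :=
  ∀ l l', HasDerivL l l' → HasDerivPS (fun t => l t (f t)) (l' (f 0) + l 0 f')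

namespace HasDerivIn

lemma const (v : V) : HasDerivIn (fun _ => v) 0 := fun l l' h => by
  simpa using h v

lemma add {f g : ℝ → V} {f' g' : V} (hf : HasDerivIn f f') (hg : HasDerivIn g g') :
    HasDerivIn (fun t => f t + g t) (f' + g') := fun l l' h => by
  simp only [map_add]
  refine ((hf l l' h).add (hg l l' h)).congr_deriv ?_
  ring

lemma sum {ι : Type*} (S : Finset ι) {f : ι → ℝ → V} {f' : ι → V}
    (h : ∀ i ∈ S, HasDerivIn (f i) (f' i)) :
    HasDerivIn (fun t => ∑ i ∈ S, f i t) (∑ i ∈ S, f' i) := fun l l' hl => by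
  simp only [map_sum, ← Finset.sum_add_distrib]
  exact HasDerivPS.sum S fun i hi => h i hi l l' hl

lemma smul {c : ℝ → ℝ} {c' : ℝ} (hc : HasDerivAt c c' 0) {f : ℝ → V} {f' : V}
    (hf : HasDerivIn f f') : HasDerivIn (fun t => c t • f t) (c' • f 0 + c 0 • f') := by
  intro l l' h
  simp only [map_smul, map_add]
  refine (HasDerivPS.smul hc (hf l l' h)).congr_deriv ?_
  rw [smul_add]
  abel

lemma congr_deriv {f : ℝ → V} {f' g' : V} (h : HasDerivIn f f') (e : f' = g') :
    HasDerivIn f g' := e ▸ h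

variable {A : Type*} [CommRing A] [Algebra ℝ A]

lemma mul {f g : ℝ → A} {f' g' : A} (hf : HasDerivIn f f') (hg : HasDerivIn g g') :
    HasDerivIn (fun t => f t * g t) (f' * g 0 + f 0 * g') := by
  intro l l' h
  have h1 := hg (fun t => (l t).comp (LinearMap.mulLeft ℝ (f t)))
    (l'.comp (LinearMap.mulLeft ℝ (f 0)) + (l 0).comp (LinearMap.mulLeft ℝ f')) fun k =>
      hf (fun t => (l t).comp (LinearMap.mulRight ℝ k)) (l'.comp (LinearMap.mulRight ℝ k))
        fun k' => h (k' * k)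
  refine h1.congr_deriv ?_
  simp only [LinearMap.add_apply, LinearMap.comp_apply, LinearMap.mulLeft_apply, map_add]
  ring

lemma prod_zero {ι : Type*} (S : Finset ι) {f : ι → ℝ → A}
    (h : ∀ i ∈ S, HasDerivIn (f i) 0) : HasDerivIn (fun t => ∏ i ∈ S, f i t) 0 := by
  classical
  induction S using Finset.induction_on with
  | empty => simpa using const (1 : A)
  | insert i S hi ih =>
    simp only [Finset.prod_insert hi]
    exact ((h i (Finset.mem_insert_self i S)).mul
      (ih fun j hj => h j (Finset.mem_insert_of_mem hj))).congr_deriv (by simp)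

lemma sum_zero {ι : Type*} (S : Finset ι) {f : ι → ℝ → V}
    (h : ∀ i ∈ S, HasDerivIn (f i) 0) : HasDerivIn (fun t => ∑ i ∈ S, f i t) 0 :=
  (sum S h).congr_deriv (by simp)

end HasDerivIn

lemma HasDerivL.of_monomial {σ : Type*} {l : ℝ → (MvPolynomial σ ℝ →ₗ[ℝ] PowerSeries ℝ)}
    {l' : MvPolynomial σ ℝ →ₗ[ℝ] PowerSeries ℝ}
    (h : ∀ m, HasDerivPS (fun t => l t (MvPolynomial.monomial m 1))
      (l' (MvPolynomial.monomial m 1))) : HasDerivL l l' := by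
  intro g
  have hg : g = ∑ m ∈ g.support, MvPolynomial.coeff m g • MvPolynomial.monomial m (1 : ℝ) := by
    conv_lhs => rw [MvPolynomial.as_sum g]
    simp [MvPolynomial.smul_monomial]
  rw [hg]
  simp only [map_sum, map_smul]
  refine HasDerivPS.sum _ fun m _ => ?_
  exact (HasDerivPS.smul (hasDerivAt_const 0 _) (h m)).congr_deriv (by simp)

variable {d : ℕ} {P : Type*} [Fintype P] [DecidableEq P]

lemma HasDerivL.tensor {lam : ℝ → P → WeylDual d} {lam' : P → WeylDual d}
    (h : ∀ α, HasDerivL (fun t => lam t α) (lam' α)) :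
    HasDerivL (fun t => Fedosov.tensor (lam t))
      (∑ α, Fedosov.tensor (Function.update (lam 0) α (lam' α))) := by
  refine HasDerivL.of_monomial fun m => ?_
  simp only [tensor_monomial, LinearMap.sum_apply]
  refine (HasDerivPS.prod Finset.univ fun α _ =>
    h α (MvPolynomial.monomial (slice m α) 1)).congr_deriv ?_
  refine Finset.sum_congr rfl fun α _ => ?_
  rw [← Finset.mul_prod_erase Finset.univ _ (Finset.mem_univ α), Function.update_self]
  congr 1
  refine Finset.prod_congr rfl fun β hβ => ?_
  rw [Function.update_of_ne (Finset.ne_of_mem_erase hβ)]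

/-- The product rule for the pairing of a curve of functionals with a curve of symbols. -/
lemma HasDerivPS.hExt {A : Type*} [CommRing A] [Algebra ℝ A] {l : ℝ → (A →ₗ[ℝ] PowerSeries ℝ)}
    {l' : A →ₗ[ℝ] PowerSeries ℝ} (h : HasDerivL l l') {F : ℝ → PowerSeries A} {F' : PowerSeries A}
    (hF : ∀ m, HasDerivIn (fun t => PowerSeries.coeff m (F t)) (PowerSeries.coeff m F')) :
    HasDerivPS (fun t => Fedosov.hExt (l t) (F t))
      (Fedosov.hExt l' (F 0) + Fedosov.hExt (l 0) F') := by
  intro N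
  simp only [map_add, coeff_hExt, ← Finset.sum_add_distrib]
  refine HasDerivAt.fun_sum fun x _ => ?_
  exact hF x.1 l l' h x.2

lemma HasDerivPS.corr {lam : ℝ → P → WeylDual d} {lam' : P → WeylDual d}
    (h : ∀ α, HasDerivL (fun t => lam t α) (lam' α))
    {F : ℝ → PowerSeries (MvPolynomial (P × Fin d) ℝ)}
    (hF : ∀ m, HasDerivIn (fun t => PowerSeries.coeff m (F t)) 0) :
    HasDerivPS (fun t => Fedosov.corr (lam t) (F t))
      (∑ α, Fedosov.corr (Function.update (lam 0) α (lam' α)) (F 0)) := by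
  refine (HasDerivPS.hExt (HasDerivL.tensor h) (F' := 0) (by simpa using hF)).congr_deriv ?_
  simp only [corr_apply, map_zero, add_zero]
  refine (congrArg (fun l => l (F 0)) (map_sum hExtHom _ _)).trans ?_
  rw [LinearMap.sum_apply]
  rfl

lemma hasDerivIn_bsym {Pi : ℝ → Matrix (Fin d) (Fin d) ℝ}
    (h : ∀ i j, HasDerivAt (fun t => Pi t i j) 0 0) (α β : P) :
    HasDerivIn (fun t => bsym (Pi t) α β) 0 := by
  unfold bsym
  refine HasDerivIn.sum_zero _ fun i _ => HasDerivIn.sum_zero _ fun j _ => ?_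
  simp only [← MvPolynomial.smul_eq_C_mul]
  exact (HasDerivIn.smul (h i j) (HasDerivIn.const _)).congr_deriv (by simp)

lemma hasDerivIn_cfg {A : Type*} [CommRing A] [Algebra ℝ A] {b : ℝ → P → P → A}
    (h : ∀ α β, HasDerivIn (fun t => b t α β) 0) (m : ℕ) : HasDerivIn (fun t => cfg m (b t)) 0 := by
  unfold cfg
  refine (HasDerivIn.smul (hasDerivAt_const 0 _) (HasDerivIn.sum_zero _ fun f _ =>
    (HasDerivIn.smul (hasDerivAt_const 0 _) (HasDerivIn.prod_zero _ fun i _ => h _ _)).congr_deriv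
      (by simp))).congr_deriv (by simp)

lemma hasDerivIn_expH {A : Type*} [CommRing A] [Algebra ℝ A] {b : ℝ → A}
    (h : HasDerivIn b 0) (m : ℕ) : HasDerivIn (fun t => PowerSeries.coeff m (expH (b t))) 0 := by
  simp only [expH, PowerSeries.coeff_mk, ← Fin.prod_const]
  exact (HasDerivIn.smul (hasDerivAt_const 0 _)
    (HasDerivIn.prod_zero _ fun i _ => h)).congr_deriv (by simp)

/-- The product rule for the cocycle, along a curve with stationary Poisson tensor. -/
lemma HasDerivPS.Theta {Pi : ℝ → Matrix (Fin d) (Fin d) ℝ}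
    (hPi : ∀ i j, HasDerivAt (fun t => Pi t i j) 0 0) {x : ℝ → WeylDual d} {x' : WeylDual d}
    (hx : HasDerivL x x') {v : ℝ → Fin d → WeylDual d} {v' : Fin d → WeylDual d}
    (hv : ∀ k, HasDerivL (fun t => v t k) (v' k)) :
    HasDerivPS (fun t => Fedosov.Theta (Pi t) (x t) (v t))
      (Fedosov.Theta (Pi 0) x' (v 0) +
        ∑ k, Fedosov.Theta (Pi 0) (x 0) (Function.update (v 0) k (v' k))) := by
  unfold Fedosov.Theta
  refine (HasDerivPS.corr (lam := fun t => consPt (x t) (v t)) (lam' := consPt x' v') ?_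
    ?_).congr_deriv ?_
  · intro α
    cases α with
    | none => exact hx
    | some k => exact hv k
  · intro m
    simp only [thetaSym, PowerSeries.coeff_C_mul, cfgH, PowerSeries.coeff_mk]
    exact ((HasDerivIn.const _).mul (hasDerivIn_cfg (hasDerivIn_bsym hPi) m)).congr_deriv (by simp)
  · rw [Fintype.sum_option, update_consPt_none]
    simp only [update_consPt_some, consPt_none, consPt_some]

/-- The product rule for the Moyal product, along a curve with stationary Poisson tensor. -/
lemma HasDerivL.starL {Pi : ℝ → Matrix (Fin d) (Fin d) ℝ}
    (hPi : ∀ i j, HasDerivAt (fun t => Pi t i j) 0 0) {a b : ℝ → WeylDual d} {a' b' : WeylDual d}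
    (ha : HasDerivL a a') (hb : HasDerivL b b') :
    HasDerivL (fun t => Fedosov.starL (Pi t) (a t) (b t))
      (Fedosov.starL (Pi 0) a' (b 0) + Fedosov.starL (Pi 0) (a 0) b') := by
  intro f
  simp only [starL_apply, LinearMap.add_apply]
  refine (HasDerivPS.corr (lam := fun t => ![a t, b t]) (lam' := ![a', b']) ?_ ?_).congr_deriv ?_
  · intro α
    fin_cases α
    · exact ha
    · exact hb
  · intro m
    simp only [PowerSeries.coeff_mul_C]
    refine ((hasDerivIn_expH ?_ m).mul (HasDerivIn.const _)).congr_deriv (by simp)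
    exact (HasDerivIn.smul (hasDerivAt_const 0 _) (hasDerivIn_bsym hPi 0 1)).congr_deriv (by simp)
  · simp [Fin.sum_univ_two, update_pair_zero, update_pair_one]

/-- The infinitesimal generator of a linear change of the fibre coordinates. -/
def linDeriv (Γ : Matrix (Fin d) (Fin d) ℝ) (f : MvPolynomial (Fin d) ℝ) : MvPolynomial (Fin d) ℝ :=
  ∑ i, ∑ j, MvPolynomial.C (Γ i j) * (MvPolynomial.X i * MvPolynomial.pderiv j f)

/-- A curve of linear changes of coordinates through the identity has the derivative `linDeriv`. -/
lemma hasDerivIn_linSubst {Ψ : ℝ → Matrix (Fin d) (Fin d) ℝ} {Ψ' : Matrix (Fin d) (Fin d) ℝ}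
    (h : ∀ i j, HasDerivAt (fun t => Ψ t i j) (Ψ' i j) 0) (h0 : Ψ 0 = 1)
    (f : MvPolynomial (Fin d) ℝ) :
    HasDerivIn (fun t => linSubst (fun j i => Ψ t i j) f) (linDeriv Ψ' f) := by
  have hid : ∀ g : MvPolynomial (Fin d) ℝ, linSubst (fun j i => Ψ 0 i j) g = g := by
    intro g
    have : linSubst (fun j i => Ψ 0 i j) = AlgHom.id ℝ _ := by
      refine MvPolynomial.algHom_ext fun i => ?_
      simp [h0, Matrix.one_apply]
    rw [this]; rfl
  induction f using MvPolynomial.induction_on with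
  | C c =>
    simp only [MvPolynomial.algHom_C]
    exact (HasDerivIn.const _).congr_deriv (by simp [linDeriv])
  | add f g hf hg =>
    simp only [map_add]
    refine (hf.add hg).congr_deriv ?_
    simp only [linDeriv, map_add, mul_add, Finset.sum_add_distrib]
  | mul_X f j hf =>
    simp only [map_mul, linSubst_X]
    have hX : HasDerivIn (fun t => ∑ i, MvPolynomial.C (Ψ t i j) * MvPolynomial.X i)
        (∑ i, MvPolynomial.C (Ψ' i j) * (MvPolynomial.X i : MvPolynomial (Fin d) ℝ)) := by
      refine HasDerivIn.sum _ fun i _ => ?_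
      simp only [← MvPolynomial.smul_eq_C_mul]
      exact (HasDerivIn.smul (h i j) (HasDerivIn.const _)).congr_deriv (by simp)
    refine (hf.mul hX).congr_deriv ?_
    have h1 : ∑ i, MvPolynomial.C (Ψ 0 i j) * (MvPolynomial.X i : MvPolynomial (Fin d) ℝ) =
        MvPolynomial.X j := by
      simp [h0, Matrix.one_apply]
    simp only [hid, h1]
    simp only [linDeriv, Derivation.leibniz, MvPolynomial.pderiv_X, smul_eq_mul, mul_add,
      Finset.sum_add_distrib]
    rw [add_comm, Finset.sum_mul, Finset.mul_sum]
    congr 1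
    · refine Finset.sum_congr rfl fun i _ => ?_
      rw [Finset.sum_eq_single j]
      · simp; ring
      · intro k _ hk; simp [hk.symm]
      · simp
    · refine Finset.sum_congr rfl fun i _ => ?_
      rw [Finset.sum_mul]
      refine Finset.sum_congr rfl fun k _ => ?_
      ring

lemma HasDerivL.frame {Ψ : ℝ → Matrix (Fin d) (Fin d) ℝ} {Ψ' : Matrix (Fin d) (Fin d) ℝ}
    (h : ∀ i j, HasDerivAt (fun t => Ψ t i j) (Ψ' i j) 0) (h0 : Ψ 0 = 1)
    {a : ℝ → WeylDual d} {a' : WeylDual d} (ha : HasDerivL a a') (b : WeylDual d)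
    (hb : ∀ f, b f = a' f + a 0 (linDeriv Ψ' f)) :
    HasDerivL (fun t => Fedosov.frame (Ψ t) (a t)) b := by
  intro f
  refine (hasDerivIn_linSubst h h0 f a a' ha).congr_deriv ?_
  have : linSubst (fun j i => Ψ 0 i j) = AlgHom.id ℝ _ := by
    refine MvPolynomial.algHom_ext fun i => ?_
    simp [h0, Matrix.one_apply]
  have h1 : linSubst (fun j i => Ψ 0 i j) f = f := by rw [this]; rfl
  change a' (linSubst (fun j i => Ψ 0 i j) f) + _ = _
  rw [hb, h1]

end Curves

/-! ### Dependence on parameters -/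

section Regularity

variable {T : Type*}

/-- The coefficients of a family of power series belong to a given algebra of functions. -/
def InPS (𝒜 : Subalgebra ℝ (T → ℝ)) (φ : T → PowerSeries ℝ) : Prop :=
  ∀ N, (fun t => PowerSeries.coeff N (φ t)) ∈ 𝒜

variable {𝒜 : Subalgebra ℝ (T → ℝ)}

lemma InPS.sum {ι : Type*} (S : Finset ι) {f : ι → T → PowerSeries ℝ} (h : ∀ i ∈ S, InPS 𝒜 (f i)) :
    InPS 𝒜 fun t => ∑ i ∈ S, f i t := fun N => by
  simp only [map_sum]
  have := 𝒜.sum_mem fun i hi => h i hi N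
  convert! this using 1
  funext t
  simp

lemma InPS.mul {φ ψ : T → PowerSeries ℝ} (h : InPS 𝒜 φ) (k : InPS 𝒜 ψ) :
    InPS 𝒜 fun t => φ t * ψ t := fun N => by
  simp only [PowerSeries.coeff_mul]
  have := 𝒜.sum_mem (t := Finset.HasAntidiagonal.antidiagonal N) fun x _ =>
    𝒜.mul_mem (h x.1) (k x.2)
  convert! this using 1
  funext t
  simp

lemma InPS.const (c : PowerSeries ℝ) : InPS 𝒜 fun _ => c := fun N =>
  𝒜.algebraMap_mem (PowerSeries.coeff N c)

lemma InPS.smul {c : T → ℝ} (hc : c ∈ 𝒜) {φ : T → PowerSeries ℝ} (h : InPS 𝒜 φ) :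
    InPS 𝒜 fun t => c t • φ t := fun N => by
  simp only [PowerSeries.coeff_smul]
  exact 𝒜.mul_mem hc (h N)

lemma InPS.prod {ι : Type*} (S : Finset ι) {f : ι → T → PowerSeries ℝ} (h : ∀ i ∈ S, InPS 𝒜 (f i)) :
    InPS 𝒜 fun t => ∏ i ∈ S, f i t := by
  classical
  induction S using Finset.induction_on with
  | empty => simpa using InPS.const 1
  | insert i S hi ih =>
    simp only [Finset.prod_insert hi]
    exact (h i (Finset.mem_insert_self i S)).mul (ih fun j hj => h j (Finset.mem_insert_of_mem hj))

variable {V : Type*} [AddCommGroup V] [Module ℝ V]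

/-- The values of a family of functionals belong to a given algebra of functions. -/
def InL (𝒜 : Subalgebra ℝ (T → ℝ)) (l : T → (V →ₗ[ℝ] PowerSeries ℝ)) : Prop :=
  ∀ g, InPS 𝒜 fun t => l t g

/-- A family of vectors depends on the parameter through a given algebra of functions, tested
against families of functionals. -/
def InV (𝒜 : Subalgebra ℝ (T → ℝ)) (f : T → V) : Prop :=
  ∀ l, InL 𝒜 l → InPS 𝒜 fun t => l t (f t)

lemma InV.const (v : V) : InV 𝒜 fun _ => v := fun _ h => h v

lemma InV.sum {ι : Type*} (S : Finset ι) {f : ι → T → V} (h : ∀ i ∈ S, InV 𝒜 (f i)) :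
    InV 𝒜 fun t => ∑ i ∈ S, f i t := fun l hl => by
  simp only [map_sum]
  exact InPS.sum S fun i hi => h i hi l hl

lemma InV.smul {c : T → ℝ} (hc : c ∈ 𝒜) {f : T → V} (h : InV 𝒜 f) : InV 𝒜 fun t => c t • f t :=
  fun l hl => by
    simp only [map_smul]
    exact (h l hl).smul hc

lemma InV.mul {A : Type*} [CommRing A] [Algebra ℝ A] {f g : T → A} (hf : InV 𝒜 f)
    (hg : InV 𝒜 g) : InV 𝒜 fun t => f t * g t := fun l hl =>
  hg (fun t => (l t).comp (LinearMap.mulLeft ℝ (f t))) fun k =>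
    hf (fun t => (l t).comp (LinearMap.mulRight ℝ k)) fun k' => hl (k' * k)

lemma InV.prod {A : Type*} [CommRing A] [Algebra ℝ A] {ι : Type*} (S : Finset ι) {f : ι → T → A}
    (h : ∀ i ∈ S, InV 𝒜 (f i)) : InV 𝒜 fun t => ∏ i ∈ S, f i t := by
  classical
  induction S using Finset.induction_on with
  | empty => simpa using InV.const 1
  | insert i S hi ih =>
    simp only [Finset.prod_insert hi]
    exact (h i (Finset.mem_insert_self i S)).mul (ih fun j hj => h j (Finset.mem_insert_of_mem hj))

lemma InL.of_monomial {σ : Type*} {l : T → (MvPolynomial σ ℝ →ₗ[ℝ] PowerSeries ℝ)}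
    (h : ∀ m, InPS 𝒜 fun t => l t (MvPolynomial.monomial m 1)) : InL 𝒜 l := by
  intro g
  have hg : g = ∑ m ∈ g.support, MvPolynomial.coeff m g • MvPolynomial.monomial m (1 : ℝ) := by
    conv_lhs => rw [MvPolynomial.as_sum g]
    simp [MvPolynomial.smul_monomial]
  rw [hg]
  simp only [map_sum, map_smul]
  exact InPS.sum _ fun m _ => (h m).smul (𝒜.algebraMap_mem _)

variable {d : ℕ} {P : Type*} [Fintype P] [DecidableEq P]

lemma InL.tensor {lam : T → P → WeylDual d} (h : ∀ α, InL 𝒜 fun t => lam t α) :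
    InL 𝒜 fun t => Fedosov.tensor (lam t) := by
  refine InL.of_monomial fun m => ?_
  simp only [tensor_monomial]
  exact InPS.prod _ fun α _ => h α _

lemma InPS.corr {lam : T → P → WeylDual d} (h : ∀ α, InL 𝒜 fun t => lam t α)
    {F : T → PowerSeries (MvPolynomial (P × Fin d) ℝ)}
    (hF : ∀ m, InV 𝒜 fun t => PowerSeries.coeff m (F t)) :
    InPS 𝒜 fun t => Fedosov.corr (lam t) (F t) := by
  intro N
  simp only [corr_apply, coeff_hExt]
  have := 𝒜.sum_mem (t := Finset.HasAntidiagonal.antidiagonal N) fun x _ =>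
    hF x.1 _ (InL.tensor h) x.2
  convert! this using 1
  funext t
  simp

lemma InV.bsym {Pi : T → Matrix (Fin d) (Fin d) ℝ} (h : ∀ i j, (fun t => Pi t i j) ∈ 𝒜) (α β : P) :
    InV 𝒜 fun t => Fedosov.bsym (Pi t) α β := by
  unfold Fedosov.bsym
  simp only [← MvPolynomial.smul_eq_C_mul]
  exact InV.sum _ fun i _ => InV.sum _ fun j _ => InV.smul (h i j) (InV.const _)

lemma InPS.Theta {Pi : T → Matrix (Fin d) (Fin d) ℝ} (hPi : ∀ i j, (fun t => Pi t i j) ∈ 𝒜)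
    {x : T → WeylDual d} (hx : InL 𝒜 x) {v : T → Fin d → WeylDual d}
    (hv : ∀ k, InL 𝒜 fun t => v t k) : InPS 𝒜 fun t => Fedosov.Theta (Pi t) (x t) (v t) := by
  unfold Fedosov.Theta
  refine InPS.corr ?_ fun m => ?_
  · intro α
    cases α with
    | none => exact hx
    | some k => exact hv k
  · simp only [thetaSym, PowerSeries.coeff_C_mul, cfgH, PowerSeries.coeff_mk, cfg]
    exact (InV.const _).mul (InV.smul (𝒜.algebraMap_mem _) (InV.sum _ fun f _ =>
      InV.smul (𝒜.algebraMap_mem _) (InV.prod _ fun i _ => InV.bsym hPi _ _)))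

lemma InL.starL {Pi : T → Matrix (Fin d) (Fin d) ℝ} (hPi : ∀ i j, (fun t => Pi t i j) ∈ 𝒜)
    {a b : T → WeylDual d} (ha : InL 𝒜 a) (hb : InL 𝒜 b) :
    InL 𝒜 fun t => Fedosov.starL (Pi t) (a t) (b t) := by
  intro f
  simp only [starL_apply]
  refine InPS.corr ?_ fun m => ?_
  · intro α
    fin_cases α
    · exact ha
    · exact hb
  · simp only [PowerSeries.coeff_mul_C, expH, PowerSeries.coeff_mk, ← Fin.prod_const]
    exact (InV.smul (𝒜.algebraMap_mem _) (InV.prod _ fun i _ =>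
      InV.smul (𝒜.algebraMap_mem _) (InV.bsym hPi _ _))).mul (InV.const _)

lemma inL_dualW {σ : Type*} {A : T → PowerSeries (MvPowerSeries σ ℝ)}
    (h : ∀ N m, (fun t => MvPowerSeries.coeff m (PowerSeries.coeff N (A t))) ∈ 𝒜) :
    InL 𝒜 fun t => dualW (A t) := by
  refine InL.of_monomial fun m N => ?_
  simp only [coeff_dualW, pair_monomial, one_mul]
  exact 𝒜.mul_mem (𝒜.algebraMap_mem _) (h N m)

lemma coeff_mem_of_inL_dualW {σ : Type*} {A : T → PowerSeries (MvPowerSeries σ ℝ)}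
    (h : InL 𝒜 fun t => dualW (A t)) (N : ℕ) (m : σ →₀ ℕ) :
    (fun t => MvPowerSeries.coeff m (PowerSeries.coeff N (A t))) ∈ 𝒜 := by
  have := 𝒜.mul_mem (𝒜.algebraMap_mem (multiFactorial m)⁻¹) (h (MvPolynomial.monomial m 1) N)
  simp only [coeff_dualW, pair_monomial, one_mul] at this
  convert! this using 1
  funext t
  exact (inv_mul_cancel_left₀ (multiFactorial_ne_zero m) _).symm

lemma hasDerivL_dualW {σ : Type*} {A : ℝ → PowerSeries (MvPowerSeries σ ℝ)}
    {A' : PowerSeries (MvPowerSeries σ ℝ)}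
    (h : ∀ N m, HasDerivAt (fun t => MvPowerSeries.coeff m (PowerSeries.coeff N (A t)))
      (MvPowerSeries.coeff m (PowerSeries.coeff N A')) 0) :
    HasDerivL (fun t => dualW (A t)) (dualW A') := by
  refine HasDerivL.of_monomial fun m N => ?_
  simp only [coeff_dualW, pair_monomial, one_mul]
  exact (h N m).const_mul _

lemma det_mem {n : Type*} [Fintype n] [DecidableEq n] {A : T → Matrix n n ℝ}
    (h : ∀ i j, (fun t => A t i j) ∈ 𝒜) : (fun t => (A t).det) ∈ 𝒜 := by
  have := 𝒜.sum_mem (t := Finset.univ) fun (σ : Equiv.Perm n) _ =>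
    𝒜.smul_mem (𝒜.prod_mem (t := Finset.univ) fun i _ => h (σ i) i) (((Equiv.Perm.sign σ : ℤ) : ℝ))
  convert! this using 1
  funext t
  simp [Matrix.det_apply']

lemma inv_mem {n : Type*} [Fintype n] [DecidableEq n] {A : T → Matrix n n ℝ}
    (h : ∀ i j, (fun t => A t i j) ∈ 𝒜) (hd : (fun t => ((A t).det)⁻¹) ∈ 𝒜) (i j : n) :
    (fun t => (A t)⁻¹ i j) ∈ 𝒜 := by
  have h1 : (fun t => (A t).adjugate i j) ∈ 𝒜 := by
    simp only [Matrix.adjugate_apply]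
    refine det_mem fun k l => ?_
    by_cases hk : k = j
    · subst hk
      simp only [Matrix.updateRow_self]
      exact 𝒜.algebraMap_mem _
    · simp only [Matrix.updateRow_ne hk]
      exact h k l
  convert! 𝒜.mul_mem hd h1 using 1
  funext t
  simp [Matrix.inv_def]

end Regularity

/-! ### Coordinate frames, Christoffel symbols and the divergence -/

section CoordinateFrames

variable {d : ℕ} {M : Type*} [TopologicalSpace M] [ChartedSpace (EuclideanSpace ℝ (Fin d)) M]
  [IsManifold (𝓡 d) ∞ M]

lemma mem_baseSet {x₀ q : M} (hq : q ∈ (chartAt (EuclideanSpace ℝ (Fin d)) x₀).source) :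
    q ∈ (trivializationAt (EuclideanSpace ℝ (Fin d)) (TangentSpace (𝓡 d) : M → Type _) x₀).baseSet
      :=
  hq

lemma coordField_eq {x₀ q : M} (hq : q ∈ (chartAt (EuclideanSpace ℝ (Fin d)) x₀).source)
    (j : Fin d) :
    coordField x₀ j q = tangentCoordChange (𝓡 d) x₀ q q (EuclideanSpace.single j (1 : ℝ)) := by
  unfold coordField
  rw [Trivialization.localFrame_apply_of_mem_baseSet _ _ (mem_baseSet hq)]
  simp only [Trivialization.basisAt, Module.Basis.map_apply, OrthonormalBasis.coe_toBasis,
    EuclideanSpace.basisFun_apply]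
  have := TangentBundle.symmL_trivializationAt_eq_core (I := 𝓡 d) (b₀ := x₀) (b := q) hq
  exact (Trivialization.symmL_apply (R := ℝ) (trivializationAt (EuclideanSpace ℝ (Fin d))
    (TangentSpace (𝓡 d) : M → Type _) x₀) (mem_baseSet hq)
    (EuclideanSpace.single j (1 : ℝ))).symm.trans (DFunLike.congr_fun this _)

lemma mem_source_self (p : M) : p ∈ (chartAt (EuclideanSpace ℝ (Fin d)) p).source :=
  mem_chart_source _ p

lemma coordField_self (p : M) (j : Fin d) : coordField p j p = stdVec j p := by
  rw [coordField_eq (mem_source_self p), tangentCoordChange_self]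
  · rfl
  · simp

lemma frameMatrix_self (p : M) : frameMatrix (d := d) p p = 1 := by
  ext i j
  simp only [frameMatrix, Matrix.of_apply, coordField_self]
  simp [comp, stdVec, Matrix.one_apply]

lemma mdifferentiableAt_coordField {x₀ q : M}
    (hq : q ∈ (chartAt (EuclideanSpace ℝ (Fin d)) x₀).source) (j : Fin d) :
    MDifferentiableAt (𝓡 d) (𝓡 d).tangent
      (fun q => (⟨q, coordField x₀ j q⟩ : TangentBundle (𝓡 d) M)) q := by
  have h := (Trivialization.contMDiffOn_localFrame_baseSet (I := 𝓡 d) (n := ∞)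
    (e := trivializationAt (EuclideanSpace ℝ (Fin d)) (TangentSpace (𝓡 d) : M → Type _) x₀)
    (b := (EuclideanSpace.basisFun (Fin d) ℝ).toBasis) j)
  exact (h.contMDiffAt ((Trivialization.open_baseSet _).mem_nhds hq)).mdifferentiableAt (by simp)

lemma hasFDerivAt_comp_chart_symm {q : M} {h : M → ℝ}
    (hh : MDifferentiableAt (𝓡 d) 𝓘(ℝ, ℝ) h q) :
    HasFDerivAt (h ∘ (chartAt (EuclideanSpace ℝ (Fin d)) q).symm) (mvfderiv (𝓡 d) h q)
      (chartAt (EuclideanSpace ℝ (Fin d)) q q) := by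
  set ψ := chartAt (EuclideanSpace ℝ (Fin d)) q with hψ
  have h1 := hh.mvfderiv
  have h2 := hh.differentiableWithinAt_writtenInExtChartAt
  have h3 := h2.hasFDerivWithinAt
  rw [← h1] at h3
  have h4 : (chartAt ℝ (h q) : ℝ → ℝ) ∘ h ∘ ψ.symm = h ∘ ψ.symm := rfl
  have h5 : HasFDerivWithinAt ((chartAt ℝ (h q) : ℝ → ℝ) ∘ h ∘ ψ.symm) (mvfderiv (𝓡 d) h q)
      Set.univ (ψ q) := by
    simpa [writtenInExtChartAt] using! h3
  rw [h4] at h5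
  exact hasFDerivWithinAt_univ.1 h5

/-- In the chart at `x₀`, differentiation along a coordinate vector field is a partial
derivative. -/
lemma mvfderiv_coordField {x₀ q : M} (hq : q ∈ (chartAt (EuclideanSpace ℝ (Fin d)) x₀).source)
    {h : M → ℝ} (hh : MDifferentiableAt (𝓡 d) 𝓘(ℝ, ℝ) h q) (j : Fin d) :
    mvfderiv (𝓡 d) h q (coordField x₀ j q) =
      fderiv ℝ (h ∘ (chartAt (EuclideanSpace ℝ (Fin d)) x₀).symm)
        (chartAt (EuclideanSpace ℝ (Fin d)) x₀ q) (EuclideanSpace.single j (1 : ℝ)) := by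
  set φ := chartAt (EuclideanSpace ℝ (Fin d)) x₀ with hφ
  set ψ := chartAt (EuclideanSpace ℝ (Fin d)) q with hψ
  have e1 : HasFDerivAt (ψ ∘ φ.symm) (tangentCoordChange (𝓡 d) x₀ q q) (φ q) := by
    have := hasFDerivWithinAt_tangentCoordChange (I := 𝓡 d) (x := x₀) (y := q) (z := q)
      ⟨by simpa using hq, by simp⟩
    simpa [hasFDerivWithinAt_univ] using! this
  have e2 : HasFDerivAt (h ∘ ψ.symm) (mvfderiv (𝓡 d) h q) (ψ q) :=
    hasFDerivAt_comp_chart_symm hh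
  have e3 : HasFDerivAt (h ∘ φ.symm)
      ((mvfderiv (𝓡 d) h q).comp (tangentCoordChange (𝓡 d) x₀ q q)) (φ q) := by
    have e2' : HasFDerivAt (h ∘ ψ.symm) (mvfderiv (𝓡 d) h q) ((ψ ∘ φ.symm) (φ q)) := by
      simpa [φ.left_inv hq] using e2
    refine (e2'.comp (φ q) e1).congr_of_eventuallyEq ?_
    have hm : φ.symm.source ∩ φ.symm ⁻¹' ψ.source ∈ nhds (φ q) := by
      refine (φ.symm.isOpen_inter_preimage ψ.open_source).mem_nhds ⟨φ.map_source hq, ?_⟩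
      simp [φ.left_inv hq, hψ]
    filter_upwards [hm] with x hx
    simp only [Function.comp_apply]
    rw [ψ.left_inv hx.2]
  rw [e3.fderiv, coordField_eq hq]
  rfl

/-- The Jacobian matrix at `q` of the change of coordinates from the chart at `x₀` to the chart
at `y₀`. -/
def jacobian (x₀ y₀ q : M) : Matrix (Fin d) (Fin d) ℝ :=
  Matrix.of fun i j =>
    (tangentCoordChange (𝓡 d) x₀ y₀ q (EuclideanSpace.single j (1 : ℝ)) : EuclideanSpace ℝ (Fin d))
      i

lemma jacobian_mulVec (x₀ y₀ q : M) (v : EuclideanSpace ℝ (Fin d)) (i : Fin d) :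
    (tangentCoordChange (𝓡 d) x₀ y₀ q v) i = ∑ j, jacobian x₀ y₀ q i j * v j := by
  have hv : v = ∑ j, v j • EuclideanSpace.single j (1 : ℝ) := by
    ext k; simp [Pi.single_apply]
  conv_lhs => rw [hv]
  simp [jacobian, mul_comm]

lemma frameMatrix_eq_jacobian {x₀ q : M}
    (hq : q ∈ (chartAt (EuclideanSpace ℝ (Fin d)) x₀).source) :
    frameMatrix x₀ q = jacobian (d := d) x₀ q q := by
  ext i j
  simp only [frameMatrix, jacobian, Matrix.of_apply, coordField_eq hq]
  rfl

lemma jacobian_mul {x₀ y₀ z₀ q : M}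
    (hx : q ∈ (chartAt (EuclideanSpace ℝ (Fin d)) x₀).source)
    (hy : q ∈ (chartAt (EuclideanSpace ℝ (Fin d)) y₀).source)
    (hz : q ∈ (chartAt (EuclideanSpace ℝ (Fin d)) z₀).source) :
    jacobian (d := d) y₀ z₀ q * jacobian (d := d) x₀ y₀ q = jacobian (d := d) x₀ z₀ q := by
  ext i j
  have := tangentCoordChange_comp (I := 𝓡 d) (w := x₀) (x := y₀) (y := z₀) (z := q)
    (v := EuclideanSpace.single j (1 : ℝ)) (by simp [hx, hy, hz])
  simp only [Matrix.mul_apply, jacobian, Matrix.of_apply]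
  rw [← this, jacobian_mulVec y₀ z₀]
  rfl

lemma jacobian_self {x₀ q : M} (hx : q ∈ (chartAt (EuclideanSpace ℝ (Fin d)) x₀).source) :
    jacobian (d := d) x₀ x₀ q = 1 := by
  ext i j
  simp only [jacobian, Matrix.of_apply]
  rw [tangentCoordChange_self (by simpa using hx)]
  simp [Matrix.one_apply]

lemma frameMatrix_mul_jacobian {x₀ y₀ q : M}
    (hx : q ∈ (chartAt (EuclideanSpace ℝ (Fin d)) x₀).source)
    (hy : q ∈ (chartAt (EuclideanSpace ℝ (Fin d)) y₀).source) :
    frameMatrix (d := d) y₀ q * jacobian x₀ y₀ q = frameMatrix x₀ q := by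
  rw [frameMatrix_eq_jacobian hx, frameMatrix_eq_jacobian hy,
    jacobian_mul hx hy (mem_source_self q)]

lemma isUnit_det_jacobian {x₀ y₀ q : M}
    (hx : q ∈ (chartAt (EuclideanSpace ℝ (Fin d)) x₀).source)
    (hy : q ∈ (chartAt (EuclideanSpace ℝ (Fin d)) y₀).source) :
    IsUnit (jacobian (d := d) x₀ y₀ q).det := by
  have h := congrArg Matrix.det (jacobian_mul hx hy hx)
  rw [jacobian_self hx, Matrix.det_mul, Matrix.det_one] at h
  exact .of_mul_eq_one_right _ h

lemma isUnit_det_frameMatrix {x₀ q : M}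
    (hx : q ∈ (chartAt (EuclideanSpace ℝ (Fin d)) x₀).source) :
    IsUnit (frameMatrix (d := d) x₀ q).det := by
  rw [frameMatrix_eq_jacobian hx]
  exact isUnit_det_jacobian hx (mem_source_self q)

lemma vec_eq_sum_stdVec {q : M} (v : TangentSpace (𝓡 d) q) : v = ∑ i, comp v i • stdVec i q := by
  have h : (show EuclideanSpace ℝ (Fin d) from v) =
      ∑ i, comp v i • EuclideanSpace.single i (1 : ℝ) := by
    ext k
    simp [comp, Pi.single_apply]
  exact h

lemma comp_sum {ι : Type*} {q : M} (S : Finset ι) (v : ι → TangentSpace (𝓡 d) q) (i : Fin d) :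
    comp (∑ s ∈ S, v s) i = ∑ s ∈ S, comp (v s) i := by
  classical
  induction S using Finset.induction_on with
  | empty => rw [Finset.sum_empty, Finset.sum_empty]; rfl
  | insert a S ha ih => rw [Finset.sum_insert ha, Finset.sum_insert ha, ← ih]; rfl

lemma comp_smul {q : M} (c : ℝ) (v : TangentSpace (𝓡 d) q) (i : Fin d) :
    comp (c • v) i = c * comp v i := rfl

lemma comp_injective {q : M} {v w : TangentSpace (𝓡 d) q} (h : ∀ i, comp v i = comp w i) :
    v = w := by
  rw [vec_eq_sum_stdVec v, vec_eq_sum_stdVec w]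
  simp only [h]

lemma coordField_eq_sum_stdVec (x₀ q : M) (j : Fin d) :
    coordField x₀ j q = ∑ i, frameMatrix x₀ q i j • stdVec i q :=
  vec_eq_sum_stdVec _

/-- Coordinate vector fields commute. -/
lemma mlieBracket_coordField {x₀ q : M} (hq : q ∈ (chartAt (EuclideanSpace ℝ (Fin d)) x₀).source)
    (j k : Fin d) :
    VectorField.mlieBracket (𝓡 d) (coordField (d := d) x₀ j) (coordField x₀ k) q = 0 := by
  set φ := chartAt (EuclideanSpace ℝ (Fin d)) x₀ with hφ
  have hpb : ∀ i : Fin d, coordField x₀ i =ᶠ[nhds q]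
      VectorField.mpullback (𝓡 d) (𝓡 d) φ
        (stdVec (M := EuclideanSpace ℝ (Fin d)) i) := by
    intro i
    filter_upwards [φ.open_source.mem_nhds hq] with y hy
    have hinv : (tangentCoordChange (𝓡 d) y x₀ y).inverse = tangentCoordChange (𝓡 d) x₀ y y := by
      refine ContinuousLinearMap.inverse_eq ?_ ?_
      · ext v : 1
        have hy' : y ∈ (chartAt (EuclideanSpace ℝ (Fin d)) x₀).source := hy
        exact (tangentCoordChange_comp (by simp [hy'])).trans
          (tangentCoordChange_self (by simpa using hy'))
      · ext v : 1
        have hy' : y ∈ (chartAt (EuclideanSpace ℝ (Fin d)) x₀).source := hy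
        exact (tangentCoordChange_comp (by simp [hy'])).trans
          (tangentCoordChange_self (by simp))
    have h1 := VectorField.mpullback_apply (I := 𝓡 d) (I' := 𝓡 d) (f := φ)
      (V := stdVec (M := EuclideanSpace ℝ (Fin d)) i) (x := y)
    rw [mfderiv_chartAt_eq_tangentCoordChange hy] at h1
    rw [h1, coordField_eq hy]
    exact (DFunLike.congr_fun hinv _).symm
  have hdiff : ∀ i : Fin d, MDifferentiableAt (𝓡 d) (𝓡 d).tangent
      (fun x : EuclideanSpace ℝ (Fin d) => (⟨x, stdVec i x⟩ :
        TangentBundle (𝓡 d) (EuclideanSpace ℝ (Fin d)))) (φ q) := by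
    intro i
    have := contMDiffAt_vectorSpace_iff_contDiffAt (𝕜 := ℝ) (n := 1)
      (V := stdVec (M := EuclideanSpace ℝ (Fin d)) i) (x := φ q)
    refine (this.2 ?_).mdifferentiableAt (by simp)
    exact contDiffAt_const (c := (EuclideanSpace.single i (1 : ℝ) : EuclideanSpace ℝ (Fin d)))
  have : IsManifold (𝓡 d) (minSmoothness ℝ 2) M := by
    rw [minSmoothness_of_isRCLikeNormedField]
    infer_instance
  rw [(hpb j).mlieBracket_vectorField_eq (hpb k),
    ← VectorField.mpullback_mlieBracket (n := ∞) (hdiff j) (hdiff k)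
      ((contMDiffOn_chart (I := 𝓡 d) (n := ∞)).contMDiffAt (φ.open_source.mem_nhds hq))
      (by rw [minSmoothness_of_isRCLikeNormedField]; exact WithTop.coe_le_coe.2 le_top),
    VectorField.mpullback_apply]
  have h0 : VectorField.mlieBracket (𝓡 d) (stdVec (M := EuclideanSpace ℝ (Fin d)) j) (stdVec k)
      (φ q) = 0 := by
    rw [← VectorField.mlieBracketWithin_univ]
    have := VectorField.mlieBracketWithin_eq_lieBracketWithin (𝕜 := ℝ)
      (V := stdVec (M := EuclideanSpace ℝ (Fin d)) j) (W := stdVec k) (s := Set.univ)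
    refine (congrFun this (φ q)).trans ?_
    have hc : ∀ i : Fin d, HasFDerivWithinAt
        (fun _ : EuclideanSpace ℝ (Fin d) => (EuclideanSpace.single i (1 : ℝ) :
          EuclideanSpace ℝ (Fin d)))
        (0 : EuclideanSpace ℝ (Fin d) →L[ℝ] EuclideanSpace ℝ (Fin d)) Set.univ (φ q) := fun i =>
          hasFDerivWithinAt_const _ _ _
    have hz := (hc k).fderivWithin uniqueDiffWithinAt_univ
    have hz' := (hc j).fderivWithin uniqueDiffWithinAt_univ
    have : VectorField.lieBracketWithin ℝ
        (fun _ : EuclideanSpace ℝ (Fin d) => (EuclideanSpace.single j (1 : ℝ) :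
          EuclideanSpace ℝ (Fin d)))
        (fun _ : EuclideanSpace ℝ (Fin d) => (EuclideanSpace.single k (1 : ℝ) :
          EuclideanSpace ℝ (Fin d))) Set.univ (φ q) = 0 := by
      rw [VectorField.lieBracketWithin, hz, hz']
      simp
    exact this
  rw [h0]
  exact map_zero _

/-- The Christoffel symbols `Γ^i_{kj}` of a connection on the tangent bundle, at the point `q` in
the chart at `x₀`. -/
def christoffel (cov : TangentConnection d M) (x₀ q : M) (k : Fin d) : Matrix (Fin d) (Fin d) ℝ :=
  Matrix.of fun i j => (frameMatrix x₀ q)⁻¹.mulVec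
    (comp (cov (coordField x₀ j) q (coordField x₀ k q))) i

lemma sum_smul_coordField {x₀ q : M} (c : Fin d → ℝ) (i : Fin d) :
    comp (∑ j, c j • coordField x₀ j q) i = (frameMatrix x₀ q).mulVec c i := by
  rw [comp_sum]
  simp only [comp_smul, Matrix.mulVec, dotProduct]
  exact Finset.sum_congr rfl fun j _ => mul_comm _ _

lemma cov_coordField {x₀ q : M} (hq : q ∈ (chartAt (EuclideanSpace ℝ (Fin d)) x₀).source)
    (cov : TangentConnection d M) (k j : Fin d) :
    cov (coordField x₀ j) q (coordField x₀ k q) =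
      ∑ i, christoffel cov x₀ q k i j • coordField x₀ i q := by
  apply comp_injective
  intro i
  rw [sum_smul_coordField (fun i => christoffel cov x₀ q k i j)]
  have : (fun i => christoffel cov x₀ q k i j) = (frameMatrix x₀ q)⁻¹.mulVec
      (comp (cov (coordField x₀ j) q (coordField x₀ k q))) := rfl
  rw [this, Matrix.mulVec_mulVec, Matrix.mul_nonsing_inv _ (isUnit_det_frameMatrix hq),
    Matrix.one_mulVec]

lemma coordField_linearIndependent {x₀ q : M}
    (hq : q ∈ (chartAt (EuclideanSpace ℝ (Fin d)) x₀).source) {c c' : Fin d → ℝ}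
    (h : ∑ j, c j • coordField x₀ j q = ∑ j, c' j • coordField x₀ j q) : c = c' := by
  have h2 : (frameMatrix x₀ q).mulVec c = (frameMatrix x₀ q).mulVec c' := by
    ext i
    rw [← sum_smul_coordField, ← sum_smul_coordField, h]
  have := congrArg (frameMatrix x₀ q)⁻¹.mulVec h2
  simpa [Matrix.mulVec_mulVec, Matrix.nonsing_inv_mul _ (isUnit_det_frameMatrix hq)] using this

/-- The Christoffel symbols of a torsion-free connection are symmetric. -/
lemma christoffel_symm {Ω : BilinField d M} {cov : TangentConnection d M}
    (hcov : IsSymplecticConnection Ω cov) {x₀ q : M}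
    (hq : q ∈ (chartAt (EuclideanSpace ℝ (Fin d)) x₀).source) (k i j : Fin d) :
    christoffel cov x₀ q k i j = christoffel cov x₀ q j i k := by
  have h := cov.torsion_apply (mdifferentiableAt_coordField hq k) (mdifferentiableAt_coordField hq
      j)
  rw [hcov.torsion_free, mlieBracket_coordField hq, cov_coordField hq, cov_coordField hq] at h
  have h2 : ∑ i, christoffel cov x₀ q k i j • coordField x₀ i q =
      ∑ i, christoffel cov x₀ q j i k • coordField x₀ i q := by
    have h3 := h.symm
    rw [sub_zero] at h3
    exact sub_eq_zero.1 h3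
  exact congrFun (coordField_linearIndependent hq h2) i

/-- The matrix of a field of bilinear forms in the coordinate frame of the chart at `x₀`. -/
def formMatrix (Ω : BilinField d M) (x₀ q : M) : Matrix (Fin d) (Fin d) ℝ :=
  Matrix.of fun i j => Ω q (coordField x₀ i q) (coordField x₀ j q)

lemma formMatrix_self (Ω : BilinField d M) (q : M) :
    formMatrix Ω q q = Matrix.of fun i j => Ω q (stdVec i q) (stdVec j q) := by
  ext i j
  simp [formMatrix, coordField_self]

lemma poisson_eq (Ω : BilinField d M) (q : M) : poisson Ω q = (formMatrix Ω q q)⁻¹ := by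
  rw [formMatrix_self, poisson]

lemma bilin_sum (Ω : BilinField d M) (q : M) (c e : Fin d → ℝ)
    (v w : Fin d → TangentSpace (𝓡 d) q) :
    Ω q (∑ i, c i • v i) (∑ j, e j • w j) = ∑ i, ∑ j, c i * (Ω q (v i) (w j) * e j) := by
  simp only [map_sum, map_smul, sum_apply, smul_apply, smul_eq_mul]
  simp only [Finset.mul_sum]
  rw [Finset.sum_comm]
  exact Finset.sum_congr rfl fun i _ => Finset.sum_congr rfl fun j _ => by ring

lemma formMatrix_eq (Ω : BilinField d M) (x₀ q : M) :
    formMatrix Ω x₀ q = (frameMatrix x₀ q).transpose * formMatrix Ω q q * frameMatrix x₀ q := by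
  ext i j
  rw [formMatrix_self]
  simp only [formMatrix, Matrix.of_apply, coordField_eq_sum_stdVec, bilin_sum, Matrix.mul_apply,
    Matrix.transpose_apply, Finset.sum_mul]
  rw [Finset.sum_comm]
  simp only [mul_assoc]

variable {Ω : BilinField d M}

lemma bilin_swap (hΩ : IsSymplectic Ω) (q : M) (v w : TangentSpace (𝓡 d) q) :
    Ω q v w = -Ω q w v := by
  have h := hΩ.alternating q (v + w)
  simp only [map_add, add_apply, hΩ.alternating, zero_add, add_zero] at h
  linarith

lemma formMatrix_transpose (hΩ : IsSymplectic Ω) (x₀ q : M) :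
    (formMatrix Ω x₀ q).transpose = -formMatrix Ω x₀ q := by
  ext i j
  simpa [formMatrix] using bilin_swap hΩ q _ _

lemma isUnit_det_formMatrix_self (hΩ : IsSymplectic Ω) (q : M) :
    IsUnit (formMatrix Ω q q).det := by
  rw [isUnit_iff_ne_zero]
  intro h0
  obtain ⟨c, hc, hc0⟩ := Matrix.exists_vecMul_eq_zero_iff.2 h0
  apply hc
  have hu := hΩ.nondegenerate q (∑ i, c i • stdVec i q) fun v => by
    rw [vec_eq_sum_stdVec v, bilin_sum, Finset.sum_comm]
    refine Finset.sum_eq_zero fun j _ => ?_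
    have := congrFun hc0 j
    rw [formMatrix_self] at this
    simp only [Matrix.vecMul, dotProduct, Matrix.of_apply, Pi.zero_apply] at this
    calc _ = (∑ i, c i * Ω q (stdVec i q) (stdVec j q)) * comp v j := by
          rw [Finset.sum_mul]; exact Finset.sum_congr rfl fun i _ => by ring
      _ = 0 := by rw [this, zero_mul]
  refine coordField_linearIndependent (x₀ := q) (mem_source_self q) ?_
  simp only [coordField_self, hu, Pi.zero_apply, zero_smul, Finset.sum_const_zero]

lemma isUnit_det_formMatrix (hΩ : IsSymplectic Ω) {x₀ q : M}
    (hq : q ∈ (chartAt (EuclideanSpace ℝ (Fin d)) x₀).source) :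
    IsUnit (formMatrix Ω x₀ q).det := by
  rw [formMatrix_eq, Matrix.det_mul, Matrix.det_mul, Matrix.det_transpose]
  have hF := isUnit_det_frameMatrix hq
  exact (hF.mul (isUnit_det_formMatrix_self hΩ q)).mul hF

lemma poisson_transpose (hΩ : IsSymplectic Ω) (q : M) :
    (poisson Ω q).transpose = -poisson Ω q := by
  rw [poisson_eq, Matrix.transpose_nonsing_inv, formMatrix_transpose hΩ]
  have h := isUnit_det_formMatrix_self hΩ q
  refine Matrix.inv_eq_left_inv ?_
  rw [neg_mul_neg, Matrix.nonsing_inv_mul _ h]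

/-- The bivector field in the coordinate frame of a chart is the inverse of the matrix of the
symplectic form. -/
lemma formMatrix_inv (Ω : BilinField d M) {x₀ q : M}
    (hq : q ∈ (chartAt (EuclideanSpace ℝ (Fin d)) x₀).source) :
    frameMatrix x₀ q * (formMatrix Ω x₀ q)⁻¹ * (frameMatrix x₀ q).transpose = poisson Ω q := by
  have hF : IsUnit (frameMatrix (d := d) x₀ q).det := isUnit_det_frameMatrix hq
  have hFt : IsUnit (frameMatrix (d := d) x₀ q).transpose.det := by rwa [Matrix.det_transpose]
  rw [formMatrix_eq Ω x₀ q, Matrix.mul_inv_rev, Matrix.mul_inv_rev, poisson_eq, ← Matrix.mul_assoc,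
    ← Matrix.mul_assoc, Matrix.mul_nonsing_inv _ hF, Matrix.one_mul, Matrix.mul_assoc,
    Matrix.nonsing_inv_mul _ hFt, Matrix.mul_one]

lemma contMDiffOn_formMatrix (hΩ : IsSymplectic Ω) (x₀ : M) (i j : Fin d) :
    ContMDiffOn (𝓡 d) 𝓘(ℝ, ℝ) ∞ (fun q => formMatrix Ω x₀ q i j)
      (chartAt (EuclideanSpace ℝ (Fin d)) x₀).source := by
  have h (j : Fin d) : ContMDiffOn (𝓡 d) (𝓡 d).tangent ∞
      (fun q => (⟨q, coordField x₀ j q⟩ : TangentBundle (𝓡 d) M))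
      (chartAt (EuclideanSpace ℝ (Fin d)) x₀).source :=
    (Trivialization.contMDiffOn_localFrame_baseSet (I := 𝓡 d) (n := ∞)
    (e := trivializationAt (EuclideanSpace ℝ (Fin d)) (TangentSpace (𝓡 d) : M → Type _) x₀)
    (b := (EuclideanSpace.basisFun (Fin d) ℝ).toBasis) j)
  have := ContMDiffOn.clm_bundle_apply₂ (E₃ := Bundle.Trivial M ℝ) (hΩ.smooth.contMDiffOn)
    (h i) (h j)
  intro q hq
  have h2 := this q hq
  rw [Bundle.contMDiffWithinAt_totalSpace] at h2
  exact h2.2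

/-- The derivative of the matrix of the symplectic form, which is parallel. -/
lemma mvfderiv_formMatrix {cov : TangentConnection d M} (hcov : IsSymplecticConnection Ω cov)
    {x₀ q : M} (hq : q ∈ (chartAt (EuclideanSpace ℝ (Fin d)) x₀).source) (k i j : Fin d) :
    mvfderiv (𝓡 d) (fun q => formMatrix Ω x₀ q i j) q (coordField x₀ k q) =
      ((christoffel cov x₀ q k).transpose * formMatrix Ω x₀ q +
        formMatrix Ω x₀ q * christoffel cov x₀ q k) i j := by
  have h := hcov.parallel (coordField x₀ i) (coordField x₀ j) q (mdifferentiableAt_coordField hq i)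
    (mdifferentiableAt_coordField hq j) (coordField x₀ k q)
  refine h.trans ?_
  rw [cov_coordField hq, cov_coordField hq, Matrix.add_apply, Matrix.mul_apply, Matrix.mul_apply]
  congr 1
  · rw [map_sum, sum_apply]
    refine Finset.sum_congr rfl fun a _ => ?_
    rw [map_smul]
    rfl
  · rw [map_sum]
    refine Finset.sum_congr rfl fun a _ => ?_
    rw [map_smul, smul_eq_mul, mul_comm]
    rfl

/-- The components of a vector field in the coordinate frame of the chart at `x₀`. -/
def components (X : Π p : M, TangentSpace (𝓡 d) p) (x₀ q : M) : Fin d → ℝ :=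
  (frameMatrix x₀ q)⁻¹.mulVec (comp (X q))

/-- The divergence of a vector field, that is the trace of its covariant derivative. -/
def divergence (cov : TangentConnection d M) (X : Π p : M, TangentSpace (𝓡 d) p) (q : M) : ℝ :=
  ∑ i, comp (cov X q (stdVec i q)) i

lemma sum_components_smul (X : Π p : M, TangentSpace (𝓡 d) p) {x₀ q : M}
    (hq : q ∈ (chartAt (EuclideanSpace ℝ (Fin d)) x₀).source) :
    X q = ∑ j, components X x₀ q j • coordField x₀ j q := by
  apply comp_injective
  intro i
  rw [sum_smul_coordField, components, Matrix.mulVec_mulVec,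
    Matrix.mul_nonsing_inv _ (isUnit_det_frameMatrix hq), Matrix.one_mulVec]

lemma cov_sum (cov : TangentConnection d M) {ι : Type*} (S : Finset ι) {q : M} (g : ι → M → ℝ)
    (Y : ι → Π p : M, TangentSpace (𝓡 d) p)
    (hg : ∀ k, MDifferentiableAt (𝓡 d) 𝓘(ℝ, ℝ) (g k) q)
    (hY : ∀ k, MDifferentiableAt (𝓡 d) (𝓡 d).tangent
      (fun q => (⟨q, Y k q⟩ : TangentBundle (𝓡 d) M)) q) (v : TangentSpace (𝓡 d) q) :
    MDifferentiableAt (𝓡 d) (𝓡 d).tangent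
      (fun q => (⟨q, (∑ k ∈ S, g k • Y k) q⟩ : TangentBundle (𝓡 d) M)) q ∧
    cov (∑ k ∈ S, g k • Y k) q v =
      ∑ k ∈ S, (g k q • cov (Y k) q v + mvfderiv (𝓡 d) (g k) q v • Y k q) := by
  classical
  have hgY (k : ι) : MDifferentiableAt (𝓡 d) (𝓡 d).tangent
      (fun q => (⟨q, (g k • Y k) q⟩ : TangentBundle (𝓡 d) M)) q :=
    (hg k).smul_section (hY k)
  induction S using Finset.induction_on with
  | empty =>
    simp only [Finset.sum_empty]
    refine ⟨?_, ?_⟩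
    · exact mdifferentiableAt_zeroSection ..
    · rw [CovariantDerivative.zero]; rfl
  | insert a S ha ih =>
    simp only [Finset.sum_insert ha]
    refine ⟨mdifferentiableAt_add_section (hgY a) ih.1, ?_⟩
    rw [cov.isCovariantDerivativeOnUniv.add (hgY a) ih.1,
      cov.isCovariantDerivativeOnUniv.leibniz (hY a) (hg a), ← ih.2]
    rfl

/-- The divergence in the coordinate frame of a chart. -/
lemma divergence_eq {cov : TangentConnection d M} (hcov : IsSymplecticConnection Ω cov)
    (X : Π p : M, TangentSpace (𝓡 d) p) {x₀ q : M}
    (hq : q ∈ (chartAt (EuclideanSpace ℝ (Fin d)) x₀).source)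
    (hX : ∀ k, MDifferentiableAt (𝓡 d) 𝓘(ℝ, ℝ) (fun q => components X x₀ q k) q) :
    divergence cov X q = ∑ k, (mvfderiv (𝓡 d) (fun q => components X x₀ q k) q (coordField x₀ k q)
      + (christoffel cov x₀ q k).trace * components X x₀ q k) := by
  set F := frameMatrix (d := d) x₀ q with hF
  have hFu : IsUnit F.det := isUnit_det_frameMatrix hq
  let A : Matrix (Fin d) (Fin d) ℝ := Matrix.of fun i k => comp (cov X q (stdVec k q)) i
  let B : Matrix (Fin d) (Fin d) ℝ := Matrix.of fun i k =>
    mvfderiv (𝓡 d) (fun q => components X x₀ q i) q (coordField x₀ k q) +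
      ∑ j, components X x₀ q j * christoffel cov x₀ q k i j
  have hcong : cov X q = cov (∑ j, (fun q => components X x₀ q j) • coordField x₀ j) q := by
    have hsum := (cov_sum cov Finset.univ _ _ hX (fun k => mdifferentiableAt_coordField hq k)
      0).1
    have hev : ∀ᶠ y in nhds q,
        X y = (∑ j, (fun q => components X x₀ q j) • coordField x₀ j :
          Π p : M, TangentSpace (𝓡 d) p) y := by
      filter_upwards [(chartAt (EuclideanSpace ℝ (Fin d)) x₀).open_source.mem_nhds hq] with y hy
      rw [sum_components_smul X hy, Finset.sum_apply]
      rfl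
    refine cov.isCovariantDerivativeOnUniv.congr_of_eventuallyEq ?_ hsum Filter.univ_mem hev
    refine hsum.congr_of_eventuallyEq ?_
    filter_upwards [hev] with y hy
    rw [hy]
  -- `A` and `B` are the matrices of the covariant derivative in the two frames
  have hAF : A * F = F * B := by
    ext i k
    have h1 : (A * F) i k = comp (cov X q (coordField x₀ k q)) i := by
      rw [coordField_eq_sum_stdVec, map_sum, comp_sum, Matrix.mul_apply]
      refine Finset.sum_congr rfl fun j _ => ?_
      rw [map_smul, comp_smul, mul_comm]
      rfl
    rw [h1, hcong, (cov_sum cov Finset.univ _ _ hX (fun k => mdifferentiableAt_coordField hq k)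
      (coordField x₀ k q)).2]
    simp only [cov_coordField hq]
    have h2 : ∑ j, (components X x₀ q j • ∑ a, christoffel cov x₀ q k a j • coordField x₀ a q +
        mvfderiv (𝓡 d) (fun q => components X x₀ q j) q (coordField x₀ k q) • coordField x₀ j q) =
        ∑ a, B a k • coordField x₀ a q := by
      simp only [Finset.sum_add_distrib, Finset.smul_sum, smul_smul]
      rw [Finset.sum_comm, ← Finset.sum_add_distrib]
      refine Finset.sum_congr rfl fun a _ => ?_
      rw [← Finset.sum_smul, ← add_smul, add_comm]
      rfl
    rw [h2, sum_smul_coordField (fun a => B a k)]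
    rfl
  have htr : A.trace = B.trace := by
    have : B = F⁻¹ * (A * F) := by
      rw [hAF, ← Matrix.mul_assoc, Matrix.nonsing_inv_mul _ hFu, Matrix.one_mul]
    rw [this, Matrix.trace_mul_comm, Matrix.mul_assoc, Matrix.mul_nonsing_inv _ hFu, Matrix.mul_one]
  have h3 : divergence cov X q = A.trace := rfl
  rw [h3, htr]
  simp only [Matrix.trace, Matrix.diag_apply, B, Matrix.of_apply, Finset.sum_add_distrib]
  congr 1
  rw [Finset.sum_comm]
  refine Finset.sum_congr rfl fun k _ => ?_
  rw [Finset.sum_mul]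
  refine Finset.sum_congr rfl fun j _ => ?_
  rw [christoffel_symm hcov hq, mul_comm]

end CoordinateFrames

/-! ### Sections of the Weyl bundle in charts -/

section Charts

variable {d : ℕ} {M : Type*} [TopologicalSpace M] [ChartedSpace (EuclideanSpace ℝ (Fin d)) M]
  [IsManifold (𝓡 d) ∞ M]

/-- A tangent vector as an element of the model space. -/
def vecE {p : M} (v : TangentSpace (𝓡 d) p) : EuclideanSpace ℝ (Fin d) := v

/-- The coordinate line through `p` in the direction `v`, in the chart at `p`. -/
def coordLine (p : M) (v : TangentSpace (𝓡 d) p) (t : ℝ) : M :=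
  (chartAt (EuclideanSpace ℝ (Fin d)) p).symm (chartAt (EuclideanSpace ℝ (Fin d)) p p + t • vecE v)

lemma coordLine_zero (p : M) (v : TangentSpace (𝓡 d) p) : coordLine p v 0 = p := by
  simp [coordLine]

lemma eventually_coordLine_mem (p : M) (v : TangentSpace (𝓡 d) p) :
    ∀ᶠ t in nhds (0 : ℝ), coordLine p v t ∈ (chartAt (EuclideanSpace ℝ (Fin d)) p).source := by
  set φ := chartAt (EuclideanSpace ℝ (Fin d)) p with hφ
  have hc : Continuous fun t : ℝ => φ p + t • vecE v := by fun_prop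
  have := hc.continuousAt.preimage_mem_nhds (x := 0) (φ.open_target.mem_nhds (by simp [hφ]))
  filter_upwards [this] with t ht
  exact φ.map_target ht

lemma hasDerivAt_coordLine (p : M) (v : TangentSpace (𝓡 d) p) {h : M → ℝ}
    (hh : MDifferentiableAt (𝓡 d) 𝓘(ℝ, ℝ) h p) :
    HasDerivAt (fun t => h (coordLine p v t)) (mvfderiv (𝓡 d) h p v) 0 := by
  set φ := chartAt (EuclideanSpace ℝ (Fin d)) p with hφ
  have e2 : HasFDerivAt (h ∘ φ.symm) (mvfderiv (𝓡 d) h p) (φ p) := hasFDerivAt_comp_chart_symm hh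
  have e1 : HasDerivAt (fun t : ℝ => φ p + t • vecE v)
      (vecE v) 0 := by
    simpa using! ((hasDerivAt_id (0 : ℝ)).smul_const
      (vecE v)).const_add (φ p)
  have e3 : HasFDerivAt (h ∘ φ.symm) (mvfderiv (𝓡 d) h p)
      (φ p + (0 : ℝ) • vecE v) := by simpa using e2
  exact e3.comp_hasDerivAt 0 e1

/-- A section of the Weyl bundle at `q`, as a functional, in the coordinate frame of the chart at
`x₀`. -/
def chartDual (x₀ q : M) (a : WeylSection M d) : WeylDual d :=
  frame (frameMatrix x₀ q) (dualW (atPt q a))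

lemma pair_inFrame (x₀ q : M) (F : MvPowerSeries (Fin d) ℝ) (f : MvPolynomial (Fin d) ℝ) :
    pair (inFrame x₀ q F) f = pair F (linSubst (fun j i => frameMatrix x₀ q i j) f) := by
  exact pair_subst _ _ _

lemma chartDual_eq (x₀ q : M) (a : WeylSection M d) :
    chartDual x₀ q a = dualW (PowerSeries.mk fun N => inFrame x₀ q (PowerSeries.coeff N a q)) := by
  refine LinearMap.ext fun f => ?_
  ext N
  rw [coeff_dualW, PowerSeries.coeff_mk, pair_inFrame, chartDual, frame, LinearMap.comp_apply,
    coeff_dualW, coeff_atPt]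
  rfl

lemma chartDual_self (p : M) (a : WeylSection M d) : chartDual p p a = dualW (atPt p a) := by
  rw [chartDual, frameMatrix_self, frame_one]

/-- The algebra of functions that are smooth on the domain of the chart at `x₀`. -/
def smoothOn (x₀ : M) : Subalgebra ℝ (M → ℝ) where
  carrier := {f | ContMDiffOn (𝓡 d) 𝓘(ℝ, ℝ) ∞ f (chartAt (EuclideanSpace ℝ (Fin d)) x₀).source}
  mul_mem' hf hg := ContMDiffOn.mul hf hg
  add_mem' hf hg := ContMDiffOn.add hf hg
  algebraMap_mem' _ := contMDiffOn_const

lemma smoothOn_congr {x₀ : M} {f g : M → ℝ} (hf : f ∈ smoothOn (d := d) x₀)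
    (h : ∀ q ∈ (chartAt (EuclideanSpace ℝ (Fin d)) x₀).source, g q = f q) :
    g ∈ smoothOn (d := d) x₀ :=
  ContMDiffOn.congr hf h

lemma smoothOn_mdifferentiableAt {x₀ q : M} {f : M → ℝ} (hf : f ∈ smoothOn (d := d) x₀)
    (hq : q ∈ (chartAt (EuclideanSpace ℝ (Fin d)) x₀).source) :
    MDifferentiableAt (𝓡 d) 𝓘(ℝ, ℝ) f q :=
  (ContMDiffOn.contMDiffAt hf ((chartAt (EuclideanSpace ℝ (Fin d)) x₀).open_source.mem_nhds
    hq)).mdifferentiableAt (by simp)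

lemma smoothOn_inv {x₀ : M} {f : M → ℝ} (hf : f ∈ smoothOn (d := d) x₀)
    (h : ∀ q ∈ (chartAt (EuclideanSpace ℝ (Fin d)) x₀).source, f q ≠ 0) :
    (fun q => (f q)⁻¹) ∈ smoothOn (d := d) x₀ :=
  ContMDiffOn.inv₀ hf h

lemma isSmoothInChart_iff (x₀ : M) (a : WeylSection M d) :
    IsSmoothInChart x₀ a ↔ InL (smoothOn (d := d) x₀) fun q => chartDual x₀ q a := by
  have h0 : (fun q => chartDual x₀ q a) = fun q => dualW (PowerSeries.mk fun N =>
      inFrame x₀ q (PowerSeries.coeff N a q)) := funext fun q => chartDual_eq x₀ q a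
  rw [h0]
  constructor
  · intro h
    refine inL_dualW fun N m => ?_
    simp only [PowerSeries.coeff_mk]
    exact h N m
  · intro h N m
    have := coeff_mem_of_inL_dualW h N m
    simp only [PowerSeries.coeff_mk] at this
    exact this

lemma InL.congr_smoothOn {x₀ : M} {V : Type*} [AddCommGroup V] [Module ℝ V]
    {l l' : M → V →ₗ[ℝ] PowerSeries ℝ} (h : InL (smoothOn (d := d) x₀) l)
    (e : ∀ q ∈ (chartAt (EuclideanSpace ℝ (Fin d)) x₀).source, l' q = l q) :
    InL (smoothOn (d := d) x₀) l' := fun g N =>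
  smoothOn_congr (h g N) fun q hq => by simp only [e q hq]

variable {Ω : BilinField d M}

lemma formMatrix_inv_mem (hΩ : IsSymplectic Ω) (x₀ : M) (i j : Fin d) :
    (fun q => (formMatrix Ω x₀ q)⁻¹ i j) ∈ smoothOn (d := d) x₀ := by
  have h : ∀ i j, (fun q => formMatrix Ω x₀ q i j) ∈ smoothOn (d := d) x₀ :=
    fun i j => contMDiffOn_formMatrix hΩ x₀ i j
  exact inv_mem h (smoothOn_inv (det_mem h) fun q hq => (isUnit_det_formMatrix hΩ hq).ne_zero) i j

lemma starL_frame_poisson (Ω : BilinField d M) {x₀ q : M}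
    (hq : q ∈ (chartAt (EuclideanSpace ℝ (Fin d)) x₀).source) (a b : WeylSection M d) :
    starL (formMatrix Ω x₀ q)⁻¹ (chartDual x₀ q a) (chartDual x₀ q b) =
      chartDual x₀ q (moyal (poisson Ω) a b) := by
  rw [chartDual, chartDual, starL_frame, formMatrix_inv Ω hq, chartDual, dualW_moyal]

lemma isSmooth_moyal (hΩ : IsSymplectic Ω) {a b : WeylSection M d} (ha : IsSmooth a)
    (hb : IsSmooth b) : IsSmooth (moyal (poisson Ω) a b) := by
  intro x₀
  rw [isSmoothInChart_iff]
  refine InL.congr_smoothOn (InL.starL (formMatrix_inv_mem hΩ x₀)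
    ((isSmoothInChart_iff x₀ a).1 (ha x₀)) ((isSmoothInChart_iff x₀ b).1 (hb x₀))) fun q hq => ?_
  exact (starL_frame_poisson Ω hq a b).symm

/-- The matrix of `∇_v` on the coordinate vector fields of the chart at `p`. -/
def connMatrix (cov : TangentConnection d M) (p : M) (v : TangentSpace (𝓡 d) p) :
    Matrix (Fin d) (Fin d) ℝ :=
  Matrix.of fun i j => comp (cov (coordField p j) p v) i

/-- The frame obtained from the coordinate frame of the chart at `p`, along a coordinate line, by
an infinitesimal parallel transport at `p`. -/
def parFrame (cov : TangentConnection d M) (p : M) (v : TangentSpace (𝓡 d) p) (t : ℝ) :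
    Matrix (Fin d) (Fin d) ℝ :=
  1 - t • connMatrix cov p v

lemma parFrame_zero (cov : TangentConnection d M) (p : M) (v : TangentSpace (𝓡 d) p) :
    parFrame cov p v 0 = 1 := by
  simp [parFrame]

lemma hasDerivAt_parFrame (cov : TangentConnection d M) (p : M) (v : TangentSpace (𝓡 d) p)
    (i j : Fin d) : HasDerivAt (fun t => parFrame cov p v t i j) (-connMatrix cov p v i j) 0 := by
  simp only [parFrame, Matrix.sub_apply, Matrix.smul_apply, smul_eq_mul]
  simpa using! ((hasDerivAt_id (0 : ℝ)).mul_const (connMatrix cov p v i j)).const_sub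
    ((1 : Matrix (Fin d) (Fin d) ℝ) i j)

lemma eventually_parFrame_det_ne_zero (cov : TangentConnection d M) (p : M)
    (v : TangentSpace (𝓡 d) p) : ∀ᶠ t in nhds (0 : ℝ), (parFrame cov p v t).det ≠ 0 := by
  have hc : Continuous fun t : ℝ => (parFrame cov p v t).det := by
    unfold parFrame
    fun_prop
  refine hc.continuousAt.eventually_ne ?_
  rw [parFrame_zero, Matrix.det_one]
  exact one_ne_zero

/-- The covariant derivative on the Weyl bundle is an ordinary derivative in a frame that is
parallel to first order. -/
lemma hasDerivL_nabla (cov : TangentConnection d M) (V : Π p : M, TangentSpace (𝓡 d) p)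
    (a : WeylSection M d) (p : M) (ha : IsSmoothInChart p a) :
    HasDerivL (fun t => frame (parFrame cov p (V p) t) (chartDual p (coordLine p (V p) t) a))
      (dualW (atPt p (nabla cov V a))) := by
  set A' : PowerSeries (MvPowerSeries (Fin d) ℝ) := PowerSeries.mk fun N =>
    (show MvPowerSeries (Fin d) ℝ from fun m => mvfderiv (𝓡 d) (fun q => MvPowerSeries.coeff m
      (inFrame p q (PowerSeries.coeff N a q))) p (V p)) with hA'
  refine HasDerivL.frame (Ψ' := -connMatrix cov p (V p)) (hasDerivAt_parFrame cov p (V p))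
    (parFrame_zero cov p (V p)) (a' := dualW A') ?_ _ ?_
  · simp only [chartDual_eq]
    refine hasDerivL_dualW fun N m => ?_
    rw [hA', PowerSeries.coeff_mk]
    simp only [PowerSeries.coeff_mk]
    exact hasDerivAt_coordLine p (V p) (smoothOn_mdifferentiableAt (ha N m) (mem_source_self p))
  · intro f
    rw [coordLine_zero, chartDual_self]
    ext N
    rw [map_add, coeff_dualW, coeff_dualW, coeff_dualW, coeff_atPt, coeff_atPt]
    have h1 : PowerSeries.coeff N (nabla cov V a) p = PowerSeries.coeff N A' -
        ∑ i, ∑ j, MvPowerSeries.C (connMatrix cov p (V p) i j) *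
          (MvPowerSeries.X j * MvPowerSeries.pderiv ℝ i (PowerSeries.coeff N a p)) := by
      rw [hA', PowerSeries.coeff_mk]
      exact congrFun (PowerSeries.coeff_mk N _) p
    rw [h1, sub_eq_add_neg, pair_add, LinearMap.add_apply]
    congr 1
    rw [linDeriv, ← pairHom_apply, map_neg, map_sum, LinearMap.neg_apply, LinearMap.sum_apply,
      map_sum, ← Finset.sum_neg_distrib]
    refine Finset.sum_congr rfl fun i _ => ?_
    rw [map_sum, LinearMap.sum_apply, map_sum, ← Finset.sum_neg_distrib]
    refine Finset.sum_congr rfl fun j _ => ?_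
    rw [← MvPowerSeries.smul_eq_C_mul, map_smul, LinearMap.smul_apply, pairHom_apply,
      pair_X_mul_apply, ← pair_X_mul, pair_C_mul, smul_eq_mul]
    exact (neg_mul _ _).symm

/-- The section `a` along a coordinate line, as a functional in the first-order parallel frame. -/
def parDual (cov : TangentConnection d M) (p : M) (v : TangentSpace (𝓡 d) p) (a : WeylSection M d)
    (t : ℝ) : WeylDual d :=
  frame (parFrame cov p v t) (chartDual p (coordLine p v t) a)

lemma parDual_zero (cov : TangentConnection d M) (p : M) (v : TangentSpace (𝓡 d) p)
    (a : WeylSection M d) : parDual cov p v a 0 = dualW (atPt p a) := by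
  rw [parDual, parFrame_zero, frame_one, coordLine_zero, chartDual_self]

lemma parDual_eq (cov : TangentConnection d M) (p : M) (v : TangentSpace (𝓡 d) p)
    (a : WeylSection M d) (t : ℝ) : parDual cov p v a t =
      frame (frameMatrix p (coordLine p v t) * parFrame cov p v t)
        (dualW (atPt (coordLine p v t) a)) := by
  rw [parDual, chartDual, ← frame_mul]

/-- The bivector field along a coordinate line, in the first-order parallel frame. -/
def parPoisson (Ω : BilinField d M) (cov : TangentConnection d M) (p : M)
    (v : TangentSpace (𝓡 d) p) (t : ℝ) : Matrix (Fin d) (Fin d) ℝ :=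
  ((parFrame cov p v t).transpose * formMatrix Ω p (coordLine p v t) * parFrame cov p v t)⁻¹

lemma parPoisson_zero (Ω : BilinField d M) (cov : TangentConnection d M) (p : M)
    (v : TangentSpace (𝓡 d) p) : parPoisson Ω cov p v 0 = poisson Ω p := by
  rw [parPoisson, parFrame_zero, coordLine_zero, Matrix.transpose_one, Matrix.one_mul,
    Matrix.mul_one, poisson_eq]

lemma eventually_parPoisson (Ω : BilinField d M) (cov : TangentConnection d M) (p : M)
    (v : TangentSpace (𝓡 d) p) : ∀ᶠ t in nhds (0 : ℝ),
      frameMatrix p (coordLine p v t) * parFrame cov p v t * parPoisson Ω cov p v t *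
        (frameMatrix p (coordLine p v t) * parFrame cov p v t).transpose =
      poisson Ω (coordLine p v t) := by
  filter_upwards [eventually_coordLine_mem p v, eventually_parFrame_det_ne_zero cov p v]
    with t ht ht'
  have hΨ : IsUnit (parFrame cov p v t).det := isUnit_iff_ne_zero.2 ht'
  have hΨt : IsUnit (parFrame cov p v t).transpose.det := by rwa [Matrix.det_transpose]
  rw [parPoisson, Matrix.mul_inv_rev, Matrix.mul_inv_rev, Matrix.transpose_mul,
    ← formMatrix_inv Ω ht]
  set Ψ := parFrame cov p v t
  set F := frameMatrix (d := d) p (coordLine p v t)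
  set O := (formMatrix Ω p (coordLine p v t))⁻¹
  calc F * Ψ * (Ψ⁻¹ * (O * Ψ.transpose⁻¹)) * (Ψ.transpose * F.transpose)
      = F * (Ψ * Ψ⁻¹) * O * (Ψ.transpose⁻¹ * Ψ.transpose) * F.transpose := by
        simp only [Matrix.mul_assoc]
    _ = F * O * F.transpose := by
        rw [Matrix.mul_nonsing_inv _ hΨ, Matrix.nonsing_inv_mul _ hΨt, Matrix.mul_one,
          Matrix.mul_one]

/-- The algebra of functions of one real variable that are stationary at `0`. -/
def stationary : Subalgebra ℝ (ℝ → ℝ) where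
  carrier := {f | HasDerivAt f 0 0}
  mul_mem' hf hg := by simpa using! hf.mul hg
  add_mem' hf hg := by simpa using! hf.add hg
  algebraMap_mem' c := hasDerivAt_const 0 c

/-- As the connection preserves the symplectic form, the bivector field is stationary in a frame
that is parallel to first order. -/
lemma hasDerivAt_parPoisson (hΩ : IsSymplectic Ω) {cov : TangentConnection d M}
    (hcov : IsSymplecticConnection Ω cov) (p : M) (v : TangentSpace (𝓡 d) p) (i j : Fin d) :
    HasDerivAt (fun t => parPoisson Ω cov p v t i j) 0 0 := by
  set Γ := connMatrix cov p v with hΓ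
  have hO : ∀ a b, HasDerivAt (fun t => formMatrix Ω p (coordLine p v t) a b)
      ((Γ.transpose * formMatrix Ω p p + formMatrix Ω p p * Γ) a b) 0 := by
    intro a b
    have h1 := hasDerivAt_coordLine p v (smoothOn_mdifferentiableAt (x₀ := p)
      (contMDiffOn_formMatrix hΩ p a b) (mem_source_self p))
    refine h1.congr_deriv ?_
    have h := hcov.parallel (coordField p a) (coordField p b) p
      (mdifferentiableAt_coordField (mem_source_self p) a)
      (mdifferentiableAt_coordField (mem_source_self p) b) v
    refine h.trans ?_
    rw [Matrix.add_apply, Matrix.mul_apply, Matrix.mul_apply]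
    congr 1
    · rw [vec_eq_sum_stdVec (cov (coordField p a) p v), map_sum, sum_apply]
      refine Finset.sum_congr rfl fun e _ => ?_
      rw [map_smul, ← coordField_self]
      rfl
    · rw [vec_eq_sum_stdVec (cov (coordField p b) p v), map_sum]
      refine Finset.sum_congr rfl fun e _ => ?_
      rw [map_smul, ← coordField_self, smul_eq_mul, mul_comm]
      rfl
  have hB : ∀ a b, (fun t => ((parFrame cov p v t).transpose *
      formMatrix Ω p (coordLine p v t) * parFrame cov p v t) a b) ∈ stationary := by
    intro a b
    have hΨ := hasDerivAt_parFrame cov p v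
    simp only [Matrix.mul_apply, Matrix.transpose_apply]
    have h1 := HasDerivAt.fun_sum fun e (_ : e ∈ Finset.univ) => (HasDerivAt.fun_sum
      fun c (_ : c ∈ Finset.univ) => (hΨ c a).mul (hO c e)).mul (hΨ e b)
    refine h1.congr_deriv ?_
    rw [parFrame_zero, coordLine_zero]
    have h2 : (((-Γ).transpose * formMatrix Ω p p + (1 : Matrix (Fin d) (Fin d) ℝ).transpose *
        (Γ.transpose * formMatrix Ω p p + formMatrix Ω p p * Γ)) * (1 : Matrix (Fin d) (Fin d) ℝ) +
        (1 : Matrix (Fin d) (Fin d) ℝ).transpose * formMatrix Ω p p * (-Γ) : Matrix (Fin d) (Fin d)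
          ℝ) a b = 0 := by
      rw [Matrix.transpose_one, Matrix.one_mul, Matrix.one_mul, Matrix.mul_one,
          Matrix.transpose_neg,
        Matrix.neg_mul, Matrix.mul_neg, neg_add_cancel_left, add_neg_cancel, Matrix.zero_apply]
    refine Eq.trans ?_ h2
    rw [Matrix.add_apply, Matrix.mul_apply, Matrix.mul_apply, ← Finset.sum_add_distrib]
    refine Finset.sum_congr rfl fun e _ => ?_
    rw [Matrix.add_apply, Matrix.mul_apply, Matrix.mul_apply, Matrix.mul_apply,
      ← Finset.sum_add_distrib]
    simp only [Pi.mul_apply, parFrame_zero, coordLine_zero]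
    rfl
  have hdet : (fun t => ((parFrame cov p v t).transpose *
      formMatrix Ω p (coordLine p v t) * parFrame cov p v t).det⁻¹) ∈ stationary := by
    have h := det_mem hB
    have h2 : HasDerivAt _ _ (0 : ℝ) := HasDerivAt.fun_inv (c := fun t => ((parFrame cov p v
        t).transpose *
      formMatrix Ω p (coordLine p v t) * parFrame cov p v t).det) h ?_
    · simpa using! h2
    · rw [parFrame_zero, coordLine_zero, Matrix.transpose_one, Matrix.one_mul, Matrix.mul_one]
      exact (isUnit_det_formMatrix_self hΩ p).ne_zero
  exact inv_mem hB hdet i j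

lemma eventually_starL_parDual (Ω : BilinField d M) (cov : TangentConnection d M) (p : M)
    (v : TangentSpace (𝓡 d) p) (a b : WeylSection M d) : ∀ᶠ t in nhds (0 : ℝ),
      starL (parPoisson Ω cov p v t) (parDual cov p v a t) (parDual cov p v b t) =
        parDual cov p v (moyal (poisson Ω) a b) t := by
  filter_upwards [eventually_parPoisson Ω cov p v] with t ht
  rw [parDual_eq, parDual_eq, parDual_eq, starL_frame, ht, dualW_moyal]

lemma HasDerivL.congr_of_eventually {V : Type*} [AddCommGroup V] [Module ℝ V]
    {l k : ℝ → (V →ₗ[ℝ] PowerSeries ℝ)} {l' : V →ₗ[ℝ] PowerSeries ℝ} (h : HasDerivL l l')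
    (e : ∀ᶠ t in nhds (0 : ℝ), k t = l t) : HasDerivL k l' := fun g N =>
  (h g N).congr_of_eventuallyEq (by filter_upwards [e] with t ht; rw [ht])

lemma HasDerivL.unique {V : Type*} [AddCommGroup V] [Module ℝ V]
    {l : ℝ → (V →ₗ[ℝ] PowerSeries ℝ)} {l' k' : V →ₗ[ℝ] PowerSeries ℝ} (h : HasDerivL l l')
    (k : HasDerivL l k') : l' = k' := LinearMap.ext fun g => (h g).unique (k g)

/-- A symplectic connection is a derivation of the fibrewise Moyal product. -/
lemma dualW_nabla_moyal (hΩ : IsSymplectic Ω) {cov : TangentConnection d M}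
    (hcov : IsSymplecticConnection Ω cov) (V : Π p : M, TangentSpace (𝓡 d) p) (p : M)
    {a b : WeylSection M d} (ha : IsSmooth a) (hb : IsSmooth b) :
    dualW (atPt p (nabla cov V (moyal (poisson Ω) a b))) =
      starL (poisson Ω p) (dualW (atPt p (nabla cov V a))) (dualW (atPt p b)) +
      starL (poisson Ω p) (dualW (atPt p a)) (dualW (atPt p (nabla cov V b))) := by
  have h1 := hasDerivL_nabla cov V _ p (isSmooth_moyal hΩ ha hb p)
  have h2 := HasDerivL.starL (hasDerivAt_parPoisson hΩ hcov p (V p))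
    (hasDerivL_nabla cov V a p (ha p)) (hasDerivL_nabla cov V b p (hb p))
  have h3 := h2.congr_of_eventually (k := parDual cov p (V p) (moyal (poisson Ω) a b)) (by
    filter_upwards [eventually_starL_parDual Ω cov p (V p) a b] with t ht using ht.symm)
  refine (h1.unique h3).trans ?_
  have ea := parDual_zero cov p (V p) a
  have eb := parDual_zero cov p (V p) b
  rw [parDual] at ea eb
  rw [ea, eb, parPoisson_zero]

end Charts

/-! ### Weights and commutators with linear forms -/

section Commutator

variable {d : ℕ}

lemma starL_smul_left (Pi : Matrix (Fin d) (Fin d) ℝ) (c : PowerSeries ℝ) (a b : WeylDual d) :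
    starL Pi (c • a) b = c • starL Pi a b := by
  rw [← starB_apply, map_smul, LinearMap.smul_apply, starB_apply]

lemma starL_smul_right (Pi : Matrix (Fin d) (Fin d) ℝ) (c : PowerSeries ℝ) (a b : WeylDual d) :
    starL Pi a (c • b) = c • starL Pi a b := by
  rw [← starB_apply, map_smul, starB_apply]

/-- The Moyal commutator is divisible by `ħ`. -/
lemma coeff_zero_commL (Pi : Matrix (Fin d) (Fin d) ℝ) (a b : WeylDual d)
    (f : MvPolynomial (Fin d) ℝ) : PowerSeries.coeff 0 (commL Pi a b f) = 0 := by
  have h : ∀ (Q : Matrix (Fin d) (Fin d) ℝ), PowerSeries.coeff 0 (starL Q a b f) =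
      PowerSeries.coeff 0 (tensor ![a, b] (diag f)) := by
    intro Q
    rw [starL_apply, corr_apply, coeff_hExt]
    simp [expH, PowerSeries.coeff_mul_C]
  rw [commL, LinearMap.sub_apply, map_sub, h, starL_swap, h, sub_self]

/-- A functional vanishes below weight `w` if it pairs to zero with all terms `ħ^N y^m` of
weight `2 N + |m| < w`. -/
def VanishBelow (w : ℕ) (a : WeylDual d) : Prop :=
  ∀ N m, 2 * N + m.degree < w → PowerSeries.coeff N (a (MvPolynomial.monomial m 1)) = 0

lemma coeff_prod_eq_zero {P : Type*} (S : Finset P) (φ : P → PowerSeries ℝ) (w : P → ℕ)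
    (h : ∀ α ∈ S, ∀ N, 2 * N < w α → PowerSeries.coeff N (φ α) = 0) (N : ℕ)
    (hN : 2 * N < ∑ α ∈ S, w α) : PowerSeries.coeff N (∏ α ∈ S, φ α) = 0 := by
  classical
  induction S using Finset.induction_on generalizing N with
  | empty => simp at hN
  | insert β S hβ ih =>
    rw [Finset.prod_insert hβ, PowerSeries.coeff_mul]
    rw [Finset.sum_insert hβ] at hN
    refine Finset.sum_eq_zero fun x hx => ?_
    rw [Finset.HasAntidiagonal.mem_antidiagonal] at hx
    by_cases h1 : 2 * x.1 < w β
    · rw [h β (Finset.mem_insert_self _ _) _ h1, zero_mul]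
    · rw [ih (fun α hα => h α (Finset.mem_insert_of_mem hα)) x.2 (by omega), mul_zero]

lemma VanishBelow.tensor {P : Type*} [Fintype P] [DecidableEq P] {lam : P → WeylDual d} {w : P → ℕ}
    (h : ∀ α, VanishBelow (w α) (lam α)) {D N : ℕ} {g : MvPolynomial (P × Fin d) ℝ}
    (hg : g.IsHomogeneous D) (hN : 2 * N + D < ∑ α, w α) :
    PowerSeries.coeff N (Fedosov.tensor lam g) = 0 := by
  have hg' : g = ∑ m ∈ g.support, MvPolynomial.coeff m g • MvPolynomial.monomial m (1 : ℝ) := by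
    conv_lhs => rw [MvPolynomial.as_sum g]
    simp [MvPolynomial.smul_monomial]
  rw [hg', map_sum, map_sum]
  refine Finset.sum_eq_zero fun m hm => ?_
  rw [map_smul, PowerSeries.coeff_smul, tensor_monomial]
  have hD : ∑ α, (slice m α).degree = D := by
    have := hg (MvPolynomial.mem_support_iff.1 hm)
    have h1 : Finsupp.weight 1 m = m.degree := (DFunLike.congr_fun Finsupp.degree_eq_weight_one
        m).symm
    rw [← this, h1, Finsupp.degree_eq_sum, Fintype.sum_prod_type]
    simp only [Finsupp.degree_eq_sum, slice_apply]
  rw [coeff_prod_eq_zero Finset.univ _ (fun α => w α - (slice m α).degree), smul_zero]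
  · intro α _ K hK
    exact h α K _ (by omega)
  · have : ∑ α, w α ≤ ∑ α, (w α - (slice m α).degree) + ∑ α, (slice m α).degree := by
      rw [← Finset.sum_add_distrib]
      exact Finset.sum_le_sum fun α _ => by omega
    omega

lemma VanishBelow.coeff_eq_zero {a : WeylDual d} {w : ℕ} (h : VanishBelow w a) {D N : ℕ}
    {g : MvPolynomial (Fin d) ℝ} (hg : g.IsHomogeneous D) (hN : 2 * N + D < w) :
    PowerSeries.coeff N (a g) = 0 := by
  have hg' : g = ∑ m ∈ g.support, MvPolynomial.coeff m g • MvPolynomial.monomial m (1 : ℝ) := by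
    conv_lhs => rw [MvPolynomial.as_sum g]
    simp [MvPolynomial.smul_monomial]
  rw [hg', map_sum, map_sum]
  refine Finset.sum_eq_zero fun m hm => ?_
  have h1 : Finsupp.weight 1 m = m.degree := (DFunLike.congr_fun Finsupp.degree_eq_weight_one
      m).symm
  have hD := hg (MvPolynomial.mem_support_iff.1 hm)
  rw [h1] at hD
  rw [map_smul, PowerSeries.coeff_smul, h N m (by omega), smul_zero]

lemma VanishBelow.frame (Φ : Matrix (Fin d) (Fin d) ℝ) {a : WeylDual d} {w : ℕ}
    (h : VanishBelow w a) : VanishBelow w (Fedosov.frame Φ a) := by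
  intro N m hN
  rw [Fedosov.frame, LinearMap.comp_apply]
  refine h.coeff_eq_zero ?_ hN
  rw [AlgHom.toLinearMap_apply, MvPolynomial.monomial_eq, map_one, one_mul, Finsupp.prod, map_prod]
  simp only [map_pow]
  refine MvPolynomial.IsHomogeneous.prod _ _ _ fun i _ => ?_
  have h1 : (linSubst (fun j i => Φ i j) (MvPolynomial.X i)).IsHomogeneous 1 := by
    rw [linSubst_X]
    refine MvPolynomial.IsHomogeneous.sum _ _ _ fun j _ => ?_
    simpa using (MvPolynomial.isHomogeneous_C (Fin d) (Φ j i)).mul (MvPolynomial.isHomogeneous_X ℝ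
        j)
  simpa using h1.pow (m i)

lemma isHomogeneous_bsym {P : Type*} (Pi : Matrix (Fin d) (Fin d) ℝ) (α β : P) :
    (bsym Pi α β).IsHomogeneous 2 := by
  unfold bsym
  refine MvPolynomial.IsHomogeneous.sum _ _ _ fun i _ => MvPolynomial.IsHomogeneous.sum _ _ _ fun j
      _ => ?_
  simpa using (MvPolynomial.isHomogeneous_C _ (Pi i j)).mul
    ((MvPolynomial.isHomogeneous_X ℝ (α, i)).mul (MvPolynomial.isHomogeneous_X ℝ (β, j)))

lemma isHomogeneous_diag_monomial (m : Fin d →₀ ℕ) :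
    (diag (MvPolynomial.monomial m (1 : ℝ))).IsHomogeneous m.degree := by
  rw [MvPolynomial.monomial_eq, map_one, one_mul, Finsupp.prod, map_prod]
  simp only [map_pow]
  refine MvPolynomial.IsHomogeneous.prod _ _ _ fun i _ => ?_
  have h : (diag (MvPolynomial.X i) : MvPolynomial (Fin 2 × Fin d) ℝ).IsHomogeneous 1 := by
    simpa [diag] using (MvPolynomial.isHomogeneous_X ℝ ((0 : Fin 2), i)).add
      (MvPolynomial.isHomogeneous_X ℝ ((1 : Fin 2), i))
  simpa using h.pow (m i)

/-- The Moyal product is additive on weights. -/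
lemma VanishBelow.starL (Pi : Matrix (Fin d) (Fin d) ℝ) {a b : WeylDual d} {v w : ℕ}
    (ha : VanishBelow v a) (hb : VanishBelow w b) : VanishBelow (v + w) (Fedosov.starL Pi a b) := by
  intro N m hN
  rw [starL_apply, corr_apply, coeff_hExt]
  refine Finset.sum_eq_zero fun x hx => ?_
  rw [Finset.HasAntidiagonal.mem_antidiagonal] at hx
  rw [PowerSeries.coeff_mul_C, expH, PowerSeries.coeff_mk, smul_mul_assoc, map_smul,
    PowerSeries.coeff_smul, smul_pow, smul_mul_assoc, map_smul, PowerSeries.coeff_smul]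
  have hg := ((isHomogeneous_bsym Pi (0 : Fin 2) 1).pow x.1).mul (isHomogeneous_diag_monomial m)
  rw [VanishBelow.tensor (w := ![v, w]) ?_ hg ?_, smul_zero, smul_zero]
  · intro α
    fin_cases α
    · exact ha
    · exact hb
  · simp
    omega

lemma commL_add_left (Pi : Matrix (Fin d) (Fin d) ℝ) (a b c : WeylDual d) :
    Fedosov.commL Pi (a + b) c = Fedosov.commL Pi a c + Fedosov.commL Pi b c := by
  simp only [Fedosov.commL, ← starB_apply, map_add, LinearMap.add_apply]
  abel

lemma VanishBelow.commL (Pi : Matrix (Fin d) (Fin d) ℝ) {a b : WeylDual d} {v w : ℕ}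
    (ha : VanishBelow v a) (hb : VanishBelow w b) : VanishBelow (v + w) (Fedosov.commL Pi a b) := by
  intro N m hN
  rw [Fedosov.commL, LinearMap.sub_apply, map_sub, VanishBelow.starL Pi ha hb N m hN,
    VanishBelow.starL Pi hb ha N m (by omega), sub_self]

/-- The linear form `∑ cᵢ yⁱ` as a functional. -/
def linForm (c : Fin d → ℝ) : WeylDual d where
  toFun f := PowerSeries.C (∑ i, c i * MvPolynomial.coeff (Finsupp.single i 1) f)
  map_add' f g := by simp [mul_add, Finset.sum_add_distrib]
  map_smul' r f := by
    simp only [MvPolynomial.coeff_smul, smul_eq_mul, RingHom.id_apply]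
    rw [PowerSeries.smul_eq_C_mul, ← map_mul, Finset.mul_sum]
    congr 1
    exact Finset.sum_congr rfl fun i _ => by ring

/-- Restriction to zero of the first of two points. -/
def firstZero : MvPolynomial (Fin 2 × Fin d) ℝ →ₐ[ℝ] MvPolynomial (Fin d) ℝ :=
  MvPolynomial.aeval fun x => if x.1 = 0 then 0 else MvPolynomial.X x.2

lemma coeff_single_one_eq (f : MvPolynomial (Fin d) ℝ) (i : Fin d) :
    MvPolynomial.coeff (Finsupp.single i 1) f = 
      MvPolynomial.constantCoeff (MvPolynomial.pderiv i f) := by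
  rw [MvPolynomial.constantCoeff_eq, MvPolynomial.coeff_pderiv]
  simp

/-- A linear form contributes the terms of the symbol which are linear in its variables. -/
lemma tensor_linForm (c : Fin d → ℝ) (a : WeylDual d) (g : MvPolynomial (Fin 2 × Fin d) ℝ) :
    tensor ![linForm c, a] g =
      ∑ i, c i • a (firstZero (MvPolynomial.pderiv ((0 : Fin 2), i) g)) := by
  have h : tensor ![linForm c, a] = ∑ i, c i • a.comp (firstZero.toLinearMap.comp
      (MvPolynomial.pderiv (R := ℝ) ((0 : Fin 2), i)).toLinearMap) := by
    refine linearMap_ext_monomial fun m => ?_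
    rw [monomial_eq_prod_slice, tensor_prod, Fin.prod_univ_two, Fin.prod_univ_two]
    generalize MvPolynomial.monomial (slice m 0) (1 : ℝ) = g₀
    generalize MvPolynomial.monomial (slice m 1) (1 : ℝ) = g₁
    have h0 : ∀ i, firstZero (MvPolynomial.pderiv ((0 : Fin 2), i)
        (MvPolynomial.rename (Prod.mk (0 : Fin 2)) g₀ * MvPolynomial.rename (Prod.mk 1) g₁)) =
        MvPolynomial.coeff (Finsupp.single i 1) g₀ • g₁ := by
      intro i
      have e1 : MvPolynomial.pderiv ((0 : Fin 2), i) (MvPolynomial.rename (Prod.mk (1 : Fin 2)) g₁)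
          =
          0 := by
        refine MvPolynomial.pderiv_eq_zero_of_notMem_vars fun hm => ?_
        have := MvPolynomial.vars_rename (Prod.mk (1 : Fin 2)) g₁ hm
        simp at this
      have e2 : MvPolynomial.pderiv ((0 : Fin 2), i) (MvPolynomial.rename (Prod.mk (0 : Fin 2)) g₀)
          =
          MvPolynomial.rename (Prod.mk (0 : Fin 2)) (MvPolynomial.pderiv i g₀) :=
        MvPolynomial.pderiv_rename (Prod.mk_right_injective _) _ _
      have e3 : ∀ g : MvPolynomial (Fin d) ℝ,
          firstZero (MvPolynomial.rename (Prod.mk (0 : Fin 2)) g) =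
            MvPolynomial.C (MvPolynomial.constantCoeff g) := by
        intro g
        rw [firstZero, MvPolynomial.aeval_rename]
        have : ((fun x : Fin 2 × Fin d => if x.1 = 0 then (0 : MvPolynomial (Fin d) ℝ) else
          MvPolynomial.X x.2) ∘ Prod.mk (0 : Fin 2)) = 0 := by funext i; simp
        rw [this, MvPolynomial.aeval_zero]
        rfl
      have e4 : ∀ g : MvPolynomial (Fin d) ℝ,
          firstZero (MvPolynomial.rename (Prod.mk (1 : Fin 2)) g) = g := by
        intro g
        rw [firstZero, MvPolynomial.aeval_rename]
        have : ((fun x : Fin 2 × Fin d => if x.1 = 0 then (0 : MvPolynomial (Fin d) ℝ) else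
          MvPolynomial.X x.2) ∘ Prod.mk (1 : Fin 2)) = MvPolynomial.X := by funext i; simp
        rw [this, MvPolynomial.aeval_X_left_apply]
      rw [Derivation.leibniz, e1, e2, smul_zero, zero_add, smul_eq_mul, map_mul, e3, e4,
        coeff_single_one_eq, MvPolynomial.smul_eq_C_mul, mul_comm]
    simp only [LinearMap.sum_apply, LinearMap.smul_apply, LinearMap.comp_apply]
    have h1 : ∀ i, a (firstZero.toLinearMap ((MvPolynomial.pderiv (R := ℝ)
        ((0 : Fin 2), i)).toLinearMap (MvPolynomial.rename (Prod.mk (0 : Fin 2)) g₀ *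
          MvPolynomial.rename (Prod.mk 1) g₁))) = MvPolynomial.coeff (Finsupp.single i 1) g₀ • a g₁
            := by
      intro i
      rw [← map_smul, ← h0]
      rfl
    simp only [h1]
    have h2 : (linForm c) g₀ =
      PowerSeries.C (∑ i, c i * MvPolynomial.coeff (Finsupp.single i 1) g₀) := rfl
    change linForm c g₀ * a g₁ = _
    rw [h2, ← PowerSeries.smul_eq_C_mul, Finset.sum_smul]
    simp only [smul_smul]
  rw [h]
  simp only [LinearMap.sum_apply, LinearMap.smul_apply, LinearMap.comp_apply]
  rfl

/-- The Moyal product with a linear form has only the terms of orders zero and one. -/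
lemma starL_linForm (Pi : Matrix (Fin d) (Fin d) ℝ) (c : Fin d → ℝ) (a : WeylDual d)
    (f : MvPolynomial (Fin d) ℝ) :
    starL Pi (linForm c) a f = ∑ i, c i • a (MvPolynomial.pderiv i f) +
      PowerSeries.X * ((1 / 2 : ℝ) • ∑ i, ∑ j, (c i * Pi i j) • a (MvPolynomial.X j * f)) := by
  have hdiag : firstZero (diag f) = f := by
    have : (firstZero (d := d)).comp diag = AlgHom.id ℝ _ :=
      MvPolynomial.algHom_ext fun i => by simp [firstZero, diag]
    exact DFunLike.congr_fun this f
  have hb : firstZero (bsym Pi (0 : Fin 2) 1) = 0 := by simp [firstZero, bsym]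
  have hdb : ∀ i, firstZero (MvPolynomial.pderiv ((0 : Fin 2), i) (bsym Pi (0 : Fin 2) 1)) =
      ∑ j, MvPolynomial.C (Pi i j) * MvPolynomial.X j := by
    intro i
    have : ∀ a b, MvPolynomial.pderiv ((0 : Fin 2), i) (MvPolynomial.C (Pi a b) *
        (MvPolynomial.X ((0 : Fin 2), a) * MvPolynomial.X ((1 : Fin 2), b))) =
        if a = i then MvPolynomial.C (Pi a b) * MvPolynomial.X ((1 : Fin 2), b) else 0 := by
      intro a b
      rw [MvPolynomial.pderiv_C_mul, Derivation.leibniz, MvPolynomial.pderiv_X_of_ne (by simp),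
        smul_zero, zero_add]
      split_ifs with h
      · rw [h, MvPolynomial.pderiv_X_self, smul_eq_mul, mul_one]
      · rw [MvPolynomial.pderiv_X_of_ne (by simpa using h), smul_zero, mul_zero]
    simp only [bsym, map_sum, this]
    rw [Finset.sum_eq_single i (fun a _ ha => by simp [ha]) (by simp)]
    simp [firstZero]
  have hdiag' : ∀ g : MvPolynomial (Fin d) ℝ, firstZero (diag g) = g := by
    intro g
    have : (firstZero (d := d)).comp diag = AlgHom.id ℝ _ :=
      MvPolynomial.algHom_ext fun i => by simp [firstZero, diag]
    exact DFunLike.congr_fun this g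
  have hdd : ∀ i, firstZero (MvPolynomial.pderiv ((0 : Fin 2), i) (diag f)) =
      MvPolynomial.pderiv i f := by
    intro i
    clear hdiag
    induction f using MvPolynomial.induction_on with
    | C r => simp [MvPolynomial.algHom_C]
    | add p q hp hq => simp only [map_add, hp, hq]
    | mul_X p n hp =>
      have hX : firstZero (MvPolynomial.pderiv ((0 : Fin 2), i) (diag (MvPolynomial.X n))) =
          MvPolynomial.pderiv i (MvPolynomial.X n) := by
        classical
        simp [diag, MvPolynomial.pderiv_X, _root_.Pi.single_apply, firstZero, apply_ite]
      rw [map_mul, Derivation.leibniz, map_add, smul_eq_mul, smul_eq_mul, map_mul, map_mul, hX, hp,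
        hdiag', hdiag', Derivation.leibniz, smul_eq_mul, smul_eq_mul]
  have hk : ∀ k i, firstZero (MvPolynomial.pderiv ((0 : Fin 2), i)
      ((bsym Pi (0 : Fin 2) 1) ^ (k + 2) * diag f)) = 0 := by
    intro k i
    rw [Derivation.leibniz, Derivation.leibniz_pow]
    simp [hb]
  set F : PowerSeries (MvPolynomial (Fin 2 × Fin d) ℝ) :=
    expH ((1 / 2 : ℝ) • bsym Pi 0 1) * PowerSeries.C (diag f) with hF
  have hFk : ∀ k, PowerSeries.coeff k F = ((k.factorial : ℝ)⁻¹ * (1 / 2) ^ k) •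
      (bsym Pi (0 : Fin 2) 1 ^ k * diag f) := by
    intro k
    rw [hF, PowerSeries.coeff_mul_C, expH, PowerSeries.coeff_mk, smul_pow, smul_smul,
      smul_mul_assoc]
  -- terms of order at least two in `ħ` have degree at least two in the variables of the linear form
  have hsplit : F = PowerSeries.C (PowerSeries.coeff 0 F) + PowerSeries.X *
      (PowerSeries.C (PowerSeries.coeff 1 F) + PowerSeries.X *
        PowerSeries.mk fun k => PowerSeries.coeff (k + 2) F) := by
    ext1 k
    match k with
    | 0 => simp
    | 1 => simp [PowerSeries.coeff_succ_X_mul]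
    | k + 2 =>
      rw [map_add, PowerSeries.coeff_succ_X_mul, map_add, PowerSeries.coeff_succ_X_mul,
        PowerSeries.coeff_mk]
      simp
  have h2 : hExt (tensor ![linForm c, a]) (PowerSeries.mk fun k => PowerSeries.coeff (k + 2) F) =
      0 := by
    ext N
    rw [coeff_hExt, map_zero]
    refine Finset.sum_eq_zero fun x _ => ?_
    rw [PowerSeries.coeff_mk, hFk, map_smul, tensor_linForm]
    simp only [hk, map_zero, smul_zero, Finset.sum_const_zero]
  rw [starL_apply, corr_apply, ← hF, hsplit, map_add, hExt_C, hExt_X_mul, map_add, hExt_C,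
    hExt_X_mul, h2, mul_zero, add_zero, hFk, hFk, map_smul, map_smul, tensor_linForm,
    tensor_linForm]
  have h1 : ∀ i, firstZero (MvPolynomial.pderiv ((0 : Fin 2), i)
      ((bsym Pi (0 : Fin 2) 1) ^ 1 * diag f)) =
        ∑ j, Pi i j • (MvPolynomial.X j * f) := by
    intro i
    rw [pow_one, Derivation.leibniz, smul_eq_mul, smul_eq_mul, map_add, map_mul, map_mul, hb, hdb,
      hdiag, zero_mul, zero_add, Finset.mul_sum]
    exact Finset.sum_congr rfl fun j _ => by rw [MvPolynomial.smul_eq_C_mul]; ring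
  simp only [h1, pow_zero, one_mul, hdd, map_sum, map_smul, Finset.smul_sum, smul_smul]
  norm_num

/-- The commutator with a linear form is `ħ` times a Hamiltonian derivative. -/
lemma commL_linForm {Pi : Matrix (Fin d) (Fin d) ℝ} (hPi : Pi.transpose = -Pi) (c : Fin d → ℝ)
    (a : WeylDual d) (f : MvPolynomial (Fin d) ℝ) :
    commL Pi (linForm c) a f =
      PowerSeries.X * ∑ i, ∑ j, (c i * Pi i j) • a (MvPolynomial.X j * f) := by
  have h2 : commL Pi (linForm c) a f = starL Pi (linForm c) a f - starL (-Pi) (linForm c) a f := by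
    rw [commL, LinearMap.sub_apply, starL_swap Pi a, hPi]
  rw [h2, starL_linForm, starL_linForm, add_sub_add_left_eq_sub, ← mul_sub, ← smul_sub]
  congr 1
  simp only [Matrix.neg_apply, mul_neg, neg_smul, Finset.sum_neg_distrib, sub_neg_eq_add]
  rw [← two_smul ℝ, smul_smul]
  norm_num

end Commutator

/-! ### Flat sections -/

section Flat

variable {d : ℕ} {M : Type*} [TopologicalSpace M] [ChartedSpace (EuclideanSpace ℝ (Fin d)) M]
  [IsManifold (𝓡 d) ∞ M]

lemma atPt_along (γ : WeylOneForm d M) (V : Π p : M, TangentSpace (𝓡 d) p) (p : M) :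
    atPt p (γ.along V) = γ p (V p) := by
  ext1 N
  rw [coeff_atPt, WeylOneForm.along, PowerSeries.coeff_mk]

lemma dualW_X_mul {σ : Type*} (A : PowerSeries (MvPowerSeries σ ℝ)) :
    dualW (PowerSeries.X * A) = (PowerSeries.X : PowerSeries ℝ) • dualW A := by
  refine LinearMap.ext fun f => ?_
  ext N
  rw [LinearMap.smul_apply, smul_eq_mul, coeff_dualW]
  cases N with
  | zero => simp [← pairHom_apply]
  | succ N => rw [PowerSeries.coeff_succ_X_mul, PowerSeries.coeff_succ_X_mul, coeff_dualW]

lemma vanishBelow_dualW (w : ℕ) (A : PowerSeries (MvPowerSeries (Fin d) ℝ)) :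
    VanishBelow w (dualW A) ↔
      ∀ N m, 2 * N + m.degree < w → MvPowerSeries.coeff m (PowerSeries.coeff N A) = 0 := by
  refine forall_congr' fun N => forall_congr' fun m => imp_congr_right fun _ => ?_
  rw [coeff_dualW, pair_monomial, one_mul]
  exact mul_eq_zero_iff_left (multiFactorial_ne_zero m)

lemma dualW_linForm (c : Fin d → ℝ) : dualW (PowerSeries.C (∑ i, MvPowerSeries.C (c i) *
    (MvPowerSeries.X i : MvPowerSeries (Fin d) ℝ))) = linForm c := by
  have h1 : ∀ g : MvPolynomial (Fin d) ℝ, pair 1 g = MvPolynomial.constantCoeff g := by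
    intro g
    have : pair (1 : MvPowerSeries (Fin d) ℝ) =
        (MvPolynomial.aeval (R := ℝ) (fun _ : Fin d => (0 : ℝ))).toLinearMap := by
      classical
      refine linearMap_ext_monomial fun m => ?_
      rw [pair_monomial, MvPowerSeries.coeff_one, AlgHom.toLinearMap_apply,
        MvPolynomial.aeval_monomial, map_one, one_mul, one_mul]
      split_ifs with h
      · simp [h, multiFactorial]
      · obtain ⟨i, hi⟩ := Finsupp.ne_iff.1 h
        rw [mul_zero]
        exact (Finset.prod_eq_zero (i := i) (Finsupp.mem_support_iff.2 hi) (zero_pow hi)).symm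
    rw [this, AlgHom.toLinearMap_apply, MvPolynomial.aeval_zero']
    rfl
  refine LinearMap.ext fun f => ?_
  ext N
  have h2 : linForm c f = PowerSeries.C (∑ i, c i * MvPolynomial.coeff (Finsupp.single i 1) f) :=
      rfl
  rw [coeff_dualW, h2, PowerSeries.coeff_C, PowerSeries.coeff_C]
  split_ifs
  · rw [← pairHom_apply, map_sum, LinearMap.sum_apply]
    refine Finset.sum_congr rfl fun i _ => ?_
    rw [← MvPowerSeries.smul_eq_C_mul, map_smul, LinearMap.smul_apply, pairHom_apply,
      ← mul_one (MvPowerSeries.X i), pair_X_mul_apply, h1, coeff_single_one_eq, smul_eq_mul]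
  · simp [← pairHom_apply]

lemma dualW_zero {σ : Type*} : dualW (0 : PowerSeries (MvPowerSeries σ ℝ)) = 0 := by
  refine LinearMap.ext fun f => ?_
  ext N
  rw [coeff_dualW]
  simp [← pairHom_apply]

variable {Ω : BilinField d M}

/-- The value of a Fedosov one-form is a linear form plus terms of weight at least three. -/
lemma exists_leading {cov : TangentConnection d M} {Ωh : ℕ → BilinField d M} {γ : WeylOneForm d M}
    (hγ : IsFedosovSolution Ω cov Ωh γ) (p : M) (v : TangentSpace (𝓡 d) p) :
    ∃ r, VanishBelow 3 r ∧ dualW (γ p v) = linForm (fun i => Ω p (stdVec i p) v) + r := by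
  refine ⟨dualW (γ p v - PowerSeries.C (∑ i, MvPowerSeries.C (Ω p (stdVec i p) v) *
    (MvPowerSeries.X i : MvPowerSeries (Fin d) ℝ))), ?_, ?_⟩
  · rw [vanishBelow_dualW]
    intro N m h
    rw [map_sub, map_sub, hγ.leading p v N m h, sub_self]
  · rw [← dualW_linForm, ← dualW_add, add_sub_cancel]

lemma coeff_zero_moyalComm (Pi : M → Matrix (Fin d) (Fin d) ℝ) (a b : WeylSection M d) :
    PowerSeries.coeff 0 (moyalComm Pi a b) = 0 := by
  funext p
  refine pair_injective (LinearMap.ext fun f => ?_)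
  rw [← coeff_atPt, ← coeff_dualW, dualW_moyalComm, coeff_zero_commL]
  simp [← pairHom_apply]

/-- `ħ` times the covariant derivative `D`. -/
lemma dualW_fedosovD (cov : TangentConnection d M) (γ : WeylOneForm d M)
    (V : Π p : M, TangentSpace (𝓡 d) p) (a : WeylSection M d) (p : M) :
    (PowerSeries.X : PowerSeries ℝ) • dualW (atPt p (fedosovD Ω cov γ V a)) =
      (PowerSeries.X : PowerSeries ℝ) • dualW (atPt p (nabla cov V a)) +
        commL (poisson Ω p) (dualW (γ p (V p))) (dualW (atPt p a)) := by
  rw [← atPt_along, ← dualW_moyalComm, ← dualW_X_mul, ← dualW_X_mul, ← dualW_add]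
  congr 1
  ext1 N
  cases N with
  | zero =>
    rw [map_add, coeff_atPt, coeff_zero_moyalComm]
    simp
  | succ N =>
    rw [map_add, PowerSeries.coeff_succ_X_mul, PowerSeries.coeff_succ_X_mul, coeff_atPt,
      coeff_atPt, coeff_atPt, fedosovD, map_add, divHbar, PowerSeries.coeff_mk]
    rfl

/-- Multiplication by `ħ` is injective. -/
lemma X_smul_dualW_injective {A B : PowerSeries (MvPowerSeries (Fin d) ℝ)}
    (h : (PowerSeries.X : PowerSeries ℝ) • dualW A = (PowerSeries.X : PowerSeries ℝ) • dualW B) :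
    A = B := by
  rw [← dualW_X_mul, ← dualW_X_mul] at h
  have := dualW_injective h
  ext1 N
  rw [← PowerSeries.coeff_succ_X_mul, this, PowerSeries.coeff_succ_X_mul]

/-- The flatness equation, multiplied by `ħ`. -/
lemma IsFlatSection.dualW_nabla {cov : TangentConnection d M} {γ : WeylOneForm d M}
    {a : WeylSection M d} (ha : IsFlatSection Ω cov γ a) (V : Π p : M, TangentSpace (𝓡 d) p)
    (p : M) : (PowerSeries.X : PowerSeries ℝ) • dualW (atPt p (nabla cov V a)) =
      -commL (poisson Ω p) (dualW (γ p (V p))) (dualW (atPt p a)) := by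
  have h := dualW_fedosovD (Ω := Ω) cov γ V a p
  rw [ha.2 V, map_zero] at h
  rw [dualW_zero, smul_zero] at h
  exact eq_neg_of_add_eq_zero_left h.symm

/-- Flat sections are closed under the Moyal product. -/
lemma IsFlatSection.moyal (hΩ : IsSymplectic Ω) {cov : TangentConnection d M}
    (hcov : IsSymplecticConnection Ω cov) {γ : WeylOneForm d M} {a b : WeylSection M d}
    (ha : IsFlatSection Ω cov γ a) (hb : IsFlatSection Ω cov γ b) :
    IsFlatSection Ω cov γ (moyal (poisson Ω) a b) := by
  refine ⟨isSmooth_moyal hΩ ha.1 hb.1, fun V => atPt_ext fun p => X_smul_dualW_injective ?_⟩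
  rw [dualW_fedosovD, dualW_nabla_moyal hΩ hcov V p ha.1 hb.1, dualW_moyal, commL_starL, smul_add,
    ← starL_smul_left, ← starL_smul_right, ha.dualW_nabla V p, hb.dualW_nabla V p]
  simp only [← starB_apply, map_neg, LinearMap.neg_apply]
  rw [map_zero, dualW_zero, smul_zero]
  abel

/-- A flat section is determined by its symbol. -/
lemma IsFlatSection.eq_of_symbol (hΩ : IsSymplectic Ω) {cov : TangentConnection d M}
    {Ωh : ℕ → BilinField d M} {γ : WeylOneForm d M} (hγ : IsFedosovSolution Ω cov Ωh γ)
    {a b : WeylSection M d} (ha : IsFlatSection Ω cov γ a) (hb : IsFlatSection Ω cov γ b)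
    (h0 : symbol a = symbol b) : a = b := by
  set D : M → WeylDual d := fun p => dualW (atPt p a) - dualW (atPt p b) with hD
  -- Differentiation does not lower the weight, as the frame changes are homogeneous.
  have hnab : ∀ w, (∀ p, VanishBelow w (D p)) → ∀ V p,
      VanishBelow w (dualW (atPt p (nabla cov V a)) - dualW (atPt p (nabla cov V b))) := by
    intro w hw V p N m h
    have h1 := hasDerivL_nabla cov V a p (ha.1 p) (MvPolynomial.monomial m 1) N
    have h2 := hasDerivL_nabla cov V b p (hb.1 p) (MvPolynomial.monomial m 1) N
    rw [LinearMap.sub_apply, map_sub]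
    refine (h1.fun_sub h2).unique ?_
    have h3 : (fun t => PowerSeries.coeff N (frame (parFrame cov p (V p) t)
        (chartDual p (coordLine p (V p) t) a) (MvPolynomial.monomial m 1)) -
        PowerSeries.coeff N (frame (parFrame cov p (V p) t)
        (chartDual p (coordLine p (V p) t) b) (MvPolynomial.monomial m 1))) = fun _ => 0 := by
      funext t
      rw [← map_sub]
      exact ((hw (coordLine p (V p) t)).frame _).frame _ N m h
    rw [h3]
    exact hasDerivAt_const _ _
  -- induction on the weight: the leading part of `D` is the de Rham differential of the fibre, so
  -- that the terms of lowest weight of the difference of two flat sections are constant in `y`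
  have key : ∀ w p, VanishBelow w (D p) := by
    intro w
    induction w with
    | zero => intro p N m h; omega
    | succ w ih =>
      intro p N m h
      rcases Nat.lt_succ_iff_lt_or_eq.1 h with h | h
      · exact ih p N m h
      by_cases hm : m = 0
      · subst hm
        simp only [hD]
        rw [LinearMap.sub_apply, map_sub, coeff_dualW, pair_monomial, one_mul, coeff_atPt,
          coeff_dualW, pair_monomial, one_mul, coeff_atPt, ← mul_sub]
        have := congrFun (congrArg (PowerSeries.coeff N) h0) p
        rw [symbol, PowerSeries.coeff_map, PowerSeries.coeff_map] at this
        exact mul_eq_zero_of_right _ (sub_eq_zero.2 this)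
      obtain ⟨j, hj⟩ := Finsupp.ne_iff.1 hm
      obtain ⟨m', rfl⟩ : ∃ m', m = Finsupp.single j 1 + m' :=
        le_iff_exists_add.1 (Finsupp.single_le_iff.2 (Nat.one_le_iff_ne_zero.2 hj))
      have hdeg : (Finsupp.single j 1 + m').degree = 1 + m'.degree := by simp
      rw [hdeg] at h
      -- `z` collects the partial derivatives of the lowest terms
      set z : Fin d → ℝ := fun j => PowerSeries.coeff N
        (D p (MvPolynomial.X j * MvPolynomial.monomial m' 1)) with hz
      have hz0 : ∀ k, ∑ i, Ω p (stdVec i p) (stdVec k p) * ∑ j, poisson Ω p i j * z j = 0 := by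
        intro k
        have hflat : (PowerSeries.X : PowerSeries ℝ) • (dualW (atPt p (nabla cov (stdVec k) a)) -
            dualW (atPt p (nabla cov (stdVec k) b))) =
            -commL (poisson Ω p) (dualW (γ p (stdVec k p))) (D p) := by
          rw [smul_sub, ha.dualW_nabla, hb.dualW_nabla]
          simp only [hD, commL, ← starB_apply, map_sub, LinearMap.sub_apply]
          abel
        obtain ⟨r, hr, hlead⟩ := exists_leading hγ p (stdVec k p)
        have h1 := congrArg (fun l => PowerSeries.coeff (N + 1) (l (MvPolynomial.monomial m' 1)))
          hflat
        have hn := hnab w ih (stdVec k) p N m' (by omega)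
        rw [LinearMap.sub_apply, map_sub] at hn
        simp only [LinearMap.smul_apply, LinearMap.neg_apply, smul_eq_mul, map_neg,
          LinearMap.sub_apply, map_sub, PowerSeries.coeff_succ_X_mul] at h1
        rw [hn, hlead, commL_add_left, LinearMap.add_apply,
          map_add, VanishBelow.commL _ hr (ih p) (N + 1) m' (by omega),
          commL_linForm (poisson_transpose hΩ p), PowerSeries.coeff_succ_X_mul, add_zero] at h1
        rw [← neg_eq_zero, h1, map_sum]
        congr 1
        refine Finset.sum_congr rfl fun i _ => ?_
        rw [map_sum, Finset.mul_sum]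
        refine Finset.sum_congr rfl fun j _ => ?_
        rw [PowerSeries.coeff_smul, smul_eq_mul, mul_assoc]
      -- the symplectic form is nondegenerate
      have hz1 : Matrix.vecMul ((poisson Ω p).mulVec z) (formMatrix Ω p p) = 0 := by
        funext k
        rw [formMatrix_self]
        refine Eq.trans ?_ (hz0 k)
        simp only [Matrix.vecMul, dotProduct, Matrix.of_apply, Matrix.mulVec]
        exact Finset.sum_congr rfl fun i _ => mul_comm _ _
      have hu := isUnit_det_formMatrix_self hΩ p
      have hz2 : z = 0 := by
        have e1 : (poisson Ω p).mulVec z = 0 := by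
          have := congrArg (fun v => Matrix.vecMul v (formMatrix Ω p p)⁻¹) hz1
          simpa [Matrix.vecMul_vecMul, Matrix.mul_nonsing_inv _ hu] using this
        have := congrArg (formMatrix Ω p p).mulVec e1
        rw [poisson_eq, Matrix.mulVec_mulVec, Matrix.mul_nonsing_inv _ hu, Matrix.one_mulVec,
          Matrix.mulVec_zero] at this
        exact this
      have := congrFun hz2 j
      have e : MvPolynomial.monomial (Finsupp.single j 1 + m') (1 : ℝ) =
          MvPolynomial.X j * MvPolynomial.monomial m' 1 := by
        rw [MvPolynomial.X, MvPolynomial.monomial_mul, one_mul]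
      rw [e]
      exact this
  refine atPt_ext fun p => ?_
  rw [← sub_eq_zero]
  ext1 N
  ext1 m
  have h := key (2 * N + m.degree + 1) p
  simp only [hD] at h
  rw [← dualW_sub] at h
  rw [(vanishBelow_dualW _ _).1 h N m (by omega)]
  simp

lemma symbolInv_spec {cov : TangentConnection d M} {γ : WeylOneForm d M} {f : PowerSeries (M → ℝ)}
    (h : ∃ a, IsFlatSection Ω cov γ a ∧ symbol a = f) :
    IsFlatSection Ω cov γ (symbolInv Ω cov γ f) ∧ symbol (symbolInv Ω cov γ f) = f := by
  rw [symbolInv, dif_pos h]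
  exact h.choose_spec

/-- The flat section of a star product is the fibrewise product of the flat sections. -/
lemma symbolInv_star (hΩ : IsSymplectic Ω) {cov : TangentConnection d M}
    (hcov : IsSymplecticConnection Ω cov) {Ωh : ℕ → BilinField d M} {γ : WeylOneForm d M}
    (hγ : IsFedosovSolution Ω cov Ωh γ) {f g : PowerSeries (M → ℝ)}
    (hf : ∃ a, IsFlatSection Ω cov γ a ∧ symbol a = f)
    (hg : ∃ a, IsFlatSection Ω cov γ a ∧ symbol a = g) :
    symbolInv Ω cov γ (star Ω cov γ f g) =
      moyal (poisson Ω) (symbolInv Ω cov γ f) (symbolInv Ω cov γ g) := by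
  have h := (symbolInv_spec hf).1.moyal hΩ hcov (symbolInv_spec hg).1
  have h2 := symbolInv_spec (f := star Ω cov γ f g) ⟨_, h, rfl⟩
  exact h2.1.eq_of_symbol hΩ hγ h h2.2

end Flat

/-! ### The cocycle as an alternating form -/

section ThetaAlgebra

variable {d : ℕ}

/-- The cocycle as an alternating form in the one-form entries, over `ℝ[[ħ]]`. -/
def thetaAlt (Pi : Matrix (Fin d) (Fin d) ℝ) (x : WeylDual d) :
    (WeylDual d) [⋀^Fin d]→ₗ[PowerSeries ℝ] PowerSeries ℝ where
  toMultilinearMap := MultilinearMap.mk' (Theta Pi x)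
    (fun v k y z => by
      simp only [Theta, ← update_consPt_some, MultilinearMap.map_update_add, LinearMap.add_apply])
    (fun v k c y => by
      simp only [Theta, ← update_consPt_some, MultilinearMap.map_update_smul,
        LinearMap.smul_apply])
  map_eq_zero_of_eq' := by
    intro v k l hv hkl
    have h := Theta_comp_swap Pi x v hkl
    have e : v ∘ Equiv.swap k l = v := by
      funext m
      by_cases h1 : m = k
      · subst h1; simp [hv]
      · by_cases h2 : m = l
        · subst h2; simp [hv]
        · simp [Equiv.swap_apply_of_ne_of_ne h1 h2]
    rw [e] at h
    change Theta Pi x v = 0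
    ext N
    have := congrArg (PowerSeries.coeff N) h
    rw [map_neg] at this
    rw [map_zero]
    exact self_eq_neg.1 this

lemma thetaAlt_apply (Pi : Matrix (Fin d) (Fin d) ℝ) (x : WeylDual d) (v : Fin d → WeylDual d) :
    thetaAlt Pi x v = Theta Pi x v := rfl

lemma Theta_add_left (Pi : Matrix (Fin d) (Fin d) ℝ) (x y : WeylDual d) (v : Fin d → WeylDual d) :
    Theta Pi (x + y) v = Theta Pi x v + Theta Pi y v := by
  unfold Theta
  rw [← update_consPt_none x (x + y), MultilinearMap.map_update_add, update_consPt_none,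
      update_consPt_none,
    LinearMap.add_apply]

lemma Theta_smul_left (Pi : Matrix (Fin d) (Fin d) ℝ) (c : PowerSeries ℝ) (x : WeylDual d)
    (v : Fin d → WeylDual d) : Theta Pi (c • x) v = c * Theta Pi x v := by
  unfold Theta
  rw [← update_consPt_none x (c • x), MultilinearMap.map_update_smul, update_consPt_none,
    LinearMap.smul_apply, smul_eq_mul]

lemma Theta_update_smul (Pi : Matrix (Fin d) (Fin d) ℝ) (x : WeylDual d) (v : Fin d → WeylDual d)
    (k : Fin d) (c : PowerSeries ℝ) (y : WeylDual d) :
    Theta Pi x (Function.update v k (c • y)) = c * Theta Pi x (Function.update v k y) :=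
  (thetaAlt Pi x).map_update_smul v k c y

lemma Theta_update_sub (Pi : Matrix (Fin d) (Fin d) ℝ) (x : WeylDual d) (v : Fin d → WeylDual d)
    (k : Fin d) (y z : WeylDual d) :
    Theta Pi x (Function.update v k (y - z)) =
      Theta Pi x (Function.update v k y) - Theta Pi x (Function.update v k z) :=
  (thetaAlt Pi x).map_update_sub v k y z

lemma C_smul_dual (c : ℝ) (a : WeylDual d) : (PowerSeries.C c : PowerSeries ℝ) • a = c • a := by
  refine LinearMap.ext fun f => ?_
  rw [LinearMap.smul_apply, LinearMap.smul_apply, PowerSeries.smul_eq_C_mul, smul_eq_mul]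

/-- An alternating form in `d` entries scales by the determinant of a linear recombination. -/
lemma Theta_linear_combination (Pi : Matrix (Fin d) (Fin d) ℝ) (x : WeylDual d)
    (v : Fin d → WeylDual d) (F : Matrix (Fin d) (Fin d) ℝ) :
    Theta Pi x (fun l => ∑ m, F m l • v m) = F.det • Theta Pi x v := by
  set B := (thetaAlt Pi x).compLinearMap (Fintype.linearCombination (PowerSeries ℝ) v) with hB
  have h := B.eq_smul_basis_det (_root_.Pi.basisFun (PowerSeries ℝ) (Fin d))
  have h2 := congrArg (fun f => f (fun l m => PowerSeries.C (F m l))) h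
  have e1 : B (fun l m => PowerSeries.C (F m l)) = Theta Pi x (fun l => ∑ m, F m l • v m) := by
    rw [hB, AlternatingMap.compLinearMap_apply, thetaAlt_apply]
    congr 1
    funext l
    rw [Fintype.linearCombination_apply]
    exact Finset.sum_congr rfl fun m _ => C_smul_dual _ _
  have e2 : B (_root_.Pi.basisFun (PowerSeries ℝ) (Fin d)) = Theta Pi x v := by
    rw [hB, AlternatingMap.compLinearMap_apply, thetaAlt_apply]
    congr 1
    funext l
    simp [Fintype.linearCombination_apply, _root_.Pi.single_apply]
  have e3 : (_root_.Pi.basisFun (PowerSeries ℝ) (Fin d)).det (fun l m => PowerSeries.C (F m l)) =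
      PowerSeries.C F.det := by
    rw [_root_.Pi.basisFun_det_apply, ← Matrix.det_transpose, RingHom.map_det]
    rfl
  rw [← e1, h2, AlternatingMap.smul_apply, e3, e2, PowerSeries.smul_eq_C_mul, smul_eq_mul,
    mul_comm]

/-- The infinitesimal form of `Theta_linear_combination`, in the direction of one entry. -/
lemma sum_Theta_update_linear_combination (Pi : Matrix (Fin d) (Fin d) ℝ) (x b : WeylDual d)
    (v : Fin d → WeylDual d) (F : Matrix (Fin d) (Fin d) ℝ) (m : Fin d) :
    ∑ k, F m k • Theta Pi x (Function.update (fun l => ∑ m, F m l • v m) k b) =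
      F.det • Theta Pi x (Function.update v m b) := by
  have hl : ∀ (c : ℝ) (y : WeylDual d), HasDerivL (fun t => y + (t * c) • b) (c • b) := by
    intro c y f N
    simp only [LinearMap.add_apply, LinearMap.smul_apply, map_add, PowerSeries.coeff_smul,
      smul_eq_mul]
    simpa using! (((hasDerivAt_id (0 : ℝ)).mul_const c).mul_const
      (PowerSeries.coeff N (b f))).const_add (PowerSeries.coeff N (y f))
  have hx : HasDerivL (fun _ => x) 0 := fun f => HasDerivPS.const _
  -- differentiate `Theta_linear_combination` with `v m` replaced by `v m + t b`
  have h1 := HasDerivPS.Theta (Pi := fun _ => Pi) (fun i j => hasDerivAt_const 0 _) hx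
    (v := fun t l => (∑ m, F m l • v m) + (t * F m l) • b) fun l => hl (F m l) _
  have h2 := HasDerivPS.Theta (Pi := fun _ => Pi) (fun i j => hasDerivAt_const 0 _) hx
    (v := fun t l => v l + (t * if l = m then 1 else 0) • b) fun l => hl (if l = m then 1 else 0) _
  have h3 := HasDerivPS.smul (hasDerivAt_const 0 F.det) h2
  have e : (fun t : ℝ => Theta Pi x (fun l => (∑ m, F m l • v m) + (t * F m l) • b)) =
      fun t => F.det • Theta Pi x (fun l => v l + (t * if l = m then 1 else 0) • b) := by
    funext t
    rw [← Theta_linear_combination]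
    congr 1
    funext l
    simp only [smul_add, Finset.sum_add_distrib]
    congr 1
    simp only [smul_smul]
    rw [← Finset.sum_smul]
    congr 1
    simp [mul_comm]
  rw [e] at h1
  have h4 := h1.unique h3
  have hz : ∀ w, Theta Pi (0 : WeylDual d) w = 0 := by
    intro w
    have := Theta_smul_left Pi 0 (0 : WeylDual d) w
    rwa [zero_smul, zero_mul] at this
  simp only [hz, zero_add, zero_smul, ← C_smul_dual, zero_mul, add_zero,
    Theta_update_smul, ← PowerSeries.smul_eq_C_mul] at h4
  simp only [C_smul_dual] at h4
  rw [h4]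
  congr 1
  rw [Finset.sum_eq_single m]
  · simp
  · intro k _ hk; simp [hk]
  · simp

/-- The algebraic core of the trace property: the cocycle identity, with commutators with the
entries written as derivatives. -/
lemma Theta_commL_eq {Pi : Matrix (Fin d) (Fin d) ℝ} (hPi : Pi.transpose = -Pi)
    {a b : WeylDual d} {G a' b' : Fin d → WeylDual d} {G' : Fin d → Fin d → WeylDual d}
    (ha : ∀ k, (PowerSeries.X : PowerSeries ℝ) • a' k = -commL Pi (G k) a)
    (hb : ∀ k, (PowerSeries.X : PowerSeries ℝ) • b' k = -commL Pi (G k) b)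
    (hG : ∀ k l, ∃ q₀ q₂, IsHomog 0 q₀ ∧ IsHomog 2 q₂ ∧
      (PowerSeries.X : PowerSeries ℝ) • (G' k l - G' l k) =
        (PowerSeries.X : PowerSeries ℝ) • (q₀ - q₂) - commL Pi (G k) (G l)) :
    Theta Pi (commL Pi b a) G = -(PowerSeries.X * ∑ k,
      (Theta Pi (a' k) (Function.update G k b) + ∑ l, Theta Pi a (Function.update
        (Function.update G k b) l (Function.update (G' k) k (b' k) l)))) := by
  have h1 : ∀ k, PowerSeries.X * Theta Pi (a' k) (Function.update G k b) =
      -Theta Pi (commL Pi (G k) a) (Function.update G k b) := by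
    intro k
    rw [← Theta_smul_left, ha]
    refine eq_neg_of_add_eq_zero_left ?_
    rw [← Theta_add_left, neg_add_cancel]
    have := Theta_smul_left Pi 0 (0 : WeylDual d) (Function.update G k b)
    rwa [zero_smul, zero_mul] at this
  have h2 : ∀ k, PowerSeries.X * Theta Pi a (Function.update G k (b' k)) =
      Theta Pi a (Function.update G k (commL Pi b (G k))) := by
    intro k
    rw [← Theta_update_smul, hb]
    congr 2
    exact neg_sub _ _
  -- constants and quadratic terms do not contribute to the cocycle
  have h3 : ∀ k l, l ≠ k → PowerSeries.X * (Theta Pi a (Function.update (Function.update G k b) l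
      (G' k l)) -
      Theta Pi a (Function.update (Function.update G k b) l (G' l k))) =
      -Theta Pi a (Function.update (Function.update G k b) l (commL Pi (G k) (G l))) := by
    intro k l _
    obtain ⟨q₀, q₂, h0, h2, h⟩ := hG k l
    rw [← Theta_update_sub, ← Theta_update_smul, h, Theta_update_sub, Theta_update_smul,
      Theta_update_sub, Theta_eq_zero_of_isHomog Pi a _ l 0 (Or.inl rfl) (by simpa using h0),
      Theta_eq_zero_of_isHomog Pi a _ l 2 (Or.inr rfl) (by simpa using h2)]
    simp
  set S : PowerSeries ℝ := ∑ k, ∑ l ∈ Finset.univ.erase k,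
    Theta Pi a (Function.update (Function.update G k b) l (G' k l)) with hS
  -- only the part of `G'` which is antisymmetric in `k, l` contributes
  have hanti : S = -∑ k, ∑ l ∈ Finset.univ.erase k,
      Theta Pi a (Function.update (Function.update G k b) l (G' l k)) := by
    rw [hS, Finset.sum_comm' (t' := Finset.univ) (s' := fun l => Finset.univ.erase l)
      (by intro x y; simp [eq_comm]), ← Finset.sum_neg_distrib]
    refine Finset.sum_congr rfl fun l _ => ?_
    rw [← Finset.sum_neg_distrib]
    refine Finset.sum_congr rfl fun k hk => ?_
    have hk' : k ≠ l := Finset.ne_of_mem_erase hk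
    rw [Theta_swap_update Pi a G hk', Function.update_comm hk'.symm]
  have h4 : 2 * (PowerSeries.X * S) = -∑ k, ∑ l ∈ Finset.univ.erase k,
      Theta Pi a (Function.update (Function.update G k b) l (commL Pi (G k) (G l))) := by
    have : 2 * S = ∑ k, ∑ l ∈ Finset.univ.erase k,
        (Theta Pi a (Function.update (Function.update G k b) l (G' k l)) -
          Theta Pi a (Function.update (Function.update G k b) l (G' l k))) := by
      simp only [Finset.sum_sub_distrib]
      rw [two_mul, ← hS]
      nth_rewrite 2 [hanti]
      rw [sub_eq_add_neg]
    rw [mul_left_comm, this, Finset.mul_sum, ← Finset.sum_neg_distrib]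
    refine Finset.sum_congr rfl fun k _ => ?_
    rw [Finset.mul_sum, ← Finset.sum_neg_distrib]
    exact Finset.sum_congr rfl fun l hl => h3 k l (Finset.ne_of_mem_erase hl)
  have h5 : ∀ k, ∑ l, Theta Pi a (Function.update (Function.update G k b) l
      (Function.update (G' k) k (b' k) l)) = Theta Pi a (Function.update G k (b' k)) +
        ∑ l ∈ Finset.univ.erase k,
          Theta Pi a (Function.update (Function.update G k b) l (G' k l)) := by
    intro k
    rw [← Finset.add_sum_erase _ _ (Finset.mem_univ k), Function.update_self,
      Function.update_idem]
    congr 1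
    refine Finset.sum_congr rfl fun l hl => ?_
    rw [Function.update_of_ne (Finset.ne_of_mem_erase hl)]
  have hc := Theta_cocycle hPi b a G
  have h6 : PowerSeries.X * (∑ k, (Theta Pi (a' k) (Function.update G k b) +
      ∑ l, Theta Pi a (Function.update (Function.update G k b) l
        (Function.update (G' k) k (b' k) l)))) =
      -∑ k, Theta Pi (commL Pi (G k) a) (Function.update G k b) +
        ∑ k, Theta Pi a (Function.update G k (commL Pi b (G k))) + PowerSeries.X * S := by
    simp only [h5, Finset.sum_add_distrib, mul_add]
    rw [← hS, ← add_assoc]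
    simp only [Finset.mul_sum, h1, h2, Finset.sum_neg_distrib]
  rw [h6]
  have h20 : (2 : PowerSeries ℝ) ≠ 0 := fun h => by
    have h' := congrArg (PowerSeries.constantCoeff (R := ℝ)) h
    rw [map_ofNat, map_zero] at h'
    exact two_ne_zero h'
  refine mul_left_cancel₀ h20 ?_
  linear_combination hc + h4

end ThetaAlgebra

/-! ### The trace density of a commutator is a divergence -/

section LocalIdentity

variable {d : ℕ} {M : Type*} [TopologicalSpace M] [ChartedSpace (EuclideanSpace ℝ (Fin d)) M]
  [IsManifold (𝓡 d) ∞ M] {Ω : BilinField d M}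

lemma dualW_smul {σ : Type*} (c : ℝ) (A : PowerSeries (MvPowerSeries σ ℝ)) :
    dualW (c • A) = c • dualW A := by
  refine LinearMap.ext fun f => ?_
  ext N
  rw [LinearMap.smul_apply, PowerSeries.coeff_smul, coeff_dualW, coeff_dualW,
      PowerSeries.coeff_smul,
    ← pairHom_apply, map_smul, LinearMap.smul_apply, pairHom_apply]

lemma dualW_sum {σ ι : Type*} (S : Finset ι) (A : ι → PowerSeries (MvPowerSeries σ ℝ)) :
    dualW (∑ i ∈ S, A i) = ∑ i ∈ S, dualW (A i) := by
  classical
  induction S using Finset.induction_on with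
  | empty => simpa using dualW_zero
  | insert i S hi ih => rw [Finset.sum_insert hi, Finset.sum_insert hi, dualW_add, ih]

/-- The values of `γ` on the standard basis of the tangent space at `q`, as functionals. -/
def gDual (γ : WeylOneForm d M) (q : M) (l : Fin d) : WeylDual d := dualW (γ q (stdVec l q))

lemma dualW_along_coordField (γ : WeylOneForm d M) (x₀ q : M) (l : Fin d) :
    dualW (atPt q (γ.along (coordField x₀ l))) =
      ∑ m, frameMatrix x₀ q m l • gDual γ q m := by
  rw [atPt_along, coordField_eq_sum_stdVec, map_sum, dualW_sum]
  refine Finset.sum_congr rfl fun m _ => ?_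
  rw [map_smul, dualW_smul]
  rfl

/-- The vector field whose components are the values of the cocycle with one entry `γ` replaced by
the section `b`. -/
def cocycleField (Ω : BilinField d M) (γ : WeylOneForm d M) (a b : WeylSection M d) (N : ℕ)
    (q : M) : TangentSpace (𝓡 d) q :=
  ∑ k, ((poisson Ω q).det * PowerSeries.coeff N (Theta (poisson Ω q) (dualW (atPt q a))
    (Function.update (gDual γ q) k (dualW (atPt q b))))) • stdVec k q

lemma update_frame (Φ : Matrix (Fin d) (Fin d) ℝ) (v : Fin d → WeylDual d) (k : Fin d)
    (b : WeylDual d) : Function.update (fun l => frame Φ (v l)) k (frame Φ b) =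
      fun l => frame Φ (Function.update v k b l) := by
  funext l
  exact (Function.apply_update (fun _ => frame Φ) v k b l).symm

lemma comp_sum_smul_stdVec (c : Fin d → ℝ) (q : M) (i : Fin d) :
    comp (∑ k, c k • stdVec k q) i = c i := by
  rw [comp_sum]
  simp only [comp_smul]
  rw [Finset.sum_eq_single i]
  · simp [comp, stdVec]
  · intro k _ hk
    have : comp (stdVec k q) i = 0 := by simp [comp, stdVec, hk.symm]
    rw [this, mul_zero]
  · simp

/-- The components of `cocycleField` in a coordinate frame, computed in any frame. -/
lemma components_cocycleField (γ : WeylOneForm d M) (a b : WeylSection M d) (N : ℕ) {x₀ q : M}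
    (hq : q ∈ (chartAt (EuclideanSpace ℝ (Fin d)) x₀).source) {Ψ Pi : Matrix (Fin d) (Fin d) ℝ}
    (hPi : frameMatrix x₀ q * Ψ * Pi * (frameMatrix x₀ q * Ψ).transpose = poisson Ω q)
    (k : Fin d) :
    components (cocycleField Ω γ a b N) x₀ q k = Pi.det * (Ψ.det * PowerSeries.coeff N
      (Theta Pi (frame Ψ (chartDual x₀ q a)) (Function.update
        (fun l => frame Ψ (chartDual x₀ q (γ.along (coordField x₀ l)))) k
        (frame Ψ (chartDual x₀ q b))))) := by
  set F := frameMatrix (d := d) x₀ q with hF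
  set v := fun l => dualW (atPt q (γ.along (coordField x₀ l))) with hv
  have hv' : v = fun l => ∑ m, F m l • gDual γ q m := funext fun l => dualW_along_coordField γ x₀ q
      l
  set w : Fin d → ℝ := fun k => PowerSeries.coeff N (Theta (poisson Ω q) (dualW (atPt q a))
    (Function.update v k (dualW (atPt q b)))) with hw
  have hR : ∀ k, Pi.det * (Ψ.det * PowerSeries.coeff N
      (Theta Pi (frame Ψ (chartDual x₀ q a)) (Function.update
        (fun l => frame Ψ (chartDual x₀ q (γ.along (coordField x₀ l)))) k
        (frame Ψ (chartDual x₀ q b))))) = (Pi.det * Ψ.det * (F * Ψ).det) * w k := by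
    intro k
    simp only [chartDual, ← frame_mul, ← hF]
    rw [update_frame (F * Ψ) v, Theta_frame, hPi, PowerSeries.coeff_smul, smul_eq_mul]
    ring
  rw [hR]
  have hdet : (Pi.det * Ψ.det * (F * Ψ).det) * F.det = (poisson Ω q).det := by
    rw [← hPi, Matrix.det_mul (F * Ψ * Pi), Matrix.det_mul (F * Ψ) Pi, Matrix.det_transpose,
      Matrix.det_mul F Ψ]
    ring
  have hcomp : comp (cocycleField Ω γ a b N q) =
      F.mulVec ((Pi.det * Ψ.det * (F * Ψ).det) • w) := by
    funext m
    rw [cocycleField, comp_sum_smul_stdVec, Matrix.mulVec_smul, _root_.Pi.smul_apply, smul_eq_mul,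
      ← hdet, mul_assoc]
    congr 1
    have h := congrArg (PowerSeries.coeff N) (sum_Theta_update_linear_combination (poisson Ω q)
      (dualW (atPt q a)) (dualW (atPt q b)) (gDual γ q) F m)
    rw [PowerSeries.coeff_smul, smul_eq_mul, map_sum] at h
    rw [← h, Matrix.mulVec, dotProduct]
    refine Finset.sum_congr rfl fun l _ => ?_
    rw [PowerSeries.coeff_smul, smul_eq_mul, hw, hv']
  rw [components, hcomp, Matrix.mulVec_mulVec,
    Matrix.nonsing_inv_mul _ (isUnit_det_frameMatrix hq), Matrix.one_mulVec, _root_.Pi.smul_apply,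
    smul_eq_mul]

lemma components_cocycleField_mem (hΩ : IsSymplectic Ω) {cov : TangentConnection d M}
    {Ωh : ℕ → BilinField d M} {γ : WeylOneForm d M} (hγ : IsFedosovSolution Ω cov Ωh γ)
    {a b : WeylSection M d} (ha : IsSmooth a) (hb : IsSmooth b) (N : ℕ) (x₀ : M) (k : Fin d) :
    (fun q => components (cocycleField Ω γ a b N) x₀ q k) ∈ smoothOn (d := d) x₀ := by
  have h1 : InPS (smoothOn (d := d) x₀) fun q => Theta (formMatrix Ω x₀ q)⁻¹ (chartDual x₀ q a)
      (Function.update (fun l => chartDual x₀ q (γ.along (coordField x₀ l))) k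
        (chartDual x₀ q b)) := by
    refine InPS.Theta (formMatrix_inv_mem hΩ x₀) ((isSmoothInChart_iff x₀ a).1 (ha x₀)) fun l => ?_
    by_cases h : l = k
    · subst h
      simp only [Function.update_self]
      exact (isSmoothInChart_iff x₀ b).1 (hb x₀)
    · simp only [Function.update_of_ne h]
      exact (isSmoothInChart_iff x₀ _).1 (hγ.smooth x₀ l)
  have h2 := (smoothOn (d := d) x₀).mul_mem (det_mem (formMatrix_inv_mem hΩ x₀)) (h1 N)
  refine smoothOn_congr h2 fun q hq => ?_
  have h := components_cocycleField γ a b N hq (Ω := Ω) (Ψ := 1) (Pi := (formMatrix Ω x₀ q)⁻¹)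
    (by rw [Matrix.mul_one]; exact formMatrix_inv Ω hq) k
  simp only [frame_one, Matrix.det_one, one_mul] at h
  exact h

lemma linSubst_two_monomial (m : Fin d →₀ ℕ) :
    linSubst (fun i k : Fin d => if i = k then (2 : ℝ) else 0) (MvPolynomial.monomial m 1) =
      MvPolynomial.C ((2 : ℝ) ^ m.degree) * MvPolynomial.monomial m 1 := by
  rw [MvPolynomial.monomial_eq, map_one, one_mul, Finsupp.prod, map_prod]
  have h : ∀ i : Fin d, linSubst (fun i k : Fin d => if i = k then (2 : ℝ) else 0)
      (MvPolynomial.X i) = MvPolynomial.C 2 * MvPolynomial.X i := by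
    intro i
    rw [linSubst_X, Finset.sum_eq_single i]
    · simp
    · intro k _ hk; simp [hk.symm]
    · simp
  simp only [map_pow, h, mul_pow, Finset.prod_mul_distrib]
  congr 1
  rw [Finset.prod_pow_eq_pow_sum, Finsupp.degree]
  rfl

lemma isHomog_dualW {A : PowerSeries (MvPowerSeries (Fin d) ℝ)} {j : ℕ}
    (h : ∀ N m, m.degree ≠ j → MvPowerSeries.coeff m (PowerSeries.coeff N A) = 0) :
    IsHomog j (dualW A) := by
  refine linearMap_ext_monomial fun m => ?_
  ext N
  rw [LinearMap.comp_apply, AlgHom.toLinearMap_apply, linSubst_two_monomial,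
    ← MvPolynomial.smul_eq_C_mul, map_smul, LinearMap.smul_apply, PowerSeries.coeff_smul,
    PowerSeries.coeff_smul, coeff_dualW, pair_monomial]
  by_cases hm : m.degree = j
  · rw [hm]
  · rw [h N m hm, mul_zero]
    simp

lemma coeff_curvatureQuad (cov : TangentConnection d M) (p : M) (k l : Fin d) {m : Fin d →₀ ℕ}
    (hm : m.degree ≠ 2) : MvPowerSeries.coeff m (curvatureQuad Ω cov p k l) = 0 := by
  rw [curvatureQuad, map_sum]
  refine Finset.sum_eq_zero fun i _ => ?_
  rw [map_sum]
  refine Finset.sum_eq_zero fun j _ => ?_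
  rw [MvPowerSeries.coeff_C_mul, MvPowerSeries.X, MvPowerSeries.X,
    MvPowerSeries.monomial_mul_monomial, MvPowerSeries.coeff_monomial_ne, mul_zero]
  rintro rfl
  exact hm (by simp)

lemma gDual_eq (γ : WeylOneForm d M) (p : M) (l : Fin d) :
    gDual γ p l = dualW (atPt p (γ.along (coordField p l))) := by
  rw [atPt_along, coordField_self, gDual]

/-- Fedosov's equation: up to constants and quadratic terms, the covariant exterior derivative of
`γ` is given by the commutators of its components. -/
lemma IsFedosovSolution.nabla_sub {cov : TangentConnection d M} {Ωh : ℕ → BilinField d M}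
    {γ : WeylOneForm d M} (hγ : IsFedosovSolution Ω cov Ωh γ) (p : M) (k l : Fin d) :
    ∃ q₀ q₂, IsHomog 0 q₀ ∧ IsHomog 2 q₂ ∧ (PowerSeries.X : PowerSeries ℝ) •
      (dualW (atPt p (nabla cov (coordField p k) (γ.along (coordField p l)))) -
        dualW (atPt p (nabla cov (coordField p l) (γ.along (coordField p k))))) =
      (PowerSeries.X : PowerSeries ℝ) • (q₀ - q₂) -
        commL (poisson Ω p) (gDual γ p k) (gDual γ p l) := by
  refine ⟨dualW (PowerSeries.mk fun N => MvPowerSeries.C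
    (Ωh N p (coordField p k p) (coordField p l p))),
    dualW (PowerSeries.C (curvatureQuad Ω cov p k l)), isHomog_dualW fun N m hm => ?_,
    isHomog_dualW fun N m hm => ?_, ?_⟩
  · rw [PowerSeries.coeff_mk, MvPowerSeries.coeff_C, if_neg]
    rintro rfl
    exact hm (by simp)
  · rw [PowerSeries.coeff_C]
    split_ifs
    · exact coeff_curvatureQuad cov p k l hm
    · exact map_zero _
  · rw [gDual_eq, gDual_eq, ← dualW_moyalComm, ← dualW_sub, ← dualW_sub, ← dualW_X_mul,
      ← dualW_X_mul, ← dualW_sub]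
    congr 1
    ext1 N
    cases N with
    | zero =>
      rw [map_sub (PowerSeries.coeff 0), coeff_atPt, coeff_zero_moyalComm]
      simp
    | succ N =>
      rw [map_sub (PowerSeries.coeff (N + 1)), PowerSeries.coeff_succ_X_mul,
        PowerSeries.coeff_succ_X_mul, map_sub, map_sub, coeff_atPt, coeff_atPt, coeff_atPt,
        PowerSeries.coeff_mk, PowerSeries.coeff_C, ← hγ.equation, map_add, map_sub, divHbar,
        PowerSeries.coeff_mk]
      simp only [Pi.add_apply, Pi.sub_apply]
      abel

lemma christoffel_self (cov : TangentConnection d M) (p : M) (k : Fin d) :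
    christoffel cov p p k = connMatrix cov p (coordField p k p) := by
  ext i j
  rw [christoffel, frameMatrix_self, inv_one, Matrix.of_apply, Matrix.one_mulVec]
  rfl

lemma hasDerivAt_det_one_add_smul (A : Matrix (Fin d) (Fin d) ℝ) :
    HasDerivAt (fun t : ℝ => (1 + t • A).det) A.trace 0 := by
  have h : (fun t : ℝ => (1 + t • A).det) = fun t : ℝ => 1 + A.trace * t +
      (((1 + (Polynomial.X : Polynomial ℝ) • A.map Polynomial.C).det.divX.divX).eval t) *
        t ^ 2 := by
    funext t
    rw [← Matrix.det_one_add_smul]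
  rw [h]
  have h1 := (((hasDerivAt_id (0 : ℝ)).const_mul A.trace).const_add 1).add
    (((((1 + (Polynomial.X : Polynomial ℝ) • A.map Polynomial.C).det.divX.divX).hasDerivAt
      (0 : ℝ))).mul ((hasDerivAt_id (0 : ℝ)).pow 2))
  refine h1.congr_deriv ?_
  simp

lemma hasDerivAt_det_parFrame (cov : TangentConnection d M) (p : M) (v : TangentSpace (𝓡 d) p) :
    HasDerivAt (fun t => (parFrame cov p v t).det) (-(connMatrix cov p v).trace) 0 := by
  have h := hasDerivAt_det_one_add_smul (-connMatrix cov p v)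
  rw [Matrix.trace_neg] at h
  simpa only [parFrame, sub_eq_add_neg, smul_neg] using h

/-- **The local identity.** The value of the cocycle on a commutator of flat sections is a
divergence. -/
lemma coeff_Theta_commL_eq_divergence (hΩ : IsSymplectic Ω) {cov : TangentConnection d M}
    (hcov : IsSymplecticConnection Ω cov) {Ωh : ℕ → BilinField d M} {γ : WeylOneForm d M}
    (hγ : IsFedosovSolution Ω cov Ωh γ) {a b : WeylSection M d} (ha : IsFlatSection Ω cov γ a)
    (hb : IsFlatSection Ω cov γ b) (p : M) :
    PowerSeries.coeff 0 (Theta (poisson Ω p) (commL (poisson Ω p) (dualW (atPt p b))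
      (dualW (atPt p a))) (gDual γ p)) = 0 ∧
    ∀ N, (poisson Ω p).det * PowerSeries.coeff (N + 1) (Theta (poisson Ω p)
      (commL (poisson Ω p) (dualW (atPt p b)) (dualW (atPt p a))) (gDual γ p)) =
      -divergence cov (cocycleField Ω γ a b N) p := by
  set X : ℕ → Π p : M, TangentSpace (𝓡 d) p := fun N => cocycleField Ω γ a b N with hXdef
  set V : Fin d → Π p : M, TangentSpace (𝓡 d) p := fun k => coordField p k with hV
  set a' : Fin d → WeylDual d := fun k => dualW (atPt p (nabla cov (V k) a)) with ha'
  set b' : Fin d → WeylDual d := fun k => dualW (atPt p (nabla cov (V k) b)) with hb'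
  set G' : Fin d → Fin d → WeylDual d := fun k l =>
    dualW (atPt p (nabla cov (V k) (γ.along (coordField p l)))) with hG'
  set G := gDual γ p with hG
  set D : Fin d → PowerSeries ℝ := fun k =>
    Theta (poisson Ω p) (a' k) (Function.update G k (dualW (atPt p b))) +
      ∑ l, Theta (poisson Ω p) (dualW (atPt p a)) (Function.update
        (Function.update G k (dualW (atPt p b))) l (Function.update (G' k) k (b' k) l)) with hD
  have hGk : ∀ k, G k = dualW (γ p (V k p)) := by
    intro k
    rw [hG, gDual_eq, atPt_along]
  have hmain : Theta (poisson Ω p) (commL (poisson Ω p) (dualW (atPt p b)) (dualW (atPt p a))) G =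
      -(PowerSeries.X * ∑ k, D k) := by
    refine Theta_commL_eq (poisson_transpose hΩ p) (fun k => ?_) (fun k => ?_) fun k l => ?_
    · rw [hGk]; exact ha.dualW_nabla (V k) p
    · rw [hGk]; exact hb.dualW_nabla (V k) p
    · exact hγ.nabla_sub p k l
  rw [hmain]
  refine ⟨by simp, fun N => ?_⟩
  rw [map_neg, PowerSeries.coeff_succ_X_mul, mul_neg, neg_inj, map_sum, Finset.mul_sum,
    divergence_eq hcov (X N) (mem_source_self p) fun k => smoothOn_mdifferentiableAt
      (components_cocycleField_mem hΩ hγ ha.1 hb.1 N p k) (mem_source_self p)]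
  refine Finset.sum_congr rfl fun k _ => ?_
  have hsm := smoothOn_mdifferentiableAt
      (components_cocycleField_mem hΩ hγ ha.1 hb.1 N p k) (mem_source_self p)
  have h1 := hasDerivAt_coordLine p (V k p) hsm
  -- the components, along a coordinate line, in the first-order parallel frame
  have h2 : (fun t => components (X N) p (coordLine p (V k p) t) k) =ᶠ[nhds 0] fun t =>
      (parPoisson Ω cov p (V k p) t).det * ((parFrame cov p (V k p) t).det *
        PowerSeries.coeff N (Theta (parPoisson Ω cov p (V k p) t) (parDual cov p (V k p) a t)
          (Function.update (fun l => parDual cov p (V k p) (γ.along (coordField p l)) t) k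
            (parDual cov p (V k p) b t)))) := by
    filter_upwards [eventually_parPoisson Ω cov p (V k p), eventually_coordLine_mem p (V k p)]
      with t ht hmem
    exact components_cocycleField γ a b N hmem ht k
  have h3 := HasDerivPS.Theta (hasDerivAt_parPoisson hΩ hcov p (V k p))
    (x := fun t => parDual cov p (V k p) a t) (hasDerivL_nabla cov (V k) a p (ha.1 p))
    (v := fun t => Function.update (fun l => parDual cov p (V k p) (γ.along (coordField p l)) t) k
            (parDual cov p (V k p) b t)) (v' := Function.update (G' k) k (b' k)) (by
      intro l
      by_cases h : l = k
      · subst h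
        simp only [Function.update_self]
        exact hasDerivL_nabla cov (V l) b p (hb.1 p)
      · simp only [Function.update_of_ne h]
        exact hasDerivL_nabla cov (V k) _ p (hγ.smooth p l))
  -- the derivative of the frame determinant is the trace of the connection matrix, and cancels the
  -- Christoffel term of the divergence
  have hdet : HasDerivAt (fun t => (parPoisson Ω cov p (V k p) t).det) 0 0 :=
    det_mem (𝒜 := stationary) (hasDerivAt_parPoisson hΩ hcov p (V k p))
  have h4 := hdet.mul ((hasDerivAt_det_parFrame cov p (V k p)).mul (h3 N))
  have h5 := h1.unique (h4.congr_of_eventuallyEq h2)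
  have hz := h2.eq_of_nhds
  simp only [parPoisson_zero, parFrame_zero, parDual_zero, coordLine_zero, Matrix.det_one,
    one_mul, zero_mul, zero_add, Pi.mul_apply] at h5 hz
  have hG0 : (fun l => dualW (atPt p (γ.along (coordField p l)))) = G :=
    funext fun l => (gDual_eq γ p l).symm
  rw [hG0] at h5 hz
  rw [hz, h5, christoffel_self]
  simp only [hD, ha']
  ring

end LocalIdentity

/-! ### Exterior algebras of free modules -/

section Exterior

variable {R S : Type*} [CommRing R] [CommRing S] {κ : Type*} [Fintype κ] [LinearOrder κ]

variable (R κ) in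
/-- The basis of monomials in the generators of an exterior algebra. -/
def extBasis : Module.Basis (Finset κ) R (ExteriorAlgebra R (κ → R)) :=
  (Pi.basisFun R κ).ExteriorAlgebra

variable (R) in
/-- A generator of an exterior algebra. -/
def gen (i : κ) : ExteriorAlgebra R (κ → R) := ExteriorAlgebra.ι R (Pi.single i 1)

lemma extBasis_apply {s : Finset κ} {n : ℕ} (h : s.card = n) :
    extBasis R κ s = ExteriorAlgebra.ιMulti R n fun a => Pi.single (s.orderEmbOfFin h a) 1 := by
  rw [extBasis, ExteriorAlgebra.basis_apply_ofCard _ h]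
  change ExteriorAlgebra.ιMulti R n _ = _
  congr 1
  funext a
  exact Pi.basisFun_apply _ _ _

/-- Extension of scalars for exterior algebras. -/
def baseChange (φ : R →+* S) : ExteriorAlgebra R (κ → R) →+* ExteriorAlgebra S (κ → S) :=
  letI := φ.toAlgebra
  (ExteriorAlgebra.lift R ⟨((ExteriorAlgebra.ι S).restrictScalars R).comp
    ((Algebra.linearMap R S).compLeft κ), fun _ => ExteriorAlgebra.ι_sq_zero _⟩).toRingHom

lemma baseChange_ι (φ : R →+* S) (v : κ → R) :
    baseChange φ (ExteriorAlgebra.ι R v) = ExteriorAlgebra.ι S fun i => φ (v i) := by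
  let := φ.toAlgebra
  exact ExteriorAlgebra.lift_ι_apply R (((ExteriorAlgebra.ι S).restrictScalars R).comp
    ((Algebra.linearMap R S).compLeft κ)) (fun _ => ExteriorAlgebra.ι_sq_zero _) v

lemma baseChange_gen (φ : R →+* S) (i : κ) : baseChange φ (gen R i) = gen S i := by
  rw [gen, baseChange_ι, gen]
  congr 1
  funext j
  by_cases h : j = i
  · subst h; simp
  · simp [h]

lemma baseChange_smul (φ : R →+* S) (r : R) (x : ExteriorAlgebra R (κ → R)) :
    baseChange φ (r • x) = φ r • baseChange φ x := by
  let := φ.toAlgebra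
  rw [baseChange]
  exact (map_smul (ExteriorAlgebra.lift R _) r x).trans (algebraMap_smul S r _).symm

lemma baseChange_ιMulti (φ : R →+* S) {n : ℕ} (v : Fin n → κ → R) :
    baseChange φ (ExteriorAlgebra.ιMulti R n v) =
      ExteriorAlgebra.ιMulti S n fun a i => φ (v a i) := by
  rw [ExteriorAlgebra.ιMulti_apply, ExteriorAlgebra.ιMulti_apply, map_list_prod, List.map_ofFn]
  congr 2
  funext a
  exact baseChange_ι φ _

lemma map_single_one (φ : R →+* S) (i : κ) :
    (fun j => φ ((Pi.single i (1 : R) : κ → R) j)) = Pi.single i 1 := by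
  funext j
  by_cases h : j = i
  · subst h; simp
  · simp [h]

lemma baseChange_extBasis (φ : R →+* S) (s : Finset κ) :
    baseChange φ (extBasis R κ s) = extBasis S κ s := by
  rw [extBasis_apply rfl, baseChange_ιMulti, extBasis_apply rfl]
  congr 1
  funext a
  exact map_single_one φ _

lemma repr_baseChange (φ : R →+* S) (x : ExteriorAlgebra R (κ → R)) (s : Finset κ) :
    (extBasis S κ).repr (baseChange φ x) s = φ ((extBasis R κ).repr x s) := by
  conv_lhs => rw [← (extBasis R κ).sum_repr x]
  rw [map_sum]
  simp only [baseChange_smul, baseChange_extBasis]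
  rw [(extBasis S κ).repr_sum_self]

/-- The rescaling of the generators of an exterior algebra. -/
def rescale (t : κ → R) : ExteriorAlgebra R (κ → R) →ₐ[R] ExteriorAlgebra R (κ → R) :=
  ExteriorAlgebra.map (LinearMap.mulLeft R t)

lemma mul_single_one (t : κ → R) (i : κ) : t * Pi.single i 1 = t i • Pi.single i (1 : R) := by
  funext j
  by_cases h : j = i
  · subst h; simp
  · simp [h]

lemma rescale_gen (t : κ → R) (i : κ) : rescale t (gen R i) = t i • gen R i := by
  rw [rescale, gen, ExteriorAlgebra.map_apply_ι, LinearMap.mulLeft_apply, mul_single_one, map_smul]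

lemma rescale_extBasis (t : κ → R) (s : Finset κ) :
    rescale t (extBasis R κ s) = (∏ i ∈ s, t i) • extBasis R κ s := by
  rw [extBasis_apply rfl, rescale, ExteriorAlgebra.map_apply_ιMulti]
  have h : (LinearMap.mulLeft R t : (κ → R) → κ → R) ∘
      (fun a => Pi.single (s.orderEmbOfFin rfl a) (1 : R)) =
      fun a => t (s.orderEmbOfFin rfl a) • Pi.single (s.orderEmbOfFin rfl a) (1 : R) := by
    funext a
    exact mul_single_one t _
  rw [h]
  refine ((ExteriorAlgebra.ιMulti R s.card).toMultilinearMap.map_smul_univ _ _).trans ?_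
  have h2 : ∏ a, t (s.orderEmbOfFin rfl a) = ∏ i ∈ s, t i := by
    conv_rhs => rw [← Finset.map_orderEmbOfFin_univ s rfl, Finset.prod_map]
    rfl
  rw [h2]
  rfl

lemma repr_rescale (t : κ → R) (x : ExteriorAlgebra R (κ → R)) (s : Finset κ) :
    (extBasis R κ).repr (rescale t x) s = (∏ i ∈ s, t i) * (extBasis R κ).repr x s := by
  have h : rescale t x = ∑ s, ((∏ i ∈ s, t i) * (extBasis R κ).repr x s) • extBasis R κ s := by
    conv_lhs => rw [← (extBasis R κ).sum_repr x]
    simp only [map_sum, map_smul, rescale_extBasis, smul_smul, mul_comm]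
  rw [h, (extBasis R κ).repr_sum_self]

/-- Elements that are homogeneous under a rescaling have few nonzero coefficients. -/
lemma repr_eq_zero_of_rescale [Algebra ℝ R] (t : κ → ℝ) {x : ExteriorAlgebra R (κ → R)} {c : ℝ}
    (h : rescale (fun i => algebraMap ℝ R (t i)) x = algebraMap ℝ R c • x) {s : Finset κ}
    (hs : ∏ i ∈ s, t i ≠ c) : (extBasis R κ).repr x s = 0 := by
  have h1 := repr_rescale (fun i => algebraMap ℝ R (t i)) x s
  rw [h, map_smul, Finsupp.smul_apply, smul_eq_mul, ← map_prod, ← Algebra.smul_def,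
    ← Algebra.smul_def] at h1
  have h2 : (∏ i ∈ s, t i - c) • (extBasis R κ).repr x s = 0 := by
    rw [sub_smul, h1, sub_self]
  rw [← inv_smul_smul₀ (sub_ne_zero.2 hs) ((extBasis R κ).repr x s), h2, smul_zero]

/-- The two-form `∑ (1/2) A_{ij} eⁱ ∧ eʲ` of a matrix (with the factor included in `A`). -/
def quadForm (A : Matrix κ κ R) : ExteriorAlgebra R (κ → R) :=
  ∑ i, ∑ j, A i j • (gen R i * gen R j)

/-- The top coefficient of a power of a two-form, a multiple of the Pfaffian. -/
def wedgePow (m : ℕ) (A : Matrix κ κ R) : R :=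
  (extBasis R κ).repr (quadForm A ^ m) Finset.univ

lemma baseChange_quadForm (φ : R →+* S) (A : Matrix κ κ R) :
    baseChange φ (quadForm A) = quadForm (A.map φ) := by
  simp only [quadForm, map_sum, baseChange_smul, map_mul, baseChange_gen, Matrix.map_apply]

lemma wedgePow_map (φ : R →+* S) (m : ℕ) (A : Matrix κ κ R) :
    wedgePow m (A.map φ) = φ (wedgePow m A) := by
  rw [wedgePow, ← baseChange_quadForm, ← map_pow, repr_baseChange, wedgePow]

lemma rescale_const_quadForm (t : R) (A : Matrix κ κ R) :
    rescale (fun _ => t) (quadForm A) = (t ^ 2) • quadForm A := by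
  simp only [quadForm, map_sum, map_smul, map_mul, rescale_gen, Finset.smul_sum, smul_mul_assoc,
    mul_smul_comm, smul_smul]
  refine Finset.sum_congr rfl fun i _ => Finset.sum_congr rfl fun j _ => ?_
  congr 1
  ring

lemma two_pow_injective : Function.Injective fun k : ℕ => (2 : ℝ) ^ k :=
  pow_right_injective₀ (by norm_num) (by norm_num)

/-- Elements of degree `k` have only coefficients of degree `k`. -/
lemma repr_eq_zero_of_card_ne [Algebra ℝ R] {x : ExteriorAlgebra R (κ → R)} {k : ℕ}
    (h : rescale (fun _ => algebraMap ℝ R 2) x = algebraMap ℝ R (2 ^ k) • x) {s : Finset κ}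
    (hs : s.card ≠ k) : (extBasis R κ).repr x s = 0 := by
  refine repr_eq_zero_of_rescale (fun _ => 2) h ?_
  rw [Finset.prod_const]
  exact two_pow_injective.ne hs

/-- The top power of a two-form is a multiple of the volume element. -/
lemma quadForm_pow_eq [Algebra ℝ R] {m : ℕ} (hm : Fintype.card κ = 2 * m) (A : Matrix κ κ R) :
    quadForm A ^ m = wedgePow m A • extBasis R κ Finset.univ := by
  have h : rescale (fun _ => algebraMap ℝ R 2) (quadForm A ^ m) =
      algebraMap ℝ R (2 ^ (2 * m)) • quadForm A ^ m := by
    rw [map_pow, rescale_const_quadForm, smul_pow, ← pow_mul, map_pow]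
  conv_lhs => rw [← (extBasis R κ).sum_repr (quadForm A ^ m)]
  rw [Finset.sum_eq_single Finset.univ]
  · rfl
  · intro s _ hs
    rw [repr_eq_zero_of_card_ne h, zero_smul]
    rw [← hm]
    exact fun h => hs (Finset.card_eq_iff_eq_univ s |>.1 h)
  · simp

end Exterior

/-! ### Top forms and Pfaffians -/

section TopForms

variable {R : Type*} [CommRing R] {d : ℕ}

lemma extBasis_univ : extBasis R (Fin d) Finset.univ =
    ExteriorAlgebra.ιMulti R d fun a => Pi.single a 1 := by
  rw [extBasis_apply (Finset.card_fin d)]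
  congr 1
  funext a
  have : (Finset.univ : Finset (Fin d)).orderEmbOfFin (Finset.card_fin d) a = a := by
    have := Finset.orderEmbOfFin_unique (Finset.card_fin d) (f := id)
      (fun x => Finset.mem_univ _) strictMono_id
    exact (congrFun this a).symm
  rw [this]

/-- An alternating form in `d` vectors of a free module of rank `d`. -/
lemma alternating_eq_det (f : (Fin d → R) [⋀^Fin d]→ₗ[R] R) (v : Fin d → Fin d → R) :
    f v = f (fun a => Pi.single a 1) * (Matrix.of v).det := by
  have h := f.eq_smul_basis_det (Pi.basisFun R (Fin d))
  have e : ⇑(Pi.basisFun R (Fin d)) = fun a => Pi.single a 1 :=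
    funext fun a => Pi.basisFun_apply _ _ _
  conv_lhs => rw [h]
  rw [AlternatingMap.smul_apply, Pi.basisFun_det_apply, e, smul_eq_mul]

/-- The top coefficient of a product of `d` vectors is their determinant. -/
lemma repr_ιMulti_univ (v : Fin d → Fin d → R) :
    (extBasis R (Fin d)).repr (ExteriorAlgebra.ιMulti R d v) Finset.univ = (Matrix.of v).det := by
  set f : (Fin d → R) [⋀^Fin d]→ₗ[R] R :=
    ((extBasis R (Fin d)).coord Finset.univ).compAlternatingMap (ExteriorAlgebra.ιMulti R d)
  have h := alternating_eq_det f v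
  have h1 : f (fun a => Pi.single a 1) = 1 := by
    change (extBasis R (Fin d)).repr (ExteriorAlgebra.ιMulti R d _) Finset.univ = 1
    rw [← extBasis_univ, (extBasis R (Fin d)).repr_self, Finsupp.single_eq_same]
  rw [h1, one_mul] at h
  exact h

/-- A linear map acts on the top coefficient by its determinant. -/
lemma repr_map_univ [Algebra ℝ R] (B : Matrix (Fin d) (Fin d) R)
    (x : ExteriorAlgebra R (Fin d → R)) :
    (extBasis R (Fin d)).repr (ExteriorAlgebra.map (Matrix.toLin' B) x) Finset.univ =
      B.det * (extBasis R (Fin d)).repr x Finset.univ := by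
  have key : ∀ s, (extBasis R (Fin d)).repr
      (ExteriorAlgebra.map (Matrix.toLin' B) (extBasis R (Fin d) s)) Finset.univ =
      B.det * (extBasis R (Fin d)).repr (extBasis R (Fin d) s) Finset.univ := by
    intro s
    rw [(extBasis R (Fin d)).repr_self]
    by_cases hs : s = Finset.univ
    · subst hs
      rw [Finsupp.single_eq_same, mul_one, extBasis_univ, ExteriorAlgebra.map_apply_ιMulti,
        repr_ιMulti_univ, ← Matrix.det_transpose]
      congr 1
      ext i j
      simp
    · rw [Finsupp.single_eq_of_ne (Ne.symm hs), mul_zero]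
      refine repr_eq_zero_of_card_ne (k := s.card) ?_ ?_
      · have hcomm : (rescale fun _ => algebraMap ℝ R 2).comp
            (ExteriorAlgebra.map (Matrix.toLin' B)) =
            (ExteriorAlgebra.map (Matrix.toLin' B)).comp (rescale fun _ => algebraMap ℝ R 2) := by
          refine ExteriorAlgebra.hom_ext (LinearMap.ext fun v => ?_)
          simp only [AlgHom.toLinearMap_apply, LinearMap.comp_apply, AlgHom.comp_apply, rescale,
            ExteriorAlgebra.map_apply_ι]
          congr 1
          have e : ∀ w : Fin d → R, LinearMap.mulLeft R (fun _ : Fin d => algebraMap ℝ R 2) w =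
              algebraMap ℝ R 2 • w := fun w => rfl
          rw [e, e, map_smul]
        refine (congrArg (fun f => f (extBasis R (Fin d) s)) hcomm).trans ?_
        rw [AlgHom.comp_apply, rescale_extBasis, Finset.prod_const, map_smul, map_pow]
      · rw [Finset.card_univ]
        exact fun h => hs ((Finset.card_eq_iff_eq_univ s).1 h.symm)
  conv_lhs => rw [← (extBasis R (Fin d)).sum_repr x]
  conv_rhs => rw [← (extBasis R (Fin d)).sum_repr x]
  simp only [map_sum, map_smul, Finsupp.coe_finsetSum, Finset.sum_apply, Finsupp.smul_apply,
    smul_eq_mul, key, Finset.mul_sum]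
  exact Finset.sum_congr rfl fun s _ => mul_left_comm _ _ _

/-- The behaviour of the Pfaffian under a change of basis. -/
lemma wedgePow_congr [Algebra ℝ R] (m : ℕ) (A B : Matrix (Fin d) (Fin d) R) :
    wedgePow m (B * A * B.transpose) = B.det * wedgePow m A := by
  have h : ExteriorAlgebra.map (Matrix.toLin' B) (quadForm A) =
      quadForm (B * A * B.transpose) := by
    have e : ∀ i, ExteriorAlgebra.map (Matrix.toLin' B) (gen R i) = ∑ k, B k i • gen R k := by
      intro i
      rw [gen, ExteriorAlgebra.map_apply_ι]
      simp only [gen, ← map_smul, ← map_sum]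
      congr 1
      funext k
      simp [Matrix.toLin'_apply, Pi.single_apply]
    simp only [quadForm, map_sum, map_smul, map_mul, e, Finset.sum_mul, Finset.mul_sum,
      Finset.smul_sum, smul_mul_assoc, mul_smul_comm, smul_smul, Matrix.mul_apply,
      Matrix.transpose_apply, Finset.sum_smul]
    conv_rhs => rw [Finset.sum_comm]
    rw [Finset.sum_congr rfl fun i _ => Finset.sum_comm]
    rw [Finset.sum_comm]
    refine Finset.sum_congr rfl fun k _ => ?_
    rw [Finset.sum_congr rfl fun i _ => Finset.sum_comm]
    rw [Finset.sum_comm]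
    refine Finset.sum_congr rfl fun l _ => ?_
    rw [Finset.sum_comm]
    refine Finset.sum_congr rfl fun j _ => Finset.sum_congr rfl fun i _ => ?_
    congr 1
    ring
  rw [wedgePow, ← h, ← map_pow, repr_map_univ, wedgePow]

end TopForms

/-! ### Products of two-forms in the BV algebra -/

section BVAlgebra

variable {R S : Type*} [CommRing R] [CommRing S] {d : ℕ}

lemma bvBasis_eq (R : Type*) [CommRing R] (d : ℕ) : bvBasis R d = extBasis R (Fin d ⊕ₗ Fin d) := rfl

lemma gen_eq_extBasis {κ : Type*} [Fintype κ] [LinearOrder κ] (i : κ) :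
    gen R i = extBasis R κ {i} := by
  rw [extBasis_apply (Finset.card_singleton i), ExteriorAlgebra.ιMulti_succ_apply,
    ExteriorAlgebra.ιMulti_zero_apply, mul_one, Finset.orderEmbOfFin_singleton, gen]

lemma repr_mapCoeff (T : R → S) (a : BVForms R d) (s : Finset (Fin d ⊕ₗ Fin d)) :
    (bvBasis S d).repr (mapCoeff T a) s = T ((bvBasis R d).repr a s) := by
  rw [mapCoeff, (bvBasis S d).repr_sum_self]

lemma mapCoeff_ringHom (φ : R →+* S) (a : BVForms R d) : mapCoeff φ a = baseChange φ a := by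
  refine (bvBasis S d).ext_elem fun s => ?_
  rw [repr_mapCoeff]
  exact (repr_baseChange φ a s).symm

lemma mapCoeff_sum_smul (T : R →+ S) {ι : Type*} (I : Finset ι) (c : ι → R)
    (s : ι → Finset (Fin d ⊕ₗ Fin d)) :
    mapCoeff T (∑ j ∈ I, c j • bvBasis R d (s j)) = ∑ j ∈ I, T (c j) • bvBasis S d (s j) := by
  refine (bvBasis S d).ext_elem fun u => ?_
  rw [repr_mapCoeff]
  simp only [map_sum, map_smul, (bvBasis S d).repr_self, (bvBasis R d).repr_self,
    Finsupp.coe_finsetSum, Finset.sum_apply, Finsupp.smul_apply]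
  refine Finset.sum_congr rfl fun j _ => ?_
  by_cases h : u = s j
  · subst h; simp
  · simp [Finsupp.single_eq_of_ne h]

/-- The two-form `∑ c_{ij} dyⁱ dxʲ`. -/
def bvTwoForm (c : Matrix (Fin d) (Fin d) R) : BVForms R d :=
  ∑ i, ∑ j, c i j • (dY R i * dX R j)

lemma baseChange_bvTwoForm (φ : R →+* S) (c : Matrix (Fin d) (Fin d) R) :
    baseChange φ (bvTwoForm c) = bvTwoForm (c.map φ) := by
  have hY : ∀ i, baseChange φ (dY R i : BVForms R d) = dY S i := fun i => baseChange_gen φ _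
  have hX : ∀ i, baseChange φ (dX R i : BVForms R d) = dX S i := fun i => baseChange_gen φ _
  simp only [bvTwoForm, map_sum, baseChange_smul, map_mul, hX, hY, Matrix.map_apply]

lemma rescale_bvTwoForm (t : R) (c : Matrix (Fin d) (Fin d) R) :
    rescale (fun _ => t) (bvTwoForm c) = (t ^ 2) • bvTwoForm c := by
  have hY : ∀ i, rescale (fun _ => t) (dY R i : BVForms R d) = t • dY R i := fun i =>
    rescale_gen _ _
  have hX : ∀ i, rescale (fun _ => t) (dX R i : BVForms R d) = t • dX R i := fun i =>
    rescale_gen _ _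
  simp only [bvTwoForm, map_sum, map_smul, map_mul, hX, hY, Finset.smul_sum, smul_mul_assoc,
    mul_smul_comm, smul_smul]
  refine Finset.sum_congr rfl fun i _ => Finset.sum_congr rfl fun j _ => ?_
  congr 1
  ring

lemma rescale_prod_bvTwoForm (t : R) {k : ℕ} (c : Fin k → Matrix (Fin d) (Fin d) R) :
    rescale (fun _ => t) (List.ofFn fun α => bvTwoForm (c α)).prod =
      (t ^ (2 * k)) • (List.ofFn fun α => bvTwoForm (c α)).prod := by
  induction k with
  | zero => simp
  | succ k ih =>
    rw [List.ofFn_succ, List.prod_cons, map_mul, ih fun α => c α.succ, rescale_bvTwoForm,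
      smul_mul_smul_comm]
    congr 1
    ring

/-- A product of `k` two-forms has degree `2 k`. -/
lemma repr_prod_bvTwoForm_eq_zero [Algebra ℝ R] {k : ℕ} (c : Fin k → Matrix (Fin d) (Fin d) R)
    {s : Finset (Fin d ⊕ₗ Fin d)} (hs : s.card ≠ 2 * k) :
    (bvBasis R d).repr (List.ofFn fun α => bvTwoForm (c α)).prod s = 0 := by
  refine repr_eq_zero_of_card_ne ?_ hs
  rw [rescale_prod_bvTwoForm, map_pow]

/-- The inclusion of the span of the `dyⁱ`. -/
def inclY : (Fin d → R) →ₗ[R] ((Fin d ⊕ₗ Fin d) → R) where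
  toFun v s := Sum.elim (fun _ => 0) v (ofLex s)
  map_add' v w := by
    funext s
    rcases h : ofLex s with i | i <;> simp [h]
  map_smul' c v := by
    funext s
    rcases h : ofLex s with i | i <;> simp [h]

/-- The inclusion of the span of the `dxʲ`. -/
def inclX : (Fin d → R) →ₗ[R] ((Fin d ⊕ₗ Fin d) → R) where
  toFun v s := Sum.elim v (fun _ => 0) (ofLex s)
  map_add' v w := by
    funext s
    rcases h : ofLex s with i | i <;> simp [h]
  map_smul' c v := by
    funext s
    rcases h : ofLex s with i | i <;> simp [h]

lemma inclY_single (i : Fin d) : inclY (Pi.single i (1 : R)) = Pi.single (Sum.inrₗ i) 1 := by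
  funext s
  rw [Pi.single_apply]
  obtain ⟨s, rfl⟩ := toLex.surjective s
  rcases s with j | j
  · exact (if_neg (by simp [Sum.inrₗ])).symm
  · simp [inclY, Sum.inrₗ, Pi.single_apply]

lemma inclX_single (i : Fin d) : inclX (Pi.single i (1 : R)) = Pi.single (Sum.inlₗ i) 1 := by
  funext s
  rw [Pi.single_apply]
  obtain ⟨s, rfl⟩ := toLex.surjective s
  rcases s with j | j
  · simp [inclX, Sum.inlₗ, Pi.single_apply]
  · exact (if_neg (by simp [Sum.inlₗ])).symm

lemma ι_mul_ιMulti {N : Type*} [AddCommGroup N] [Module R N] (w : N) {k : ℕ} (u : Fin k → N) :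
    ExteriorAlgebra.ι R w * ExteriorAlgebra.ιMulti R k u =
      (-1 : ℤ) ^ k • (ExteriorAlgebra.ιMulti R k u * ExteriorAlgebra.ι R w) := by
  induction k with
  | zero => simp
  | succ k ih =>
    rw [ExteriorAlgebra.ιMulti_succ_apply, ← mul_assoc,
      eq_neg_of_add_eq_zero_left (ExteriorAlgebra.ι_add_mul_swap w (u 0)), neg_mul, mul_assoc, ih,
      mul_smul_comm, ← mul_assoc, pow_succ, mul_neg_one, neg_smul]

/-- The reordering of a product of pairs of odd elements. -/
lemma exists_prod_pairs.{u} (k : ℕ) : ∃ ε : ℤ, ∀ (R : Type u) [CommRing R] (N : Type u)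
    [AddCommGroup N]
    [Module R N] (u w : Fin k → N),
    (List.ofFn fun α => ExteriorAlgebra.ι R (u α) * ExteriorAlgebra.ι R (w α)).prod =
      ε • (ExteriorAlgebra.ιMulti R k u * ExteriorAlgebra.ιMulti R k w) := by
  induction k with
  | zero => exact ⟨1, fun R _ N _ _ u w => by simp⟩
  | succ k ih =>
    obtain ⟨ε, h⟩ := ih
    refine ⟨(-1) ^ k * ε, fun R _ N _ _ u w => ?_⟩
    rw [List.ofFn_succ, List.prod_cons, h, ExteriorAlgebra.ιMulti_succ_apply,
      ExteriorAlgebra.ιMulti_succ_apply]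
    have h1 := ι_mul_ιMulti (R := R) (w 0) (Matrix.vecTail u)
    have h2 : ExteriorAlgebra.ιMulti R k (Matrix.vecTail u) * ExteriorAlgebra.ι R (w 0) =
        (-1 : ℤ) ^ k • (ExteriorAlgebra.ι R (w 0) * ExteriorAlgebra.ιMulti R k (Matrix.vecTail u))
          := by
      rw [h1, smul_smul, ← mul_pow]
      simp
    rw [mul_assoc (ExteriorAlgebra.ι R (u 0)) (ExteriorAlgebra.ιMulti R k (Matrix.vecTail u)),
      ← mul_assoc (ExteriorAlgebra.ιMulti R k (Matrix.vecTail u)), h2, smul_mul_assoc,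
      mul_smul_comm, mul_smul_comm, smul_smul, mul_assoc, mul_assoc, ← mul_assoc ((-1 : ℤ) ^ k),
      mul_right_comm, ← mul_pow]
    simp [Matrix.vecTail, Function.comp_def, mul_assoc]

lemma map_inclY (φ : R →+* S) (a : Fin d) : (fun i => φ (inclY (Pi.single a 1) i)) =
    inclY (Pi.single a 1) := by
  funext i
  rw [← map_single_one φ a]
  rcases h : ofLex i with b | b <;> simp [inclY, h]

lemma map_inclX (φ : R →+* S) (a : Fin d) : (fun i => φ (inclX (Pi.single a 1) i)) =
    inclX (Pi.single a 1) := by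
  funext i
  rw [← map_single_one φ a]
  rcases h : ofLex i with b | b <;> simp [inclX, h]

/-- The sign of a map of a finite ordered set to itself, zero if it is not bijective. -/
def mapSign (j : Fin d → Fin d) : ℤ := (Matrix.of fun a => (Pi.single (j a) 1 : Fin d → ℤ)).det

lemma det_single (R : Type*) [CommRing R] (j : Fin d → Fin d) :
    (Matrix.of fun a => (Pi.single (j a) 1 : Fin d → R)).det = (mapSign j : R) := by
  change _ = Int.castRingHom R (mapSign j)
  rw [mapSign, RingHom.map_det]
  congr 1
  ext a b
  exact (congrFun (map_single_one (Int.castRingHom R) (j a)) b).symm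

/-- The top coefficient of a product of `d` fibre vectors and `d` base vectors is, up to the value on
the standard bases, the product of two determinants. -/
lemma repr_ιMulti_mul_ιMulti (v w : Fin d → Fin d → R) :
    (bvBasis R d).repr (ExteriorAlgebra.ιMulti R d (fun a => inclY (v a)) *
      ExteriorAlgebra.ιMulti R d (fun a => inclX (w a))) Finset.univ =
    (bvBasis R d).repr (ExteriorAlgebra.ιMulti R d (fun a => inclY (Pi.single a 1)) *
      ExteriorAlgebra.ιMulti R d (fun a => inclX (Pi.single a 1))) Finset.univ *
      (Matrix.of v).det * (Matrix.of w).det := by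
  have h1 := alternating_eq_det ((((bvBasis R d).coord Finset.univ).comp
    (LinearMap.mulRight R (ExteriorAlgebra.ιMulti R d fun a => inclX (w a)))).compAlternatingMap
      ((ExteriorAlgebra.ιMulti R d).compLinearMap inclY)) v
  have h2 := alternating_eq_det ((((bvBasis R d).coord Finset.univ).comp
    (LinearMap.mulLeft R (ExteriorAlgebra.ιMulti R d fun a => inclY
      (Pi.single a (1 : R) : Fin d → R)))).compAlternatingMap
      ((ExteriorAlgebra.ιMulti R d).compLinearMap inclX)) w
  refine h1.trans ?_
  rw [mul_right_comm]
  exact congrArg (· * (Matrix.of v).det) h2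

/-- The top coefficient of a product of monomials `dyⁱ dxʲ`; the universal sign `κ` comes from the
reordering of the factors. -/
lemma exists_repr_prod_pairs.{u} (d : ℕ) : ∃ κ : ℤ, ∀ (R : Type u) [CommRing R]
    (i j : Fin d → Fin d),
    (bvBasis R d).repr (List.ofFn fun α => dY R (i α) * dX R (j α)).prod Finset.univ =
      ((κ * mapSign i * mapSign j : ℤ) : R) := by
  obtain ⟨ε, hε⟩ := exists_prod_pairs.{u} d
  refine ⟨ε * (bvBasis ℤ d).repr (ExteriorAlgebra.ιMulti ℤ d (fun a => inclY (Pi.single a 1)) *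
      ExteriorAlgebra.ιMulti ℤ d (fun a => inclX (Pi.single a 1))) Finset.univ,
    fun R _ i j => ?_⟩
  simp only [dY, dX, ← inclY_single, ← inclX_single]
  rw [hε, ← Int.cast_smul_eq_zsmul R, map_smul, Finsupp.smul_apply, smul_eq_mul,
    repr_ιMulti_mul_ιMulti, det_single, det_single]
  have h := repr_baseChange (Int.castRingHom R) (ExteriorAlgebra.ιMulti ℤ d
    (fun a => inclY (Pi.single a 1)) * ExteriorAlgebra.ιMulti ℤ d
      (fun a => inclX (Pi.single a 1))) (Finset.univ : Finset (Fin d ⊕ₗ Fin d))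
  rw [map_mul, baseChange_ιMulti, baseChange_ιMulti] at h
  have eY : (fun (a : Fin d) i => Int.castRingHom R (inclY (Pi.single a 1) i)) =
      fun a => inclY (Pi.single a 1) := funext fun a => map_inclY _ a
  have eX : (fun (a : Fin d) i => Int.castRingHom R (inclX (Pi.single a 1) i)) =
      fun a => inclX (Pi.single a 1) := funext fun a => map_inclX _ a
  rw [eY, eX] at h
  rw [bvBasis_eq, h]
  simp only [Int.coe_castRingHom, Int.cast_mul, bvBasis_eq]
  ring

/-- The top coefficient of a product of two-forms. -/
lemma exists_repr_prod_bvTwoForm.{u} (d : ℕ) : ∃ κ : ℤ, ∀ (R : Type u) [CommRing R]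
    (c : Fin d → Matrix (Fin d) (Fin d) R),
    (bvBasis R d).repr (List.ofFn fun α => bvTwoForm (c α)).prod Finset.univ =
      ∑ i : Fin d → Fin d, ∑ j : Fin d → Fin d,
        ((κ * mapSign i * mapSign j : ℤ) : R) * ∏ α, c α (i α) (j α) := by
  obtain ⟨κ, hκ⟩ := exists_repr_prod_pairs.{u} d
  refine ⟨κ, fun R _ c => ?_⟩
  have h1 : (List.ofFn fun α => bvTwoForm (c α)).prod =
      ∑ r : Fin d → Fin d × Fin d, (∏ α, c α (r α).1 (r α).2) •
        (List.ofFn fun α => dY R (r α).1 * dX R (r α).2).prod := by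
    have h2 := (MultilinearMap.mkPiAlgebraFin R d (BVForms R d)).map_sum
      (fun α (x : Fin d × Fin d) => c α x.1 x.2 • (dY R x.1 * dX R x.2))
    simp only [MultilinearMap.map_smul_univ, MultilinearMap.mkPiAlgebraFin_apply,
      Fintype.sum_prod_type] at h2
    exact h2
  rw [h1]
  simp only [map_sum, map_smul, Finsupp.coe_finsetSum, Finset.sum_apply, Finsupp.smul_apply,
    smul_eq_mul, hκ]
  rw [← Fintype.sum_prod_type']
  refine Fintype.sum_equiv (Equiv.arrowProdEquivProdArrow (Fin d) (fun _ => Fin d) fun _ => Fin d)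
      _ _ fun r => ?_
  exact mul_comm _ _

end BVAlgebra

/-! ### Contraction along the fibres -/

section Contraction

variable {R S : Type*} [CommRing R] [CommRing S] {d : ℕ}

/-- The derivation `∂/∂(dyⁱ)` of the BV algebra. -/
def contrY (R : Type*) [CommRing R] {d : ℕ} (i : Fin d) : Module.End R (BVForms R d) :=
  CliffordAlgebra.contractLeft (LinearMap.proj (Sum.inrₗ i))

lemma contrY_ι_mul (i : Fin d) (v : (Fin d ⊕ₗ Fin d) → R) (x : BVForms R d) :
    contrY R i (ExteriorAlgebra.ι R v * x) =
      v (Sum.inrₗ i) • x - ExteriorAlgebra.ι R v * contrY R i x :=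
  CliffordAlgebra.contractLeft_ι_mul _ _ _

lemma contrY_algebraMap (i : Fin d) (r : R) :
    contrY R i (algebraMap R (BVForms R d) r) = 0 :=
  CliffordAlgebra.contractLeft_algebraMap _ _ r

lemma baseChange_contrY (φ : R →+* S) (i : Fin d) (x : BVForms R d) :
    baseChange φ (contrY R i x) = contrY S i (baseChange φ x) := by
  induction x using CliffordAlgebra.left_induction with
  | algebraMap r =>
    have h1 : baseChange φ (algebraMap R (BVForms R d) r) = algebraMap S (BVForms S d) (φ r) := by
      rw [Algebra.algebraMap_eq_smul_one, baseChange_smul, map_one, Algebra.algebraMap_eq_smul_one]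
    refine (congrArg (baseChange φ) (contrY_algebraMap i r)).trans ?_
    rw [map_zero]
    exact ((congrArg (contrY S i) h1).trans (contrY_algebraMap i (φ r))).symm
  | add x y hx hy => rw [map_add, map_add, map_add, map_add, hx, hy]
  | ι_mul x v hx =>
    change baseChange φ (contrY R i (ExteriorAlgebra.ι R v * x)) =
      contrY S i (baseChange φ (ExteriorAlgebra.ι R v * x))
    rw [contrY_ι_mul, map_sub, baseChange_smul, map_mul, map_mul, baseChange_ι, contrY_ι_mul, hx]

lemma contrY_rescale (t : R) (i : Fin d) (x : BVForms R d) :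
    contrY R i (rescale (fun _ => t) x) = t • rescale (fun _ => t) (contrY R i x) := by
  induction x using CliffordAlgebra.left_induction with
  | algebraMap r =>
    have h1 : rescale (fun _ => t) (algebraMap R (BVForms R d) r) = algebraMap R (BVForms R d) r :=
      AlgHom.commutes _ r
    refine (congrArg (contrY R i) h1).trans ((contrY_algebraMap i r).trans ?_)
    refine Eq.trans ?_ (congrArg (fun y => t • rescale (fun _ => t) y)
      (contrY_algebraMap i r)).symm
    simp
  | add x y hx hy => rw [map_add, map_add, map_add, map_add, hx, hy, smul_add]
  | ι_mul x v hx =>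
    change contrY R i (rescale (fun _ => t) (ExteriorAlgebra.ι R v * x)) =
      t • rescale (fun _ => t) (contrY R i (ExteriorAlgebra.ι R v * x))
    have h1 : rescale (fun _ => t) (ExteriorAlgebra.ι R v) = ExteriorAlgebra.ι R (t • v) :=
      ExteriorAlgebra.map_apply_ι _ _
    rw [contrY_ι_mul, map_mul, h1, contrY_ι_mul, hx, map_sub, map_mul, h1, smul_sub, mul_smul_comm,
      Pi.smul_apply, smul_eq_mul, map_smul (rescale _), smul_smul]

variable (R d) in
/-- The action of fibrewise polyvectors by contraction. -/
def contr : ExteriorAlgebra R (Fin d → R) →ₐ[R] Module.End R (BVForms R d) :=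
  ExteriorAlgebra.lift R ⟨(CliffordAlgebra.contractLeft (Q := 0)).comp
    (Fintype.linearCombination R fun i : Fin d =>
      (LinearMap.proj (Sum.inrₗ i) : Module.Dual R ((Fin d ⊕ₗ Fin d) → R))),
    fun _ => LinearMap.ext fun _ => CliffordAlgebra.contractLeft_contractLeft _ _⟩

lemma contr_gen (i : Fin d) : contr R d (gen R i) = contrY R i := by
  rw [contr, gen, ExteriorAlgebra.lift_ι_apply, LinearMap.comp_apply,
    Fintype.linearCombination_apply_single, one_smul]
  rfl

lemma contr_extBasis_univ :
    contr R d (extBasis R (Fin d) Finset.univ) = ((List.finRange d).map (contrY R)).prod := by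
  rw [extBasis_univ, ExteriorAlgebra.ιMulti_apply, map_list_prod, List.map_ofFn, ← List.ofFn_id,
    List.map_ofFn]
  congr 2
  funext a
  exact contr_gen a

lemma baseChange_prod_contrY (φ : R →+* S) (l : List (Fin d)) (x : BVForms R d) :
    baseChange φ ((l.map (contrY R)).prod x) = (l.map (contrY S)).prod (baseChange φ x) := by
  induction l with
  | nil => rfl
  | cons i l ih =>
    rw [List.map_cons, List.prod_cons, List.map_cons, List.prod_cons, Module.End.mul_apply,
      Module.End.mul_apply, baseChange_contrY, ih]

lemma prod_contrY_rescale (t : R) (l : List (Fin d)) (x : BVForms R d) :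
    (l.map (contrY R)).prod (rescale (fun _ => t) x) =
      t ^ l.length • rescale (fun _ => t) ((l.map (contrY R)).prod x) := by
  induction l with
  | nil => simp
  | cons i l ih =>
    rw [List.map_cons, List.prod_cons, Module.End.mul_apply, Module.End.mul_apply, ih, map_smul,
      contrY_rescale, smul_smul, List.length_cons, pow_succ]

/-- The set of all the generators `dxʲ`. -/
def baseSet (d : ℕ) : Finset (Fin d ⊕ₗ Fin d) :=
  Finset.univ.map ⟨fun j => Sum.inlₗ j, fun _ _ h => Sum.inl_injective (toLex.injective h)⟩

lemma card_baseSet (d : ℕ) : (baseSet d).card = d := by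
  rw [baseSet, Finset.card_map, Finset.card_univ, Fintype.card_fin]

lemma card_lex (d : ℕ) : Fintype.card (Fin d ⊕ₗ Fin d) = 2 * d := by
  rw [Fintype.card_lex, Fintype.card_sum, Fintype.card_fin, two_mul]

/-- The sign relating the order of the generators of the BV algebra to the Berezin integral. -/
def berSign (d : ℕ) : ℤ :=
  (bvBasis ℤ d).repr (contr ℤ d (extBasis ℤ (Fin d) Finset.univ) (bvBasis ℤ d Finset.univ))
    (baseSet d)

/-- Contraction with the top polyvector of the fibre extracts the top coefficient. -/
lemma repr_contr_univ [Algebra ℝ R] (x : BVForms R d) :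
    (bvBasis R d).repr (contr R d (extBasis R (Fin d) Finset.univ) x) (baseSet d) =
      (berSign d : R) * (bvBasis R d).repr x Finset.univ := by
  have key : ∀ s, (bvBasis R d).repr
      (contr R d (extBasis R (Fin d) Finset.univ) (bvBasis R d s)) (baseSet d) =
      (berSign d : R) * (bvBasis R d).repr (bvBasis R d s) Finset.univ := by
    intro s
    rw [contr_extBasis_univ, (bvBasis R d).repr_self]
    by_cases hs : s = Finset.univ
    · subst hs
      rw [Finsupp.single_eq_same, mul_one]
      have h := baseChange_prod_contrY (Int.castRingHom R) (List.finRange d)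
        (bvBasis ℤ d Finset.univ)
      rw [bvBasis_eq ℤ, baseChange_extBasis] at h
      rw [bvBasis_eq R, ← h, repr_baseChange, berSign, contr_extBasis_univ]
      rfl
    · rw [Finsupp.single_eq_of_ne (Ne.symm hs), mul_zero]
      have h := prod_contrY_rescale (algebraMap ℝ R 2) (List.finRange d) (bvBasis R d s)
      rw [bvBasis_eq R, rescale_extBasis, Finset.prod_const, map_smul, List.length_finRange] at h
      have h1 := congrArg (fun y => (extBasis R (Fin d ⊕ₗ Fin d)).repr y (baseSet d)) h
      simp only [map_smul, Finsupp.smul_apply, smul_eq_mul, repr_rescale, Finset.prod_const,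
        card_baseSet, ← mul_assoc, ← pow_add] at h1
      rw [← map_pow, ← map_pow, ← Algebra.smul_def, ← Algebra.smul_def, ← sub_eq_zero,
        ← sub_smul] at h1
      have hne : (2 : ℝ) ^ s.card - 2 ^ (d + d) ≠ 0 := sub_ne_zero.2 fun h2 => hs <|
        (Finset.card_eq_iff_eq_univ s).1 ((two_pow_injective h2).trans
          ((two_mul d).symm.trans (card_lex d).symm))
      have h3 := congrArg (fun y => ((2 : ℝ) ^ s.card - 2 ^ (d + d))⁻¹ • y) h1
      simp only [inv_smul_smul₀ hne, smul_zero] at h3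
      exact h3
  conv_lhs => rw [← (bvBasis R d).sum_repr x]
  conv_rhs => rw [← (bvBasis R d).sum_repr x]
  simp only [map_sum, map_smul, Finsupp.coe_finsetSum, Finset.sum_apply, Finsupp.smul_apply,
    smul_eq_mul, key, Finset.mul_sum]
  exact Finset.sum_congr rfl fun s _ => mul_left_comm _ _ _

end Contraction

/-! ### The fibrewise integral -/

section Berezin

variable {M : Type*} {n : ℕ}

/-- Constants, in `y` and `ħ`, as coefficients of forms. -/
def laurentConst (M : Type*) (d : ℕ) : (M → ℝ) →+* LaurentSection M d :=
  HahnSeries.C.comp ((MvPowerSeries.C (σ := Fin d) (R := ℝ)).compLeft M)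

/-- The operator in the fibrewise integral is the contraction with the Poisson bivector. -/
lemma berOp_eq {d : ℕ} (Pi : M → Matrix (Fin d) (Fin d) ℝ) (a : BVForms (LaurentSection M d) d) :
    berOp Pi a = contr _ d (quadForm (Matrix.of fun i j =>
      laurentConst M d fun p => (1 / 2 : ℝ) * Pi p i j)) a := by
  rw [berOp, quadForm]
  simp only [map_sum (contr _ d), map_smul (contr _ d), map_mul (contr _ d), contr_gen,
    LinearMap.sum_apply, LinearMap.smul_apply, Module.End.mul_apply]
  rfl

/-- The fibrewise integral extracts the top coefficient, multiplied by a Pfaffian. -/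
lemma repr_berOp (Pi : M → Matrix (Fin (2 * n)) (Fin (2 * n)) ℝ)
    (a : BVForms (LaurentSection M (2 * n)) (2 * n)) :
    (bvBasis _ (2 * n)).repr ((berOp Pi)^[n] a) (baseSet (2 * n)) =
      laurentConst M (2 * n) (fun p => (berSign (2 * n) : ℝ) * wedgePow n ((1 / 2 : ℝ) • Pi p)) *
        (bvBasis _ (2 * n)).repr a Finset.univ := by
  set A : Matrix (Fin (2 * n)) (Fin (2 * n)) (M → ℝ) :=
    Matrix.of fun i j p => (1 / 2 : ℝ) * Pi p i j with hA
  have hB : (Matrix.of fun i j => laurentConst M (2 * n) fun p => (1 / 2 : ℝ) * Pi p i j) =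
      A.map (laurentConst M (2 * n)) := rfl
  have h1 : (berOp Pi)^[n] a =
      contr _ _ (quadForm (A.map (laurentConst M (2 * n))) ^ n) a := by
    have e : berOp Pi = ⇑(contr _ _ (quadForm (A.map (laurentConst M (2 * n))))) := by
      funext x
      rw [berOp_eq, hB]
    rw [e, map_pow, Module.End.pow_apply]
  have hw : wedgePow n A = fun p => wedgePow n ((1 / 2 : ℝ) • Pi p) := by
    funext p
    exact (wedgePow_map (_root_.Pi.evalRingHom (fun _ : M => ℝ) p) n A).symm
  rw [h1, quadForm_pow_eq (Fintype.card_fin _), wedgePow_map, map_smul, LinearMap.smul_apply,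
    map_smul, Finsupp.smul_apply, repr_contr_univ, smul_eq_mul, ← mul_assoc, hw]
  congr 1
  refine (mul_comm _ _).trans ?_
  rw [← map_intCast (laurentConst M (2 * n)) (berSign (2 * n)), ← map_mul]
  rfl

end Berezin

/-! ### Units of exterior algebras -/

section Unit

variable {R : Type*} [CommRing R] {κ : Type*} [Fintype κ] [LinearOrder κ]

/-- Monomials of even degree are central. -/
lemma commute_extBasis {s : Finset κ} (hs : Even s.card) (x : ExteriorAlgebra R (κ → R)) :
    Commute (extBasis R κ s) x := by
  induction x using CliffordAlgebra.left_induction with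
  | algebraMap r => exact Algebra.commute_algebraMap_right r _
  | add x y hx hy => exact hx.add_right hy
  | ι_mul x v hx =>
    refine Commute.mul_right ?_ hx
    have h := ι_mul_ιMulti (R := R) v fun a => Pi.single (s.orderEmbOfFin rfl a) (1 : R)
    rw [hs.neg_one_pow, one_smul, ← extBasis_apply] at h
    exact h.symm

lemma extBasis_sq {s : Finset κ} (hs : Even s.card) (h0 : s ≠ ∅) :
    extBasis R κ s * extBasis R κ s = 0 := by
  obtain ⟨k, hk⟩ : ∃ k, s.card = k + 1 :=
    Nat.exists_eq_succ_of_ne_zero (Finset.card_ne_zero.2 (Finset.nonempty_iff_ne_empty.2 h0))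
  obtain ⟨v, y, hy⟩ : ∃ v y, extBasis R κ s = ExteriorAlgebra.ι R v * y := by
    rw [extBasis_apply hk, ExteriorAlgebra.ιMulti_succ_apply]
    exact ⟨_, _, rfl⟩
  have h := (commute_extBasis hs (ExteriorAlgebra.ι R v)).eq
  have h1 : extBasis R κ s * extBasis R κ s = extBasis R κ s * (ExteriorAlgebra.ι R v * y) :=
    congrArg (extBasis R κ s * ·) hy
  have h2 : ExteriorAlgebra.ι R v * extBasis R κ s = 0 := by
    rw [hy, ← mul_assoc, ExteriorAlgebra.ι_sq_zero, zero_mul]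
  rw [h1, ← mul_assoc, h, h2, zero_mul]

lemma extBasis_empty : extBasis R κ ∅ = 1 := by
  rw [extBasis_apply Finset.card_empty, ExteriorAlgebra.ιMulti_zero_apply]

/-- An even element with constant term `1` is invertible and central. -/
lemma isUnit_of_repr {x : ExteriorAlgebra R (κ → R)}
    (h0 : (extBasis R κ).repr x ∅ = 1)
    (h : ∀ s, ¬ Even s.card → (extBasis R κ).repr x s = 0) :
    IsUnit x ∧ ∀ y, Commute x y := by
  have hx : x = ∑ s, (extBasis R κ).repr x s • extBasis R κ s := ((extBasis R κ).sum_repr x).symm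
  have hcomm : ∀ s y, Commute ((extBasis R κ).repr x s • extBasis R κ s) y := by
    intro s y
    by_cases hs : Even s.card
    · exact (commute_extBasis hs y).smul_left _
    · rw [h s hs, zero_smul]
      exact Commute.zero_left y
  constructor
  · have h1 : x = 1 + ∑ s ∈ Finset.univ.erase ∅, (extBasis R κ).repr x s • extBasis R κ s := by
      conv_lhs => rw [hx, ← Finset.add_sum_erase _ _ (Finset.mem_univ ∅), h0, one_smul,
        extBasis_empty]
    rw [h1]
    refine IsNilpotent.isUnit_one_add ?_
    refine Commute.isNilpotent_sum (fun s hs => ?_) fun s t _ _ => hcomm s _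
    refine ⟨2, ?_⟩
    by_cases hev : Even s.card
    · rw [pow_two, smul_mul_smul_comm, extBasis_sq hev (Finset.ne_of_mem_erase hs), smul_zero]
    · rw [h s hev, zero_smul, zero_pow two_ne_zero]
  · intro y
    rw [hx]
    exact Commute.sum_left _ _ _ fun s _ => hcomm s y

end Unit

/-! ### The local-to-global map -/

section Insertion

variable {M : Type*} {d : ℕ}

lemma configIntegral_apply_zero (Pi : M → Matrix (Fin d) (Fin d) ℝ) (k : ℕ) :
    configIntegral Pi k 0 = 0 := by
  refine PowerSeries.ext fun N => ?_
  funext p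
  refine MvPowerSeries.ext fun m => ?_
  have h : ∀ θ : Fin k → ℝ, expHbar (partialP Pi θ) 0 = 0 := fun θ => by
    refine PowerSeries.ext fun N => ?_
    simp [expHbar]
  have h2 : PowerSeries.coeff N (configIntegral Pi k 0) = _ := PowerSeries.coeff_mk N _
  rw [h2]
  change ∫ θ in Set.Icc (0 : Fin k → ℝ) 1, MvPowerSeries.coeff m
        (PowerSeries.coeff N (multMap k (expHbar (partialP Pi θ) 0)) p) = _
  simp [h]

lemma configIntegral_one (Pi : M → Matrix (Fin d) (Fin d) ℝ) :
    configIntegral Pi 0 1 = 1 := by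
  refine PowerSeries.ext fun N => ?_
  funext p
  refine MvPowerSeries.ext fun m => ?_
  have h : ∀ θ : Fin 0 → ℝ, expHbar (partialP Pi θ) 1 = 1 := fun θ => by
    have h0 : partialP Pi θ = 0 := by simp [partialP]
    refine PowerSeries.ext fun N => ?_
    rw [expHbar, PowerSeries.coeff_mk, Finset.sum_eq_single 0]
    · simp
    · intro m _ hm
      rw [h0, zero_pow hm]
      simp
    · simp
  have h2 : PowerSeries.coeff N (configIntegral Pi 0 1) = _ := PowerSeries.coeff_mk N _
  rw [h2]
  change ∫ θ in Set.Icc (0 : Fin 0 → ℝ) 1, MvPowerSeries.coeff m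
        (PowerSeries.coeff N (multMap 0 (expHbar (partialP Pi θ) 1)) p) = _
  simp only [h, map_one]
  rw [MeasureTheory.setIntegral_const]
  simp [MeasureTheory.Measure.real, Real.volume_Icc_pi]

/-- The operation applied to the coefficients of the `k`-th term of the local-to-global map. -/
def cfgTerm (Pi : M → Matrix (Fin d) (Fin d) ℝ) (k l : ℕ)
    (a : FormalSection M (Fin l × Fin d)) : LaurentSection M d :=
  divFactorialHbarPow k (configIntegral Pi l a)

lemma cfgTerm_zero (Pi : M → Matrix (Fin d) (Fin d) ℝ) (k l : ℕ) : cfgTerm Pi k l 0 = 0 := by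
  rw [cfgTerm, configIntegral_apply_zero, divFactorialHbarPow, map_zero, mul_zero]

lemma cfgTerm_one (Pi : M → Matrix (Fin d) (Fin d) ℝ) : cfgTerm Pi 0 0 1 = 1 := by
  rw [cfgTerm, configIntegral_one, divFactorialHbarPow, map_one, mul_one]
  simp
  rfl

/-- The fibrewise partial derivative as an additive map. -/
def dyHom (i : Fin d) : WeylSection M d →+ WeylSection M d where
  toFun := dy i
  map_zero' := by
    refine PowerSeries.ext fun N => ?_
    funext p
    simp [dy]
  map_add' a b := by
    refine PowerSeries.ext fun N => ?_
    funext p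
    simp [dy]

variable [TopologicalSpace M] [ChartedSpace (EuclideanSpace ℝ (Fin d)) M]
  [IsManifold (𝓡 d) ∞ M]

/-- The coefficients of the two-form `d_{TM} γ`. -/
def dyMatrix (γ : WeylOneForm d M) : Matrix (Fin d) (Fin d) (WeylSection M d) :=
  Matrix.of fun i j => dy i (γ.along (stdVec j))

lemma dTM_toBV (γ : WeylOneForm d M) : dTM γ.toBV = bvTwoForm (dyMatrix γ) := by
  have hX : ∀ j, dX (WeylSection M d) j = bvBasis _ d {Sum.inlₗ j} := fun j => gen_eq_extBasis _
  have h : γ.toBV = ∑ j, γ.along (stdVec j) • bvBasis _ d {Sum.inlₗ j} := by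
    simp only [WeylOneForm.toBV, hX]
  rw [dTM, h, bvTwoForm]
  refine Finset.sum_congr rfl fun i _ => ?_
  have h2 := mapCoeff_sum_smul (dyHom i) Finset.univ (fun j => γ.along (stdVec j))
    fun j => {Sum.inlₗ j}
  refine (congrArg (dY (WeylSection M d) i * ·) h2).trans ?_
  simp only [Finset.mul_sum, mul_smul_comm, hX]
  rfl

lemma prod_slot_dTM {k l : ℕ} (e : Fin k → Fin l) (γ : WeylOneForm d M) :
    (List.ofFn fun α : Fin k => mapCoeff (slot (e α)) (dTM γ.toBV)).prod =
      (List.ofFn fun α : Fin k => bvTwoForm ((dyMatrix γ).map (slot (e α)))).prod := by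
  simp only [dTM_toBV, mapCoeff_ringHom, baseChange_bvTwoForm]

lemma repr_cfgTerm_eq_zero (Pi : M → Matrix (Fin d) (Fin d) ℝ) {k l : ℕ} (e : Fin k → Fin l)
    (γ : WeylOneForm d M) (O : FormalSection M (Fin l × Fin d)) {s : Finset (Fin d ⊕ₗ Fin d)}
    (hs : s.card ≠ 2 * k) :
    (bvBasis (LaurentSection M d) d).repr (mapCoeff (cfgTerm Pi k l)
      (O • (List.ofFn fun α : Fin k => mapCoeff (slot (e α)) (dTM γ.toBV)).prod)) s = 0 := by
  rw [repr_mapCoeff, prod_slot_dTM, map_smul, Finsupp.smul_apply, repr_prod_bvTwoForm_eq_zero _ hs,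
    smul_zero, cfgTerm_zero]

/-- The exponential of the effective action is invertible and central. -/
lemma expGammaInfty_isUnit (Pi : M → Matrix (Fin d) (Fin d) ℝ) (γ : WeylOneForm d M) :
    IsUnit (expGammaInfty Pi γ.toBV) ∧ ∀ y, Commute (expGammaInfty Pi γ.toBV) y := by
  have h : expGammaInfty Pi γ.toBV = ∑ k ∈ Finset.range (d + 1), mapCoeff (cfgTerm Pi k k)
      ((1 : FormalSection M (Fin k × Fin d)) •
        (List.ofFn fun α : Fin k => mapCoeff (slot (id α)) (dTM γ.toBV)).prod) := by
    simp only [one_smul]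
    rfl
  have key : ∀ s, (extBasis (LaurentSection M d) (Fin d ⊕ₗ Fin d)).repr
      (expGammaInfty Pi γ.toBV) s = ∑ k ∈ Finset.range (d + 1),
      (bvBasis (LaurentSection M d) d).repr (mapCoeff (cfgTerm Pi k k)
      ((1 : FormalSection M (Fin k × Fin d)) •
        (List.ofFn fun α : Fin k => mapCoeff (slot (id α)) (dTM γ.toBV)).prod)) s := by
    intro s
    rw [h, map_sum, Finsupp.coe_finsetSum, Finset.sum_apply]
    rfl
  refine isUnit_of_repr ?_ fun s hs => ?_
  · rw [key, Finset.sum_eq_single 0]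
    · rw [List.ofFn_zero, List.prod_nil, one_smul, repr_mapCoeff, bvBasis_eq, ← extBasis_empty,
        (extBasis _ _).repr_self, Finsupp.single_eq_same, cfgTerm_one]
    · intro k _ hk
      refine repr_cfgTerm_eq_zero Pi id γ 1 ?_
      rw [Finset.card_empty]
      omega
    · simp
  · rw [key]
    refine Finset.sum_eq_zero fun k _ => repr_cfgTerm_eq_zero Pi id γ 1 fun h => hs ?_
    exact ⟨k, h.trans (two_mul k)⟩

/-- The factor `e^{γ_∞/ħ}` of the twisted integration map cancels its inverse in `[O]_∞`. -/
lemma expGammaInfty_mul_localToGlobal (Pi : M → Matrix (Fin d) (Fin d) ℝ) (γ : WeylOneForm d M)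
    (O : WeylSection M d) :
    expGammaInfty Pi γ.toBV * localToGlobal Pi γ.toBV O = insertion Pi γ.toBV O := by
  obtain ⟨hu, hc⟩ := expGammaInfty_isUnit Pi γ
  rw [(hc _).eq, localToGlobal, mul_assoc, Ring.inverse_mul_cancel _ hu, mul_one]

/-- Only the term with `d` copies of `d_{TM} γ` contributes to the top coefficient. -/
lemma repr_insertion_univ (Pi : M → Matrix (Fin d) (Fin d) ℝ) (γ : WeylOneForm d M)
    (O : WeylSection M d) :
    (bvBasis (LaurentSection M d) d).repr (insertion Pi γ.toBV O) Finset.univ =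
      cfgTerm Pi d (d + 1) (slot 0 O * (bvBasis _ d).repr
        (List.ofFn fun α : Fin d => bvTwoForm ((dyMatrix γ).map (slot α.succ))).prod
          Finset.univ) := by
  have h : insertion Pi γ.toBV O = ∑ k ∈ Finset.range (d + 1), mapCoeff (cfgTerm Pi k (k + 1))
      (slot (0 : Fin (k + 1)) O •
        (List.ofFn fun α : Fin k => mapCoeff (slot α.succ) (dTM γ.toBV)).prod) := rfl
  rw [h, map_sum, Finsupp.coe_finsetSum, Finset.sum_apply, Finset.sum_eq_single d]
  · rw [repr_mapCoeff, prod_slot_dTM, map_smul, Finsupp.smul_apply, smul_eq_mul]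
  · intro k _ hk
    refine repr_cfgTerm_eq_zero Pi Fin.succ γ _ ?_
    rw [Finset.card_univ, card_lex]
    omega
  · simp

end Insertion

/-! ### Symbols of the insertion -/

section Symbols

variable {d : ℕ} {P : Type*} [Fintype P] [DecidableEq P]

lemma tensor_mul_prod (lam : P → WeylDual d) (h : P → MvPolynomial (Fin d) ℝ)
    (f : MvPolynomial (P × Fin d) ℝ) :
    tensor lam (f * ∏ α, MvPolynomial.rename (Prod.mk α) (h α)) =
      tensor (fun α => lam α ∘ₗ LinearMap.mulRight ℝ (h α)) f := by
  have key : tensor lam ∘ₗ LinearMap.mulRight ℝ (∏ α, MvPolynomial.rename (Prod.mk α) (h α)) =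
      tensor (fun α => lam α ∘ₗ LinearMap.mulRight ℝ (h α)) := by
    refine (MvPolynomial.basisMonomials (P × Fin d) ℝ).ext fun m => ?_
    rw [MvPolynomial.coe_basisMonomials, LinearMap.comp_apply, LinearMap.mulRight_apply]
    dsimp only
    rw [monomial_eq_prod_slice, tensor_prod, ← Finset.prod_mul_distrib]
    simp only [← map_mul]
    rw [tensor_prod]
    rfl
  exact LinearMap.congr_fun key f

lemma hExt_C_mul {A : Type*} [CommRing A] [Algebra ℝ A] (T : A →ₗ[ℝ] PowerSeries ℝ) (a : A) (F :
    PowerSeries A) :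
    hExt (T ∘ₗ LinearMap.mulRight ℝ a) F = hExt T (PowerSeries.C a * F) := by
  ext N
  simp [coeff_hExt, mul_comm]

lemma hExt_linear_combination {A ι : Type*} [CommRing A] [Algebra ℝ A] (I : Finset ι) (c : ι → ℝ)
    (T : ι → A →ₗ[ℝ] PowerSeries ℝ) (F : PowerSeries A) :
    hExt (∑ i ∈ I, c i • T i) F = ∑ i ∈ I, c i • hExt (T i) F := by
  ext N
  simp only [coeff_hExt, map_sum, LinearMap.sum_apply, LinearMap.smul_apply,
    PowerSeries.coeff_smul, Finset.smul_sum]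
  exact Finset.sum_comm

/-- The Leibniz expansion of a determinant as a sum over all maps. -/
lemma det_eq_sum_mapSign {R : Type*} [CommRing R] (A : Matrix (Fin d) (Fin d) R) :
    A.det = ∑ i : Fin d → Fin d, (mapSign i : R) * ∏ k, A k (i k) := by
  have h := (Matrix.detRowAlternating (R := R) (n := Fin d)).toMultilinearMap.map_sum
    (fun k (i : Fin d) => A k i • (Pi.single i 1 : Fin d → R))
  have h1 : (fun k => ∑ i, A k i • (Pi.single i 1 : Fin d → R)) = A := by
    funext k j
    simp [Pi.single_apply]
  rw [h1] at h
  refine Eq.trans h (Finset.sum_congr rfl fun i _ => ?_)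
  rw [MultilinearMap.map_smul_univ, smul_eq_mul, mul_comm]
  congr 1
  exact det_single R i

lemma rowDet_eq_sum (r : Fin d → P) : rowDet (d := d) r = ∑ i : Fin d → Fin d,
    (mapSign i : MvPolynomial (P × Fin d) ℝ) * ∏ k, MvPolynomial.X (r k, i k) := by
  rw [rowDet, det_eq_sum_mapSign]
  rfl

/-- The behaviour of the cocycle under a rearrangement of its entries. -/
lemma Theta_comp (Pi : Matrix (Fin d) (Fin d) ℝ) (x : WeylDual d) (v : Fin d → WeylDual d)
    (j : Fin d → Fin d) : Theta Pi x (v ∘ j) = (mapSign j : ℝ) • Theta Pi x v := by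
  have h := Theta_linear_combination Pi x v (Matrix.of fun m l => if m = j l then 1 else 0)
  have h1 : (fun l => ∑ m, (Matrix.of fun m l => if m = j l then (1 : ℝ) else 0) m l • v m) =
      v ∘ j := by
    funext l
    simp
  rw [h1] at h
  rw [h, ← det_single ℝ j, ← Matrix.det_transpose]
  congr 2
  ext a b
  simp [_root_.Pi.single_apply]

end Symbols

/-! ### The top coefficient of the insertion -/

section TopCoefficient

variable {M : Type*} {d : ℕ} [TopologicalSpace M] [ChartedSpace (EuclideanSpace ℝ (Fin d)) M]
  [IsManifold (𝓡 d) ∞ M]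

/-- The derivatives `∂_{yⁱ}` in `d_{TM} γ` become factors of the symbol. -/
lemma dualW_slot_mul_prod (γ : WeylOneForm d M) (O : WeylSection M d) (i j : Fin d → Fin d) (p : M)
    (f : MvPolynomial (Fin (d + 1) × Fin d) ℝ) :
    dualW (atPt p (slot (0 : Fin (d + 1)) O * ∏ α, slot α.succ (dyMatrix γ (i α) (j α)))) f =
      tensor (Fin.cons (dualW (atPt p O)) fun α => gDual γ p (j α))
        (f * ∏ α : Fin d, MvPolynomial.X (α.succ, i α)) := by
  have h1 : atPt p (slot (0 : Fin (d + 1)) O * ∏ α, slot α.succ (dyMatrix γ (i α) (j α))) =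
      ∏ α : Fin (d + 1), slotW α ((Fin.cons (atPt p O) fun α =>
        pdW (i α) (atPt p (γ.along (stdVec (j α)))) : Fin (d + 1) → _) α) := by
    rw [Fin.prod_univ_succ, map_mul, map_prod, atPt_slot]
    simp only [atPt_slot, Fin.cons_zero, Fin.cons_succ]
    rfl
  have h2 : (∏ α : Fin d, (MvPolynomial.X (α.succ, i α) :
      MvPolynomial (Fin (d + 1) × Fin d) ℝ)) =
      ∏ α : Fin (d + 1), MvPolynomial.rename (Prod.mk α)
        ((Fin.cons 1 fun α => MvPolynomial.X (i α) : Fin (d + 1) → MvPolynomial (Fin d) ℝ) α) := by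
    rw [Fin.prod_univ_succ]
    simp
  rw [h1, dualW_prod_slotW, h2, tensor_mul_prod]
  congr 2
  funext α
  refine LinearMap.ext fun g => ?_
  refine Fin.cases ?_ (fun α => ?_) α
  · simp
  · simp only [Fin.cons_succ, LinearMap.comp_apply, LinearMap.mulRight_apply]
    rw [← dualW_mul_X, gDual, atPt_along]

/-- The cocycle in terms of configurations of `Fin (d + 1)`. -/
lemma hExt_tensor_cons (Pi : Matrix (Fin d) (Fin d) ℝ) (x : WeylDual d) (v : Fin d → WeylDual d) :
    hExt (tensor (Fin.cons x v : Fin (d + 1) → WeylDual d))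
      (PowerSeries.C (rowDet (d := d) Fin.succ) * cfgH (bsym Pi)) = Theta Pi x v := by
  have h := corr_relabel (finSuccEquiv d) (consPt x v)
    (PowerSeries.C (rowDet (d := d) Fin.succ) * cfgH (bsym Pi))
  rw [map_mul (mapH _), mapH_C, mapH_cfgH, relabel_rowDet] at h
  simp only [relabel_bsym] at h
  rw [cfgH_relabel (finSuccEquiv d) (bsym Pi)] at h
  have h2 : (fun β => consPt x v (finSuccEquiv d β)) = Fin.cons x v := by
    funext β
    refine Fin.cases ?_ (fun β => ?_) β
    · rfl
    · rw [finSuccEquiv_succ]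
      rfl
  have h3 : ⇑(finSuccEquiv d) ∘ Fin.succ = some := by
    funext β
    exact finSuccEquiv_succ β
  rw [h2, h3] at h
  exact h

lemma dualW_sum_slot_mul_prod (γ : WeylOneForm d M) (O : WeylSection M d) (κ : ℤ) (p : M) :
    dualW (atPt p (slot (0 : Fin (d + 1)) O * ∑ i : Fin d → Fin d, ∑ j : Fin d → Fin d,
      ((κ * mapSign i * mapSign j : ℤ) : FormalSection M (Fin (d + 1) × Fin d)) *
        ∏ α : Fin d, slot α.succ (dyMatrix γ (i α) (j α)))) =
      ∑ j : Fin d → Fin d, ((κ : ℝ) * mapSign j) •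
        ((tensor (Fin.cons (dualW (atPt p O)) fun α => gDual γ p (j α))) ∘ₗ
          LinearMap.mulRight ℝ (rowDet (d := d) Fin.succ)) := by
  refine LinearMap.ext fun f => ?_
  simp only [Finset.mul_sum, map_sum, dualW_sum, LinearMap.sum_apply,
    LinearMap.smul_apply, LinearMap.comp_apply, LinearMap.mulRight_apply, rowDet_eq_sum]
  rw [Finset.sum_comm]
  refine Finset.sum_congr rfl fun j _ => ?_
  rw [Finset.smul_sum]
  refine Finset.sum_congr rfl fun i _ => ?_
  rw [mul_left_comm, ← zsmul_eq_mul, map_zsmul, ← Int.cast_smul_eq_zsmul ℝ, dualW_smul,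
    LinearMap.smul_apply, dualW_slot_mul_prod, mul_left_comm f,
    ← zsmul_eq_mul (f * _) (mapSign i), map_zsmul, ← Int.cast_smul_eq_zsmul ℝ, smul_smul]
  congr 1
  push_cast
  ring

lemma hExt_sum_tensor_cons (Pi : Matrix (Fin d) (Fin d) ℝ) (x : WeylDual d)
    (v : Fin d → WeylDual d) (κ : ℝ) :
    hExt (∑ j : Fin d → Fin d, (κ * mapSign j) • ((tensor (Fin.cons x fun α => v (j α) :
      Fin (d + 1) → WeylDual d)) ∘ₗ LinearMap.mulRight ℝ (rowDet (d := d) Fin.succ)))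
        (cfgH (bsym Pi)) =
      (κ * ∑ j : Fin d → Fin d, (mapSign j : ℝ) * mapSign j) • Theta Pi x v := by
  rw [hExt_linear_combination, Finset.mul_sum, Finset.sum_smul]
  refine Finset.sum_congr rfl fun j _ => ?_
  rw [hExt_C_mul, hExt_tensor_cons, ← mul_assoc]
  exact (congrArg ((κ * mapSign j) • ·) (Theta_comp Pi x v j)).trans (smul_smul _ _ _)

variable (M d) in
/-- The top coefficient is, up to a universal constant, the cocycle `Theta` evaluated on the
components of `γ`. -/
lemma exists_configIntegral_top : ∃ c : ℝ, ∀ (Pi : M → Matrix (Fin d) (Fin d) ℝ)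
    (γ : WeylOneForm d M) (O : WeylSection M d) (p : M) (N : ℕ),
    MvPowerSeries.constantCoeff (PowerSeries.coeff N (configIntegral Pi (d + 1)
      (slot 0 O * (bvBasis _ d).repr (List.ofFn fun α : Fin d =>
        bvTwoForm ((dyMatrix γ).map (slot α.succ))).prod Finset.univ)) p) =
      c * PowerSeries.coeff N (Theta (Pi p) (dualW (atPt p O)) (gDual γ p)) := by
  obtain ⟨κ, hκ⟩ := exists_repr_prod_bvTwoForm d
  refine ⟨κ * ∑ j : Fin d → Fin d, (mapSign j : ℝ) * mapSign j, fun Pi γ O p N => ?_⟩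
  rw [configIntegral_zero, hκ]
  refine (congrArg (fun T => PowerSeries.coeff N (hExt T (cfgH (bsym (Pi p)))))
    (dualW_sum_slot_mul_prod γ O κ p)).trans ?_
  rw [hExt_sum_tensor_cons, PowerSeries.coeff_smul, smul_eq_mul]

end TopCoefficient

/-! ### The trace as an integral of the cocycle -/

section TraceCoefficient

variable {n : ℕ} {M : Type*} [TopologicalSpace M]
  [ChartedSpace (EuclideanSpace ℝ (Fin (2 * n))) M] [IsManifold (𝓡 (2 * n)) ∞ M]
  [T2Space M] [CompactSpace M]

/-- The trace in terms of the top coefficient of the insertion. -/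
lemma coeff_integralForms_twistedIntegral (Ω : BilinField (2 * n) M) (γ : WeylOneForm (2 * n) M)
    (O : WeylSection M (2 * n)) (z : ℤ) :
    (integralForms Ω (twistedIntegral Ω γ (localToGlobal (poisson Ω) γ.toBV O))).coeff z =
      integralTop Ω fun p => ((n.factorial : ℝ)⁻¹) * MvPowerSeries.constantCoeff
        ((((bvBasis _ (2 * n)).repr ((berOp (poisson Ω))^[n] (insertion (poisson Ω) γ.toBV O)))
          (baseSet (2 * n))).coeff z p) := by
  rw [twistedIntegral, expGammaInfty_mul_localToGlobal, integralForms, berezin,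
    (baseBasis _ (2 * n)).repr_sum_self, HahnSeries.C_mul_eq_smul]
  rfl

variable (M n) in
/-- The coefficients of the trace as integrals of the cocycle `Theta`. -/
lemma exists_coeff_integralForms : ∃ c : ℝ, ∀ (Ω : BilinField (2 * n) M)
    (γ : WeylOneForm (2 * n) M) (O : WeylSection M (2 * n)) (z : ℤ),
    (integralForms Ω (twistedIntegral Ω γ (localToGlobal (poisson Ω) γ.toBV O))).coeff z =
      integralTop Ω fun p => if z + (2 * n : ℕ) < 0 then 0 else
        c * (wedgePow n ((1 / 2 : ℝ) • poisson Ω p) * PowerSeries.coeff (z + (2 * n : ℕ)).natAbs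
          (Theta (poisson Ω p) (dualW (atPt p O)) (gDual γ p))) := by
  obtain ⟨c, hc⟩ := exists_configIntegral_top M (2 * n)
  refine ⟨(n.factorial : ℝ)⁻¹ * berSign (2 * n) * ((2 * n).factorial : ℝ)⁻¹ * c,
    fun Ω γ O z => ?_⟩
  rw [coeff_integralForms_twistedIntegral]
  congr 1
  funext p
  rw [repr_berOp, repr_insertion_univ, cfgTerm, divFactorialHbarPow, laurentConst]
  rw [RingHom.comp_apply, HahnSeries.C_mul_eq_smul, HahnSeries.coeff_smul,
    HahnSeries.coeff_single_mul, sub_neg_eq_add, PowerSeries.coeff_coe]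
  split_ifs with h
  · simp
  · rw [smul_eq_mul, Pi.mul_apply, Pi.mul_apply, map_mul, map_mul, hc]
    simp only [RingHom.compLeft_apply, Function.comp_apply, MvPowerSeries.constantCoeff_C]
    ring

end TraceCoefficient

/-! ### Integration by parts in a chart -/

section Euclidean

open MeasureTheory

/-- The absolute value of a function is differentiable if its derivative vanishes at its zeros. -/
lemma hasFDerivAt_abs_of_zero {E : Type*} [NormedAddCommGroup E] [NormedSpace ℝ E] {h : E → ℝ}
    {h' : E →L[ℝ] ℝ} {x : E} (hh : HasFDerivAt h h' x) (h0 : h x = 0 → h' = 0) :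
    HasFDerivAt (fun y => |h y|) ((SignType.sign (h x) : ℝ) • h') x := by
  by_cases hx : h x = 0
  · rw [h0 hx] at hh
    rw [h0 hx, smul_zero]
    rw [hasFDerivAt_iff_isLittleO] at hh ⊢
    simp only [hx, abs_zero, sub_zero, zero_apply] at hh ⊢
    exact hh.abs_left
  · exact hh.abs hx

/-- A divergence with compact support in an open set, with respect to the density `|h|`, has
integral zero. -/
lemma integral_divergence_eq_zero {E : Type*} [NormedAddCommGroup E] [InnerProductSpace ℝ E]
    [FiniteDimensional ℝ E] [MeasurableSpace E] [BorelSpace E] {U K : Set E} (hU : IsOpen U)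
    (hK : IsCompact K) (hKU : K ⊆ U) {F h : E → ℝ} (hF : ContDiffOn ℝ ∞ F U)
    (hh : ContDiffOn ℝ ∞ h U) (hF0 : ∀ x ∈ U, x ∉ K → F x = 0)
    (h0 : ∀ x ∈ U, h x = 0 → fderiv ℝ h x = 0) (e : E) (L : E → ℝ)
    (hL : ∀ x ∈ U, fderiv ℝ h x e = L x * h x) :
    IntegrableOn (fun x => (fderiv ℝ F x e + L x * F x) * |h x|) U ∧
      ∫ x in U, (fderiv ℝ F x e + L x * F x) * |h x| = 0 := by
  set u : E → ℝ := U.indicator fun x => F x * |h x| with hu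
  set g : E → ℝ := fun x => (fderiv ℝ F x e + L x * F x) * |h x| with hg
  have hdF : ∀ x ∈ U, HasFDerivAt F (fderiv ℝ F x) x := fun x hx =>
    ((hF.contDiffAt (hU.mem_nhds hx)).differentiableAt (by simp)).hasFDerivAt
  have hdh : ∀ x ∈ U, HasFDerivAt h (fderiv ℝ h x) x := fun x hx =>
    ((hh.contDiffAt (hU.mem_nhds hx)).differentiableAt (by simp)).hasFDerivAt
  -- `u` is differentiable also at the zeros of `h`, and its derivative along `e` is `g`
  have hd1 : ∀ x ∈ U, HasFDerivAt u (F x • ((SignType.sign (h x) : ℝ) • fderiv ℝ h x) +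
      |h x| • fderiv ℝ F x) x := by
    intro x hx
    refine ((hdF x hx).mul (hasFDerivAt_abs_of_zero (hdh x hx) (h0 x hx))).congr_of_eventuallyEq ?_
    filter_upwards [hU.mem_nhds hx] with y hy
    exact Set.indicator_of_mem hy _
  have hu0 : ∀ x, x ∉ K → u x = 0 := by
    intro x hx
    by_cases hxU : x ∈ U
    · rw [hu, Set.indicator_of_mem hxU, hF0 x hxU hx, zero_mul]
    · exact Set.indicator_of_notMem hxU _
  have hd2 : ∀ x, x ∉ K → HasFDerivAt u (0 : E →L[ℝ] ℝ) x := by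
    intro x hx
    refine (hasFDerivAt_const (0 : ℝ) x).congr_of_eventuallyEq ?_
    filter_upwards [hK.isClosed.isOpen_compl.mem_nhds hx] with y hy
    exact hu0 y hy
  have hdu : Differentiable ℝ u := fun x => by
    by_cases hx : x ∈ K
    · exact (hd1 x (hKU hx)).differentiableAt
    · exact (hd2 x hx).differentiableAt
  have hfd : (fun x => fderiv ℝ u x e) = U.indicator g := by
    funext x
    by_cases hx : x ∈ U
    · rw [(hd1 x hx).fderiv, Set.indicator_of_mem hx, hg]
      simp only [add_apply, smul_apply, smul_eq_mul, hL x hx]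
      rw [← sign_mul_self (h x)]
      ring
    · rw [(hd2 x fun hxK => hx (hKU hxK)).fderiv, Set.indicator_of_notMem hx]
      rfl
  have hcF : ContinuousOn (fun x => fderiv ℝ F x e) K :=
    ((hF.continuousOn_fderiv_of_isOpen hU (by simp)).clm_apply continuousOn_const).mono hKU
  have hch : ContinuousOn (fun x => fderiv ℝ h x e) K :=
    ((hh.continuousOn_fderiv_of_isOpen hU (by simp)).clm_apply continuousOn_const).mono hKU
  have hF1 := hF.continuousOn.mono hKU
  have hh1 := hh.continuousOn.mono hKU
  have hB : Integrable (K.indicator fun x => |fderiv ℝ F x e * h x| + |F x * fderiv ℝ h x e|)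
      volume :=
    (integrable_indicator_iff hK.measurableSet).2
      (((hcF.mul hh1).abs.add (hF1.mul hch).abs).integrableOn_compact hK)
  have hui : Integrable u volume := by
    have : u = K.indicator fun x => F x * |h x| := by
      funext x
      by_cases hx : x ∈ K
      · rw [Set.indicator_of_mem hx, hu, Set.indicator_of_mem (hKU hx)]
      · rw [Set.indicator_of_notMem hx, hu0 x hx]
    rw [this]
    exact (integrable_indicator_iff hK.measurableSet).2
      ((hF1.mul hh1.abs).integrableOn_compact hK)
  have hgi : Integrable (fun x => fderiv ℝ u x e) volume := by
    refine hB.mono' (measurable_fderiv_apply_const ℝ u e).aestronglyMeasurable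
      (Filter.Eventually.of_forall fun x => ?_)
    by_cases hx : x ∈ K
    · rw [Set.indicator_of_mem hx, congrFun hfd x, Set.indicator_of_mem (hKU hx), hg, hL x (hKU hx),
        Real.norm_eq_abs]
      dsimp only
      rw [add_mul]
      refine (abs_add_le _ _).trans (le_of_eq ?_)
      simp only [abs_mul, abs_abs]
      ring
    · rw [Set.indicator_of_notMem hx, (hd2 x hx).fderiv]
      simp
  have hint := integral_mul_fderiv_eq_neg_fderiv_mul_of_integrable (μ := volume)
    (f := fun _ : E => (1 : ℝ)) (g := u) (v := e) (by simp) (by simpa using hgi)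
    (by simpa using hui) (fun x _ => differentiableAt_const _) fun x _ => hdu x
  simp only [one_mul, fderiv_fun_const, Pi.zero_apply, zero_apply, zero_mul, integral_zero,
    neg_zero] at hint
  rw [hfd] at hint hgi
  exact ⟨(integrable_indicator_iff hU.measurableSet).1 hgi, by
    rwa [integral_indicator hU.measurableSet] at hint⟩

end Euclidean

/-! ### The derivative of the Pfaffian -/

section Pfaffian

variable {d : ℕ}

lemma wedgePow_mem {T κ : Type*} [Fintype κ] [LinearOrder κ] (𝒜 : Subalgebra ℝ (T → ℝ))
    (m : ℕ) {A : T → Matrix κ κ ℝ} (h : ∀ i j, (fun t => A t i j) ∈ 𝒜) :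
    (fun t => wedgePow m (A t)) ∈ 𝒜 := by
  set B : Matrix κ κ 𝒜 := Matrix.of fun i j => ⟨fun t => A t i j, h i j⟩
  have h1 : (fun t => wedgePow m (A t)) = (wedgePow m B : 𝒜) := by
    funext t
    exact wedgePow_map ((Pi.evalRingHom (fun _ : T => ℝ) t).comp 𝒜.val.toRingHom) m B
  rw [h1]
  exact (wedgePow m B).2

/-- The Pfaffian is a polynomial in the entries of the matrix. -/
lemma differentiable_wedgePow (m : ℕ) :
    Differentiable ℝ fun A : Fin d → Fin d → ℝ => wedgePow m (Matrix.of A) := by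
  let 𝒜 : Subalgebra ℝ ((Fin d → Fin d → ℝ) → ℝ) :=
    { carrier := {f | Differentiable ℝ f}
      mul_mem' := fun hf hg => Differentiable.mul hf hg
      add_mem' := fun hf hg => Differentiable.add hf hg
      algebraMap_mem' := fun c => differentiable_const c }
  refine wedgePow_mem 𝒜 m (A := fun A : Fin d → Fin d → ℝ => Matrix.of A) fun i j => ?_
  change Differentiable ℝ fun A : Fin d → Fin d → ℝ => A i j
  fun_prop

/-- The derivative of the Pfaffian in the direction of an infinitesimal change of basis. -/
lemma fderiv_wedgePow (m : ℕ) (A B : Matrix (Fin d) (Fin d) ℝ) :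
    fderiv ℝ (fun A : Fin d → Fin d → ℝ => wedgePow m (Matrix.of A)) (fun i j => A i j)
      (fun i j => (B.transpose * A + A * B) i j) = B.trace * wedgePow m A := by
  have hc : HasDerivAt (fun (t : ℝ) (i j : Fin d) =>
      ((1 + t • B).transpose * A * (1 + t • B)) i j)
      (fun i j => (B.transpose * A + A * B) i j) 0 := by
    refine hasDerivAt_pi.2 fun i => hasDerivAt_pi.2 fun j => ?_
    have e : (fun t : ℝ => ((1 + t • B).transpose * A * (1 + t • B)) i j) = fun t : ℝ =>
        A i j + t * (B.transpose * A + A * B) i j + t ^ 2 * (B.transpose * A * B) i j := by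
      funext t
      have : (1 + t • B).transpose * A * (1 + t • B) =
          A + t • (B.transpose * A + A * B) + t ^ 2 • (B.transpose * A * B) := by
        simp only [Matrix.transpose_add, Matrix.transpose_one, Matrix.transpose_smul, add_mul,
          mul_add, one_mul, mul_one, Matrix.smul_mul, Matrix.mul_smul, smul_add, smul_smul, pow_two]
        abel
      rw [this]
      simp [mul_add]
    rw [e]
    have h1 := (((hasDerivAt_id (0 : ℝ)).mul_const ((B.transpose * A + A * B) i j)).const_add
      (A i j)).add (((hasDerivAt_id (0 : ℝ)).pow 2).mul_const ((B.transpose * A * B) i j))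
    refine h1.congr_deriv ?_
    simp
  have h0 : (fun i j => ((1 + (0 : ℝ) • B).transpose * A * (1 + (0 : ℝ) • B)) i j) =
      fun i j => A i j := by
    funext i j
    simp
  have h1 : HasDerivAt (fun t : ℝ => wedgePow m ((1 + t • B).transpose * A * (1 + t • B)))
      (fderiv ℝ (fun A : Fin d → Fin d → ℝ => wedgePow m (Matrix.of A)) (fun i j => A i j)
      (fun i j => (B.transpose * A + A * B) i j)) 0 := by
    have h2 := (differentiable_wedgePow (d := d) m
      (fun i j => ((1 + (0 : ℝ) • B).transpose * A * (1 + (0 : ℝ) • B)) i j)).hasFDerivAt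
    have h3 := h2.comp_hasDerivAt (0 : ℝ) hc
    rw [h0] at h3
    exact h3
  have h2 : (fun t : ℝ => wedgePow m ((1 + t • B).transpose * A * (1 + t • B))) =
      fun t : ℝ => (1 + t • B).det * wedgePow m A := by
    funext t
    have := wedgePow_congr m A (1 + t • B).transpose
    rwa [Matrix.transpose_transpose, Matrix.det_transpose] at this
  rw [h2] at h1
  exact h1.unique ((hasDerivAt_det_one_add_smul B).mul_const _)

end Pfaffian

/-! ### Integrals over charts -/

section ChartIntegral

open MeasureTheory

variable {d : ℕ} {M : Type*} [TopologicalSpace M] [ChartedSpace (EuclideanSpace ℝ (Fin d)) M]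
  [IsManifold (𝓡 d) ∞ M] {Ω : BilinField d M}

/-- The coefficient of the `m`-th power of `Ω` in the coordinate frame of the chart at `x₀`. -/
def pfaffian (m : ℕ) (Ω : BilinField d M) (x₀ q : M) : ℝ :=
  wedgePow m ((1 / 2 : ℝ) • formMatrix Ω x₀ q)

lemma smoothOn_contDiffOn {x₀ : M} {f : M → ℝ} (hf : f ∈ smoothOn (d := d) x₀) :
    ContDiffOn ℝ ∞ (f ∘ (chartAt (EuclideanSpace ℝ (Fin d)) x₀).symm)
      (chartAt (EuclideanSpace ℝ (Fin d)) x₀).target :=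
  contMDiffOn_iff_contDiffOn.1 (ContMDiffOn.comp hf (contMDiffOn_chart_symm (I := 𝓡 d))
    fun _ hx => (chartAt (EuclideanSpace ℝ (Fin d)) x₀).map_target hx)

lemma pfaffian_mem (m : ℕ) (hΩ : IsSymplectic Ω) (x₀ : M) :
    pfaffian m Ω x₀ ∈ smoothOn (d := d) x₀ :=
  wedgePow_mem _ m fun i j => (smoothOn (d := d) x₀).smul_mem (contMDiffOn_formMatrix hΩ x₀ i j) _

lemma pfaffian_eq (m : ℕ) (Ω : BilinField d M) (x₀ q : M) :
    pfaffian m Ω x₀ q = (frameMatrix (d := d) x₀ q).det * pfaffian m Ω q q := by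
  have h := wedgePow_congr m ((1 / 2 : ℝ) • formMatrix Ω q q) (frameMatrix (d := d) x₀ q).transpose
  rw [Matrix.transpose_transpose, Matrix.det_transpose, Matrix.mul_smul, Matrix.smul_mul,
    ← formMatrix_eq] at h
  exact h

/-- The Pfaffian of the inverse matrix. -/
lemma wedgePow_poisson (m : ℕ) (hΩ : IsSymplectic Ω) (q : M) :
    wedgePow m ((1 / 2 : ℝ) • poisson Ω q) =
      (-1) ^ m * ((poisson Ω q).det * pfaffian m Ω q q) := by
  have h := wedgePow_congr m ((1 / 2 : ℝ) • formMatrix Ω q q) (poisson Ω q)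
  rw [Matrix.mul_smul, Matrix.smul_mul, poisson_eq, Matrix.nonsing_inv_mul _
    (isUnit_det_formMatrix_self hΩ q), Matrix.one_mul, ← poisson_eq, poisson_transpose hΩ,
    smul_neg] at h
  rw [pfaffian, ← h]
  have hneg : ∀ A : Matrix (Fin d) (Fin d) ℝ, wedgePow m (-A) = (-1) ^ m * wedgePow m A := by
    intro A
    have : quadForm (-A) = (-1 : ℝ) • quadForm A := by
      simp only [quadForm, Finset.smul_sum, Matrix.neg_apply, smul_smul, neg_one_mul]
    rw [wedgePow, this, smul_pow, map_smul, Finsupp.smul_apply, smul_eq_mul, wedgePow]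
  rw [hneg, ← mul_assoc, ← mul_pow]
  simp

/-- The Pfaffian is parallel. -/
lemma mvfderiv_pfaffian (m : ℕ) (hΩ : IsSymplectic Ω) {cov : TangentConnection d M}
    (hcov : IsSymplecticConnection Ω cov) {x₀ q : M}
    (hq : q ∈ (chartAt (EuclideanSpace ℝ (Fin d)) x₀).source) (k : Fin d) :
    fderiv ℝ (pfaffian m Ω x₀ ∘ (chartAt (EuclideanSpace ℝ (Fin d)) x₀).symm)
      (chartAt (EuclideanSpace ℝ (Fin d)) x₀ q) (EuclideanSpace.single k (1 : ℝ)) =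
      (christoffel cov x₀ q k).trace * pfaffian m Ω x₀ q := by
  set φ := chartAt (EuclideanSpace ℝ (Fin d)) x₀ with hφ
  have hsm : ∀ i j, (fun q => formMatrix Ω x₀ q i j) ∈ smoothOn (d := d) x₀ :=
    fun i j => contMDiffOn_formMatrix hΩ x₀ i j
  have hd : ∀ i j, HasFDerivAt ((fun q => (1 / 2 : ℝ) * formMatrix Ω x₀ q i j) ∘ φ.symm)
      ((1 / 2 : ℝ) • fderiv ℝ ((fun q => formMatrix Ω x₀ q i j) ∘ φ.symm) (φ q)) (φ q) := by
    intro i j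
    have h1 := (((smoothOn_contDiffOn (hsm i j)).contDiffAt (φ.open_target.mem_nhds
      (φ.map_source hq))).differentiableAt (by simp)).hasFDerivAt
    exact h1.const_mul (1 / 2 : ℝ)
  have hpi : HasFDerivAt (fun x i j => (1 / 2 : ℝ) * formMatrix Ω x₀ (φ.symm x) i j)
      (ContinuousLinearMap.pi fun i => ContinuousLinearMap.pi fun j =>
        (1 / 2 : ℝ) • fderiv ℝ ((fun q => formMatrix Ω x₀ q i j) ∘ φ.symm) (φ q)) (φ q) :=
    hasFDerivAt_pi.2 fun i => hasFDerivAt_pi.2 fun j => hd i j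
  have hc := ((differentiable_wedgePow (d := d) m
    (fun i j => (1 / 2 : ℝ) * formMatrix Ω x₀ (φ.symm (φ q)) i j)).hasFDerivAt.comp (φ q) hpi)
  have hc' : HasFDerivAt (pfaffian m Ω x₀ ∘ φ.symm) _ (φ q) := hc
  rw [hc'.fderiv, ContinuousLinearMap.comp_apply, φ.left_inv hq]
  have hB := fderiv_wedgePow m ((1 / 2 : ℝ) • formMatrix Ω x₀ q) (christoffel cov x₀ q k)
  rw [pfaffian, ← hB]
  congr 1
  funext i j
  have h1 := mvfderiv_coordField hq (smoothOn_mdifferentiableAt (hsm i j) hq) k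
  have h2 := mvfderiv_formMatrix hcov hq k i j
  change (1 / 2 : ℝ) * fderiv ℝ ((fun q => formMatrix Ω x₀ q i j) ∘ φ.symm) (φ q)
    (EuclideanSpace.single k (1 : ℝ)) = _
  rw [← h1, h2, Matrix.mul_smul, Matrix.smul_mul, ← smul_add, Matrix.smul_apply, smul_eq_mul]

/-- The integral over the domain of the chart at `x₀` against the density `|Ω^m|`. -/
def chartIntegral (m : ℕ) (Ω : BilinField d M) (x₀ : M) (h : M → ℝ) : ℝ :=
  ∫ x in (chartAt (EuclideanSpace ℝ (Fin d)) x₀).target,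
    (fun q => h q * |pfaffian m Ω x₀ q|) ((chartAt (EuclideanSpace ℝ (Fin d)) x₀).symm x)

lemma integrableOn_chart [CompactSpace M] {x₀ : M} {h : M → ℝ} {C : Set M} (hC : IsClosed C)
    (hCs : C ⊆ (chartAt (EuclideanSpace ℝ (Fin d)) x₀).source)
    (hc : ContinuousOn h (chartAt (EuclideanSpace ℝ (Fin d)) x₀).source)
    (h0 : ∀ q, q ∉ C → h q = 0) :
    IntegrableOn (fun x => h ((chartAt (EuclideanSpace ℝ (Fin d)) x₀).symm x))
      (chartAt (EuclideanSpace ℝ (Fin d)) x₀).target := by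
  set φ := chartAt (EuclideanSpace ℝ (Fin d)) x₀ with hφ
  have hK : IsCompact (φ '' C) := hC.isCompact.image_of_continuousOn (φ.continuousOn.mono hCs)
  have hKt : φ '' C ⊆ φ.target := by
    rintro _ ⟨q, hq, rfl⟩
    exact φ.map_source (hCs hq)
  have h1 : IntegrableOn (fun x => h (φ.symm x)) (φ '' C) :=
    ((hc.comp φ.continuousOn_symm fun x hx => φ.map_target hx).mono hKt).integrableOn_compact hK
  refine h1.of_forall_sdiff_eq_zero φ.open_target.measurableSet fun x hx => h0 _ fun hxC => hx.2 ?_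
  exact ⟨φ.symm x, hxC, φ.right_inv hx.1⟩

lemma integrableOn_chartIntegral [CompactSpace M] (m : ℕ) (hΩ : IsSymplectic Ω) {x₀ : M}
    {h : M → ℝ} {C : Set M} (hC : IsClosed C)
    (hCs : C ⊆ (chartAt (EuclideanSpace ℝ (Fin d)) x₀).source)
    (hc : ContinuousOn h (chartAt (EuclideanSpace ℝ (Fin d)) x₀).source)
    (h0 : ∀ q, q ∉ C → h q = 0) :
    IntegrableOn (fun x => (fun q => h q * |pfaffian m Ω x₀ q|)
      ((chartAt (EuclideanSpace ℝ (Fin d)) x₀).symm x))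
      (chartAt (EuclideanSpace ℝ (Fin d)) x₀).target :=
  integrableOn_chart hC hCs (hc.mul (ContMDiffOn.continuousOn (pfaffian_mem m hΩ x₀)).abs)
    fun q hq => (congrArg (· * |pfaffian m Ω x₀ q|) (h0 q hq)).trans (zero_mul _)

/-- The integral of a divergence with compact support in the domain of a chart vanishes. -/
lemma chartIntegral_divergence [CompactSpace M] (m : ℕ) (hΩ : IsSymplectic Ω)
    {cov : TangentConnection d M} (hcov : IsSymplecticConnection Ω cov) {x₀ : M} {f : M → ℝ}
    {C : Set M} (hC : IsClosed C) (hCs : C ⊆ (chartAt (EuclideanSpace ℝ (Fin d)) x₀).source)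
    (hf : f ∈ smoothOn (d := d) x₀) (h0 : ∀ q, q ∉ C → f q = 0) (k : Fin d) :
    IntegrableOn (fun x => (fun q => (mvfderiv (𝓡 d) f q (coordField x₀ k q) +
      (christoffel cov x₀ q k).trace * f q) * |pfaffian m Ω x₀ q|)
        ((chartAt (EuclideanSpace ℝ (Fin d)) x₀).symm x))
      (chartAt (EuclideanSpace ℝ (Fin d)) x₀).target ∧
    chartIntegral m Ω x₀ (fun q => mvfderiv (𝓡 d) f q (coordField x₀ k q) +
      (christoffel cov x₀ q k).trace * f q) = 0 := by
  set φ := chartAt (EuclideanSpace ℝ (Fin d)) x₀ with hφ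
  have hK : IsCompact (φ '' C) := hC.isCompact.image_of_continuousOn (φ.continuousOn.mono hCs)
  have hKt : φ '' C ⊆ φ.target := by
    rintro _ ⟨q, hq, rfl⟩
    exact φ.map_source (hCs hq)
  have hL : ∀ k, ∀ x ∈ φ.target, fderiv ℝ (pfaffian m Ω x₀ ∘ φ.symm) x
      (EuclideanSpace.single k (1 : ℝ)) = (christoffel cov x₀ (φ.symm x) k).trace *
        (pfaffian m Ω x₀ ∘ φ.symm) x := by
    intro k x hx
    have h := mvfderiv_pfaffian m hΩ hcov (φ.map_target hx) k
    rwa [← hφ, φ.right_inv hx] at h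
  have h := integral_divergence_eq_zero φ.open_target hK hKt (smoothOn_contDiffOn hf)
    (smoothOn_contDiffOn (pfaffian_mem m hΩ x₀)) (fun x hx hxK => h0 _ fun hxC =>
      hxK ⟨φ.symm x, hxC, φ.right_inv hx⟩) (fun x hx hx0 => ?_) (EuclideanSpace.single k (1 : ℝ))
    (fun x => (christoffel cov x₀ (φ.symm x) k).trace) (hL k)
  · have e : Set.EqOn (fun x => (fderiv ℝ (f ∘ φ.symm) x (EuclideanSpace.single k (1 : ℝ)) +
        (christoffel cov x₀ (φ.symm x) k).trace * (f ∘ φ.symm) x) *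
          |(pfaffian m Ω x₀ ∘ φ.symm) x|) (fun x => (fun q =>
        (mvfderiv (𝓡 d) f q (coordField x₀ k q) + (christoffel cov x₀ q k).trace * f q) *
          |pfaffian m Ω x₀ q|) (φ.symm x)) φ.target := by
      intro x hx
      have h1 := mvfderiv_coordField (φ.map_target hx)
        (smoothOn_mdifferentiableAt hf (φ.map_target hx)) k
      rw [← hφ, φ.right_inv hx] at h1
      dsimp only
      rw [h1]
      rfl
    exact ⟨h.1.congr_fun e φ.open_target.measurableSet,
      (setIntegral_congr_fun φ.open_target.measurableSet e).symm.trans h.2⟩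
  · have h1 : (fderiv ℝ (pfaffian m Ω x₀ ∘ φ.symm) x).toLinearMap = 0 := by
      refine (EuclideanSpace.basisFun (Fin d) ℝ).toBasis.ext fun j => ?_
      rw [OrthonormalBasis.coe_toBasis, EuclideanSpace.basisFun_apply]
      refine (hL j x hx).trans ?_
      rw [hx0, mul_zero]
      rfl
    exact ContinuousLinearMap.coe_injective h1

lemma det_tangentCoordChange (x₀ y₀ q : M) :
    (tangentCoordChange (𝓡 d) x₀ y₀ q).det = (jacobian (d := d) x₀ y₀ q).det := by
  rw [ContinuousLinearMap.det, ← LinearMap.det_toMatrix (EuclideanSpace.basisFun (Fin d) ℝ).toBasis]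
  congr 1

/-- The integral of a function supported in the domains of two charts may be computed in
either. -/
lemma chartIntegral_change (m : ℕ) {x₀ y₀ : M} {h : M → ℝ}
    (hx : ∀ q, q ∉ (chartAt (EuclideanSpace ℝ (Fin d)) x₀).source → h q = 0)
    (hy : ∀ q, q ∉ (chartAt (EuclideanSpace ℝ (Fin d)) y₀).source → h q = 0) :
    chartIntegral m Ω x₀ h = chartIntegral m Ω y₀ h := by
  set φ := chartAt (EuclideanSpace ℝ (Fin d)) x₀ with hφ
  set ψ := chartAt (EuclideanSpace ℝ (Fin d)) y₀ with hψ
  set e := φ.symm.trans ψ with he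
  have hA : e.source = φ.target ∩ φ.symm ⁻¹' ψ.source := OpenPartialHomeomorph.trans_source _ _
  have hB : e.target = ψ.target ∩ ψ.symm ⁻¹' φ.source := OpenPartialHomeomorph.trans_target _ _
  have h1 : chartIntegral m Ω x₀ h = ∫ x in e.source,
      (fun q => h q * |pfaffian m Ω x₀ q|) (φ.symm x) := by
    refine setIntegral_eq_of_subset_of_forall_sdiff_eq_zero φ.open_target.measurableSet
      (hA ▸ Set.inter_subset_left) fun x hx' => ?_
    rw [hA] at hx'
    dsimp only
    rw [hy _ fun h => hx'.2 ⟨hx'.1, h⟩, zero_mul]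
  have h2 : chartIntegral m Ω y₀ h = ∫ x in e.target,
      (fun q => h q * |pfaffian m Ω y₀ q|) (ψ.symm x) := by
    refine setIntegral_eq_of_subset_of_forall_sdiff_eq_zero ψ.open_target.measurableSet
      (hB ▸ Set.inter_subset_left) fun x hx' => ?_
    rw [hB] at hx'
    dsimp only
    rw [hx _ fun h => hx'.2 ⟨hx'.1, h⟩, zero_mul]
  have hder : ∀ x ∈ e.source, HasFDerivWithinAt e (tangentCoordChange (𝓡 d) x₀ y₀ (φ.symm x))
      e.source x := by
    intro x hx'
    rw [hA] at hx'
    have h3 := hasFDerivWithinAt_tangentCoordChange (I := 𝓡 d) (x := x₀) (y := y₀) (z := φ.symm x)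
      ⟨by simpa using φ.map_target hx'.1, by simpa using hx'.2⟩
    have h4 : HasFDerivAt e (tangentCoordChange (𝓡 d) x₀ y₀ (φ.symm x)) (φ (φ.symm x)) := by
      simpa [hasFDerivWithinAt_univ] using! h3
    rw [φ.right_inv hx'.1] at h4
    exact h4.hasFDerivWithinAt
  rw [h1, h2, ← e.image_source_eq_target,
    integral_image_eq_integral_abs_det_fderiv_smul volume e.open_source.measurableSet hder
      e.injOn]
  refine setIntegral_congr_fun e.open_source.measurableSet fun x hx' => ?_
  rw [hA] at hx'
  have hq : ψ.symm (e x) = φ.symm x := ψ.left_inv hx'.2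
  have hJ := congrArg Matrix.det (frameMatrix_mul_jacobian (d := d) (φ.map_target hx'.1) hx'.2)
  dsimp only
  rw [hq, det_tangentCoordChange, pfaffian_eq m Ω x₀, pfaffian_eq m Ω y₀, ← hJ, Matrix.det_mul,
    smul_eq_mul]
  simp only [abs_mul]
  ring

end ChartIntegral

/-! ### Integrals of divergences over closed manifolds -/

section Stokes

open MeasureTheory

variable {d : ℕ} {M : Type*} [TopologicalSpace M] [ChartedSpace (EuclideanSpace ℝ (Fin d)) M]
  [IsManifold (𝓡 d) ∞ M] {Ω : BilinField d M}

/-- Continuous functions on the domain of the chart at `x₀` with compact support in it. -/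
def SupportedIn (x₀ : M) (h : M → ℝ) : Prop :=
  ContinuousOn h (chartAt (EuclideanSpace ℝ (Fin d)) x₀).source ∧
    ∃ C : Set M, IsClosed C ∧ C ⊆ (chartAt (EuclideanSpace ℝ (Fin d)) x₀).source ∧
      ∀ q, q ∉ C → h q = 0

lemma SupportedIn.mul_left {x₀ : M} {h : M → ℝ} (hh : SupportedIn (d := d) x₀ h) {f : M → ℝ}
    (hf : ContinuousOn f (chartAt (EuclideanSpace ℝ (Fin d)) x₀).source) :
    SupportedIn (d := d) x₀ fun q => f q * h q := by
  obtain ⟨hc, C, hC, hCs, h0⟩ := hh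
  exact ⟨hf.mul hc, C, hC, hCs, fun q hq =>
    (congrArg (f q * ·) (h0 q hq)).trans (mul_zero _)⟩

section Integrals

variable [CompactSpace M]

lemma SupportedIn.integrableOn {x₀ : M} {h : M → ℝ} (hh : SupportedIn (d := d) x₀ h) (m : ℕ)
    (hΩ : IsSymplectic Ω) :
    IntegrableOn (fun x => (fun q => h q * |pfaffian m Ω x₀ q|)
      ((chartAt (EuclideanSpace ℝ (Fin d)) x₀).symm x))
      (chartAt (EuclideanSpace ℝ (Fin d)) x₀).target := by
  obtain ⟨hc, C, hC, hCs, h0⟩ := hh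
  exact integrableOn_chartIntegral m hΩ hC hCs hc h0

lemma chartIntegral_sum {ι : Type*} (I : Finset ι) (m : ℕ) (hΩ : IsSymplectic Ω) {x₀ : M}
    {h : ι → M → ℝ} (hh : ∀ i ∈ I, SupportedIn (d := d) x₀ (h i)) :
    chartIntegral m Ω x₀ (fun q => ∑ i ∈ I, h i q) = ∑ i ∈ I, chartIntegral m Ω x₀ (h i) := by
  simp only [chartIntegral, Finset.sum_mul]
  exact integral_finsetSum I fun i hi => (hh i hi).integrableOn m hΩ

lemma chartIntegral_sub (m : ℕ) (hΩ : IsSymplectic Ω) {x₀ : M} {h k : M → ℝ}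
    (hh : SupportedIn (d := d) x₀ h) (hk : SupportedIn (d := d) x₀ k) :
    chartIntegral m Ω x₀ (fun q => h q - k q) =
      chartIntegral m Ω x₀ h - chartIntegral m Ω x₀ k := by
  simp only [chartIntegral, sub_mul]
  exact integral_sub (hh.integrableOn m hΩ) (hk.integrableOn m hΩ)

end Integrals

/-- The derivative of a function along a vector field. -/
def along (X : Π p : M, TangentSpace (𝓡 d) p) (f : M → ℝ) (q : M) : ℝ := mvfderiv (𝓡 d) f q (X q)

variable {X : Π p : M, TangentSpace (𝓡 d) p}

lemma along_eq {x₀ q : M} (hq : q ∈ (chartAt (EuclideanSpace ℝ (Fin d)) x₀).source) (f : M → ℝ) :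
    along X f q = ∑ k, components X x₀ q k * mvfderiv (𝓡 d) f q (coordField x₀ k q) := by
  rw [along]
  conv_lhs => rw [sum_components_smul X hq]
  rw [map_sum]
  exact Finset.sum_congr rfl fun k _ => map_smul _ _ _

lemma along_eq_zero {f : M → ℝ} {q : M} (hq : q ∉ tsupport f) : along X f q = 0 := by
  have hf := notMem_tsupport_iff_eventuallyEq.1 hq
  have hd : MDifferentiableAt (𝓡 d) 𝓘(ℝ, ℝ) f q :=
    (mdifferentiableAt_const (c := (0 : ℝ))).congr_of_eventuallyEq hf
  have hc := (chartAt (EuclideanSpace ℝ (Fin d)) q).continuousAt_symm (mem_chart_target _ q)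
  have h0 : f ∘ (chartAt (EuclideanSpace ℝ (Fin d)) q).symm
      =ᶠ[nhds (chartAt (EuclideanSpace ℝ (Fin d)) q q)] fun _ => 0 := by
    rw [← (chartAt (EuclideanSpace ℝ (Fin d)) q).left_inv (mem_chart_source _ q)] at hf
    exact hc.eventually hf
  rw [along_eq (mem_source_self q)]
  refine Finset.sum_eq_zero fun k _ => ?_
  rw [mvfderiv_coordField (mem_source_self q) hd, h0.fderiv_eq, fderiv_fun_const]
  exact mul_zero _

lemma continuousOn_mvfderiv_coordField {x₀ : M} {f : M → ℝ} (hf : f ∈ smoothOn (d := d) x₀)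
    (k : Fin d) : ContinuousOn (fun q => mvfderiv (𝓡 d) f q (coordField x₀ k q))
      (chartAt (EuclideanSpace ℝ (Fin d)) x₀).source := by
  set φ := chartAt (EuclideanSpace ℝ (Fin d)) x₀ with hφ
  have h1 : ContinuousOn (fun x => fderiv ℝ (f ∘ φ.symm) x (EuclideanSpace.single k (1 : ℝ)))
      φ.target := ((smoothOn_contDiffOn hf).continuousOn_fderiv_of_isOpen φ.open_target
        (by simp)).clm_apply continuousOn_const
  refine (h1.comp φ.continuousOn fun q hq => φ.map_source hq).congr fun q hq => ?_
  exact mvfderiv_coordField hq (smoothOn_mdifferentiableAt hf hq) k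

lemma continuousOn_along (hX : ∀ x₀ k, (fun q => components X x₀ q k) ∈ smoothOn (d := d) x₀)
    {x₀ : M} {f : M → ℝ} (hf : f ∈ smoothOn (d := d) x₀) :
    ContinuousOn (along X f) (chartAt (EuclideanSpace ℝ (Fin d)) x₀).source :=
  (continuousOn_finsetSum Finset.univ fun k _ => (ContMDiffOn.continuousOn (hX x₀ k)).mul
    (continuousOn_mvfderiv_coordField hf k)).congr fun _ hq => along_eq hq f

/-- The derivatives of the members of a partition of unity add up to zero. -/
lemma along_sum {ι : Type*} (I : Finset ι) {f : ι → M → ℝ} {q : M}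
    (hf : ∀ i, MDifferentiableAt (𝓡 d) 𝓘(ℝ, ℝ) (f i) q) (h1 : ∀ y, ∑ i ∈ I, f i y = 1) :
    ∑ i ∈ I, along X (f i) q = 0 := by
  have h2 := HasDerivAt.fun_sum (u := I) fun i _ => hasDerivAt_coordLine q (X q) (hf i)
  have h3 : HasDerivAt (fun t => ∑ i ∈ I, f i (coordLine q (X q) t)) 0 0 := by
    simp only [h1]
    exact hasDerivAt_const _ _
  exact h2.unique h3

variable [CompactSpace M]

/-- In one chart, the integral of a divergence multiplied by a cutoff function. -/
lemma chartIntegral_mul_divergence (m : ℕ) (hΩ : IsSymplectic Ω) {cov : TangentConnection d M}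
    (hcov : IsSymplecticConnection Ω cov)
    (hX : ∀ x₀ k, (fun q => components X x₀ q k) ∈ smoothOn (d := d) x₀) {x₀ : M} {ρ : M → ℝ}
    (hρ : ρ ∈ smoothOn (d := d) x₀)
    (hs : tsupport ρ ⊆ (chartAt (EuclideanSpace ℝ (Fin d)) x₀).source) :
    chartIntegral m Ω x₀ (fun q => ρ q * divergence cov X q) =
      -chartIntegral m Ω x₀ (along X ρ) := by
  set φ := chartAt (EuclideanSpace ℝ (Fin d)) x₀ with hφ
  have hfk : ∀ k, (fun q => ρ q * components X x₀ q k) ∈ smoothOn (d := d) x₀ := fun k =>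
    (smoothOn (d := d) x₀).mul_mem hρ (hX x₀ k)
  have h0 : ∀ q, q ∉ tsupport ρ → ρ q = 0 := fun q hq => image_eq_zero_of_notMem_tsupport hq
  have hk := fun k => chartIntegral_divergence m hΩ hcov (isClosed_tsupport ρ) hs (hfk k)
    (fun q hq => by rw [h0 q hq, zero_mul]) k
  have hρs : SupportedIn (d := d) x₀ (along X ρ) :=
    ⟨continuousOn_along hX hρ, tsupport ρ, isClosed_tsupport ρ, hs, fun q hq => along_eq_zero hq⟩
  have hpt : ∀ q ∈ φ.source, ρ q * divergence cov X q =
      (∑ k, (mvfderiv (𝓡 d) (fun q => ρ q * components X x₀ q k) q (coordField x₀ k q) +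
        (christoffel cov x₀ q k).trace * (ρ q * components X x₀ q k))) - along X ρ q := by
    intro q hq
    rw [divergence_eq hcov X hq fun k => smoothOn_mdifferentiableAt (hX x₀ k) hq, along_eq hq,
      Finset.mul_sum, ← Finset.sum_sub_distrib]
    refine Finset.sum_congr rfl fun k _ => ?_
    have h1 := congrArg (fun L => L (coordField x₀ k q)) (mvfderiv_mul
      (smoothOn_mdifferentiableAt hρ hq) (smoothOn_mdifferentiableAt (hX x₀ k) hq))
    have h2 : mvfderiv (𝓡 d) (fun q => ρ q * components X x₀ q k) q (coordField x₀ k q) =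
        ρ q * mvfderiv (𝓡 d) (fun q => components X x₀ q k) q (coordField x₀ k q) +
          components X x₀ q k * mvfderiv (𝓡 d) ρ q (coordField x₀ k q) := h1
    rw [h2]
    ring
  have h1 : chartIntegral m Ω x₀ (fun q => ρ q * divergence cov X q) = ∫ x in φ.target,
      ((∑ k, (fun q => (mvfderiv (𝓡 d) (fun q => ρ q * components X x₀ q k) q
        (coordField x₀ k q) + (christoffel cov x₀ q k).trace * (ρ q * components X x₀ q k)) *
          |pfaffian m Ω x₀ q|) (φ.symm x)) -
        (fun q => along X ρ q * |pfaffian m Ω x₀ q|) (φ.symm x)) := by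
    refine setIntegral_congr_fun φ.open_target.measurableSet fun x hx => ?_
    dsimp only
    rw [hpt _ (φ.map_target hx), sub_mul, Finset.sum_mul]
  rw [h1, integral_sub (integrable_finsetSum _ fun k _ => (hk k).1) (hρs.integrableOn m hΩ),
    integral_finsetSum _ fun k _ => (hk k).1]
  refine (congrArg (· - _) (Finset.sum_eq_zero fun k _ => (hk k).2)).trans (zero_sub _)

/-- **Stokes' theorem**: the integral of a divergence vanishes. -/
lemma sum_chartIntegral_divergence (m : ℕ) (hΩ : IsSymplectic Ω) {cov : TangentConnection d M}
    (hcov : IsSymplecticConnection Ω cov)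
    (hX : ∀ x₀ k, (fun q => components X x₀ q k) ∈ smoothOn (d := d) x₀)
    (ρ : M → M → ℝ) (hρ : ∀ i x₀, ρ i ∈ smoothOn (d := d) x₀)
    (hs : ∀ i, tsupport (ρ i) ⊆ (chartAt (EuclideanSpace ℝ (Fin d)) i).source)
    (T : Finset M) (hT : ∀ q, ∑ i ∈ T, ρ i q = 1) :
    ∑ i ∈ T, chartIntegral m Ω i (fun q => ρ i q * divergence cov X q) = 0 := by
  have hc : ∀ i x₀, ContinuousOn (ρ i) (chartAt (EuclideanSpace ℝ (Fin d)) x₀).source :=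
    fun i x₀ => ContMDiffOn.continuousOn (hρ i x₀)
  have hρ0 : ∀ i q, q ∉ tsupport (ρ i) → ρ i q = 0 := fun i q hq =>
    image_eq_zero_of_notMem_tsupport hq
  -- insert the partition of unity again, and integrate each term in the other chart
  have h1 : ∀ i, chartIntegral m Ω i (along X (ρ i)) =
      ∑ j ∈ T, chartIntegral m Ω j (fun q => ρ j q * along X (ρ i) q) := by
    intro i
    have hi : SupportedIn (d := d) i (along X (ρ i)) :=
      ⟨continuousOn_along hX (hρ i i), tsupport (ρ i), isClosed_tsupport _, hs i,
        fun q hq => along_eq_zero hq⟩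
    have e : along X (ρ i) = fun q => ∑ j ∈ T, ρ j q * along X (ρ i) q := by
      funext q
      rw [← Finset.sum_mul, hT, one_mul]
    conv_lhs => rw [e]
    rw [chartIntegral_sum T m hΩ fun j _ => hi.mul_left (hc j i)]
    refine Finset.sum_congr rfl fun j _ => chartIntegral_change m (fun q hq => ?_) fun q hq => ?_
    · rw [along_eq_zero fun h => hq (hs i h), mul_zero]
    · rw [hρ0 j q fun h => hq (hs j h), zero_mul]
  rw [Finset.sum_congr rfl fun i _ => chartIntegral_mul_divergence m hΩ hcov hX (hρ i i) (hs i),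
    Finset.sum_neg_distrib, neg_eq_zero, Finset.sum_congr rfl fun i _ => h1 i, Finset.sum_comm]
  refine Finset.sum_eq_zero fun j _ => ?_
  rw [← chartIntegral_sum T m hΩ fun i _ => ?_]
  · have e : (fun q => ∑ i ∈ T, ρ j q * along X (ρ i) q) = fun _ => 0 := by
      funext q
      rw [← Finset.mul_sum, along_sum T (fun i => smoothOn_mdifferentiableAt (hρ i q)
        (mem_source_self q)) hT, mul_zero]
    rw [e]
    simp [chartIntegral]
  · refine ⟨(hc j j).mul (continuousOn_along hX (hρ i j)), tsupport (ρ j), isClosed_tsupport _,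
      hs j, fun q hq =>
      (congrArg (· * along X (ρ i) q) (hρ0 j q hq)).trans (zero_mul _)⟩

end Stokes

/-! ### The trace density -/

section TraceDensity

variable {d : ℕ} {M : Type*} [TopologicalSpace M] [ChartedSpace (EuclideanSpace ℝ (Fin d)) M]
  [IsManifold (𝓡 d) ∞ M] {Ω : BilinField d M}

/-- The trace density of a section of the Weyl bundle, relative to the Liouville density. -/
def traceScalar (Ω : BilinField d M) (γ : WeylOneForm d M) (O : WeylSection M d) (N : ℕ)
    (q : M) : ℝ :=
  (poisson Ω q).det *
    PowerSeries.coeff N (Theta (poisson Ω q) (dualW (atPt q O)) (gDual γ q))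

/-- The trace density is independent of the frame. -/
lemma traceScalar_eq (γ : WeylOneForm d M) (O : WeylSection M d) (N : ℕ) {x₀ q : M}
    (hq : q ∈ (chartAt (EuclideanSpace ℝ (Fin d)) x₀).source) :
    traceScalar Ω γ O N q = (formMatrix Ω x₀ q)⁻¹.det * PowerSeries.coeff N
      (Theta (formMatrix Ω x₀ q)⁻¹ (chartDual x₀ q O)
        fun l => chartDual x₀ q (γ.along (coordField x₀ l))) := by
  have hPi := formMatrix_inv Ω hq
  have h1 : Theta (formMatrix Ω x₀ q)⁻¹ (chartDual x₀ q O)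
      (fun l => chartDual x₀ q (γ.along (coordField x₀ l))) =
      ((frameMatrix (d := d) x₀ q).det * (frameMatrix (d := d) x₀ q).det) •
        Theta (poisson Ω q) (dualW (atPt q O)) (gDual γ q) := by
    simp only [chartDual]
    rw [Theta_frame, hPi]
    simp only [dualW_along_coordField]
    rw [Theta_linear_combination, smul_smul]
  rw [h1, traceScalar, PowerSeries.coeff_smul, smul_eq_mul, ← hPi, Matrix.det_mul, Matrix.det_mul,
    Matrix.det_transpose]
  ring

lemma traceScalar_mem (hΩ : IsSymplectic Ω) {cov : TangentConnection d M}
    {Ωh : ℕ → BilinField d M} {γ : WeylOneForm d M} (hγ : IsFedosovSolution Ω cov Ωh γ)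
    {O : WeylSection M d} (hO : IsSmooth O) (N : ℕ) (x₀ : M) :
    traceScalar Ω γ O N ∈ smoothOn (d := d) x₀ := by
  have h1 : InPS (smoothOn (d := d) x₀) fun q => Theta (formMatrix Ω x₀ q)⁻¹ (chartDual x₀ q O)
      fun l => chartDual x₀ q (γ.along (coordField x₀ l)) :=
    InPS.Theta (formMatrix_inv_mem hΩ x₀) ((isSmoothInChart_iff x₀ O).1 (hO x₀)) fun l =>
      (isSmoothInChart_iff x₀ _).1 (hγ.smooth x₀ l)
  exact smoothOn_congr ((smoothOn (d := d) x₀).mul_mem (det_mem (formMatrix_inv_mem hΩ x₀)) (h1 N))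
    fun q hq => traceScalar_eq γ O N hq

/-- The trace density of a commutator of flat sections is a divergence. -/
lemma traceScalar_moyal_sub (hΩ : IsSymplectic Ω) {cov : TangentConnection d M}
    (hcov : IsSymplecticConnection Ω cov) {Ωh : ℕ → BilinField d M} {γ : WeylOneForm d M}
    (hγ : IsFedosovSolution Ω cov Ωh γ) {a b : WeylSection M d} (ha : IsFlatSection Ω cov γ a)
    (hb : IsFlatSection Ω cov γ b) (N : ℕ) :
    ∃ X : Π p : M, TangentSpace (𝓡 d) p,
      (∀ x₀ k, (fun q => components X x₀ q k) ∈ smoothOn (d := d) x₀) ∧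
      ∀ q, traceScalar Ω γ (moyal (poisson Ω) a b) N q -
        traceScalar Ω γ (moyal (poisson Ω) b a) N q = divergence cov X q := by
  have key : ∀ q, traceScalar Ω γ (moyal (poisson Ω) a b) N q -
      traceScalar Ω γ (moyal (poisson Ω) b a) N q = -((poisson Ω q).det * PowerSeries.coeff N
        (Theta (poisson Ω q) (commL (poisson Ω q) (dualW (atPt q b)) (dualW (atPt q a)))
          (gDual γ q))) := by
    intro q
    have h1 : dualW (atPt q (moyal (poisson Ω) b a)) =
        commL (poisson Ω q) (dualW (atPt q b)) (dualW (atPt q a)) +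
          dualW (atPt q (moyal (poisson Ω) a b)) := by
      rw [← dualW_moyalComm, moyalComm, map_sub, dualW_sub, sub_add_cancel]
    simp only [traceScalar]
    rw [h1, Theta_add_left, map_add]
    ring
  rcases N with - | N
  · refine ⟨fun _ => 0, fun x₀ k => ?_, fun q => ?_⟩
    · have e : (fun q => components (fun p => (0 : TangentSpace (𝓡 d) p)) x₀ q k) = 0 := by
        funext q
        have h0 : comp (0 : TangentSpace (𝓡 d) q) = 0 := rfl
        rw [components, h0, Matrix.mulVec_zero]
        rfl
      rw [e]
      exact (smoothOn (d := d) x₀).zero_mem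
    · rw [key, (coeff_Theta_commL_eq_divergence hΩ hcov hγ ha hb q).1, mul_zero, neg_zero,
        divergence]
      have h0 : cov (fun p : M => (0 : TangentSpace (𝓡 d) p)) = 0 := cov.zero
      rw [h0]
      exact (Finset.sum_eq_zero fun i _ => rfl).symm
  · refine ⟨cocycleField Ω γ a b N, fun x₀ k => components_cocycleField_mem hΩ hγ ha.1 hb.1 N x₀ k,
      fun q => ?_⟩
    rw [key, (coeff_Theta_commL_eq_divergence hΩ hcov hγ ha hb q).2, neg_neg]

end TraceDensity

/-! ### Symmetry of the trace -/

section Trace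

variable {n : ℕ} {M : Type*} [TopologicalSpace M]
  [ChartedSpace (EuclideanSpace ℝ (Fin (2 * n))) M] [IsManifold (𝓡 (2 * n)) ∞ M]
  [T2Space M] [CompactSpace M] {Ω : BilinField (2 * n) M}

lemma real_sign_mul_self (r : ℝ) : Real.sign r * r = |r| := by
  rcases lt_trichotomy r 0 with h | h | h
  · rw [Real.sign_of_neg h, abs_of_neg h, neg_one_mul]
  · rw [h, mul_zero, abs_zero]
  · rw [Real.sign_of_pos h, abs_of_pos h, one_mul]

/-- The integrand of the trace in a chart. -/
lemma orientationSign_mul (hΩ : IsSymplectic Ω) (γ : WeylOneForm (2 * n) M)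
    (O : WeylSection M (2 * n)) (N : ℕ) (x₀ q : M) :
    orientationSign Ω q * (wedgePow n ((1 / 2 : ℝ) • poisson Ω q) * PowerSeries.coeff N
      (Theta (poisson Ω q) (dualW (atPt q O)) (gDual γ q))) *
        |(frameMatrix (d := 2 * n) x₀ q).det| =
      (-1) ^ n * (traceScalar Ω γ O N q * |pfaffian n Ω x₀ q|) := by
  have h : orientationSign Ω q = Real.sign (pfaffian n Ω q q) := by
    rw [pfaffian, formMatrix_self]
    rfl
  rw [h, wedgePow_poisson n hΩ, pfaffian_eq n Ω x₀ q, abs_mul, ← real_sign_mul_self (pfaffian n Ω q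
      q),
    traceScalar]
  ring

/-- The integral of the trace density as a sum of integrals over charts. -/
lemma integralTop_eq (hΩ : IsSymplectic Ω) (γ : WeylOneForm (2 * n) M)
    (O : WeylSection M (2 * n)) (N : ℕ) (c : ℝ) :
    integralTop Ω (fun q => c * (wedgePow n ((1 / 2 : ℝ) • poisson Ω q) * PowerSeries.coeff N
      (Theta (poisson Ω q) (dualW (atPt q O)) (gDual γ q)))) =
      (c * (-1) ^ n) * ∑ᶠ x₀ : M, chartIntegral n Ω x₀ fun q =>
        (SmoothPartitionOfUnity.exists_isSubordinate_chartAt_source (𝓡 (2 * n)) M).choose x₀ q *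
          traceScalar Ω γ O N q := by
  refine Eq.trans ?_ (mul_finsum _ (c * (-1) ^ n)).symm
  refine finsum_congr fun x₀ => ?_
  refine Eq.trans ?_ (MeasureTheory.integral_const_mul (c * (-1) ^ n) _)
  refine congrArg (fun F : EuclideanSpace ℝ (Fin (2 * n)) → ℝ =>
    ∫ x in (chartAt (EuclideanSpace ℝ (Fin (2 * n))) x₀).target, F x) (funext fun x => ?_)
  have h := orientationSign_mul hΩ γ O N x₀
    ((chartAt (EuclideanSpace ℝ (Fin (2 * n))) x₀).symm x)
  dsimp only
  linear_combination (c * (SmoothPartitionOfUnity.exists_isSubordinate_chartAt_source (𝓡 (2 * n))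
    M).choose x₀ ((chartAt (EuclideanSpace ℝ (Fin (2 * n))) x₀).symm x)) * h

/-- The integrals of the trace densities of the two products of two flat sections agree. -/
lemma finsum_chartIntegral_comm (hΩ : IsSymplectic Ω) {cov : TangentConnection (2 * n) M}
    (hcov : IsSymplecticConnection Ω cov) {Ωh : ℕ → BilinField (2 * n) M}
    {γ : WeylOneForm (2 * n) M} (hγ : IsFedosovSolution Ω cov Ωh γ) {a b : WeylSection M (2 * n)}
    (ha : IsFlatSection Ω cov γ a) (hb : IsFlatSection Ω cov γ b) (N m : ℕ)
    {ρ : SmoothPartitionOfUnity M (𝓡 (2 * n)) M Set.univ}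
    (hρ : ρ.IsSubordinate fun x => (chartAt (EuclideanSpace ℝ (Fin (2 * n))) x).source) :
    ∑ᶠ x₀ : M, chartIntegral m Ω x₀ (fun q => ρ x₀ q *
      traceScalar Ω γ (moyal (poisson Ω) a b) N q) =
    ∑ᶠ x₀ : M, chartIntegral m Ω x₀ (fun q => ρ x₀ q *
      traceScalar Ω γ (moyal (poisson Ω) b a) N q) := by
  have hfin := ρ.locallyFinite.finite_nonempty_of_compact
  set T := hfin.toFinset with hT
  have hzero : ∀ i, i ∉ T → ∀ q, ρ i q = 0 := by
    intro i hi q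
    by_contra h
    exact hi (hfin.mem_toFinset.2 ⟨q, h⟩)
  have hsum : ∀ h : M → ℝ, ∑ᶠ x₀ : M, chartIntegral m Ω x₀ (fun q => ρ x₀ q * h q) =
      ∑ i ∈ T, chartIntegral m Ω i fun q => ρ i q * h q := by
    intro h
    refine finsum_eq_sum_of_support_subset _ fun i hi => ?_
    by_contra hiT
    refine hi ?_
    simp [chartIntegral, hzero i hiT]
  have hone : ∀ q, ∑ i ∈ T, ρ i q = 1 := by
    intro q
    rw [← ρ.sum_eq_one (Set.mem_univ q)]
    refine (finsum_eq_sum_of_support_subset _ fun i hi => ?_).symm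
    by_contra hiT
    exact hi (hzero i hiT q)
  have hsm : ∀ i x₀, (ρ i : M → ℝ) ∈ smoothOn (d := 2 * n) x₀ := fun i x₀ =>
    (ρ i).contMDiff.contMDiffOn
  have hsupp : ∀ {O : WeylSection M (2 * n)}, IsSmooth O → ∀ i, SupportedIn (d := 2 * n) i
      fun q => ρ i q * traceScalar Ω γ O N q := fun {O} hO i =>
    ⟨(ContMDiffOn.continuousOn (hsm i i)).mul (ContMDiffOn.continuousOn
      (traceScalar_mem hΩ hγ hO N i)), tsupport (ρ i), isClosed_tsupport _, hρ i, fun q hq =>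
        (congrArg (· * traceScalar Ω γ O N q) (image_eq_zero_of_notMem_tsupport hq)).trans
          (zero_mul _)⟩
  obtain ⟨X, hX, hdiv⟩ := traceScalar_moyal_sub hΩ hcov hγ ha hb N
  rw [hsum, hsum, ← sub_eq_zero, ← Finset.sum_sub_distrib]
  refine Eq.trans (Finset.sum_congr rfl fun i _ => ?_) (sum_chartIntegral_divergence m hΩ hcov hX
    (fun i => ρ i) hsm hρ T hone)
  rw [← chartIntegral_sub m hΩ (hsupp (isSmooth_moyal hΩ ha.1 hb.1) i)
    (hsupp (isSmooth_moyal hΩ hb.1 ha.1) i)]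
  congr 1
  funext q
  rw [← mul_sub, hdiv]

/-- The trace property on the level of flat sections. -/
lemma trace_moyal_comm (hΩ : IsSymplectic Ω) {cov : TangentConnection (2 * n) M}
    (hcov : IsSymplecticConnection Ω cov) {Ωh : ℕ → BilinField (2 * n) M}
    {γ : WeylOneForm (2 * n) M} (hγ : IsFedosovSolution Ω cov Ωh γ) {a b : WeylSection M (2 * n)}
    (ha : IsFlatSection Ω cov γ a) (hb : IsFlatSection Ω cov γ b) :
    integralForms Ω (twistedIntegral Ω γ
      (localToGlobal (poisson Ω) γ.toBV (moyal (poisson Ω) a b))) =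
    integralForms Ω (twistedIntegral Ω γ
      (localToGlobal (poisson Ω) γ.toBV (moyal (poisson Ω) b a))) := by
  obtain ⟨c, hc⟩ := exists_coeff_integralForms n M
  ext z
  rw [hc, hc]
  by_cases hz : z + (2 * n : ℕ) < 0
  · simp only [if_pos hz]
  · simp only [if_neg hz]
    exact (integralTop_eq hΩ γ _ _ c).trans ((congrArg (c * (-1) ^ n * ·)
      (finsum_chartIntegral_comm hΩ hcov hγ ha hb _ n
        (SmoothPartitionOfUnity.exists_isSubordinate_chartAt_source (𝓡 (2 * n))
          M).choose_spec)).trans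
      (integralTop_eq hΩ γ _ _ c).symm)

lemma expHbar_zero {R : Type*} [CommRing R] [Algebra ℝ R] (T : Module.End ℝ R) :
    expHbar T 0 = 0 := by
  ext N
  simp [expHbar]

lemma moyal_zero_left (Pi : M → Matrix (Fin (2 * n)) (Fin (2 * n)) ℝ) (a : WeylSection M (2 * n)) :
    moyal Pi 0 a = 0 := by
  rw [moyal, map_zero, zero_mul, expHbar_zero, map_zero]

lemma moyal_zero_right (Pi : M → Matrix (Fin (2 * n)) (Fin (2 * n)) ℝ)
    (a : WeylSection M (2 * n)) : moyal Pi a 0 = 0 := by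
  rw [moyal, map_zero, mul_zero, expHbar_zero, map_zero]

end Trace

end Fedosov

end

theorem mainTheorem4 {n : ℕ} {M : Type*} [TopologicalSpace M]
    [ChartedSpace (EuclideanSpace ℝ (Fin (2 * n))) M] [IsManifold (𝓡 (2 * n)) ∞ M]
    [T2Space M] [CompactSpace M]
    (Ω : Fedosov.BilinField (2 * n) M) (hΩ : Fedosov.IsSymplectic Ω)
    (cov : Fedosov.TangentConnection (2 * n) M) (hcov : Fedosov.IsSymplecticConnection Ω cov)
    (Ωh : ℕ → Fedosov.BilinField (2 * n) M) (hΩh0 : ∀ p, Ωh 0 p = -Ω p)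
    (hΩh : ∀ k, 1 ≤ k → Fedosov.IsClosedTwoForm (Ωh k))
    (γ : Fedosov.WeylOneForm (2 * n) M) (hγ : Fedosov.IsFedosovSolution Ω cov Ωh γ)
    (f g : PowerSeries (M → ℝ))
    (hf : Fedosov.IsSmoothSeries (d := 2 * n) f) (hg : Fedosov.IsSmoothSeries (d := 2 * n) g) :
    Fedosov.trace Ω cov γ (Fedosov.star Ω cov γ f g) =
      Fedosov.trace Ω cov γ (Fedosov.star Ω cov γ g f) := by
  by_cases hf' : ∃ a, Fedosov.IsFlatSection Ω cov γ a ∧ Fedosov.symbol a = f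
  · by_cases hg' : ∃ a, Fedosov.IsFlatSection Ω cov γ a ∧ Fedosov.symbol a = g
    · unfold Fedosov.trace
      rw [Fedosov.symbolInv_star hΩ hcov hγ hf' hg', Fedosov.symbolInv_star hΩ hcov hγ hg' hf']
      exact Fedosov.trace_moyal_comm hΩ hcov hγ (Fedosov.symbolInv_spec hf').1
        (Fedosov.symbolInv_spec hg').1
    -- a series without a flat lift has, by convention, the lift `0`, so that both products vanish;
    -- Fedosov's theorem on the surjectivity of the symbol map is therefore not needed
    · have h0 : Fedosov.symbolInv Ω cov γ g = 0 := dif_neg hg'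
      unfold Fedosov.star
      rw [h0, Fedosov.moyal_zero_left, Fedosov.moyal_zero_right]
  · have h0 : Fedosov.symbolInv Ω cov γ f = 0 := dif_neg hf'
    unfold Fedosov.star
    rw [h0, Fedosov.moyal_zero_left, Fedosov.moyal_zero_right]
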